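/- **Setting.** Let $\Omega_h\subset\mathbb R^2$ be a bounded open set of class $C^2$, $\Omega=\Omega_h\times(0,1)$, and write $x=(x_h,x_3)$. Let $\mu,\kappa>0$, $\alpha\in\mathbb R$, $g\in\mathbb R^3$, $F(x)=g\cdot x+|x_h|^2$ (up to an additive constant), $\vartheta_B\in C^2(\mathbb R^3)$, and $\langle\Theta\rangle(t,x_h)=\int_0^1\Theta(t,x_h,x_3)\,dx_3$. The rotating Oberbeck–Boussinesq system for $u=u(t,x_h)\in\mathbb R^2$ and $\Theta=\Theta(t,x)\in\mathbb R$ is $$\mathrm{div}_h u=0,\qquad \partial_t u+\mathrm{div}_h(u\otimes u)+\nabla_h\Pi=\mu\Delta_h u-\langle\Theta\rangle\nabla_hF\quad\text{in }\Omega_h,$$ $$\partial_t\Theta+\mathrm{div}_x(\Theta\,[u,0])=\kappa\Delta_x\Theta\quad\text{in }\Omega,$$ $$u|_{\partial\Omega_h}=0,\qquad \Theta|_{\partial\Omega}=\vartheta_B-\alpha\frac1{|\Omega|}\int_\Omega\Theta\,dx .$$ Let $I\subset\mathbb R$ be an interval. A *weak solution on $I$* is a pair $(u,\Theta)$ with $u\in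 C_{\rm weak}(I;L^2(\Omega_h;\mathbb R^2))\cap L^2_{\rm loc}(I;W^{1,2}_0(\Omega_h;\mathbb R^2))$ and $\Theta\in C(I;L^2(\Omega))\cap L^\infty_{\rm loc}(I;L^\infty(\Omega))\cap L^2_{\rm loc}(I;W^{1,2}(\Omega))$, such that $\mathrm{div}_hu(t)=0$ in the sense of distributions for all $t\in I$, such that $\Theta(t)+\alpha\frac1{|\Omega|}\int_\Omega\Theta(t)\,dx-\vartheta_B\in W^{1,2}_0(\Omega)$ for a.e. $t\in I$, and such that for all $a\le b$ in $I$ $$\Big[\int_{\Omega_h}u\cdot\varphi\,dx_h\Big]_{t=a}^{t=b}=\int_a^b\!\!\int_{\Omega_h}\big(u\otimes u:\nabla_h\varphi-\mu\nabla_hu:\nabla_h\varphi-\langle\Theta\rangle\nabla_hF\cdot\varphi\big)\,dx_h\,dt$$ for all $\varphi\in C_c^\infty(\Omega_h;\mathbb R^2)$ with $\mathrm{div}_h\varphi=0$, and $$\Big[\int_{\Omega}\Theta\psi\,dx\Big]_{t=a}^{t=b}=\int_a^b\!\!\int_{\Omega}\big(\Theta u\cdot\nabla_h\psi-\kappa\nabla_x\Theta\cdot\nabla_x\psi\big)\,dx\,dt$$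 for all $\psi\in C_c^\infty(\Omega)$. **Proposition 3.2.** Let $0<\alpha<1$. For every $\Omega_h,\mu,\kappa,\alpha$ as above and all $M_F,M_B\in\mathbb R$ there are constants $\mathcal E_{2,\infty}$ and $\mathcal E_{2,2}$, depending only on $(\Omega_h,\mu,\kappa,\alpha,M_F,M_B)$, such that the following holds for all $g$ and $\vartheta_B$ with $\|\nabla_hF\|_{L^\infty(\Omega)}\le M_F$ and $\|\vartheta_B\|_{L^\infty(\partial\Omega)}\le M_B$. 1. Let $T_n\to-\infty$, and let $(u_n,\Theta_n)$, $n\ge1$, be weak solutions on $[T_n,\infty)$ such that, for some $\mathcal F_0$ and all $n$, $$\|u_n(T_n)\|_{L^2(\Omega_h)}+\|\Theta_n(T_n)\|_{L^\infty(\Omega)}\le\mathcal F_0 .$$ Then there are a subsequence (not relabelled) and a weak solution $(u,\Theta)$ on $\mathbb R$ such that $$u_n\to u\ \text{ in }C_{\rm weak,loc}(\mathbb R;L^2(\Omega_h;\mathbb R^2))\text{ and weakly in }L^2_{\rm loc}(\mathbb R;W^{1,2}_0(\Omega_h;\mathbb R^2)),$$ $$\Theta_n\to\Theta\ \text{ in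 }C_{\rm loc}(\mathbb R;L^2(\Omega)),\text{ weakly-}(*)\text{ in }L^\infty_{\rm loc}(\mathbb R\times\overline\Omega),\text{ and weakly in }L^2_{\rm loc}(\mathbb R;W^{1,2}(\Omega)),$$ and $$\|u(t)\|_{L^2(\Omega_h)}+\|\Theta(t)\|_{L^\infty(\Omega)}\le\mathcal E_{2,\infty}\qquad\text{for all }t\in\mathbb R .$$ In particular the bound is independent of $\mathcal F_0$. 2. For every $T\in\mathbb R$ and every weak solution $(u,\Theta)$ on $[T,\infty)$, $$\limsup_{t\to\infty}\big[\|u(t)\|_{L^2(\Omega_h)}+\|\Theta(t)\|_{L^2(\Omega)}\big]\le\mathcal E_{2,2}.$$ -/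

import Mathlib

open Filter Topology MeasureTheory TopologicalSpace
open scoped ENNReal InnerProductSpace Distributions

noncomputable section

namespace ROB

/-- The horizontal plane, with its Euclidean structure. -/
abbrev E2 : Type := EuclideanSpace ℝ (Fin 2)

/-- Values of gradients of scalar functions of three variables. -/
abbrev E3 : Type := EuclideanSpace ℝ (Fin 3)

/-- `2 × 2` matrices with the Frobenius norm and inner product (values of gradients of planar
vector fields). -/
abbrev E22 : Type := EuclideanSpace ℝ (Fin 2 × Fin 2)

/-- Points of physical space `x = (x_h, x_3)`, with Lebesgue measure. -/
abbrev X3 : Type := E2 × ℝ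

/-- The horizontal coordinate directions of the plane. -/
def e2 (i : Fin 2) : E2 := EuclideanSpace.single i 1

/-- The three coordinate directions in physical space. -/
def e3 : Fin 3 → X3 := ![(e2 0, 0), (e2 1, 0), (0, 1)]

/-- Gradient of a planar vector field: the entry `(i, j)` is `∂_j φ_i`. -/
def gradVec (φ : E2 → E2) (y : E2) : E22 :=
  WithLp.toLp 2 fun ij => (fderiv ℝ φ y (e2 ij.2)) ij.1

/-- Divergence of a planar vector field. -/
def divVec (φ : E2 → E2) (y : E2) : ℝ := ∑ i, (fderiv ℝ φ y (e2 i)) i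

/-- Gradient of a scalar function of `x = (x_h, x_3)`. -/
def gradScal (ψ : X3 → ℝ) (x : X3) : E3 :=
  WithLp.toLp 2 fun i => fderiv ℝ ψ x (e3 i)

/-- The driving potential `F(x) = g · x + |x_h|²` (an additive constant in `F` is immaterial, only
`∇_h F` enters the system). -/
def potential (g : X3) (x : X3) : ℝ := ⟪g.1, x.1⟫_ℝ + g.2 * x.2 + ‖x.1‖ ^ 2

/-- The horizontal gradient `∇_h F(x_h)`, which does not depend on `x_3`. -/
def gradF (g : X3) (y : E2) : E2 := g.1 + (2 : ℝ) • y

theorem hasGradientAt_potential (g x : X3) :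
    HasGradientAt (fun y : E2 => potential g (y, x.2)) (gradF g x.1) x.1 := by
  rw [hasGradientAt_iff_hasFDerivAt]
  have h1 : HasFDerivAt (fun y : E2 => ⟪g.1, y⟫_ℝ) (innerSL ℝ g.1) x.1 :=
    (innerSL ℝ g.1).hasFDerivAt
  have h2 : HasFDerivAt (fun y : E2 => ‖y‖ ^ 2) (2 • (innerSL ℝ x.1)) x.1 :=
    (hasStrictFDerivAt_norm_sq x.1).hasFDerivAt
  have h := (h1.add_const (g.2 * x.2)).add h2
  refine h.congr_fderiv ?_
  ext v
  simp [gradF]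

/-- The open set `Ω_h` is bounded and of class `C²`: near every boundary point it is
the sublevel set of a `C²` function with nonvanishing differential. -/
def IsBoundedC2 (Ωh : Opens E2) : Prop :=
  Bornology.IsBounded (Ωh : Set E2) ∧
    ∀ p ∈ frontier (Ωh : Set E2), ∃ U : Set E2, IsOpen U ∧ p ∈ U ∧ ∃ ρ : E2 → ℝ,
      ContDiffOn ℝ 2 ρ U ∧ fderiv ℝ ρ p ≠ 0 ∧ (Ωh : Set E2) ∩ U = {y ∈ U | ρ y < 0}

/-- The cylinder `Ω = Ω_h × (0, 1)`. -/
def cyl (Ωh : Opens E2) : Opens X3 :=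
  ⟨(Ωh : Set E2) ×ˢ Set.Ioo (0 : ℝ) 1, Ωh.isOpen.prod isOpen_Ioo⟩

/-- Lebesgue measure on `Ω_h`. -/
abbrev volH (Ωh : Opens E2) : Measure E2 := volume.restrict (Ωh : Set E2)

/-- Lebesgue measure on `Ω`. -/
abbrev vol3 (Ωh : Opens E2) : Measure X3 := volume.restrict (cyl Ωh : Set X3)

/-- `L²(Ω_h; R²)` -/
abbrev L2Vel (Ωh : Opens E2) : Type := Lp E2 2 (volH Ωh)

/-- `L²(Ω_h; R^{2×2})` -/
abbrev L2GradVel (Ωh : Opens E2) : Type := Lp E22 2 (volH Ωh)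

/-- `L²(Ω)` -/
abbrev L2Temp (Ωh : Opens E2) : Type := Lp ℝ 2 (vol3 Ωh)

/-- `L²(Ω; R³)` -/
abbrev L2GradTemp (Ωh : Opens E2) : Type := Lp E3 2 (vol3 Ωh)

/-- `f ∈ W^{1,2}_0(Ω_h; R²)` with gradient `G`: the pair `(f, G)` is an `L²` limit of pairs
`(φ, ∇φ)` with `φ` smooth and compactly supported in `Ω_h`. -/
def MemW120Vel (Ωh : Opens E2) (f : E2 → E2) (G : E2 → E22) : Prop :=
  ∃ φ : ℕ → 𝓓(Ωh, E2),
    Tendsto (fun k => eLpNorm (fun y => f y - φ k y) 2 (volH Ωh)) atTop (𝓝 0) ∧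
    Tendsto (fun k => eLpNorm (fun y => G y - gradVec (φ k) y) 2 (volH Ωh)) atTop (𝓝 0)

/-- `f ∈ W^{1,2}_0(Ω)` with gradient `G`. -/
def MemW120Temp (Ωh : Opens E2) (f : X3 → ℝ) (G : X3 → E3) : Prop :=
  ∃ φ : ℕ → 𝓓(cyl Ωh, ℝ),
    Tendsto (fun k => eLpNorm (fun x => f x - φ k x) 2 (vol3 Ωh)) atTop (𝓝 0) ∧
    Tendsto (fun k => eLpNorm (fun x => G x - gradScal (φ k) x) 2 (vol3 Ωh)) atTop (𝓝 0)

/-- `G` is the weak gradient of `f` in `Ω`. -/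
def HasWeakGradTemp (Ωh : Opens E2) (f : X3 → ℝ) (G : X3 → E3) : Prop :=
  ∀ (φ : 𝓓(cyl Ωh, ℝ)) (i : Fin 3),
    ∫ x in cyl Ωh, f x * gradScal φ x i = - ∫ x in cyl Ωh, G x i * φ x

/-- The vertical mean `⟨Θ⟩(x_h) = ∫_0^1 Θ(x_h, x_3) dx_3`. -/
def vmean (f : X3 → ℝ) (y : E2) : ℝ := ∫ z in Set.Ioo (0 : ℝ) 1, f (y, z)

/-- `(u, Θ)`, with spatial gradients `(Du, DΘ)`, is a weak solution, on the time interval `I`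
(endpoints that belong to `I` included), of the system

* `div_h u = 0`, `∂_t u + div_h (u ⊗ u) + ∇_h Π = μ Δ_h u - ⟨Θ⟩ ∇_h F` in `I × Ω_h`,
* `∂_t Θ + div_x (Θ u) = κ Δ_x Θ` in `I × Ω`,
* `u = 0` on `∂Ω_h`, `Θ = ϑ_B - α ⨍_Ω Θ` on `∂Ω`.

The pressure is eliminated by testing with solenoidal fields, and both evolution equations are
integrated in time. -/
structure IsWeakSolution (Ωh : Opens E2) (μ κ α : ℝ) (g : X3) (ϑB : X3 → ℝ) (I : Set ℝ)
    (u : ℝ → L2Vel Ωh) (Du : ℝ → L2GradVel Ωh)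
    (Θ : ℝ → L2Temp Ωh) (DΘ : ℝ → L2GradTemp Ωh) : Prop where
  /-- `u ∈ C_weak(I; L²)` -/
  u_weakCont : ∀ w : L2Vel Ωh, ContinuousOn (fun t => ⟪u t, w⟫_ℝ) I
  /-- `∇u ∈ L²_loc(I; L²)` -/
  Du_memLp : ∀ a ∈ I, ∀ b ∈ I, MemLp Du 2 (volume.restrict (Set.Icc a b))
  /-- the no-slip condition: `u(t) ∈ W^{1,2}_0` with gradient `Du(t)` for a.e. `t` -/
  u_mem : ∀ᵐ t ∂(volume.restrict I), MemW120Vel Ωh (u t) (Du t)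
  /-- `div_h u = 0` -/
  u_div : ∀ t ∈ I, ∀ ψ : 𝓓(Ωh, ℝ), ∫ y in Ωh, fderiv ℝ ψ y (u t y) = 0
  /-- `Θ ∈ C(I; L²)` -/
  Θ_cont : ContinuousOn Θ I
  /-- `Θ ∈ L^∞_loc(I; L^∞)` -/
  Θ_bdd : ∀ a ∈ I, ∀ b ∈ I, ∃ C : ℝ, ∀ t ∈ Set.Icc a b,
    eLpNorm (Θ t) ∞ (vol3 Ωh) ≤ ENNReal.ofReal C
  /-- `∇Θ ∈ L²_loc(I; L²)` -/
  DΘ_memLp : ∀ a ∈ I, ∀ b ∈ I, MemLp DΘ 2 (volume.restrict (Set.Icc a b))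
  /-- `DΘ(t)` is the weak gradient of `Θ(t)` for a.e. `t` -/
  Θ_grad : ∀ᵐ t ∂(volume.restrict I), HasWeakGradTemp Ωh (Θ t) (DΘ t)
  /-- the nonlocal boundary condition, in the sense of traces -/
  Θ_bdry : ∀ᵐ t ∂(volume.restrict I),
    MemW120Temp Ωh (fun x => Θ t x - (ϑB x - α * ⨍ z in (cyl Ωh : Set X3), Θ t z))
      (fun x => DΘ t x - gradScal ϑB x)
  /-- the momentum equation -/
  momentum : ∀ φ : 𝓓(Ωh, E2), (∀ y, divVec φ y = 0) → ∀ a ∈ I, ∀ b ∈ I, a ≤ b →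
    (∫ y in Ωh, ⟪u b y, φ y⟫_ℝ) - (∫ y in Ωh, ⟪u a y, φ y⟫_ℝ) =
      ∫ t in a..b, ∫ y in Ωh,
        (⟪u t y, fderiv ℝ φ y (u t y)⟫_ℝ - μ * ⟪Du t y, gradVec φ y⟫_ℝ
          - vmean (Θ t) y * ⟪gradF g y, φ y⟫_ℝ)
  /-- the heat equation; `fderiv ℝ ψ x (u, 0)` is `u · ∇_h ψ` -/
  heat : ∀ ψ : 𝓓(cyl Ωh, ℝ), ∀ a ∈ I, ∀ b ∈ I, a ≤ b →
    (∫ x in cyl Ωh, Θ b x * ψ x) - (∫ x in cyl Ωh, Θ a x * ψ x) =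
      ∫ t in a..b, ∫ x in cyl Ωh,
        (Θ t x * fderiv ℝ ψ x (u t x.1, 0) - κ * ⟪DΘ t x, gradScal ψ x⟫_ℝ)

/-- Convergence in `C_{weak,loc}(R; H)`. -/
def TendstoCWeakLoc {H : Type*} [NormedAddCommGroup H] [InnerProductSpace ℝ H]
    (v : ℕ → ℝ → H) (v' : ℝ → H) : Prop :=
  ∀ w : H, ∀ K : ℝ, TendstoUniformlyOn (fun n t => ⟪v n t, w⟫_ℝ) (fun t => ⟪v' t, w⟫_ℝ) atTop
    (Set.Icc (-K) K)

/-- Convergence in `C_loc(R; H)`. -/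
def TendstoCLoc {H : Type*} [NormedAddCommGroup H]
    (v : ℕ → ℝ → H) (v' : ℝ → H) : Prop :=
  ∀ K : ℝ, TendstoUniformlyOn v v' atTop (Set.Icc (-K) K)

/-- Weak convergence in `L²_loc(R; H)`. Weak convergence in `L²_loc(R; W^{1,2})` is
weak convergence in `L²_loc(R; L²)` of the functions and of their gradients. -/
def TendstoWeakL2Loc {H : Type*} [NormedAddCommGroup H] [InnerProductSpace ℝ H]
    (v : ℕ → ℝ → H) (v' : ℝ → H) : Prop :=
  ∀ (K : ℝ) (Φ : ℝ → H), MemLp Φ 2 (volume.restrict (Set.Icc (-K) K)) →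
    Tendsto (fun n => ∫ t in Set.Icc (-K) K, ⟪v n t, Φ t⟫_ℝ) atTop
      (𝓝 (∫ t in Set.Icc (-K) K, ⟪v' t, Φ t⟫_ℝ))

/-- Weak-(*) convergence in `L^∞_loc(R × closure Ω)`: convergence against every function in
`L¹((-K, K) × Ω)`. -/
def TendstoWeakStarLinftyLoc (Ωh : Opens E2) (v : ℕ → ℝ → L2Temp Ωh) (v' : ℝ → L2Temp Ωh) :
    Prop :=
  ∀ (K : ℝ) (h : ℝ × X3 → ℝ),
    Integrable h ((volume.restrict (Set.Icc (-K) K)).prod (vol3 Ωh)) →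
    Tendsto (fun n => ∫ t in Set.Icc (-K) K, ∫ x in cyl Ωh, v n t x * h (t, x)) atTop
      (𝓝 (∫ t in Set.Icc (-K) K, ∫ x in cyl Ωh, v' t x * h (t, x)))

end ROB

end

open scoped NNReal

noncomputable section

namespace ROB
open Set (Icc Ioc Ici Ioo indicator_of_mem indicator_of_notMem mem_Ici indicator_apply)
open intervalIntegral (integral_add_adjacent_intervals integral_of_le integral_mono_on integral_mono_ae_restrict)
open Bornology (IsBounded)
open WithLp (toLp)
open ENNReal (ofReal ofReal_le_ofReal)
open Real (norm_eq_abs norm_of_nonneg le_sqrt_of_sq_le)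
open ContinuousLinearMap (lsmul)
open InnerProductSpace (toDual)
open Metric (cthickening)
open Submodule (topologicalClosure_coe)

set_option linter.unusedSectionVars false

section Steklov

variable {H : Type*} [NormedAddCommGroup H] [InnerProductSpace ℝ H]

theorem _root_.MeasureTheory.MemLp.integrable_real_inner {X : Type*} [MeasurableSpace X]
    {μ : Measure X} {f g : X → H} (hf : MemLp f 2 μ) (hg : MemLp g 2 μ) :
    Integrable (fun x => ⟪f x, g x⟫_ℝ) μ := by
  have h := hf.norm.integrable_mul hg.norm
  exact h.mono (hf.1.inner hg.1) (ae_of_all _ fun x => by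
    simpa using norm_inner_le_norm (𝕜 := ℝ) (f x) (g x))

theorem intervalIntegrable_of_Icc {E : Type*} [NormedAddCommGroup E] {f : ℝ → E} {a b : ℝ}
    (hab : a ≤ b) (hf : IntegrableOn f (Icc a b)) : IntervalIntegrable f volume a b :=
  (intervalIntegrable_iff_integrableOn_Icc_of_le hab).2 hf

/-- Translation of a square integrable curve, as a curve in `L²(ℝ; H)`. -/
def translate {B : ℝ → H} (hB : MemLp B 2 volume) (σ : ℝ) : Lp H 2 (volume : Measure ℝ) :=
  Lp.compMeasurePreserving (fun r => σ + r) (measurePreserving_add_left volume σ) hB.toLp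

theorem coeFn_translate {B : ℝ → H} (hB : MemLp B 2 volume) (σ : ℝ) :
    translate hB σ =ᵐ[volume] fun r => B (σ + r) := by
  refine (Lp.coeFn_compMeasurePreserving _ (measurePreserving_add_left volume σ)).trans ?_
  exact (measurePreserving_add_left volume σ).quasiMeasurePreserving.ae_eq_comp hB.coeFn_toLp

theorem continuous_translate {B : ℝ → H} (hB : MemLp B 2 volume) :
    Continuous (translate hB) := by
  have hg : Continuous (ContinuousMap.curry
      (⟨fun p : ℝ × ℝ => p.1 + p.2, by fun_prop⟩ : C(ℝ × ℝ, ℝ))) := ContinuousMap.continuous _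
  exact (continuous_const (y := hB.toLp)).compMeasurePreservingLp hg
    (fun σ => measurePreserving_add_left volume σ) (by norm_num)

theorem continuous_integral_inner_translate {B W : ℝ → H} (hB : MemLp B 2 volume)
    (hW : MemLp W 2 volume) (s t : ℝ) :
    Continuous fun q : ℝ × ℝ => ∫ r in s..t, ⟪B (q.1 + r), W (q.2 + r)⟫_ℝ := by
  have key : ∀ S : Set ℝ, MeasurableSet S →
      Continuous fun q : ℝ × ℝ => ∫ r in S, ⟪B (q.1 + r), W (q.2 + r)⟫_ℝ := by
    intro S hS
    let R := LpToLpRestrictCLM ℝ H ℝ volume 2 S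
    have h1 : ∀ q : ℝ × ℝ, ∫ r in S, ⟪B (q.1 + r), W (q.2 + r)⟫_ℝ
        = ⟪R (translate hB q.1), R (translate hW q.2)⟫_ℝ := by
      intro q
      rw [L2.inner_def]
      refine integral_congr_ae ?_
      filter_upwards [LpToLpRestrictCLM_coeFn ℝ S (translate hB q.1),
        LpToLpRestrictCLM_coeFn ℝ S (translate hW q.2),
        ae_restrict_of_ae (coeFn_translate hB q.1), ae_restrict_of_ae (coeFn_translate hW q.2)]
        with r h1 h2 h3 h4
      rw [h1, h2, h3, h4]
    simp_rw [h1]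
    exact ((R.continuous.comp ((continuous_translate hB).comp continuous_fst))).inner
      (R.continuous.comp ((continuous_translate hW).comp continuous_snd))
  unfold intervalIntegral
  exact (key _ measurableSet_Ioc).sub (key _ measurableSet_Ioc)

theorem integral_swap_translate {B W : ℝ → H} (hB : MemLp B 2 volume)
    (hW : MemLp W 2 volume) {s t h : ℝ} (hst : s ≤ t) (hh : 0 ≤ h) :
    IntervalIntegrable (fun r => ∫ τ in r..r + h, ⟪B τ, W (h + r)⟫_ℝ) volume s t ∧
    ∫ r in s..t, ∫ τ in r..r + h, ⟪B τ, W (h + r)⟫_ℝ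
      = ∫ σ in (0 : ℝ)..h, ∫ r in s..t, ⟪B (σ + r), W (h + r)⟫_ℝ := by
  have e1 : ∀ r, ∫ τ in r..r + h, ⟪B τ, W (h + r)⟫_ℝ
      = ∫ σ in Ioc (0 : ℝ) h, ⟪B (σ + r), W (h + r)⟫_ℝ := by
    intro r
    rw [← integral_of_le hh]
    have := intervalIntegral.integral_comp_add_right (fun τ => ⟪B τ, W (h + r)⟫_ℝ) r
      (a := 0) (b := h)
    rw [this]
    simp [add_comm]
  have iB : Integrable (fun z : ℝ × ℝ => ‖B (z.2 + z.1)‖ ^ 2)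
      ((volume.restrict (Ioc s t)).prod (volume.restrict (Ioc 0 h))) := by
    rw [Measure.prod_restrict]
    have hp : MeasurePreserving (fun z : ℝ × ℝ => (z.2, z.2 + z.1)) (volume.prod volume)
        (volume.prod volume) := by
      have := (measurePreserving_prod_add (volume : Measure ℝ) (volume : Measure ℝ)).comp
        (Measure.measurePreserving_swap (μ := (volume : Measure ℝ)) (ν := (volume : Measure ℝ)))
      exact this
    have hi : Integrable (fun z : ℝ × ℝ => (Ioc 0 h).indicator (fun _ => (1 : ℝ)) z.1
        * ‖B z.2‖ ^ 2) (volume.prod volume) := by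
      refine Integrable.mul_prod (f := (Ioc 0 h).indicator (fun _ => (1 : ℝ)))
        (g := fun x => ‖B x‖ ^ 2) ?_ ?_
      · exact (integrable_indicator_iff measurableSet_Ioc).2 (by simp)
      · exact hB.integrable_norm_pow (by norm_num)
    have h2 := (hp.integrable_comp hi.1).2 hi
    refine (h2.integrableOn (s := Ioc s t ×ˢ Ioc 0 h)).congr ?_
    filter_upwards [ae_restrict_mem (measurableSet_Ioc.prod measurableSet_Ioc)] with z hz
    have : z.2 ∈ Ioc 0 h := hz.2
    simp [Function.comp, this.1, this.2, Set.indicator]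
  have iW : Integrable (fun z : ℝ × ℝ => ‖W (h + z.1)‖ ^ 2)
      ((volume.restrict (Ioc s t)).prod (volume.restrict (Ioc 0 h))) := by
    have h1 : Integrable (fun r => ‖W (h + r)‖ ^ 2) volume :=
      ((measurePreserving_add_left volume h).integrable_comp
        (hW.integrable_norm_pow (by norm_num)).1).2 (hW.integrable_norm_pow (by norm_num))
    have := (h1.integrableOn (s := Ioc s t)).mul_prod
      (integrable_const (1 : ℝ) (μ := volume.restrict (Ioc 0 h)))
    simpa using this
  have mB : AEStronglyMeasurable (fun z : ℝ × ℝ => B (z.2 + z.1))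
      ((volume.restrict (Ioc s t)).prod (volume.restrict (Ioc 0 h))) := by
    have hq : Measure.QuasiMeasurePreserving (fun z : ℝ × ℝ => z.2 + z.1)
        (volume.prod volume) volume := by
      have hp := (measurePreserving_prod_add (volume : Measure ℝ) (volume : Measure ℝ)).comp
        (Measure.measurePreserving_swap (μ := (volume : Measure ℝ)) (ν := (volume : Measure ℝ)))
      exact Measure.quasiMeasurePreserving_snd.comp hp.quasiMeasurePreserving
    have := hB.1.comp_quasiMeasurePreserving hq
    rw [Measure.prod_restrict]
    exact this.mono_measure Measure.restrict_le_self
  have mW : AEStronglyMeasurable (fun z : ℝ × ℝ => W (h + z.1))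
      ((volume.restrict (Ioc s t)).prod (volume.restrict (Ioc 0 h))) := by
    have hq : Measure.QuasiMeasurePreserving (fun z : ℝ × ℝ => h + z.1)
        (volume.prod volume) volume :=
      (measurePreserving_add_left volume h).quasiMeasurePreserving.comp
        Measure.quasiMeasurePreserving_fst
    have := hW.1.comp_quasiMeasurePreserving hq
    rw [Measure.prod_restrict]
    exact this.mono_measure Measure.restrict_le_self
  have iBW : Integrable (fun z : ℝ × ℝ => ⟪B (z.2 + z.1), W (h + z.1)⟫_ℝ)
      ((volume.restrict (Ioc s t)).prod (volume.restrict (Ioc 0 h))) := by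
    refine (iB.add iW).mono (mB.inner mW) (ae_of_all _ fun z => ?_)
    have h1 := norm_inner_le_norm (𝕜 := ℝ) (B (z.2 + z.1)) (W (h + z.1))
    simp only [Pi.add_apply, norm_eq_abs] at h1 ⊢
    refine le_trans ?_ (le_abs_self _)
    nlinarith [sq_nonneg (‖B (z.2 + z.1)‖ - ‖W (h + z.1)‖), sq_nonneg (‖B (z.2 + z.1)‖),
      sq_nonneg (‖W (h + z.1)‖)]
  constructor
  · simp_rw [e1]
    rw [intervalIntegrable_iff_integrableOn_Ioc_of_le hst]
    exact iBW.integral_prod_left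
  · simp_rw [e1, integral_of_le hh, integral_of_le hst]
    exact integral_integral_swap iBW

/-- From an increment inequality tested with the value at the right endpoint to the energy
inequality, for square integrable `B` and `W` on the line. -/
theorem increment_le_integral_of_memLp {B W : ℝ → H} (hB : MemLp B 2 volume)
    (hW : MemLp W 2 volume) {J : ℝ → ℝ} {a c : ℝ} (hJ : IntegrableOn J (Icc a c))
    (hinc : ∀ᵐ t, t ∈ Icc a c → ∀ s ∈ Icc a t, J t - J s ≤ ∫ τ in s..t, ⟪B τ, W t⟫_ℝ)
    (hlsc : ∀ t ∈ Set.Ico a c, ∀ ε > 0, ∀ᶠ r in 𝓝[>] t, J t - ε ≤ J r)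
    {s t : ℝ} (has : a ≤ s) (hst : s ≤ t) (htc : t < c) :
    J t - J s ≤ ∫ τ in s..t, ⟪B τ, W τ⟫_ℝ := by
  have hJi : ∀ {p q : ℝ}, a ≤ p → p ≤ q → q ≤ c → IntervalIntegrable J volume p q := by
    intro p q h1 h2 h3
    exact intervalIntegrable_of_Icc h2 <| hJ.mono_set (Set.Icc_subset_Icc h1 h3)
  have iB2 : Integrable (fun x => ‖B x‖ ^ 2) volume := hB.integrable_norm_pow (by norm_num)
  have iW2 : Integrable (fun x => ‖W x‖ ^ 2) volume := hW.integrable_norm_pow (by norm_num)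
  refine le_of_forall_pos_le_add fun ε hε => ?_
  have hδ := (continuous_integral_inner_translate hB hW s t).tendsto (0, 0)
  simp only [zero_add] at hδ
  have hδ' := hδ.eventually_le_const (lt_add_of_pos_right _ (show 0 < ε / 3 by linarith))
  rw [Metric.eventually_nhds_iff] at hδ'
  obtain ⟨δ, hδ0, hδ1⟩ := hδ'
  have hE1 : ∀ᶠ h in 𝓝[>] (0 : ℝ), h * (J t - ε / 3) ≤ ∫ r in t..t + h, J r := by
    have h1 := hlsc t ⟨has.trans hst, htc⟩ (ε / 3) (by linarith)
    rw [eventually_nhdsWithin_iff, Metric.eventually_nhds_iff] at h1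
    obtain ⟨η, hη, h1⟩ := h1
    filter_upwards [Ioo_mem_nhdsGT (show 0 < min η (c - t) from lt_min hη (by linarith))]
      with h hh
    have hh1 := hh.2.trans_le (min_le_left _ _)
    have hh2 := hh.2.trans_le (min_le_right _ _)
    have hh0 := hh.1
    calc h * (J t - ε / 3) = ∫ r in t..t + h, (J t - ε / 3) := by
          rw [intervalIntegral.integral_const, add_sub_cancel_left, smul_eq_mul]
      _ ≤ _ := by
        refine intervalIntegral.integral_mono_on_of_le_Ioo (by linarith) (by simp)
          (hJi (has.trans hst) (by linarith) (by linarith)) fun r hr => ?_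
        refine h1 ?_ hr.1
        rw [Real.dist_eq, abs_lt]
        constructor <;> linarith [hr.1, hr.2]
  have hE2 : ∀ᶠ h in 𝓝[>] (0 : ℝ), ∫ r in s..s + h, J r ≤ h * (J s + ε / 3) := by
    have hc : Continuous fun h => ∫ r in s..s + h, (‖B r‖ ^ 2 + ‖W r‖ ^ 2) :=
      (intervalIntegral.continuous_primitive (fun p q => (iB2.add iW2).intervalIntegrable) s).comp
        (continuous_const.add continuous_id)
    have h1 := (hc.tendsto 0).eventually_le_const (u := ε / 3) (by simp; linarith)
    filter_upwards [nhdsWithin_le_nhds h1,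
      Ioo_mem_nhdsGT (show 0 < c - s by linarith)] with h hh hhs
    have h0 := hhs.1
    have hb : ∫ r in s..s + h, J r ≤
        ∫ r in s..s + h, ((J s + (1 / 2) * ∫ r in s..s + h, ‖B r‖ ^ 2)
          + (h / 2) * ‖W r‖ ^ 2) := by
      refine integral_mono_ae_restrict (by linarith)
        (hJi has (by linarith) (by linarith [hhs.2]))
        (intervalIntegrable_const.add (iW2.intervalIntegrable.const_mul _)) ?_
      filter_upwards [ae_restrict_of_ae hinc, ae_restrict_mem measurableSet_Icc] with r hr hr2
      have h2 := hr ⟨has.trans hr2.1, by linarith [hr2.2, hhs.2]⟩ s ⟨has, hr2.1⟩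
      have h3 : ∫ τ in s..r, ⟪B τ, W r⟫_ℝ
          ≤ ∫ τ in s..r, ((1 / 2) * ‖B τ‖ ^ 2 + (1 / 2) * ‖W r‖ ^ 2) := by
        have hBi : IntervalIntegrable B volume s r :=
          intervalIntegrable_of_Icc hr2.1 <| (hB.restrict _).integrable (by norm_num)
        refine integral_mono_on hr2.1 ?_
          ((iB2.intervalIntegrable.const_mul _).add intervalIntegrable_const) fun τ _ => ?_
        · rw [intervalIntegrable_iff_integrableOn_Icc_of_le hr2.1] at hBi ⊢
          exact hBi.inner_const _
        · have h1 := (le_abs_self _).trans (abs_real_inner_le_norm (B τ) (W r))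
          nlinarith [sq_nonneg (‖B τ‖ - ‖W r‖)]
      rw [intervalIntegral.integral_add (iB2.intervalIntegrable.const_mul _)
        intervalIntegrable_const, intervalIntegral.integral_const,
        intervalIntegral.integral_const_mul, smul_eq_mul] at h3
      have h4 := integral_add_adjacent_intervals
        (iB2.intervalIntegrable (a := s) (b := r)) (iB2.intervalIntegrable (b := s + h))
      have h5 := intervalIntegral.integral_nonneg (μ := volume) (f := fun r => ‖B r‖ ^ 2)
        hr2.2 (fun _ _ => by positivity)
      have h6 : (r - s) * (1 / 2 * ‖W r‖ ^ 2) ≤ h / 2 * ‖W r‖ ^ 2 := by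
        nlinarith [sq_nonneg ‖W r‖, hr2.2, mul_le_mul_of_nonneg_right
          (show r - s ≤ h by linarith [hr2.2]) (sq_nonneg ‖W r‖)]
      linarith
    rw [intervalIntegral.integral_add intervalIntegrable_const
      (iW2.intervalIntegrable.const_mul _), intervalIntegral.integral_const,
      intervalIntegral.integral_const_mul] at hb
    rw [intervalIntegral.integral_add iB2.intervalIntegrable iW2.intervalIntegrable] at hh
    simp only [add_sub_cancel_left, smul_eq_mul] at hb
    nlinarith [intervalIntegral.integral_nonneg (μ := volume) (f := fun r => ‖B r‖ ^ 2)
      (show s ≤ s + h by linarith) (fun _ _ => by positivity),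
      intervalIntegral.integral_nonneg (μ := volume) (f := fun r => ‖W r‖ ^ 2)
      (show s ≤ s + h by linarith) (fun _ _ => by positivity)]
  have hE3 : ∀ᶠ h in 𝓝[>] (0 : ℝ), h < min δ (c - t) ∧ 0 < h :=
    Eventually.and (nhdsWithin_le_nhds (Iio_mem_nhds (lt_min hδ0 (by linarith))))
      self_mem_nhdsWithin
  obtain ⟨h, hh1, hh2, hh3, h0⟩ := (hE1.and (hE2.and hE3)).exists
  have hhδ := hh3.trans_le (min_le_left _ _)
  have hhc := hh3.trans_le (min_le_right _ _)
  obtain ⟨hi, hsw⟩ := integral_swap_translate hB hW hst h0.le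
  have e1 : ∫ r in s..t, (J (h + r) - J r) = (∫ r in t..t + h, J r) - ∫ r in s..s + h, J r := by
    rw [intervalIntegral.integral_sub, intervalIntegral.integral_comp_add_left J h]
    · rw [add_comm h s, add_comm h t]
      have h1 := integral_add_adjacent_intervals
        (hJi has (show s ≤ s + h by linarith) (by linarith))
        (hJi (has.trans (by linarith)) (show s + h ≤ t + h by linarith) (by linarith))
      have h2 := integral_add_adjacent_intervals
        (hJi has hst htc.le) (hJi (has.trans hst) (show t ≤ t + h by linarith) (by linarith))
      linarith
    · have := hJi (p := s + h) (q := t + h) (by linarith) (by linarith) (by linarith)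
      have := this.comp_add_left h
      simpa using this
    · exact hJi has hst htc.le
  have e2 : ∫ r in s..t, (J (h + r) - J r)
      ≤ ∫ r in s..t, ∫ τ in r..r + h, ⟪B τ, W (h + r)⟫_ℝ := by
    refine integral_mono_ae_restrict hst ?_ hi ?_
    · refine IntervalIntegrable.sub ?_ (hJi has hst htc.le)
      have := hJi (p := s + h) (q := t + h) (by linarith) (by linarith) (by linarith)
      have := this.comp_add_left h
      simpa using this
    · have h1 := (measurePreserving_add_left volume h).quasiMeasurePreserving.ae hinc
      filter_upwards [ae_restrict_of_ae h1, ae_restrict_mem measurableSet_Icc] with r hr hr2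
      have := hr ⟨by linarith [hr2.1], by linarith [hr2.2]⟩ r ⟨by linarith [hr2.1], by linarith⟩
      rwa [add_comm r h]
  have e3 : ∫ σ in (0 : ℝ)..h, ∫ r in s..t, ⟪B (σ + r), W (h + r)⟫_ℝ
      ≤ ∫ σ in (0 : ℝ)..h, ((∫ r in s..t, ⟪B r, W r⟫_ℝ) + ε / 3) := by
    have hcc := (continuous_integral_inner_translate hB hW s t).comp
      (Continuous.prodMk_left h)
    refine integral_mono_on h0.le (hcc.intervalIntegrable _ _) (by simp) ?_
    intro σ hσ
    have := hδ1 (y := (σ, h)) (by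
      rw [Prod.dist_eq, max_lt_iff]
      simp only [Real.dist_eq, sub_zero]
      rw [abs_of_nonneg hσ.1, abs_of_pos h0]
      exact ⟨hσ.2.trans_lt hhδ, hhδ⟩)
    exact this
  rw [e1, hsw] at e2
  rw [intervalIntegral.integral_const, sub_zero, smul_eq_mul] at e3
  have : h * (J t - J s) ≤ h * ((∫ r in s..t, ⟪B r, W r⟫_ℝ) + ε) := by nlinarith
  exact le_of_mul_le_mul_left this h0

/-- From an increment inequality tested with the value at the right endpoint to the energy
inequality. -/
theorem increment_le_integral {B W : ℝ → H} {J : ℝ → ℝ} {a c : ℝ}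
    (hB : MemLp B 2 (volume.restrict (Icc a c)))
    (hW : MemLp W 2 (volume.restrict (Icc a c))) (hJ : IntegrableOn J (Icc a c))
    (hinc : ∀ᵐ t ∂volume.restrict (Icc a c),
      ∀ s ∈ Icc a t, J t - J s ≤ ∫ τ in s..t, ⟪B τ, W t⟫_ℝ)
    (hlsc : ∀ t ∈ Set.Ico a c, ∀ ε > 0, ∀ᶠ r in 𝓝[>] t, J t - ε ≤ J r)
    {s t : ℝ} (has : a ≤ s) (hst : s ≤ t) (htc : t < c) :
    J t - J s ≤ ∫ τ in s..t, ⟪B τ, W τ⟫_ℝ := by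
  have hB' := (memLp_indicator_iff_restrict measurableSet_Icc).2 hB
  have hW' := (memLp_indicator_iff_restrict measurableSet_Icc).2 hW
  have h := increment_le_integral_of_memLp hB' hW' hJ ?_ hlsc has hst htc
  · refine h.trans_eq (intervalIntegral.integral_congr fun τ hτ => ?_)
    rw [Set.uIcc_of_le hst] at hτ
    have : τ ∈ Icc a c := ⟨has.trans hτ.1, hτ.2.trans htc.le⟩
    simp [indicator_of_mem this]
  · rw [ae_restrict_iff' measurableSet_Icc] at hinc
    filter_upwards [hinc] with t ht htm s hs
    refine (ht htm s hs).trans_eq (intervalIntegral.integral_congr fun τ hτ => ?_)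
    rw [Set.uIcc_of_le hs.2] at hτ
    have : τ ∈ Icc a c := ⟨hs.1.trans hτ.1, hτ.2.trans htm.2⟩
    simp [indicator_of_mem this, indicator_of_mem htm]

end Steklov

section Decay

/-- One unit time step of a dissipative integral inequality. -/
theorem unit_step_decay {f F : ℝ → ℝ} {c s : ℝ} (hc : 0 ≤ c)
    (hf : IntegrableOn f (Icc s (s + 1))) (hF : IntegrableOn F (Icc s (s + 1)))
    (hF0 : ∀ t, 0 ≤ F t) (hf0 : ∀ t, 0 ≤ f t)
    (h : ∀ p q, s ≤ p → p ≤ q → q ≤ s + 1 →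
      f q + c * ∫ τ in p..q, f τ ≤ f p + ∫ τ in p..q, F τ) :
    f (s + 1) ≤ (1 + c)⁻¹ * f s + ∫ τ in s..s + 1, F τ := by
  have hFi : ∀ {p q : ℝ}, s ≤ p → p ≤ q → q ≤ s + 1 → IntervalIntegrable F volume p q := by
    intro p q h1 h2 h3
    exact intervalIntegrable_of_Icc h2 <| hF.mono_set (Set.Icc_subset_Icc h1 h3)
  have h1 : ∀ r ∈ Icc s (s + 1), f (s + 1) - (∫ τ in s..s + 1, F τ) ≤ f r := by
    intro r hr
    have h2 := h r (s + 1) hr.1 hr.2 le_rfl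
    have h3 := intervalIntegral.integral_nonneg (μ := volume) hr.2 (fun τ _ => hf0 τ)
    have h4 := integral_add_adjacent_intervals
      (hFi le_rfl hr.1 hr.2) (hFi hr.1 hr.2 le_rfl)
    have h5 := intervalIntegral.integral_nonneg (μ := volume) hr.1 (fun τ _ => hF0 τ)
    nlinarith
  have h2 : f (s + 1) - (∫ τ in s..s + 1, F τ) ≤ ∫ τ in s..s + 1, f τ := by
    have := integral_mono_on (μ := volume) (show s ≤ s + 1 by linarith)
      (intervalIntegrable_const (c := f (s + 1) - (∫ τ in s..s + 1, F τ)))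
      ((intervalIntegrable_iff_integrableOn_Icc_of_le (by linarith)).2 hf) h1
    simpa using this
  have h3 := h s (s + 1) le_rfl (by linarith) le_rfl
  have h4 : (1 + c) * f (s + 1) ≤ f s + (1 + c) * ∫ τ in s..s + 1, F τ := by nlinarith
  have h5 : 0 < 1 + c := by linarith
  rw [← sub_nonneg]
  have : (1 + c)⁻¹ * f s + (∫ τ in s..s + 1, F τ) - f (s + 1)
      = (1 + c)⁻¹ * (f s + (1 + c) * (∫ τ in s..s + 1, F τ) - (1 + c) * f (s + 1)) := by
    field_simp
  rw [this]
  exact mul_nonneg (by positivity) (by linarith)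

/-- Decay to an absorbing level under constant forcing. -/
theorem decay_const {f : ℝ → ℝ} {c C T : ℝ} (hc : 0 < c) (hC : 0 ≤ C)
    (hf : ∀ b, IntegrableOn f (Icc T b)) (hf0 : ∀ t, 0 ≤ f t)
    (h : ∀ p q, T ≤ p → p ≤ q → f q + c * ∫ τ in p..q, f τ ≤ f p + C * (q - p)) {s t : ℝ}
    (hs : T ≤ s) (hst : s ≤ t) :
    f t ≤ (1 + c)⁻¹ ^ ⌊t - s⌋₊ * f s + C * ((1 + c) / c + 1) := by
  have hq0 : 0 ≤ (1 + c)⁻¹ := by positivity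
  have hstep : ∀ r, T ≤ r → f (r + 1) ≤ (1 + c)⁻¹ * f r + C := by
    intro r hr
    have := unit_step_decay (f := f) (F := fun _ => C) (s := r) hc.le
      ((hf (r + 1)).mono_set (Set.Icc_subset_Icc_left hr)) (by simp) (fun _ => hC) hf0
      (fun p q h1 h2 h3 => by simpa [mul_comm] using h p q (hr.trans h1) h2)
    simpa using this
  have hn : ∀ n : ℕ, f (s + n) ≤ (1 + c)⁻¹ ^ n * f s + C * ((1 + c) / c) := by
    intro n
    induction n with
    | zero => simp; positivity
    | succ n ih =>
      have h1 := hstep (s + n) (by linarith [Nat.cast_nonneg (α := ℝ) n])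
      push_cast
      rw [← add_assoc, pow_succ]
      refine h1.trans ?_
      have h2 := mul_le_mul_of_nonneg_left ih hq0
      have h3 : (1 + c)⁻¹ * (C * ((1 + c) / c)) + C = C * ((1 + c) / c) := by field_simp
      nlinarith
  have h1 := hn ⌊t - s⌋₊
  have h2 := Nat.floor_le (show 0 ≤ t - s by linarith)
  have h3 := Nat.lt_floor_add_one (t - s)
  have h4 := h (s + ⌊t - s⌋₊) t (by linarith [Nat.cast_nonneg (α := ℝ) ⌊t - s⌋₊]) (by linarith)
  have h5 := intervalIntegral.integral_nonneg (μ := volume)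
    (show s + ⌊t - s⌋₊ ≤ t by linarith) (fun τ _ => hf0 τ)
  nlinarith

/-- Decay under integrable forcing. -/
theorem decay_integrable {f F : ℝ → ℝ} {c a b : ℝ} (hc : 0 ≤ c)
    (hf : IntegrableOn f (Icc a b)) (hF : IntegrableOn F (Icc a b))
    (hF0 : ∀ t, 0 ≤ F t) (hf0 : ∀ t, 0 ≤ f t)
    (h : ∀ p q, a ≤ p → p ≤ q → q ≤ b →
      f q + c * ∫ τ in p..q, f τ ≤ f p + ∫ τ in p..q, F τ) {t : ℝ} (hat : a ≤ t) (htb : t ≤ b) :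
    f t ≤ (1 + c)⁻¹ ^ ⌊t - a⌋₊ * f a + ∫ τ in a..b, F τ := by
  have hFi : ∀ {p q : ℝ}, a ≤ p → p ≤ q → q ≤ b → IntervalIntegrable F volume p q := by
    intro p q h1 h2 h3
    exact intervalIntegrable_of_Icc h2 <| hF.mono_set (Set.Icc_subset_Icc h1 h3)
  have hq0 : 0 ≤ (1 + c)⁻¹ := by positivity
  have hq1 : (1 + c)⁻¹ ≤ 1 := inv_le_one_of_one_le₀ (by linarith)
  have hn : ∀ n : ℕ, a + n ≤ b →
      f (a + n) ≤ (1 + c)⁻¹ ^ n * f a + ∫ τ in a..a + n, F τ := by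
    intro n
    induction n with
    | zero => simp
    | succ n ih =>
      intro hnb
      push_cast at hnb ⊢
      have hn0 : (0 : ℝ) ≤ n := n.cast_nonneg
      have ih := ih (by linarith)
      have h1 := unit_step_decay (f := f) (F := F) (s := a + n) hc
        (hf.mono_set (Set.Icc_subset_Icc (by linarith) (by linarith)))
        (hF.mono_set (Set.Icc_subset_Icc (by linarith) (by linarith))) hF0 hf0
        (fun p q h1 h2 h3 => h p q (by linarith) h2 (by linarith))
      have h2 := integral_add_adjacent_intervals
        (hFi le_rfl (show a ≤ a + n by linarith) (by linarith))
        (hFi (show a ≤ a + n by linarith) (show a + n ≤ a + n + 1 by linarith) (by linarith))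
      have h3 := intervalIntegral.integral_nonneg (μ := volume)
        (show a ≤ a + n by linarith) (fun τ _ => hF0 τ)
      rw [← add_assoc, ← h2, pow_succ]
      nlinarith [mul_le_mul_of_nonneg_left ih hq0]
  have h2 := Nat.floor_le (show 0 ≤ t - a by linarith)
  have h1 := hn ⌊t - a⌋₊ (by linarith)
  have hk : (0 : ℝ) ≤ ⌊t - a⌋₊ := Nat.cast_nonneg _
  have h4 := h (a + ⌊t - a⌋₊) t (by linarith) (by linarith) htb
  have h5 := intervalIntegral.integral_nonneg (μ := volume)
    (show a + ⌊t - a⌋₊ ≤ t by linarith) (fun τ _ => hf0 τ)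
  have h6 := integral_add_adjacent_intervals
    (hFi le_rfl (show a ≤ a + ⌊t - a⌋₊ by linarith) (by linarith))
    (hFi (show a ≤ a + ⌊t - a⌋₊ by linarith) (show a + ⌊t - a⌋₊ ≤ t by linarith) htb)
  have h7 := integral_add_adjacent_intervals (hFi le_rfl hat htb)
    (hFi hat htb le_rfl)
  have h8 := intervalIntegral.integral_nonneg (μ := volume) htb (fun τ _ => hF0 τ)
  nlinarith

end Decay

instance fact_two_ne_top : Fact ((2 : ℝ≥0∞) ≠ ∞) := ⟨by norm_num⟩

section Measurability

variable {H : Type*} [NormedAddCommGroup H] [InnerProductSpace ℝ H] [CompleteSpace H]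
  [SeparableSpace H]

/-- Pettis' theorem in a separable Hilbert space: weak measurability implies strong
measurability. -/
theorem aestronglyMeasurable_of_inner {X : Type*} [MeasurableSpace X] {μ : Measure X} {u : X → H}
    (hu : ∀ w : H, AEStronglyMeasurable (fun t => ⟪u t, w⟫_ℝ) μ) : AEStronglyMeasurable u μ := by
  let U : ℕ → Submodule ℝ H := fun N => Submodule.span ℝ (denseSeq H '' Set.Iio N)
  have hfd : ∀ N, FiniteDimensional ℝ (U N) := fun N =>
    FiniteDimensional.span_of_finite ℝ ((Set.finite_Iio N).image _)
  have hmono : Monotone U := fun M N h =>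
    Submodule.span_mono (Set.image_mono (Set.Iio_subset_Iio h))
  have htop : ⊤ ≤ (⨆ N, U N).topologicalClosure := by
    intro x _
    rw [← SetLike.mem_coe, topologicalClosure_coe]
    refine closure_mono ?_ (denseRange_denseSeq H x)
    rintro _ ⟨n, rfl⟩
    exact Submodule.mem_iSup_of_mem (n + 1) (Submodule.subset_span ⟨n, by simp, rfl⟩)
  refine aestronglyMeasurable_of_tendsto_ae atTop (f := fun N t => (U N).starProjection (u t))
    (fun N => ?_) (ae_of_all _ fun t => Submodule.starProjection_tendsto_self U hmono (u t) htop)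
  let b := stdOrthonormalBasis ℝ (U N)
  have : ∀ t, (U N).starProjection (u t) = ∑ i, ⟪u t, (b i : H)⟫_ℝ • (b i : H) := by
    intro t
    rw [Submodule.starProjection_apply, ← b.sum_repr' ((U N).orthogonalProjectionOnto (u t))]
    rw [Submodule.coe_sum]
    refine Finset.sum_congr rfl fun i _ => ?_
    rw [Submodule.coe_smul, Submodule.inner_orthogonalProjectionOnto_eq_of_mem_left,
      real_inner_comm]
  simp_rw [this]
  fun_prop

/-- Weakly continuous curves are strongly measurable. -/
theorem aestronglyMeasurable_of_continuousOn_inner {u : ℝ → H} {I : Set ℝ} (hI : MeasurableSet I)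
    (hu : ∀ w : H, ContinuousOn (fun t => ⟪u t, w⟫_ℝ) I) :
    AEStronglyMeasurable u (volume.restrict I) :=
  aestronglyMeasurable_of_inner fun w => (hu w).aestronglyMeasurable hI

omit [SeparableSpace H] in
/-- Weakly continuous curves are bounded on compact sets. -/
theorem exists_bound_of_continuousOn_inner {u : ℝ → H} {I : Set ℝ} (hI : IsCompact I)
    (hu : ∀ w : H, ContinuousOn (fun t => ⟪u t, w⟫_ℝ) I) : ∃ R, 0 ≤ R ∧ ∀ t ∈ I, ‖u t‖ ≤ R := by
  obtain ⟨C, hC⟩ := banach_steinhaus (g := fun t : I => innerSL ℝ (u t)) (fun w => by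
    obtain ⟨C, hC⟩ := hI.exists_bound_of_continuousOn (hu w)
    exact ⟨C, fun t => hC t t.2⟩)
  refine ⟨max C 0, le_max_right _ _, fun t ht => ?_⟩
  have := hC ⟨t, ht⟩
  rw [innerSL_apply_norm] at this
  exact this.trans (le_max_left _ _)

end Measurability

section WeakCompactness

variable {H : Type*} [NormedAddCommGroup H] [InnerProductSpace ℝ H] [CompleteSpace H]
  [SeparableSpace H]

/-- Bounded sequences in a separable Hilbert space have weakly convergent subsequences. -/
theorem exists_subseq_tendsto_inner {v : ℕ → H} {C : ℝ} (hv : ∀ n, ‖v n‖ ≤ C) :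
    ∃ k : ℕ → ℕ, StrictMono k ∧ ∃ v' : H, ∀ w, Tendsto (fun n => ⟪v (k n), w⟫_ℝ) atTop
      (𝓝 ⟪v', w⟫_ℝ) := by
  let x : ℕ → WeakDual ℝ H := fun n => StrongDual.toWeakDual (toDual ℝ H (v n))
  obtain ⟨a, -, k, hk, ha⟩ := WeakDual.isSeqCompact_closedBall ℝ H 0 C (x := x) (fun n => by
    simp [x, hv n])
  refine ⟨k, hk, (toDual ℝ H).symm (WeakDual.toStrongDual a), fun w => ?_⟩
  have h1 := ((WeakDual.eval_continuous (𝕜 := ℝ) w).tendsto a).comp ha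
  have h2 : ⟪(toDual ℝ H).symm (WeakDual.toStrongDual a), w⟫_ℝ = a w := by
    rw [InnerProductSpace.toDual_symm_apply]; rfl
  rw [h2]
  exact h1

/-- Weak compactness in `L²_loc(ℝ; H)`. -/
theorem exists_subseq_tendstoWeakL2Loc {v : ℕ → ℝ → H} {C : ℝ}
    (hm : ∀ n, AEStronglyMeasurable (v n) volume)
    (hv : ∀ n (j : ℤ), ∫⁻ t in Set.Ico (j : ℝ) (j + 1), ‖v n t‖ₑ ^ 2 ≤ ofReal C) :
    ∃ k : ℕ → ℕ, StrictMono k ∧ ∃ v' : ℝ → H,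
      (∀ K : ℝ, MemLp v' 2 (volume.restrict (Icc (-K) K))) ∧
      TendstoWeakL2Loc (fun n => v (k n)) v' := by
  let g : ℝ → ℝ := fun t => (1 / 2) ^ (⌊t⌋.natAbs)
  have hgm : Measurable g :=
    (Measurable.of_discrete (f := fun j : ℤ => (1 / 2 : ℝ) ^ j.natAbs)).comp Int.measurable_floor
  have hg0 : ∀ t, 0 < g t := fun t => by positivity
  have hgi : ∀ K : ℝ, ∃ M : ℝ, ∀ t ∈ Icc (-K) K, (g t)⁻¹ ≤ M := by
    intro K
    refine ⟨2 ^ (⌈K⌉₊ + 1), fun t ht => ?_⟩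
    simp only [g, one_div, inv_pow, inv_inv]
    refine pow_le_pow_right₀ (by norm_num) ?_
    have h1 := Int.floor_le t
    have h2 := Int.lt_floor_add_one t
    have h3 := Nat.le_ceil K
    have h4 : ⌊t⌋ ≤ (⌈K⌉₊ + 1 : ℕ) := by
      have : (⌊t⌋ : ℝ) ≤ ((⌈K⌉₊ + 1 : ℕ) : ℤ) := by push_cast; linarith [ht.2]
      exact_mod_cast this
    have h5 : -((⌈K⌉₊ + 1 : ℕ) : ℤ) ≤ ⌊t⌋ := by
      have : ((-((⌈K⌉₊ + 1 : ℕ) : ℤ) : ℤ) : ℝ) ≤ (⌊t⌋ : ℝ) := by push_cast; linarith [ht.1]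
      exact_mod_cast this
    omega
  have hsum : Summable fun j : ℤ => (1 / 4 : ℝ) ^ j.natAbs := by
    refine Summable.of_nat_of_neg ?_ ?_ <;>
    · simpa using summable_geometric_of_lt_one (r := (4 : ℝ)⁻¹) (by norm_num) (by norm_num)
  have hbd : ∀ n, ∫⁻ t, ‖g t • v n t‖ₑ ^ 2 ≤
      ofReal ((∑' j : ℤ, (1 / 4 : ℝ) ^ j.natAbs) * max C 0) := by
    intro n
    have hU : (⋃ j : ℤ, Set.Ico (j : ℝ) (j + 1)) = Set.univ := iUnion_Ico_intCast ℝ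
    rw [← setLIntegral_univ, ← hU, lintegral_iUnion (fun j => measurableSet_Ico)
      (by exact_mod_cast Set.pairwise_disjoint_Ico_intCast ℝ), ENNReal.ofReal_mul (tsum_nonneg fun j => by positivity),
      ENNReal.ofReal_tsum_of_nonneg (fun j => by positivity) hsum, ← ENNReal.tsum_mul_right]
    refine ENNReal.tsum_le_tsum fun j => ?_
    calc ∫⁻ t in Set.Ico (j : ℝ) (j + 1), ‖g t • v n t‖ₑ ^ 2
        = ∫⁻ t in Set.Ico (j : ℝ) (j + 1),
            ofReal ((1 / 4 : ℝ) ^ j.natAbs) * ‖v n t‖ₑ ^ 2 := by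
          refine setLIntegral_congr_fun measurableSet_Ico fun t ht => ?_
          have hj : ⌊t⌋ = j := Int.floor_eq_iff.2 ht
          simp only [g, hj]
          rw [enorm_smul, mul_pow]
          congr 1
          rw [Real.enorm_of_nonneg (by positivity), ← ENNReal.ofReal_pow (by positivity),
            ← pow_mul, mul_comm, pow_mul]
          norm_num
      _ ≤ _ := by
          rw [lintegral_const_mul' _ _ ENNReal.ofReal_ne_top]
          gcongr
          exact (hv n j).trans (ofReal_le_ofReal (le_max_left _ _))
  have hmem : ∀ n, MemLp (fun t => g t • v n t) 2 volume := by
    intro n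
    refine ⟨hgm.aestronglyMeasurable.smul (hm n), ?_⟩
    rw [eLpNorm_lt_top_iff_lintegral_rpow_enorm_lt_top (by norm_num) (by norm_num)]
    simpa using (hbd n).trans_lt ENNReal.ofReal_lt_top
  have hnorm : ∀ n, ‖(hmem n).toLp (fun t => g t • v n t)‖ ≤
      √((∑' j : ℤ, (1 / 4 : ℝ) ^ j.natAbs) * max C 0) := by
    intro n
    refine le_sqrt_of_sq_le ?_
    rw [← real_inner_self_eq_norm_sq, L2.inner_def]
    have h1 : ∫ t, ⟪(hmem n).toLp _ t, (hmem n).toLp _ t⟫_ℝ = ∫ t, ‖g t • v n t‖ ^ 2 := by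
      refine integral_congr_ae ?_
      filter_upwards [(hmem n).coeFn_toLp] with t ht
      rw [ht, real_inner_self_eq_norm_sq]
    rw [h1, integral_eq_lintegral_of_nonneg_ae (ae_of_all _ fun _ => by positivity)
      ((hmem n).integrable_norm_pow (by norm_num)).1]
    refine ENNReal.toReal_le_of_le_ofReal
      (mul_nonneg (tsum_nonneg fun _ => by positivity) (le_max_right _ _)) ?_
    simpa [ENNReal.ofReal_pow] using hbd n
  obtain ⟨k, hk, w, hw⟩ := exists_subseq_tendsto_inner hnorm
  have hMul : ∀ (K : ℝ) (Φ : ℝ → H), MemLp Φ 2 (volume.restrict (Icc (-K) K)) →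
      MemLp (fun t => (g t)⁻¹ • Φ t) 2 (volume.restrict (Icc (-K) K)) := by
    intro K Φ hΦ
    obtain ⟨M, hM⟩ := hgi K
    refine hΦ.of_le_mul (c := M) (hgm.inv.aestronglyMeasurable.smul hΦ.1) ?_
    filter_upwards [ae_restrict_mem measurableSet_Icc] with t ht
    rw [norm_smul, norm_of_nonneg (inv_nonneg.2 (hg0 t).le)]
    exact mul_le_mul_of_nonneg_right (hM t ht) (norm_nonneg _)
  refine ⟨k, hk, fun t => (g t)⁻¹ • w t, fun K => hMul K _ ((Lp.memLp w).restrict _), ?_⟩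
  intro K Φ hΦ
  have hΨ := (memLp_indicator_iff_restrict measurableSet_Icc).2 (hMul K Φ hΦ)
  have h1 := hw hΨ.toLp
  have key : ∀ (x : Lp H 2 (volume : Measure ℝ)) (y : ℝ → H), x =ᵐ[volume] (fun t => g t • y t) →
      ⟪x, hΨ.toLp⟫_ℝ = ∫ t in Icc (-K) K, ⟪y t, Φ t⟫_ℝ := by
    intro x y hxy
    rw [L2.inner_def, ← integral_indicator measurableSet_Icc]
    refine integral_congr_ae ?_
    filter_upwards [hxy, hΨ.coeFn_toLp] with t ht1 ht2
    rw [ht1, ht2]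
    by_cases ht : t ∈ Icc (-K) K
    · simp only [indicator_of_mem ht, inner_smul_left, inner_smul_right]
      simp [(hg0 t).ne']
    · simp [indicator_of_notMem ht]
  rw [key w (fun t => (g t)⁻¹ • w t) (ae_of_all _ fun t => by
    simp [smul_smul, (hg0 t).ne'])] at h1
  refine h1.congr fun n => ?_
  rw [key _ (v (k n)) (hmem (k n)).coeFn_toLp]

omit [SeparableSpace H] in
/-- A weak limit in `L²_loc(ℝ; H)` of curves in a closed subspace lies in this subspace. -/
theorem ae_mem_of_tendstoWeakL2Loc {v : ℕ → ℝ → H} {v' : ℝ → H} (V : Submodule ℝ H)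
    (hV : IsClosed (V : Set H)) (hlim : TendstoWeakL2Loc v v')
    (hm : ∀ K : ℝ, MemLp v' 2 (volume.restrict (Icc (-K) K)))
    (hv : ∀ K : ℝ, ∀ᶠ n in atTop, ∀ᵐ t ∂volume.restrict (Icc (-K) K), v n t ∈ V) :
    ∀ᵐ t, v' t ∈ V := by
  have : CompleteSpace V := hV.completeSpace_coe
  have key : ∀ K : ℕ, ∀ᵐ t ∂volume.restrict (Icc (-(K : ℝ)) K), v' t ∈ V := by
    intro K
    let Φ : ℝ → H := fun t => Vᗮ.starProjection (v' t)
    have hΦ : MemLp Φ 2 (volume.restrict (Icc (-(K : ℝ)) K)) :=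
      Vᗮ.starProjection.comp_memLp' (hm K)
    have h0 : ∫ t in Icc (-(K : ℝ)) K, ⟪v' t, Φ t⟫_ℝ = 0 := by
      refine tendsto_nhds_unique (hlim K Φ hΦ) (tendsto_const_nhds.congr' ?_)
      filter_upwards [hv K] with n hn
      symm
      refine integral_eq_zero_of_ae ?_
      filter_upwards [hn] with t ht
      exact Submodule.inner_right_of_mem_orthogonal ht (Submodule.starProjection_apply_mem _ _)
    have h1 : ∀ t, ⟪v' t, Φ t⟫_ℝ = ‖Φ t‖ ^ 2 := by
      intro t
      have : Vᗮ.starProjection (Φ t) = Φ t :=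
        Submodule.starProjection_eq_self_iff.2 (Submodule.starProjection_apply_mem _ _)
      rw [← real_inner_self_eq_norm_sq]
      conv_lhs => rw [← this]
      rw [← Submodule.inner_starProjection_left_eq_right]
    simp_rw [h1] at h0
    rw [integral_eq_zero_iff_of_nonneg (fun _ => by positivity)
      (hΦ.integrable_norm_pow (by norm_num))] at h0
    filter_upwards [h0] with t ht
    have h2 : Vᗮ.starProjection (v' t) = 0 := by simpa [Φ] using ht
    rw [Submodule.starProjection_orthogonal_val, sub_eq_zero] at h2
    rw [h2]
    exact Submodule.starProjection_apply_mem _ _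
  have hU : (⋃ K : ℕ, Icc (-(K : ℝ)) K) = Set.univ := by
    refine Set.eq_univ_of_forall fun t => Set.mem_iUnion.2 ⟨⌈|t|⌉₊, abs_le.1 (Nat.le_ceil _)⟩
  rw [← Measure.restrict_univ (μ := (volume : Measure ℝ)), ← hU, ae_restrict_iUnion_iff]
  exact key

end WeakCompactness

section Smooth

variable {X F : Type*} [NormedAddCommGroup X] [NormedSpace ℝ X] [FiniteDimensional ℝ X]
  [MeasureSpace X] [BorelSpace X] [(volume : Measure X).IsAddHaarMeasure]
  [NormedAddCommGroup F] [NormedSpace ℝ F] [CompleteSpace F]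

open scoped Convolution

theorem fderiv_normed_convolution (ρ : ContDiffBump (0 : X)) {φ : X → F} (hφ : ContDiff ℝ 1 φ)
    (hc : HasCompactSupport φ) (x : X) :
    fderiv ℝ (ρ.normed volume ⋆[lsmul ℝ ℝ, volume] φ) x
      = (ρ.normed volume ⋆[lsmul ℝ ℝ, volume] fderiv ℝ φ) x := by
  have h := HasCompactSupport.hasFDerivAt_convolution_right (μ := volume)
    (lsmul ℝ ℝ : ℝ →L[ℝ] F →L[ℝ] F) hc
    (f := ρ.normed volume) ρ.continuous_normed.locallyIntegrable hφ x
  rw [h.fderiv]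
  rfl

/-- Compactly supported `C¹` functions are approximated in `C¹` by test functions. -/
theorem exists_testFunction_approx {Ω : Opens X} {φ : X → F} (hφ : ContDiff ℝ 1 φ)
    (hc : HasCompactSupport φ) (hΩ : tsupport φ ⊆ Ω) {ε : ℝ} (hε : 0 < ε) :
    ∃ ψ : 𝓓(Ω, F), (∀ x, ‖φ x - ψ x‖ ≤ ε) ∧ ∀ x, ‖fderiv ℝ φ x - fderiv ℝ ψ x‖ ≤ ε := by
  obtain ⟨δ, hδ, hδΩ⟩ := hc.isCompact.exists_cthickening_subset_open Ω.isOpen hΩ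
  have hu1 := hc.uniformContinuous_of_continuous hφ.continuous
  have hu2 := (hc.fderiv (𝕜 := ℝ)).uniformContinuous_of_continuous
    (hφ.continuous_fderiv (by norm_num))
  rw [Metric.uniformContinuous_iff] at hu1 hu2
  obtain ⟨δ1, hδ1, hu1⟩ := hu1 ε hε
  obtain ⟨δ2, hδ2, hu2⟩ := hu2 ε hε
  have hm : 0 < min δ (min δ1 δ2) := lt_min hδ (lt_min hδ1 hδ2)
  let ρ : ContDiffBump (0 : X) := ⟨min δ (min δ1 δ2) / 4, min δ (min δ1 δ2) / 2, by positivity,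
    by linarith⟩
  have hρ : ρ.rOut < min δ (min δ1 δ2) := by simp only [ρ]; linarith
  have hsupp : Function.support (ρ.normed volume ⋆[lsmul ℝ ℝ, volume] φ)
      ⊆ cthickening δ (tsupport φ) := by
    refine (support_convolution_subset _).trans ?_
    rintro _ ⟨y, hy, z, hz, rfl⟩
    refine Metric.mem_cthickening_of_dist_le _ z _ _ (subset_tsupport _ hz) ?_
    rw [ρ.support_normed_eq, mem_ball_zero_iff] at hy
    simp only [dist_add_self_left]
    exact (hy.trans hρ).le.trans (min_le_left _ _)
  have hcs : IsCompact (cthickening δ (tsupport φ)) := hc.isCompact.cthickening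
  have hsupp' := closure_minimal hsupp Metric.isClosed_cthickening
  let ψ : 𝓓(Ω, F) := ⟨ρ.normed volume ⋆[lsmul ℝ ℝ, volume] φ,
    ρ.hasCompactSupport_normed.contDiff_convolution_left _ ρ.contDiff_normed
      hφ.continuous.locallyIntegrable,
    HasCompactSupport.of_support_subset_isCompact hcs hsupp, hsupp'.trans hδΩ⟩
  refine ⟨ψ, fun x => ?_, fun x => ?_⟩
  · rw [← dist_eq_norm, dist_comm]
    refine ρ.dist_normed_convolution_le hφ.continuous.aestronglyMeasurable fun y hy => ?_
    exact (hu1 ((hy.trans hρ).trans_le ((min_le_right _ _).trans (min_le_left _ _)))).le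
  · rw [← dist_eq_norm, dist_comm]
    change dist (fderiv ℝ (ρ.normed volume ⋆[lsmul ℝ ℝ, volume] φ) x) _ ≤ _
    rw [fderiv_normed_convolution ρ hφ hc]
    refine ρ.dist_normed_convolution_le
      (hφ.continuous_fderiv (by norm_num)).aestronglyMeasurable fun y hy => ?_
    exact (hu2 ((hy.trans hρ).trans_le ((min_le_right _ _).trans (min_le_right _ _)))).le

/-- Integration by parts against a compactly supported function. -/
theorem integral_mul_fderiv_of_hasCompactSupport {f ψ : X → ℝ} (hf : ContDiff ℝ 1 f)
    (hψ : ContDiff ℝ 1 ψ) (hc : HasCompactSupport ψ) (v : X) :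
    ∫ x, f x * fderiv ℝ ψ x v = - ∫ x, fderiv ℝ f x v * ψ x := by
  have c1 : Continuous fun x => fderiv ℝ f x v :=
    (hf.continuous_fderiv (by norm_num)).clm_apply continuous_const
  have c2 : Continuous fun x => fderiv ℝ ψ x v :=
    (hψ.continuous_fderiv (by norm_num)).clm_apply continuous_const
  refine integral_mul_fderiv_eq_neg_fderiv_mul_of_integrable ?_ ?_ ?_
    (fun x _ => hf.differentiable (by norm_num) x) (fun x _ => hψ.differentiable (by norm_num) x)
  · exact (c1.mul hψ.continuous).integrable_of_hasCompactSupport hc.mul_left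
  · exact (hf.continuous.mul c2).integrable_of_hasCompactSupport
      ((hc.fderiv_apply (𝕜 := ℝ) v).mul_left)
  · exact (hf.continuous.mul hψ.continuous).integrable_of_hasCompactSupport hc.mul_left

open Module in
/-- Poincaré's inequality for compactly supported functions. -/
theorem exists_poincare_const [FiniteDimensional ℝ F] {Ω : Opens X}
    (hΩ : IsBounded (Ω : Set X)) (hd : 2 ≤ finrank ℝ X) (hd' : finrank ℝ X ≤ 3) :
    ∃ C : ℝ≥0, ∀ φ : 𝓓(Ω, F), eLpNorm φ 2 (volume.restrict (Ω : Set X))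
      ≤ C * eLpNorm (fderiv ℝ φ) 2 (volume.restrict (Ω : Set X)) := by
  let C1 := eLpNormLESNormFDerivOfLeConst F (volume : Measure X) (Ω : Set X) (3 / 2) 2
  let m : ℝ≥0∞ := volume (Ω : Set X) ^ (1 / (3 / 2 : ℝ≥0∞).toReal - 1 / (2 : ℝ≥0∞).toReal)
  have hm : m ≠ ∞ := by
    refine ENNReal.rpow_ne_top_of_nonneg ?_ hΩ.measure_lt_top.ne
    norm_num
  refine ⟨C1 * m.toNNReal, fun φ => ?_⟩
  have hsub : Function.support φ ⊆ (Ω : Set X) := (subset_tsupport _).trans φ.tsupport_subset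
  have hsub' : Function.support (fderiv ℝ φ) ⊆ (Ω : Set X) :=
    (support_fderiv_subset ℝ).trans φ.tsupport_subset
  have h1 := eLpNorm_le_eLpNorm_fderiv_of_le (volume : Measure X) (u := φ) (s := (Ω : Set X))
    (p := 3 / 2) (q := 2) (φ.contDiff.of_le (by simp)) hsub (by
      rw [one_le_div₀] <;> norm_num) (by
      have : (2 : ℝ≥0) ≤ finrank ℝ X := by exact_mod_cast hd
      refine lt_of_lt_of_le ?_ this
      rw [div_lt_iff₀] <;> norm_num) (by
      push_cast
      have h3 : (finrank ℝ X : ℝ) ≤ 3 := by exact_mod_cast hd'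
      have h2 : (2 : ℝ) ≤ finrank ℝ X := by exact_mod_cast hd
      have : (3 : ℝ)⁻¹ ≤ (finrank ℝ X : ℝ)⁻¹ := inv_anti₀ (by linarith) h3
      norm_num at this ⊢
      linarith) hΩ
  have r1 := eLpNorm_restrict_eq_of_support_subset (μ := volume) (p := ((2 : ℝ≥0) : ℝ≥0∞)) hsub
  have r2 := eLpNorm_restrict_eq_of_support_subset (μ := volume) (p := ((3 / 2 : ℝ≥0) : ℝ≥0∞))
    (f := fderiv ℝ φ) hsub'
  rw [← r1, ← r2] at h1
  have e1 : ((3 / 2 : ℝ≥0) : ℝ≥0∞) = 3 / 2 := by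
    rw [ENNReal.coe_div (by norm_num)]; norm_num
  rw [e1] at h1
  refine h1.trans ?_
  rw [ENNReal.coe_mul, ENNReal.coe_toNNReal hm, mul_assoc]
  gcongr
  rw [mul_comm]
  have h2 := eLpNorm_le_eLpNorm_mul_rpow_measure_univ (μ := volume.restrict (Ω : Set X))
    (p := 3 / 2) (q := 2) (f := fderiv ℝ φ) (by
      rw [ENNReal.div_le_iff] <;> norm_num)
    ((φ.contDiff.continuous_fderiv (by simp)).aestronglyMeasurable)
  simpa [m] using h2

end Smooth

section Ladyzhenskaya

/-- Ladyzhenskaya's inequality for compactly supported planar fields. -/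
theorem exists_ladyzhenskaya_const :
    ∃ C : ℝ≥0, ∀ φ : E2 → E2, ContDiff ℝ 1 φ → HasCompactSupport φ →
      eLpNorm φ 4 volume ^ 2 ≤ C * (eLpNorm φ 2 volume * eLpNorm (fderiv ℝ φ) 2 volume) := by
  refine ⟨eLpNormLESNormFDerivOneConst (volume : Measure E2) 2 * 2, fun φ hφ hc => ?_⟩
  have hv : ContDiff ℝ 1 fun x => ‖φ x‖ ^ 2 := hφ.norm_sq ℝ
  have hvc : HasCompactSupport fun x => ‖φ x‖ ^ 2 := hc.norm.comp_left (g := fun r : ℝ => r ^ 2)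
    (by norm_num)
  have h1 := eLpNorm_le_eLpNorm_fderiv_one (volume : Measure E2) hv hvc (p := 2) (by
    rw [show Module.finrank ℝ E2 = 2 by simp]
    exact_mod_cast NNReal.HolderConjugate.two_two)
  have e1 : eLpNorm (fun x => ‖φ x‖ ^ 2) ((2 : ℝ≥0) : ℝ≥0∞) volume = eLpNorm φ 4 volume ^ 2 := by
    have := eLpNorm_norm_rpow (μ := volume) (p := 2) φ (show (0 : ℝ) < 2 by norm_num)
    simp only [Real.rpow_ofNat, ENNReal.rpow_ofNat] at this
    rw [ENNReal.coe_ofNat, this]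
    norm_num
  rw [← e1]
  refine h1.trans ?_
  rw [ENNReal.coe_mul, mul_assoc]
  refine mul_le_mul_right ?_ _
  have h2 : ∀ x, ‖fderiv ℝ (fun x => ‖φ x‖ ^ 2) x‖ ≤ 2 * ‖φ x‖ * ‖fderiv ℝ φ x‖ := by
    intro x
    rw [((hφ.differentiable (by norm_num) x).hasFDerivAt.norm_sq).fderiv]
    refine ContinuousLinearMap.opNorm_le_bound _ (by positivity) fun v => ?_
    simp only [_root_.smul_apply, ContinuousLinearMap.comp_apply, nsmul_eq_mul,
      innerSL_apply_apply, norm_mul, Nat.cast_ofNat, Real.norm_ofNat]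
    have h3 := norm_inner_le_norm (𝕜 := ℝ) (φ x) (fderiv ℝ φ x v)
    have h4 := (fderiv ℝ φ x).le_opNorm v
    nlinarith [norm_nonneg (φ x)]
  have h3 := eLpNorm_le_eLpNorm_mul_eLpNorm'_of_norm (μ := (volume : Measure E2)) (p := 2) (q := 2)
    (r := 1) hφ.continuous.norm.aestronglyMeasurable
    (hφ.continuous_fderiv (by norm_num)).norm.aestronglyMeasurable (fun a b => 2 * a * b) 2
    (ae_of_all _ fun x => by simp)
  rw [eLpNorm_norm, eLpNorm_norm] at h3
  rw [← mul_assoc]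
  refine (eLpNorm_mono fun x => ?_).trans h3
  refine (h2 x).trans (le_abs_self _)

end Ladyzhenskaya

section L2Tools

variable {X E F G : Type*} [MeasurableSpace X] {μ : Measure X}
  [NormedAddCommGroup E] [InnerProductSpace ℝ E] [NormedAddCommGroup F] [InnerProductSpace ℝ F]
  [NormedAddCommGroup G] [InnerProductSpace ℝ G]

open Classical in
/-- The class in `L²` of a function, with the junk value `0` when it is not square integrable. -/
def toL2 (μ : Measure X) (f : X → E) : Lp E 2 μ := if h : MemLp f 2 μ then h.toLp f else 0

theorem coeFn_toL2 {f : X → E} (hf : MemLp f 2 μ) : toL2 μ f =ᵐ[μ] f := by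
  rw [toL2, dif_pos hf]; exact hf.coeFn_toLp

theorem toL2_congr {f g : X → E} (h : f =ᵐ[μ] g) : toL2 μ f = toL2 μ g := by
  by_cases hf : MemLp f 2 μ
  · rw [toL2, toL2, dif_pos hf, dif_pos (hf.ae_eq h), MemLp.toLp_eq_toLp_iff]
    exact h
  · rw [toL2, toL2, dif_neg hf, dif_neg fun hg => hf (hg.ae_eq h.symm)]

theorem norm_toL2 {f : X → E} (hf : MemLp f 2 μ) : ‖toL2 μ f‖ = (eLpNorm f 2 μ).toReal := by
  rw [toL2, dif_pos hf, Lp.norm_toLp]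

theorem inner_toL2 {f g : X → E} (hf : MemLp f 2 μ) (hg : MemLp g 2 μ) :
    ⟪toL2 μ f, toL2 μ g⟫_ℝ = ∫ x, ⟪f x, g x⟫_ℝ ∂μ := by
  rw [L2.inner_def]
  refine integral_congr_ae ?_
  filter_upwards [coeFn_toL2 hf, coeFn_toL2 hg] with x h1 h2
  rw [h1, h2]

theorem inner_toL2_right (v : Lp E 2 μ) {f : X → E} (hf : MemLp f 2 μ) :
    ⟪v, toL2 μ f⟫_ℝ = ∫ x, ⟪v x, f x⟫_ℝ ∂μ := by
  rw [L2.inner_def]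
  refine integral_congr_ae ?_
  filter_upwards [coeFn_toL2 hf] with x hx
  rw [hx]

theorem norm_sq_eq_integral (f : Lp E 2 μ) : ‖f‖ ^ 2 = ∫ x, ‖f x‖ ^ 2 ∂μ := by
  rw [← real_inner_self_eq_norm_sq, L2.inner_def]
  simp_rw [real_inner_self_eq_norm_sq]

theorem integrable_norm_sq (f : Lp E 2 μ) : Integrable (fun x => ‖f x‖ ^ 2) μ :=
  (Lp.memLp f).integrable_norm_pow (by norm_num)

theorem tendsto_toL2_of_tendsto_ae {f : ℕ → X → E} {g : X → E} {B : X → ℝ} (hB : MemLp B 2 μ)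
    (hf : ∀ n, MemLp (f n) 2 μ) (hg : MemLp g 2 μ)
    (hb : ∀ n, ∀ᵐ x ∂μ, ‖f n x - g x‖ ≤ B x)
    (hlim : ∀ᵐ x ∂μ, Tendsto (fun n => f n x) atTop (𝓝 (g x))) :
    Tendsto (fun n => toL2 μ (f n)) atTop (𝓝 (toL2 μ g)) := by
  rw [tendsto_iff_norm_sub_tendsto_zero]
  have h1 : Tendsto (fun n => ‖toL2 μ (f n) - toL2 μ g‖ ^ 2) atTop (𝓝 0) := by
    have h2 : ∀ n, ‖toL2 μ (f n) - toL2 μ g‖ ^ 2 = ∫ x, ‖f n x - g x‖ ^ 2 ∂μ := by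
      intro n
      rw [norm_sq_eq_integral]
      refine integral_congr_ae ?_
      filter_upwards [Lp.coeFn_sub (toL2 μ (f n)) (toL2 μ g), coeFn_toL2 (hf n), coeFn_toL2 hg]
        with x h1 h2 h3
      rw [h1, Pi.sub_apply, h2, h3]
    simp_rw [h2]
    rw [show (0 : ℝ) = ∫ x, 0 ∂μ by simp]
    refine tendsto_integral_of_dominated_convergence (fun x => B x ^ 2)
      (fun n => ((hf n).1.sub hg.1).norm.pow 2) hB.integrable_sq (fun n => ?_) ?_
    · filter_upwards [hb n] with x hx
      rw [norm_of_nonneg (by positivity)]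
      exact pow_le_pow_left₀ (norm_nonneg _) hx 2
    · filter_upwards [hlim] with x hx
      have := ((hx.sub_const (g x)).norm.pow 2)
      simpa using this
  have h3 := h1.sqrt
  simpa [Real.sqrt_sq] using h3

theorem exists_subseq_tendsto_ae {f : ℕ → Lp E 2 μ} {g : Lp E 2 μ}
    (h : Tendsto f atTop (𝓝 g)) :
    ∃ k : ℕ → ℕ, StrictMono k ∧ ∀ᵐ x ∂μ, Tendsto (fun n => f (k n) x) atTop (𝓝 (g x)) := by
  have := tendstoInMeasure_of_tendsto_Lp h
  exact this.exists_seq_tendsto_ae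

/-- Pointwise multiplication by a bounded operator-valued function. -/
def mulOp (A : X → E →L[ℝ] F) (M : ℝ) (hA : AEStronglyMeasurable A μ)
    (hM : ∀ᵐ x ∂μ, ‖A x‖ ≤ M) : Lp E 2 μ →L[ℝ] Lp F 2 μ :=
  have hm : ∀ f : Lp E 2 μ, MemLp (fun x => A x (f x)) 2 μ := fun f =>
    (Lp.memLp f).of_le_mul (c := M)
      ((ContinuousLinearMap.id ℝ (E →L[ℝ] F)).aestronglyMeasurable_comp₂ hA
        (Lp.aestronglyMeasurable f)) (by
      filter_upwards [hM] with x hx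
      exact ((A x).le_opNorm _).trans (mul_le_mul_of_nonneg_right hx (norm_nonneg _)))
  LinearMap.mkContinuous
    { toFun := fun f => toL2 μ fun x => A x (f x)
      map_add' := fun f g => by
        refine Lp.ext ?_
        filter_upwards [coeFn_toL2 (hm (f + g)), coeFn_toL2 (hm f), coeFn_toL2 (hm g),
          Lp.coeFn_add f g, Lp.coeFn_add (toL2 μ fun x => A x (f x)) (toL2 μ fun x => A x (g x))]
          with x h1 h2 h3 h4 h5
        rw [h1, h5, Pi.add_apply, h2, h3, h4, Pi.add_apply, map_add]
      map_smul' := fun c f => by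
        refine Lp.ext ?_
        filter_upwards [coeFn_toL2 (hm (c • f)), coeFn_toL2 (hm f),
          Lp.coeFn_smul c f, Lp.coeFn_smul c (toL2 μ fun x => A x (f x))]
          with x h1 h2 h3 h4
        rw [RingHom.id_apply, h1, h4, Pi.smul_apply, h2, h3, Pi.smul_apply, map_smul] } M
    fun f => by
      refine Lp.norm_le_mul_norm_of_ae_le_mul ?_
      filter_upwards [coeFn_toL2 (hm f), hM] with x h1 h2
      rw [LinearMap.coe_mk, AddHom.coe_mk, h1]
      exact ((A x).le_opNorm _).trans (mul_le_mul_of_nonneg_right h2 (norm_nonneg _))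

theorem coeFn_mulOp {A : X → E →L[ℝ] F} {M : ℝ} (hA : AEStronglyMeasurable A μ)
    (hM : ∀ᵐ x ∂μ, ‖A x‖ ≤ M) (f : Lp E 2 μ) : mulOp A M hA hM f =ᵐ[μ] fun x => A x (f x) := by
  refine coeFn_toL2 ((Lp.memLp f).of_le_mul (c := M)
      ((ContinuousLinearMap.id ℝ (E →L[ℝ] F)).aestronglyMeasurable_comp₂ hA
        (Lp.aestronglyMeasurable f)) ?_)
  filter_upwards [hM] with x hx
  exact ((A x).le_opNorm _).trans (mul_le_mul_of_nonneg_right hx (norm_nonneg _))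

/-- The product of a function of a scalar field and a vector field. -/
def nem (γ : ℝ → ℝ) (f : Lp ℝ 2 μ) (D : Lp E 2 μ) : Lp E 2 μ := toL2 μ fun x => γ (f x) • D x

variable {γ : ℝ → ℝ} {M : ℝ}

theorem memLp_nem (hγ : Continuous γ) (hM : ∀ s, |γ s| ≤ M) (f : Lp ℝ 2 μ) (D : Lp E 2 μ) :
    MemLp (fun x => γ (f x) • D x) 2 μ :=
  (Lp.memLp D).of_le_mul (c := M)
    ((hγ.comp_aestronglyMeasurable (Lp.aestronglyMeasurable f)).smul (Lp.aestronglyMeasurable D))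
    (ae_of_all _ fun x => by
      rw [norm_smul]
      exact mul_le_mul_of_nonneg_right (hM _) (norm_nonneg _))

theorem coeFn_nem (hγ : Continuous γ) (hM : ∀ s, |γ s| ≤ M) (f : Lp ℝ 2 μ) (D : Lp E 2 μ) :
    nem γ f D =ᵐ[μ] fun x => γ (f x) • D x :=
  coeFn_toL2 (memLp_nem hγ hM f D)

theorem norm_nem_le (hγ : Continuous γ) (hM : ∀ s, |γ s| ≤ M) (f : Lp ℝ 2 μ) (D : Lp E 2 μ) :
    ‖nem γ f D‖ ≤ M * ‖D‖ := by
  refine Lp.norm_le_mul_norm_of_ae_le_mul ?_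
  filter_upwards [coeFn_nem hγ hM f D] with x hx
  rw [hx, norm_smul]
  exact mul_le_mul_of_nonneg_right (hM _) (norm_nonneg _)

theorem nem_sub (hγ : Continuous γ) (hM : ∀ s, |γ s| ≤ M) (f : Lp ℝ 2 μ) (D D' : Lp E 2 μ) :
    nem γ f (D - D') = nem γ f D - nem γ f D' := by
  refine Lp.ext ?_
  filter_upwards [coeFn_nem hγ hM f D, coeFn_nem hγ hM f D', coeFn_nem hγ hM f (D - D'),
    Lp.coeFn_sub D D', Lp.coeFn_sub (nem γ f D) (nem γ f D')] with x h1 h2 h3 h4 h5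
  rw [h3, h5, Pi.sub_apply, h1, h2, h4, Pi.sub_apply, smul_sub]

theorem tendsto_nem (hγ : Continuous γ) (hM : ∀ s, |γ s| ≤ M) {f : ℕ → Lp ℝ 2 μ}
    {D : ℕ → Lp E 2 μ} {f' : Lp ℝ 2 μ} {D' : Lp E 2 μ} (hf : Tendsto f atTop (𝓝 f'))
    (hD : Tendsto D atTop (𝓝 D')) :
    Tendsto (fun n => nem γ (f n) (D n)) atTop (𝓝 (nem γ f' D')) := by
  refine tendsto_of_subseq_tendsto fun ns hns => ?_
  obtain ⟨k, hk, hae⟩ := exists_subseq_tendsto_ae (hf.comp hns)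
  refine ⟨k, ?_⟩
  have h1 : Tendsto (fun n => nem γ (f (ns (k n))) D') atTop (𝓝 (nem γ f' D')) := by
    refine tendsto_toL2_of_tendsto_ae (B := fun x => (2 * M) * ‖D' x‖)
      ((Lp.memLp D').norm.const_mul _) (fun n => memLp_nem hγ hM _ _) (memLp_nem hγ hM _ _)
      (fun n => ae_of_all _ fun x => ?_) ?_
    · rw [← sub_smul, norm_smul, norm_eq_abs]
      refine mul_le_mul_of_nonneg_right ?_ (norm_nonneg _)
      have := abs_sub (γ (f (ns (k n)) x)) (γ (f' x))
      linarith [hM (f (ns (k n)) x), hM (f' x)]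
    · filter_upwards [hae] with x hx
      exact (((hγ.tendsto _).comp hx)).smul_const _
  have h2 : Tendsto (fun n => nem γ (f (ns (k n))) (D (ns (k n)) - D')) atTop (𝓝 0) := by
    refine squeeze_zero_norm (fun n => norm_nem_le hγ hM _ _) ?_
    have h3 := ((hD.comp (hns.comp hk.tendsto_atTop)).sub_const D').norm.const_mul M
    simpa using h3
  have h4 := h2.add h1
  rw [zero_add] at h4
  refine h4.congr fun n => ?_
  rw [nem_sub hγ hM, sub_add_cancel]

theorem continuous_nem (hγ : Continuous γ) (hM : ∀ s, |γ s| ≤ M) :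
    Continuous fun q : Lp ℝ 2 μ × Lp E 2 μ => nem γ q.1 q.2 := by
  rw [continuous_iff_seqContinuous]
  intro q q' hq
  rw [Prod.tendsto_iff] at hq
  exact tendsto_nem hγ hM hq.1 hq.2

/-- Lipschitz functions act on `L²` of a finite measure. -/
theorem memLp_comp_lipschitz [IsFiniteMeasure μ] {Γ : ℝ → ℝ} {M : ℝ≥0} (hΓ : LipschitzWith M Γ)
    (f : Lp ℝ 2 μ) : MemLp (fun x => Γ (f x)) 2 μ := by
  have h0 : MemLp (fun _ : X => |Γ 0|) 2 μ := memLp_const _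
  have h0' : MemLp (fun x => (M : ℝ) * ‖f x‖) 2 μ := (Lp.memLp f).norm.const_mul (M : ℝ)
  have h1 : MemLp (fun x => |Γ 0| + (M : ℝ) * ‖f x‖) 2 μ := h0.add h0'
  refine h1.of_le (hΓ.continuous.comp_aestronglyMeasurable (Lp.aestronglyMeasurable f))
    (ae_of_all _ fun x => ?_)
  have h2 := hΓ.norm_sub_le (f x) 0
  rw [sub_zero] at h2
  refine le_trans ?_ (Real.le_norm_self _)
  have := norm_le_norm_add_norm_sub (Γ 0) (Γ (f x))
  rw [norm_eq_abs (Γ 0)] at this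
  rw [norm_sub_rev] at h2
  linarith

theorem norm_toL2_comp_sub_le [IsFiniteMeasure μ] {Γ : ℝ → ℝ} {M : ℝ≥0}
    (hΓ : LipschitzWith M Γ) (f g : Lp ℝ 2 μ) :
    ‖toL2 μ (fun x => Γ (f x)) - toL2 μ (fun x => Γ (g x))‖ ≤ M * ‖f - g‖ := by
  refine Lp.norm_le_mul_norm_of_ae_le_mul ?_
  filter_upwards [coeFn_toL2 (memLp_comp_lipschitz hΓ f), coeFn_toL2 (memLp_comp_lipschitz hΓ g),
    Lp.coeFn_sub f g, Lp.coeFn_sub (toL2 μ (fun x => Γ (f x))) (toL2 μ (fun x => Γ (g x)))]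
    with x h1 h2 h3 h4
  rw [h4, h3, Pi.sub_apply, Pi.sub_apply, h1, h2]
  exact hΓ.norm_sub_le _ _

theorem continuous_toL2_comp [IsFiniteMeasure μ] {Γ : ℝ → ℝ} {M : ℝ≥0}
    (hΓ : LipschitzWith M Γ) : Continuous fun f : Lp ℝ 2 μ => toL2 μ (fun x => Γ (f x)) :=
  (LipschitzWith.of_dist_le_mul (K := M) fun f g => by
    rw [dist_eq_norm, dist_eq_norm]; exact norm_toL2_comp_sub_le hΓ f g).continuous

end L2Tools

section Sobolev

variable {X F G : Type*} [NormedAddCommGroup X] [NormedSpace ℝ X] [FiniteDimensional ℝ X]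
  [MeasureSpace X] [BorelSpace X] [(volume : Measure X).IsAddHaarMeasure]
  [NormedAddCommGroup F] [InnerProductSpace ℝ F] [FiniteDimensional ℝ F]
  [NormedAddCommGroup G] [InnerProductSpace ℝ G] [FiniteDimensional ℝ G]
  {Ω : Opens X} (L : (X →L[ℝ] F) →L[ℝ] G)

/-- Lebesgue measure on an open set. -/
abbrev volOn (Ω : Opens X) : Measure X := volume.restrict (Ω : Set X)

variable (Ω F G) in
/-- Pairs (function, gradient) of square integrable fields. -/
abbrev SobPair : Type _ := WithLp 2 (Lp F 2 (volOn Ω) × Lp G 2 (volOn Ω))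

theorem memLp_testFunction (φ : 𝓓(Ω, F)) : MemLp φ 2 (volOn Ω) :=
  (φ.continuous.memLp_of_hasCompactSupport φ.hasCompactSupport).restrict _

theorem memLp_grad_testFunction (φ : 𝓓(Ω, F)) :
    MemLp (fun x => L (fderiv ℝ φ x)) 2 (volOn Ω) :=
  ((L.continuous.comp (φ.contDiff.continuous_fderiv (by simp))).memLp_of_hasCompactSupport
    ((φ.hasCompactSupport.fderiv (𝕜 := ℝ)).comp_left (map_zero L))).restrict _

/-- The pair consisting of a test function and its gradient. -/
def testPair : 𝓓(Ω, F) →ₗ[ℝ] SobPair F G Ω where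
  toFun φ := toLp 2 (toL2 (volOn Ω) φ, toL2 (volOn Ω) fun x => L (fderiv ℝ φ x))
  map_add' φ ψ := by
    have hd : ∀ x, fderiv ℝ (φ + ψ : 𝓓(Ω, F)) x = fderiv ℝ φ x + fderiv ℝ ψ x := fun x =>
      fderiv_add (φ.contDiff.differentiable (by simp) x) (ψ.contDiff.differentiable (by simp) x)
    rw [← WithLp.toLp_add, Prod.mk_add_mk]
    congr 2
    · refine Lp.ext ?_
      filter_upwards [coeFn_toL2 (memLp_testFunction φ), coeFn_toL2 (memLp_testFunction ψ),
        coeFn_toL2 (memLp_testFunction (φ + ψ)),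
        Lp.coeFn_add (toL2 (volOn Ω) φ) (toL2 (volOn Ω) ψ)] with x h1 h2 h3 h4
      rw [h3, h4, Pi.add_apply, h1, h2]; rfl
    · refine Lp.ext ?_
      filter_upwards [coeFn_toL2 (memLp_grad_testFunction L φ),
        coeFn_toL2 (memLp_grad_testFunction L ψ),
        coeFn_toL2 (memLp_grad_testFunction L (φ + ψ)),
        Lp.coeFn_add (toL2 (volOn Ω) fun x => L (fderiv ℝ φ x))
          (toL2 (volOn Ω) fun x => L (fderiv ℝ ψ x))] with x h1 h2 h3 h4
      rw [h3, h4, Pi.add_apply, h1, h2, hd, map_add]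
  map_smul' c φ := by
    have hd : ∀ x, fderiv ℝ (c • φ : 𝓓(Ω, F)) x = c • fderiv ℝ φ x := fun x =>
      fderiv_const_smul (φ.contDiff.differentiable (by simp) x) c
    rw [RingHom.id_apply, ← WithLp.toLp_smul, Prod.smul_mk]
    congr 2
    · refine Lp.ext ?_
      filter_upwards [coeFn_toL2 (memLp_testFunction φ),
        coeFn_toL2 (memLp_testFunction (c • φ)),
        Lp.coeFn_smul c (toL2 (volOn Ω) φ)] with x h1 h3 h4
      rw [h3, h4, Pi.smul_apply, h1]; rfl
    · refine Lp.ext ?_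
      filter_upwards [coeFn_toL2 (memLp_grad_testFunction L φ),
        coeFn_toL2 (memLp_grad_testFunction L (c • φ)),
        Lp.coeFn_smul c (toL2 (volOn Ω) fun x => L (fderiv ℝ φ x))] with x h1 h3 h4
      rw [h3, h4, Pi.smul_apply, h1, hd, map_smul]

variable (Ω) in
/-- `W^{1,2}_0(Ω)` as a space of pairs (function, gradient). -/
def W0 : Submodule ℝ (SobPair F G Ω) := (LinearMap.range (testPair (Ω := Ω) L)).topologicalClosure

theorem isClosed_W0 : IsClosed (W0 Ω L : Set (SobPair F G Ω)) :=
  Submodule.isClosed_topologicalClosure _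

theorem testPair_mem_W0 (φ : 𝓓(Ω, F)) : testPair L φ ∈ W0 Ω L :=
  Submodule.le_topologicalClosure _ ⟨φ, rfl⟩

theorem W0_induction {P : SobPair F G Ω → Prop} (hP : IsClosed {p | P p})
    (h : ∀ φ : 𝓓(Ω, F), P (testPair L φ)) {p : SobPair F G Ω} (hp : p ∈ W0 Ω L) : P p := by
  have : closure (Set.range (testPair (Ω := Ω) L)) ⊆ {p | P p} :=
    closure_minimal (by rintro _ ⟨φ, rfl⟩; exact h φ) hP
  refine this ?_
  rw [W0, ← SetLike.mem_coe, topologicalClosure_coe] at hp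
  exact hp

theorem exists_seq_of_mem_W0 {p : SobPair F G Ω} (hp : p ∈ W0 Ω L) :
    ∃ φ : ℕ → 𝓓(Ω, F), Tendsto (fun k => testPair L (φ k)) atTop (𝓝 p) := by
  rw [W0, ← SetLike.mem_coe, topologicalClosure_coe] at hp
  obtain ⟨x, hx, hlim⟩ := mem_closure_iff_seq_limit.1 hp
  choose φ hφ using hx
  exact ⟨φ, by simpa [hφ] using hlim⟩

theorem tendsto_toLp_iff {A B : Type*} [NormedAddCommGroup A] [NormedAddCommGroup B] {ι : Type*}
    {l : Filter ι} {x : ι → WithLp 2 (A × B)} {a : WithLp 2 (A × B)} :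
    Tendsto x l (𝓝 a) ↔
      Tendsto (fun i => (x i).fst) l (𝓝 a.fst) ∧ Tendsto (fun i => (x i).snd) l (𝓝 a.snd) := by
  rw [(WithLp.homeomorphProd 2 A B).isInducing.tendsto_nhds_iff, Prod.tendsto_iff]
  rfl

theorem tendsto_eLpNorm_sub_iff {Y E : Type*} [MeasurableSpace Y] {μ : Measure Y}
    [NormedAddCommGroup E] [InnerProductSpace ℝ E] (f : Lp E 2 μ) {g : ℕ → Y → E}
    (hg : ∀ k, MemLp (g k) 2 μ) :
    Tendsto (fun k => eLpNorm (fun y => f y - g k y) 2 μ) atTop (𝓝 0) ↔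
      Tendsto (fun k => toL2 μ (g k)) atTop (𝓝 f) := by
  rw [Lp.tendsto_Lp_iff_tendsto_eLpNorm']
  refine tendsto_congr fun k => ?_
  have h1 : (⇑(toL2 μ (g k)) - ⇑f) =ᵐ[μ] g k - ⇑f := by
    filter_upwards [coeFn_toL2 (hg k)] with x hx
    simp [hx]
  rw [eLpNorm_congr_ae h1, eLpNorm_sub_comm]
  rfl

theorem mem_W0_iff (f : Lp F 2 (volOn Ω)) (D : Lp G 2 (volOn Ω)) :
    toLp 2 (f, D) ∈ W0 Ω L ↔ ∃ φ : ℕ → 𝓓(Ω, F),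
      Tendsto (fun k => eLpNorm (fun y => f y - φ k y) 2 (volOn Ω)) atTop (𝓝 0) ∧
      Tendsto (fun k => eLpNorm (fun y => D y - L (fderiv ℝ (φ k) y)) 2 (volOn Ω)) atTop
        (𝓝 0) := by
  have key : ∀ φ : ℕ → 𝓓(Ω, F),
      Tendsto (fun k => testPair L (φ k)) atTop (𝓝 (toLp 2 (f, D))) ↔
      (Tendsto (fun k => eLpNorm (fun y => f y - φ k y) 2 (volOn Ω)) atTop (𝓝 0) ∧
      Tendsto (fun k => eLpNorm (fun y => D y - L (fderiv ℝ (φ k) y)) 2 (volOn Ω)) atTop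
        (𝓝 0)) := by
    intro φ
    rw [tendsto_eLpNorm_sub_iff f fun k => memLp_testFunction (φ k),
      tendsto_eLpNorm_sub_iff D fun k => memLp_grad_testFunction L (φ k), tendsto_toLp_iff]
    rfl
  constructor
  · intro h
    obtain ⟨φ, hφ⟩ := exists_seq_of_mem_W0 L h
    exact ⟨φ, (key φ).1 hφ⟩
  · rintro ⟨φ, hφ⟩
    exact (isClosed_W0 L).mem_of_tendsto ((key φ).2 hφ)
      (Eventually.of_forall fun k => testPair_mem_W0 L (φ k))

end Sobolev

section Sobolev

variable {X F G : Type*} [NormedAddCommGroup X] [NormedSpace ℝ X] [FiniteDimensional ℝ X]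
  [MeasureSpace X] [BorelSpace X] [(volume : Measure X).IsAddHaarMeasure]
  [NormedAddCommGroup F] [InnerProductSpace ℝ F] [FiniteDimensional ℝ F]
  [NormedAddCommGroup G] [InnerProductSpace ℝ G] [FiniteDimensional ℝ G]
  {Ω : Opens X} (L : (X →L[ℝ] F) →L[ℝ] G)

/-- On a finite measure, uniformly close functions are close in `L²`. -/
theorem norm_toL2_sub_le_of_forall {Y E : Type*} [MeasurableSpace Y] {μ : Measure Y}
    [IsFiniteMeasure μ] [NormedAddCommGroup E] [InnerProductSpace ℝ E] {f g : Y → E}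
    (hf : MemLp f 2 μ) (hg : MemLp g 2 μ) {ε : ℝ} (hε : 0 ≤ ε)
    (h : ∀ᵐ x ∂μ, ‖f x - g x‖ ≤ ε) : ‖toL2 μ f - toL2 μ g‖ ≤ √(μ.real Set.univ) * ε := by
  refine abs_le_of_sq_le_sq' ?_ (by positivity) |>.2
  rw [norm_sq_eq_integral, mul_pow, Real.sq_sqrt (by positivity)]
  calc ∫ x, ‖(toL2 μ f - toL2 μ g) x‖ ^ 2 ∂μ ≤ ∫ _, ε ^ 2 ∂μ := by
        refine integral_mono_ae (integrable_norm_sq _) (integrable_const _) ?_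
        filter_upwards [Lp.coeFn_sub (toL2 μ f) (toL2 μ g), coeFn_toL2 hf, coeFn_toL2 hg, h]
          with x h1 h2 h3 h4
        rw [h1, Pi.sub_apply, h2, h3]
        exact pow_le_pow_left₀ (norm_nonneg _) h4 2
    _ = _ := by simp

/-- Compactly supported `C¹` functions belong to `W^{1,2}_0`. -/
theorem mem_W0_of_contDiff (hΩ : IsBounded (Ω : Set X)) {g : X → F}
    (hg : ContDiff ℝ 1 g) (hc : HasCompactSupport g) (hs : tsupport g ⊆ Ω) :
    toLp 2 (toL2 (volOn Ω) g, toL2 (volOn Ω) fun x => L (fderiv ℝ g x)) ∈ W0 Ω L := by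
  have : IsFiniteMeasure (volOn Ω) := ⟨by simpa using hΩ.measure_lt_top⟩
  have hm1 : MemLp g 2 (volOn Ω) := (hg.continuous.memLp_of_hasCompactSupport hc).restrict _
  have hm2 : MemLp (fun x => L (fderiv ℝ g x)) 2 (volOn Ω) :=
    ((L.continuous.comp (hg.continuous_fderiv (by simp))).memLp_of_hasCompactSupport
      ((hc.fderiv (𝕜 := ℝ)).comp_left (map_zero L))).restrict _
  choose ψ h1 h2 using fun n : ℕ => exists_testFunction_approx (Ω := Ω) hg hc hs
    (ε := 1 / ((n : ℝ) + 1)) (by positivity)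
  refine (isClosed_W0 L).mem_of_tendsto (f := fun n => testPair L (ψ n)) (b := atTop) ?_
    (Eventually.of_forall fun k => testPair_mem_W0 L _)
  have hl := tendsto_one_div_add_atTop_nhds_zero_nat (𝕜 := ℝ)
  have hl1 : Tendsto (fun n : ℕ => √((volOn Ω).real Set.univ) * (1 / ((n : ℝ) + 1))) atTop
      (𝓝 0) := by simpa using hl.const_mul √((volOn Ω).real Set.univ)
  have hl2 : Tendsto (fun n : ℕ => √((volOn Ω).real Set.univ) * (‖L‖ * (1 / ((n : ℝ) + 1)))) atTop
      (𝓝 0) := by simpa using (hl.const_mul ‖L‖).const_mul √((volOn Ω).real Set.univ)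
  rw [tendsto_toLp_iff]
  constructor
  · rw [tendsto_iff_norm_sub_tendsto_zero]
    refine squeeze_zero (fun _ => norm_nonneg _) (fun n => ?_) hl1
    refine norm_toL2_sub_le_of_forall (memLp_testFunction (ψ n)) hm1
      (ε := 1 / ((n : ℝ) + 1)) (by positivity)
      (ae_of_all _ fun x => ?_)
    rw [norm_sub_rev]; exact h1 n x
  · rw [tendsto_iff_norm_sub_tendsto_zero]
    refine squeeze_zero (fun _ => norm_nonneg _) (fun n => ?_) hl2
    refine norm_toL2_sub_le_of_forall (memLp_grad_testFunction L (ψ n)) hm2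
      (ε := ‖L‖ * (1 / ((n : ℝ) + 1))) (by positivity)
      (ae_of_all _ fun x => ?_)
    rw [← map_sub]
    refine (L.le_opNorm _).trans ?_
    rw [norm_sub_rev]
    gcongr
    exact h2 n x

theorem norm_toL2_testFunction (φ : 𝓓(Ω, F)) :
    (testPair L φ).fst = toL2 (volOn Ω) φ ∧
      (testPair L φ).snd = toL2 (volOn Ω) fun x => L (fderiv ℝ φ x) := ⟨rfl, rfl⟩

open Module in
/-- Poincaré's inequality on `W^{1,2}_0`. -/
theorem exists_poincare_W0 (hΩ : IsBounded (Ω : Set X)) (hd : 2 ≤ finrank ℝ X)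
    (hd' : finrank ℝ X ≤ 3) (hL : Function.Injective L) :
    ∃ C : ℝ, 0 < C ∧ ∀ p ∈ W0 Ω L, ‖p.fst‖ ≤ C * ‖p.snd‖ := by
  obtain ⟨C1, hC1⟩ := exists_poincare_const (F := F) hΩ hd hd'
  obtain ⟨K, hK0, hK⟩ := L.toLinearMap.exists_antilipschitzWith (LinearMap.ker_eq_bot.2 hL)
  refine ⟨C1 * K + 1, by positivity, fun p hp => ?_⟩
  refine W0_induction L (P := fun p => ‖p.fst‖ ≤ (C1 * K + 1) * ‖p.snd‖) ?_ (fun φ => ?_) hp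
  · exact isClosed_le (WithLp.fstL 2 ℝ _ _).continuous.norm
      ((WithLp.sndL 2 ℝ _ _).continuous.norm.const_mul _)
  · have e1 := norm_toL2 (memLp_testFunction φ)
    have e2 := norm_toL2 (memLp_grad_testFunction L φ)
    have h3 : eLpNorm (fderiv ℝ φ) 2 (volOn Ω)
        ≤ K * eLpNorm (fun x => L (fderiv ℝ φ x)) 2 (volOn Ω) := by
      refine eLpNorm_le_nnreal_smul_eLpNorm_of_ae_le_mul (ae_of_all _ fun x => ?_) 2
      have := hK.le_mul_nnnorm (map_zero _) (fderiv ℝ φ x)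
      exact this
    have h4 := (hC1 φ).trans (mul_le_mul_right h3 _)
    rw [← mul_assoc] at h4
    have h5 := ENNReal.toReal_mono (ENNReal.mul_ne_top (ENNReal.mul_ne_top (by simp) (by simp))
      (memLp_grad_testFunction L φ).2.ne) h4
    rw [← norm_toL2 (memLp_testFunction φ), ENNReal.toReal_mul,
      ← norm_toL2 (memLp_grad_testFunction L φ)] at h5
    simp only [ENNReal.toReal_mul, ENNReal.coe_toReal] at h5
    change ‖toL2 (volOn Ω) φ‖ ≤ (C1 * K + 1) * ‖toL2 (volOn Ω) fun x => L (fderiv ℝ φ x)‖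
    nlinarith [norm_nonneg (toL2 (volOn Ω) fun x => L (fderiv ℝ φ x))]

end Sobolev

section ChainRule

variable {X G : Type*} [NormedAddCommGroup X] [NormedSpace ℝ X] [FiniteDimensional ℝ X]
  [MeasureSpace X] [BorelSpace X] [(volume : Measure X).IsAddHaarMeasure]
  [NormedAddCommGroup G] [InnerProductSpace ℝ G] [FiniteDimensional ℝ G]
  {Ω : Opens X} (L : (X →L[ℝ] ℝ) →L[ℝ] G)

theorem lipschitzWith_of_hasDerivAt {Γ γ : ℝ → ℝ} {M : ℝ≥0} (hΓ : ∀ s, HasDerivAt Γ (γ s) s)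
    (hM : ∀ s, |γ s| ≤ M) : LipschitzWith M Γ :=
  lipschitzWith_of_nnnorm_deriv_le (fun s => (hΓ s).differentiableAt) fun s => by
    rw [(hΓ s).deriv]; exact_mod_cast hM s

theorem continuous_memLp_volOn {E : Type*} [NormedAddCommGroup E]
    (hΩ : IsBounded (Ω : Set X)) {f : X → E} (hf : Continuous f) (p : ℝ≥0∞) :
    MemLp f p (volOn Ω) := by
  have : IsFiniteMeasure (volOn Ω) := ⟨by simpa using hΩ.measure_lt_top⟩
  obtain ⟨C, hC⟩ := hΩ.isCompact_closure.exists_bound_of_continuousOn hf.continuousOn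
  refine MemLp.of_bound hf.aestronglyMeasurable C ?_
  filter_upwards [ae_restrict_mem Ω.isOpen.measurableSet] with x hx
  exact hC x (subset_closure hx)

/-- Chain rule in `W^{1,2}_0` for a function with boundary values `b`, composed with a function
that vanishes on the boundary values. -/
theorem chain_rule_mem_W0 (hΩ : IsBounded (Ω : Set X)) {b : X → ℝ}
    (hb : ContDiff ℝ 1 b) {Γ γ : ℝ → ℝ} {M : ℝ≥0} (hΓ : ∀ s, HasDerivAt Γ (γ s) s)
    (hγ : Continuous γ) (hM : ∀ s, |γ s| ≤ M) {C : Set X} (hC : IsCompact C)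
    (hCΩ : C ⊆ Ω) (hCb : ∀ x ∈ Ω, x ∉ C → Γ (b x) = 0) {f : Lp ℝ 2 (volOn Ω)}
    {D : Lp G 2 (volOn Ω)}
    (h : toLp 2 (f - toL2 (volOn Ω) b, D - toL2 (volOn Ω) fun x => L (fderiv ℝ b x))
      ∈ W0 Ω L) :
    toLp 2 (toL2 (volOn Ω) fun x => Γ (f x), nem γ f D) ∈ W0 Ω L := by
  have : IsFiniteMeasure (volOn Ω) := ⟨by simpa using hΩ.measure_lt_top⟩
  have hLip := lipschitzWith_of_hasDerivAt hΓ hM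
  have hΓ1 : ContDiff ℝ 1 Γ := by
    rw [contDiff_one_iff_deriv]
    exact ⟨fun s => (hΓ s).differentiableAt, by rwa [show deriv Γ = γ from funext fun s => (hΓ s).deriv]⟩
  have hb1 : MemLp b 2 (volOn Ω) := continuous_memLp_volOn hΩ hb.continuous 2
  have hb2 : MemLp (fun x => L (fderiv ℝ b x)) 2 (volOn Ω) :=
    continuous_memLp_volOn hΩ (L.continuous.comp (hb.continuous_fderiv (by simp))) 2
  obtain ⟨φ, hφ⟩ := exists_seq_of_mem_W0 L h
  rw [tendsto_toLp_iff] at hφ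
  obtain ⟨h1, h2⟩ := hφ
  have h1' := h1.add_const (toL2 (volOn Ω) b)
  have h2' := h2.add_const (toL2 (volOn Ω) fun x => L (fderiv ℝ b x))
  change Tendsto _ _ (𝓝 (f - toL2 (volOn Ω) b + toL2 (volOn Ω) b)) at h1'
  change Tendsto _ _ (𝓝 (D - (toL2 (volOn Ω) fun x => L (fderiv ℝ b x)) +
    toL2 (volOn Ω) fun x => L (fderiv ℝ b x))) at h2'
  rw [sub_add_cancel] at h1' h2'
  refine (isClosed_W0 L).mem_of_tendsto (b := atTop) (f := fun k => toLp 2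
    (toL2 (volOn Ω) (fun x => Γ (((testPair L (φ k)).fst + toL2 (volOn Ω) b : Lp ℝ 2 _) x)),
      nem γ ((testPair L (φ k)).fst + toL2 (volOn Ω) b)
        ((testPair L (φ k)).snd + toL2 (volOn Ω) fun x => L (fderiv ℝ b x)))) ?_
    (Eventually.of_forall fun k => ?_)
  · rw [tendsto_toLp_iff]
    exact ⟨((continuous_toL2_comp hLip).tendsto _).comp h1', tendsto_nem hγ hM h1' h2'⟩
  · let g : X → ℝ := (Ω : Set X).indicator fun x => Γ (φ k x + b x)
    let K : Set X := tsupport (φ k) ∪ C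
    have hK : IsCompact K := (φ k).hasCompactSupport.isCompact.union hC
    have hKΩ : K ⊆ Ω := Set.union_subset (φ k).tsupport_subset hCΩ
    have hg0 : ∀ x ∉ K, g x = 0 := by
      intro x hx
      by_cases hxΩ : x ∈ (Ω : Set X)
      · have hx1 : φ k x = 0 := image_eq_zero_of_notMem_tsupport fun h => hx (Or.inl h)
        simp only [g, indicator_of_mem hxΩ, hx1, zero_add]
        exact hCb x hxΩ fun h => hx (Or.inr h)
      · simp [g, indicator_of_notMem hxΩ]
    have hgs : Function.support g ⊆ K := fun x hx => by
      by_contra hxK; exact hx (hg0 x hxK)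
    have hgc : HasCompactSupport g := HasCompactSupport.of_support_subset_isCompact hK hgs
    have hgt : tsupport g ⊆ Ω := (closure_minimal hgs hK.isClosed).trans hKΩ
    have hgeq : ∀ x ∈ (Ω : Set X), g =ᶠ[𝓝 x] fun x => Γ (φ k x + b x) := fun x hx => by
      filter_upwards [Ω.isOpen.mem_nhds hx] with y hy
      simp [g, indicator_of_mem hy]
    have hφ1 : ContDiff ℝ 1 (φ k) := (φ k).contDiff.of_le (by simp)
    have hcomp : ContDiff ℝ 1 fun x => Γ (φ k x + b x) := hΓ1.comp (hφ1.add hb)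
    have hg1 : ContDiff ℝ 1 g := by
      rw [contDiff_iff_contDiffAt]
      intro x
      by_cases hx : x ∈ K
      · exact hcomp.contDiffAt.congr_of_eventuallyEq (hgeq x (hKΩ hx))
      · refine (contDiffAt_const (c := (0 : ℝ))).congr_of_eventuallyEq ?_
        filter_upwards [hK.isClosed.isOpen_compl.mem_nhds hx] with y hy
        exact hg0 y hy
    have hmem := mem_W0_of_contDiff L hΩ hg1 hgc hgt
    have hE1 : (toL2 (volOn Ω) fun x => Γ (((testPair L (φ k)).fst + toL2 (volOn Ω) b :
        Lp ℝ 2 (volOn Ω)) x)) = toL2 (volOn Ω) g := by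
      refine toL2_congr ?_
      filter_upwards [Lp.coeFn_add (testPair L (φ k)).fst (toL2 (volOn Ω) b),
        coeFn_toL2 hb1, coeFn_toL2 (memLp_testFunction (φ k)),
        ae_restrict_mem Ω.isOpen.measurableSet] with x e1 e2 e3 hx
      simp only [g, indicator_of_mem hx]
      rw [e1, Pi.add_apply, e2]
      change Γ ((toL2 (volOn Ω) (φ k)) x + b x) = _
      rw [e3]
    have hE2 : nem γ ((testPair L (φ k)).fst + toL2 (volOn Ω) b) ((testPair L (φ k)).snd +
        toL2 (volOn Ω) fun x => L (fderiv ℝ b x)) = toL2 (volOn Ω) fun x => L (fderiv ℝ g x) := by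
      rw [nem]
      refine toL2_congr ?_
      filter_upwards [Lp.coeFn_add (testPair L (φ k)).fst (toL2 (volOn Ω) b),
        Lp.coeFn_add (testPair L (φ k)).snd (toL2 (volOn Ω) fun x => L (fderiv ℝ b x)),
        coeFn_toL2 hb1, coeFn_toL2 (memLp_testFunction (φ k)),
        coeFn_toL2 hb2, coeFn_toL2 (memLp_grad_testFunction L (φ k)),
        ae_restrict_mem Ω.isOpen.measurableSet] with x e1 e2 e3 e4 e5 e6 hx
      have hd : fderiv ℝ g x = γ (φ k x + b x) • (fderiv ℝ (φ k) x + fderiv ℝ b x) := by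
        rw [(hgeq x hx).fderiv_eq]
        exact ((hΓ _).comp_hasFDerivAt x ((hφ1.differentiable (by simp) x).hasFDerivAt.add
          (hb.differentiable (by simp) x).hasFDerivAt)).fderiv
      rw [hd, e1, e2, Pi.add_apply, Pi.add_apply, e3, e5, map_smul, map_add]
      change γ ((toL2 (volOn Ω) (φ k)) x + b x) • ((toL2 (volOn Ω) fun x => L (fderiv ℝ (φ k) x)) x
        + _) = _
      rw [e4, e6]
    rw [hE1, hE2]
    exact hmem

end ChainRule

section OutwardField

variable {E : Type*} [NormedAddCommGroup E] [NormedSpace ℝ E]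

/-- Directions along which one stays outside `Ω` near `p`, uniformly. -/
def outwardCone (Ω : Set E) (p : E) : Set E :=
  {v | ∃ δ > 0, ∀ x, dist x p < δ → x ∉ Ω → ∀ s, 0 < s → s < δ → ∀ v', dist v' v < δ →
    x + s • v' ∉ Ω}

theorem outwardCone_convex (Ω : Set E) (p : E) : Convex ℝ (outwardCone Ω p) := by
  rintro v ⟨δv, hδv, hv⟩ w ⟨δw, hδw, hw⟩ a b ha hb hab
  rcases ha.eq_or_lt with rfl | ha
  · have : b = 1 := by linarith
    subst this; simpa using ⟨δw, hδw, hw⟩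
  rcases hb.eq_or_lt with rfl | hb
  · have : a = 1 := by linarith
    subst this; simpa using ⟨δv, hδv, hv⟩
  let d := min (min δv δw) 1
  have hd : 0 < d := lt_min (lt_min hδv hδw) one_pos
  have hdv : d ≤ δv := (min_le_left _ _).trans (min_le_left _ _)
  have hdw : d ≤ δw := (min_le_left _ _).trans (min_le_right _ _)
  have hd1 : d ≤ 1 := min_le_right _ _
  have hn := norm_nonneg v
  let δ := d / (2 * (‖v‖ + 2))
  have hδ : 0 < δ := by positivity
  have hδ2 : δ * (‖v‖ + 2) = d / 2 := by simp only [δ]; field_simp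
  have hδd : δ < d := by nlinarith
  refine ⟨δ, hδ, fun x hx hxΩ s hs hsδ v' hv' => ?_⟩
  set e := v' - (a • v + b • w) with he
  have hen : ‖e‖ < δ := by rwa [he, ← dist_eq_norm]
  have h1 : x + (s * a) • (v + e) ∉ Ω := by
    refine hv x (by linarith) hxΩ _ (by positivity) ?_ _ (by simpa using by linarith)
    nlinarith
  have h2 : x + s • v' = (x + (s * a) • (v + e)) + (s * b) • (w + e) := by
    have : v' = a • (v + e) + b • (w + e) := by
      have : a • (v + e) + b • (w + e) = a • v + b • w + (a + b) • e := by module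
      rw [this, hab, he]; module
    conv_lhs => rw [this]
    module
  rw [h2]
  refine hw _ ?_ h1 _ (by positivity) (by nlinarith) _ (by simpa using by linarith)
  calc dist (x + (s * a) • (v + e)) p ≤ dist (x + (s * a) • (v + e)) x + dist x p :=
        dist_triangle _ _ _
    _ = (s * a) * ‖v + e‖ + dist x p := by
        rw [dist_self_add_left, norm_smul, norm_of_nonneg (by positivity)]
    _ < δw := by
        have h3 : ‖v + e‖ ≤ ‖v‖ + 1 := (norm_add_le _ _).trans (by linarith)
        have h4 : s * a ≤ δ := by nlinarith
        have h5 : (s * a) * ‖v + e‖ ≤ δ * (‖v‖ + 1) :=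
          mul_le_mul h4 h3 (norm_nonneg _) hδ.le
        nlinarith

theorem eventually_mem_outwardCone {Ω : Set E} {p v : E} (h : v ∈ outwardCone Ω p) :
    ∀ᶠ q in 𝓝 p, v ∈ outwardCone Ω q := by
  obtain ⟨δ, hδ, hv⟩ := h
  filter_upwards [Metric.ball_mem_nhds p (half_pos hδ)] with q hq
  refine ⟨δ / 2, half_pos hδ, fun x hx hxΩ s hs hsδ v' hv' => ?_⟩
  refine hv x ?_ hxΩ s hs (by linarith) v' (by linarith)
  have := dist_triangle x q p
  rw [Metric.mem_ball] at hq
  linarith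

theorem outwardCone_nonempty_of_sublevel {Ω U : Set E} {p : E} (hU : IsOpen U) (hp : p ∈ U)
    {ρ : E → ℝ} (hρ : ContDiffAt ℝ 1 ρ p) (hd : fderiv ℝ ρ p ≠ 0)
    (hΩ : Ω ∩ U = {y ∈ U | ρ y < 0}) : (outwardCone Ω p).Nonempty := by
  obtain ⟨w, hw⟩ : ∃ w, fderiv ℝ ρ p w ≠ 0 := by
    by_contra! h
    exact hd (ContinuousLinearMap.ext h)
  set v := (fderiv ℝ ρ p w)⁻¹ • w with hv
  have hDv : fderiv ℝ ρ p v = 1 := by simp [hv, hw]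
  have hs := hρ.hasStrictFDerivAt (by norm_num)
  have hc : 0 < 1 / (2 * (‖v‖ + 1)) := by positivity
  have hs' := (hasStrictFDerivAt_iff_isLittleO.1 hs).def hc
  have hU' : ∀ᶠ q : E × E in 𝓝 (p, p), q.1 ∈ U ∧ q.2 ∈ U := by
    have := (hU.prod hU).mem_nhds (show (p, p) ∈ U ×ˢ U from ⟨hp, hp⟩)
    exact this
  obtain ⟨η, hη, hηs⟩ := Metric.eventually_nhds_iff.1 (hs'.and hU')
  let δ := min (min (η / (2 * (‖v‖ + 2))) 1) (1 / (4 * (‖fderiv ℝ ρ p‖ + 1)))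
  have hδ : 0 < δ := by positivity
  have hδ1 : δ ≤ 1 := (min_le_left _ _).trans (min_le_right _ _)
  have hδη : δ * (‖v‖ + 2) ≤ η / 2 := by
    have : δ ≤ η / (2 * (‖v‖ + 2)) := (min_le_left _ _).trans (min_le_left _ _)
    rw [le_div_iff₀ (by positivity)] at this
    nlinarith
  have hδD : δ * ‖fderiv ℝ ρ p‖ ≤ 1 / 4 := by
    have : δ ≤ 1 / (4 * (‖fderiv ℝ ρ p‖ + 1)) := min_le_right _ _
    rw [le_div_iff₀ (by positivity)] at this
    nlinarith
  have hn := norm_nonneg v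
  refine ⟨v, δ, hδ, fun x hx hxΩ s hs hsδ v' hv' hy => ?_⟩
  have hv'n : ‖v'‖ ≤ ‖v‖ + 1 := by
    rw [dist_eq_norm] at hv'
    have := norm_add_le (v' - v) v
    rw [sub_add_cancel] at this
    linarith
  have hyp : dist (x + s • v') p < η := by
    calc dist (x + s • v') p ≤ dist (x + s • v') x + dist x p := dist_triangle _ _ _
      _ = s * ‖v'‖ + dist x p := by
        rw [dist_self_add_left, norm_smul, norm_of_nonneg hs.le]
      _ < η := by nlinarith [mul_le_mul hsδ.le hv'n (norm_nonneg _) hδ.le]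
  have hxp : dist x p < η := by nlinarith
  obtain ⟨h1, h2, h3⟩ := hηs (y := (x + s • v', x)) (by
    rw [Prod.dist_eq]; exact max_lt hyp hxp)
  have hρx : 0 ≤ ρ x := by
    by_contra! hlt
    have : x ∈ Ω ∩ U := by rw [hΩ]; exact ⟨h3, hlt⟩
    exact hxΩ this.1
  have hρy : ρ (x + s • v') < 0 := by
    have : x + s • v' ∈ Ω ∩ U := ⟨hy, h2⟩
    rw [hΩ] at this
    exact this.2
  simp only [add_sub_cancel_left, norm_smul, map_smul, smul_eq_mul, norm_eq_abs,
    abs_of_pos hs] at h1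
  have hD : 3 / 4 ≤ fderiv ℝ ρ p v' := by
    have h4 : fderiv ℝ ρ p v' = 1 + fderiv ℝ ρ p (v' - v) := by rw [map_sub, hDv]; ring
    have h5 := (fderiv ℝ ρ p).le_opNorm (v' - v)
    rw [← dist_eq_norm, norm_eq_abs] at h5
    have h6 := neg_abs_le (fderiv ℝ ρ p (v' - v))
    nlinarith [norm_nonneg (fderiv ℝ ρ p)]
  have h7 : 1 / (2 * (‖v‖ + 1)) * (s * ‖v'‖) ≤ s / 2 := by
    rw [div_mul_eq_mul_div, div_le_iff₀ (by positivity)]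
    nlinarith
  have h8 := neg_abs_le (ρ (x + s • v') - ρ x - s * fderiv ℝ ρ p v')
  nlinarith

open scoped Manifold ContDiff in
/-- A smooth compactly supported field pushing the complement of a bounded `C²` domain away from
its closure. -/
theorem exists_outward_field {Ωh : Opens E2} (hΩ : IsBoundedC2 Ωh) :
    ∃ N : E2 → E2, ContDiff ℝ ∞ N ∧ HasCompactSupport N ∧ ∃ t₀ > (0 : ℝ), ∀ t, 0 < t → t < t₀ →
      ∀ x ∉ Ωh, x + t • N x ∉ closure (Ωh : Set E2) := by
  obtain ⟨hb, hbd⟩ := hΩ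
  let T : E2 → Set E2 := fun p =>
    {v | p ∈ frontier (Ωh : Set E2) → v ∈ outwardCone (Ωh : Set E2) p}
  have hT : ∀ p, Convex ℝ (T p) := by
    intro p v hv w hw a b ha hb hab hp
    exact outwardCone_convex _ p (hv hp) (hw hp) ha hb hab
  have hloc : ∀ p, ∃ c, ∀ᶠ q in 𝓝 p, c ∈ T q := by
    intro p
    by_cases hp : p ∈ frontier (Ωh : Set E2)
    · obtain ⟨U, hU, hpU, ρ, hρ, hd, he⟩ := hbd p hp
      obtain ⟨v, hv⟩ := outwardCone_nonempty_of_sublevel hU hpU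
        ((hρ.contDiffAt (hU.mem_nhds hpU)).of_le (by norm_num)) hd he
      exact ⟨v, (eventually_mem_outwardCone hv).mono fun q hq _ => hq⟩
    · refine ⟨0, ?_⟩
      filter_upwards [isClosed_frontier.isOpen_compl.mem_nhds hp] with q hq hq'
      exact absurd hq' hq
  obtain ⟨g, hg⟩ := exists_contMDiffMap_forall_mem_convex_of_local_const (n := (⊤ : ℕ∞)) 𝓘(ℝ, E2) hT hloc
  have hgs : ContDiff ℝ ∞ g := g.contMDiff.contDiff
  obtain ⟨R, hR⟩ := hb.closure.subset_closedBall (0 : E2)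
  let χ : ContDiffBump (0 : E2) := ⟨max R 0 + 1, max R 0 + 2, by positivity, by linarith⟩
  let N : E2 → E2 := fun x => χ x • g x
  have hN : ContDiff ℝ ∞ N := χ.contDiff.smul hgs
  have hNc : HasCompactSupport N := χ.hasCompactSupport.smul_right
  have hNp : ∀ p ∈ frontier (Ωh : Set E2), N p ∈ outwardCone (Ωh : Set E2) p := by
    intro p hp
    have h1 : χ p = 1 := by
      refine χ.one_of_mem_closedBall ?_
      have := hR (frontier_subset_closure hp)
      rw [Metric.mem_closedBall] at this ⊢
      exact this.trans ((le_max_left _ _).trans (by simp only [χ]; linarith))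
    simp only [N, h1, one_smul]
    exact hg p hp
  clear_value N
  have hcl : IsCompact (closure (Ωh : Set E2)) := hb.isCompact_closure
  have hfr : IsCompact (frontier (Ωh : Set E2)) := hcl.of_isClosed_subset isClosed_frontier
    frontier_subset_closure
  have hloc : ∃ O : Set E2, IsOpen O ∧ frontier (Ωh : Set E2) ⊆ O ∧ ∃ t₁ > (0 : ℝ), ∀ t, 0 < t → t < t₁ →
      ∀ x ∈ O, x ∉ Ωh → x + t • N x ∉ closure (Ωh : Set E2) := by
    refine hfr.induction_on (p := fun S => ∃ O : Set E2, IsOpen O ∧ S ⊆ O ∧ ∃ t₁ > (0 : ℝ),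
      ∀ t, 0 < t → t < t₁ → ∀ x ∈ O, x ∉ Ωh → x + t • N x ∉ closure (Ωh : Set E2)) ?_ ?_ ?_ ?_
    · exact ⟨∅, isOpen_empty, subset_rfl, 1, one_pos, fun t _ _ x hx => by simp at hx⟩
    · rintro S S' hSS' ⟨O, h1, h2, h3⟩
      exact ⟨O, h1, hSS'.trans h2, h3⟩
    · rintro S S' ⟨O, h1, h2, t₁, ht₁, h3⟩ ⟨O', h1', h2', t₁', ht₁', h3'⟩
      refine ⟨O ∪ O', h1.union h1', Set.union_subset_union h2 h2', min t₁ t₁', lt_min ht₁ ht₁',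
        fun t ht ht' x hx hxΩ => ?_⟩
      rcases hx with hx | hx
      · exact h3 t ht (ht'.trans_le (min_le_left _ _)) x hx hxΩ
      · exact h3' t ht (ht'.trans_le (min_le_right _ _)) x hx hxΩ
    · intro p hp
      obtain ⟨δ, hδ, hv⟩ := hNp p hp
      obtain ⟨η, hη, hNη⟩ := Metric.continuous_iff.1 hN.continuous p (δ / 2) (half_pos hδ)
      refine ⟨Metric.ball p (min η δ), mem_nhdsWithin_of_mem_nhds
        (Metric.ball_mem_nhds p (lt_min hη hδ)), Metric.ball p (min η δ), Metric.isOpen_ball,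
        subset_rfl, δ, hδ, fun t ht htδ x hx hxΩ hmem => ?_⟩
      rw [Metric.mem_ball, lt_min_iff] at hx
      rw [Metric.mem_closure_iff] at hmem
      obtain ⟨y, hy, hyd⟩ := hmem (t * (δ / 2)) (by positivity)
      have h1 : y = x + t • (N x + t⁻¹ • (y - (x + t • N x))) := by
        rw [smul_add, smul_smul, mul_inv_cancel₀ ht.ne', one_smul]; abel
      refine hv x hx.2 hxΩ t ht htδ (N x + t⁻¹ • (y - (x + t • N x))) ?_ (h1 ▸ hy)
      have h2 : dist (N x + t⁻¹ • (y - (x + t • N x))) (N x) < δ / 2 := by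
        rw [dist_self_add_left, norm_smul, ← dist_eq_norm, dist_comm, norm_inv,
          norm_of_nonneg ht.le, inv_mul_lt_iff₀ ht]
        exact hyd
      linarith [dist_triangle (N x + t⁻¹ • (y - (x + t • N x))) (N x) (N p), hNη x hx.1]
  obtain ⟨O, hO, hfO, t₁, ht₁, hOt⟩ := hloc
  have hsub : closure (Ωh : Set E2) ⊆ Ωh ∪ O := by
    rw [closure_eq_interior_union_frontier, Ωh.isOpen.interior_eq]
    exact Set.union_subset_union_right _ hfO
  obtain ⟨d, hd, hdsub⟩ := hcl.exists_thickening_subset_open (Ωh.isOpen.union hO) hsub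
  obtain ⟨B, hB⟩ := hNc.exists_bound_of_continuous hN.continuous
  have hB0 : 0 ≤ B := (norm_nonneg _).trans (hB 0)
  refine ⟨N, hN, hNc, min t₁ (d / (B + 1)), lt_min ht₁ (by positivity),
    fun t ht htt x hx hmem => ?_⟩
  have ht2 := htt.trans_le (min_le_right _ _)
  rw [lt_div_iff₀ (by positivity)] at ht2
  have hxth : x ∈ Metric.thickening d (closure (Ωh : Set E2)) := by
    rw [Metric.mem_thickening_iff]
    refine ⟨_, hmem, ?_⟩
    rw [dist_self_add_right, norm_smul, norm_of_nonneg ht.le]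
    nlinarith [hB x]
  rcases hdsub hxth with h | h
  · exact hx h
  · exact hOt t ht (htt.trans_le (min_le_left _ _)) x h hx hmem

end OutwardField

section Averages

theorem eLpNorm_two_sq_eq_lintegral {X F : Type*} [MeasurableSpace X] {μ : Measure X}
    [NormedAddCommGroup F] (f : X → F) : eLpNorm f 2 μ ^ 2 = ∫⁻ x, ‖f x‖ₑ ^ 2 ∂μ := by
  have := eLpNorm_nnreal_pow_eq_lintegral (μ := μ) (f := f) (p := 2) (by norm_num)
  simpa using this

/-- The `L²` norm of an average is at most the largest `L²` norm. -/
theorem eLpNorm_average_le {X Y F : Type*} [MeasurableSpace X] [MeasurableSpace Y]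
    {μ : Measure X} [SFinite μ] {m : Measure Y} [IsProbabilityMeasure m]
    [NormedAddCommGroup F] [NormedSpace ℝ F] {h : X → Y → F}
    (hm : AEStronglyMeasurable (Function.uncurry h) (μ.prod m)) {c : ℝ≥0∞}
    (hc : ∀ᵐ y ∂m, eLpNorm (fun x => h x y) 2 μ ≤ c) :
    eLpNorm (fun x => ∫ y, h x y ∂m) 2 μ ≤ c := by
  have h2 : eLpNorm (fun x => ∫ y, h x y ∂m) 2 μ ^ 2 ≤ c ^ 2 := by
    rw [eLpNorm_two_sq_eq_lintegral]
    calc ∫⁻ x, ‖∫ y, h x y ∂m‖ₑ ^ 2 ∂μ ≤ ∫⁻ x, ∫⁻ y, ‖h x y‖ₑ ^ 2 ∂m ∂μ := by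
          refine lintegral_mono_ae ?_
          filter_upwards [hm.prodMk_left] with x hx
          calc ‖∫ y, h x y ∂m‖ₑ ^ 2 ≤ (∫⁻ y, ‖h x y‖ₑ ∂m) ^ 2 := by
                gcongr; exact enorm_integral_le_lintegral_enorm _
            _ ≤ ∫⁻ y, ‖h x y‖ₑ ^ 2 ∂m := by
                rw [← eLpNorm_one_eq_lintegral_enorm, ← eLpNorm_two_sq_eq_lintegral]
                gcongr
                exact eLpNorm_le_eLpNorm_of_exponent_le (by norm_num) hx
      _ = ∫⁻ y, ∫⁻ x, ‖h x y‖ₑ ^ 2 ∂μ ∂m := by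
          refine lintegral_lintegral_swap ?_
          exact (hm.enorm.pow_const 2)
      _ ≤ ∫⁻ _, c ^ 2 ∂m := by
          refine lintegral_mono_ae ?_
          filter_upwards [hc] with y hy
          rw [← eLpNorm_two_sq_eq_lintegral]
          gcongr
      _ = c ^ 2 := by simp
  exact (ENNReal.pow_le_pow_left_iff two_ne_zero).1 h2

section Mollify

variable {X F : Type*} [NormedAddCommGroup X] [NormedSpace ℝ X] [FiniteDimensional ℝ X]
  [MeasureSpace X] [BorelSpace X] [(volume : Measure X).IsAddHaarMeasure]
  [NormedAddCommGroup F] [NormedSpace ℝ F] [CompleteSpace F]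

open scoped Convolution

/-- Mollification by a normed bump function. -/
def mollify (ρ : ContDiffBump (0 : X)) (φ : X → F) : X → F :=
  ρ.normed volume ⋆[lsmul ℝ ℝ, volume] φ

theorem eLpNorm_mollify_sub_le (ρ : ContDiffBump (0 : X)) {φ g : X → F} (hφ : Continuous φ)
    (hg : Continuous g) {c : ℝ≥0∞}
    (hc : ∀ y, ‖y‖ < ρ.rOut → eLpNorm (fun x => φ (x - y) - g x) 2 volume ≤ c) :
    eLpNorm (fun x => mollify ρ φ x - g x) 2 volume ≤ c := by
  have : SecondCountableTopology X := inferInstance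
  let m : Measure X := volume.withDensity fun y => ofReal (ρ.normed volume y)
  have hρm : Measurable fun y => ofReal (ρ.normed volume y) :=
    (ρ.continuous_normed.measurable).ennreal_ofReal
  have hm : IsProbabilityMeasure m := by
    refine ⟨?_⟩
    rw [withDensity_apply _ MeasurableSet.univ, setLIntegral_univ,
      ← ofReal_integral_eq_lintegral_ofReal ρ.integrable_normed (ae_of_all _ ρ.nonneg_normed),
      ρ.integral_normed, ENNReal.ofReal_one]
  have hint : ∀ f : X → F, ∫ y, f y ∂m = ∫ y, ρ.normed volume y • f y := by
    intro f
    rw [integral_withDensity_eq_integral_toReal_smul hρm (ae_of_all _ fun _ => ENNReal.ofReal_lt_top)]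
    simp_rw [ENNReal.toReal_ofReal (ρ.nonneg_normed _)]
  have e : ∀ x, mollify ρ φ x - g x = ∫ y, (φ (x - y) - g x) ∂m := by
    intro x
    rw [hint]
    simp_rw [smul_sub]
    rw [integral_sub, integral_smul_const, ρ.integral_normed, one_smul]
    · rfl
    · exact (ρ.continuous_normed.smul (by fun_prop)).integrable_of_hasCompactSupport
        ρ.hasCompactSupport_normed.smul_right
    · exact ρ.integrable_normed.smul_const _
  simp_rw [e]
  refine eLpNorm_average_le ?_ ?_
  · refine Continuous.aestronglyMeasurable ?_
    fun_prop
  · have hsupp : ∀ᵐ y ∂m, ρ.normed volume y ≠ 0 := by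
      rw [ae_withDensity_iff hρm]
      refine ae_of_all _ fun y hy h0 => hy ?_
      simp [h0]
    filter_upwards [hsupp] with y hy
    refine hc y ?_
    have : y ∈ Function.support (ρ.normed volume) := hy
    rwa [ρ.support_normed_eq, mem_ball_zero_iff] at this

theorem eLpNorm_translate_sub_le {φ : X → F} (hφ : ContDiff ℝ 1 φ) (y : X) :
    eLpNorm (fun x => φ (x - y) - φ x) 2 volume
      ≤ ‖y‖ₑ * eLpNorm (fderiv ℝ φ) 2 volume := by
  have e : ∀ x, φ (x - y) - φ x
      = ∫ s, fderiv ℝ φ (x - s • y) (-y) ∂(volume.restrict (Ioc (0 : ℝ) 1)) := by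
    intro x
    rw [← integral_of_le zero_le_one]
    have hd : ∀ s : ℝ, HasDerivAt (fun s : ℝ => φ (x - s • y)) (fderiv ℝ φ (x - s • y) (-y)) s := by
      intro s
      refine (hφ.differentiable (by norm_num) _).hasFDerivAt.comp_hasDerivAt s ?_
      simpa using ((hasDerivAt_id s).smul_const y).const_sub x
    rw [intervalIntegral.integral_eq_sub_of_hasDerivAt (fun s _ => hd s)]
    · simp
    · refine Continuous.intervalIntegrable ?_ _ _
      exact ((hφ.continuous_fderiv (by norm_num)).comp (by fun_prop)).clm_apply continuous_const
  have : IsProbabilityMeasure (volume.restrict (Ioc (0 : ℝ) 1)) := ⟨by simp⟩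
  simp_rw [e]
  have hcf := hφ.continuous_fderiv (by norm_num)
  refine eLpNorm_average_le ?_ (ae_of_all _ fun s => ?_)
  · refine Continuous.aestronglyMeasurable ?_
    exact (hcf.comp (by fun_prop)).clm_apply continuous_const
  · calc eLpNorm (fun x => fderiv ℝ φ (x - s • y) (-y)) 2 volume
        ≤ ‖y‖₊ * eLpNorm (fun x => fderiv ℝ φ (x - s • y)) 2 volume := by
          refine eLpNorm_le_nnreal_smul_eLpNorm_of_ae_le_mul (ae_of_all _ fun x => ?_) 2
          have := (fderiv ℝ φ (x - s • y)).le_opNNNorm (-y)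
          rwa [nnnorm_neg, mul_comm] at this
      _ = _ := by
          have := (eLpNorm_comp_measurePreserving (p := 2) hcf.aestronglyMeasurable
            (measurePreserving_sub_right (volume : Measure X) (s • y)))
          simp only [Function.comp_def] at this
          rw [this]
          rfl

theorem eLpNorm_mollify_sub_self_le (ρ : ContDiffBump (0 : X)) {φ : X → F}
    (hφ : ContDiff ℝ 1 φ) :
    eLpNorm (fun x => mollify ρ φ x - φ x) 2 volume
      ≤ ofReal ρ.rOut * eLpNorm (fderiv ℝ φ) 2 volume := by
  refine eLpNorm_mollify_sub_le ρ hφ.continuous hφ.continuous fun y hy => ?_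
  refine (eLpNorm_translate_sub_le hφ y).trans ?_
  gcongr
  rw [← ofReal_norm]
  exact ofReal_le_ofReal hy.le

end Mollify
end Averages

section ChangeOfVariables

/-- Composition with a small smooth perturbation of the identity is bounded on `L²`. -/
theorem exists_eLpNorm_comp_perturbation_le {N : E2 → E2} (hN : ContDiff ℝ 1 N)
    (hc : HasCompactSupport N) : ∃ t₁ > (0 : ℝ), ∀ t, 0 < t → t < t₁ →
      ∀ {F : Type} [NormedAddCommGroup F] (h : E2 → F),
        eLpNorm (fun x => h (x + t • N x)) 2 volume ≤ 2 * eLpNorm h 2 volume := by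
  obtain ⟨K, hK⟩ := hN.lipschitzWith_of_hasCompactSupport hc (by norm_num)
  have hdet : ∀ᶠ A : E2 →L[ℝ] E2 in 𝓝 (ContinuousLinearMap.id ℝ E2), 1 / 4 < |A.det| := by
    have h1 : ContinuousAt (fun A : E2 →L[ℝ] E2 => |A.det|) (ContinuousLinearMap.id ℝ E2) :=
      (ContinuousLinearMap.continuous_det.abs).continuousAt
    refine h1.eventually_const_lt ?_
    have : (ContinuousLinearMap.id ℝ E2).det = 1 := by
      simp [ContinuousLinearMap.det]
    simp only [this]; norm_num
  obtain ⟨δ, hδ, hδd⟩ := Metric.eventually_nhds_iff.1 hdet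
  have hK0 : (0 : ℝ) ≤ K := K.2
  refine ⟨min 1 δ / (K + 1), by positivity, fun t ht htt F _ h => ?_⟩
  rw [lt_div_iff₀ (by positivity)] at htt
  have htK1 : t * K < 1 := by nlinarith [min_le_left 1 δ]
  have htKδ : t * K < δ := by nlinarith [min_le_right 1 δ]
  have hder : ∀ x, HasFDerivAt (fun x => x + t • N x)
      (ContinuousLinearMap.id ℝ E2 + t • fderiv ℝ N x) x := fun x =>
    (hasFDerivAt_id x).add ((hN.differentiable (by norm_num) x).hasFDerivAt.const_smul t)
  have hinj : Function.Injective fun x => x + t • N x := by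
    intro x y hxy
    simp only at hxy
    have h1 : x - y = t • (N y - N x) := by
      rw [smul_sub]; rw [sub_eq_sub_iff_add_eq_add, hxy]; abel
    have h2 : ‖x - y‖ ≤ t * K * ‖x - y‖ := by
      conv_lhs => rw [h1, norm_smul, norm_of_nonneg ht.le, ← dist_eq_norm]
      have := hK.dist_le_mul y x
      rw [dist_comm y x, dist_eq_norm x y] at this
      nlinarith
    have h3 : ‖x - y‖ = 0 := by nlinarith [norm_nonneg (x - y)]
    exact sub_eq_zero.1 (norm_eq_zero.1 h3)
  have hcv := lintegral_image_eq_lintegral_abs_det_fderiv_mul volume MeasurableSet.univ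
    (fun x _ => (hder x).hasFDerivWithinAt) hinj.injOn fun x => ‖h x‖ₑ ^ 2
  have h4 : ∫⁻ x, ‖h (x + t • N x)‖ₑ ^ 2 ≤ 4 * ∫⁻ x, ‖h x‖ₑ ^ 2 := by
    calc ∫⁻ x, ‖h (x + t • N x)‖ₑ ^ 2
        ≤ ∫⁻ x, 4 * (ofReal |(ContinuousLinearMap.id ℝ E2 + t • fderiv ℝ N x).det|
            * ‖h (x + t • N x)‖ₑ ^ 2) := by
          refine lintegral_mono fun x => ?_
          rw [← mul_assoc]
          refine le_mul_of_one_le_left bot_le ?_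
          have h5 := hδd (y := ContinuousLinearMap.id ℝ E2 + t • fderiv ℝ N x) (by
            rw [dist_self_add_left, norm_smul, norm_of_nonneg ht.le]
            have := norm_fderiv_le_of_lipschitz ℝ hK (x₀ := x)
            nlinarith)
          rw [show (4 : ℝ≥0∞) = ofReal 4 by norm_num,
            ← ENNReal.ofReal_mul (by norm_num), ← ENNReal.ofReal_one]
          exact ofReal_le_ofReal (by linarith)
      _ = 4 * ∫⁻ x in (fun x => x + t • N x) '' Set.univ, ‖h x‖ₑ ^ 2 := by
          rw [hcv, lintegral_const_mul' _ _ (by norm_num), setLIntegral_univ]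
      _ ≤ _ := by gcongr; exact Measure.restrict_le_self
  rw [← eLpNorm_two_sq_eq_lintegral, ← eLpNorm_two_sq_eq_lintegral (f := h),
    show (4 : ℝ≥0∞) = 2 ^ 2 by norm_num, ← mul_pow] at h4
  exact (ENNReal.pow_le_pow_left_iff two_ne_zero).1 h4

end ChangeOfVariables

section Gradients

/-- The linear map giving the gradient matrix of a planar field from its differential. -/
def gradVecL : (E2 →L[ℝ] E2) →L[ℝ] E22 :=
  LinearMap.toContinuousLinearMap
    { toFun := fun A => toLp 2 fun ij => (A (e2 ij.2)) ij.1
      map_add' := fun A B => by ext; simp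
      map_smul' := fun c A => by ext; simp }

theorem gradVecL_apply (A : E2 →L[ℝ] E2) (ij : Fin 2 × Fin 2) :
    gradVecL A ij = (A (e2 ij.2)) ij.1 := rfl

/-- The linear map giving the gradient of a scalar function from its differential. -/
def gradScalL : (X3 →L[ℝ] ℝ) →L[ℝ] E3 :=
  LinearMap.toContinuousLinearMap
    { toFun := fun A => toLp 2 fun i => A (e3 i)
      map_add' := fun A B => by ext; simp
      map_smul' := fun c A => by ext; simp }

theorem gradScalL_apply (A : X3 →L[ℝ] ℝ) (i : Fin 3) : gradScalL A i = A (e3 i) := rfl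

theorem eq_sum_e2 (v : E2) : v = v 0 • e2 0 + v 1 • e2 1 := by
  ext i; fin_cases i <;> simp [e2]

theorem map_eq_sum_e2 {F : Type*} [NormedAddCommGroup F] [NormedSpace ℝ F] (A : E2 →L[ℝ] F)
    (v : E2) : A v = v 0 • A (e2 0) + v 1 • A (e2 1) := by
  conv_lhs => rw [eq_sum_e2 v]
  simp

theorem gradVecL_injective : Function.Injective gradVecL := by
  rw [injective_iff_map_eq_zero]
  intro A hA
  have h : ∀ i j, (A (e2 j)) i = 0 := fun i j => by
    have := congrArg (fun M : E22 => M (i, j)) hA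
    simpa [gradVecL_apply] using this
  ext v i
  rw [map_eq_sum_e2 A v]
  simp [h]

theorem gradScalL_injective : Function.Injective gradScalL := by
  rw [injective_iff_map_eq_zero]
  intro A hA
  have h : ∀ i, A (e3 i) = 0 := fun i => by
    have := congrArg (fun M : E3 => M i) hA
    simpa [gradScalL_apply] using this
  have h0 := h 0; have h1 := h 1; have h2 := h 2
  simp only [e3, Matrix.cons_val_zero, Matrix.cons_val_one, Matrix.cons_val] at h0 h1 h2
  have key : ∀ x : X3, A x = 0 := by
    intro x
    have hx : x = x.1 0 • ((e2 0, 0) : X3) + x.1 1 • ((e2 1, 0) : X3) + x.2 • ((0, 1) : X3) := by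
      refine Prod.ext ?_ ?_
      · simpa using eq_sum_e2 x.1
      · simp
    rw [hx, map_add, map_add, map_smul, map_smul, map_smul, h0, h1, h2]; simp
  ext x
  · simp [key]
  · simp [key]

/-- The trace of a planar linear map. -/
def trL : (E2 →L[ℝ] E2) →L[ℝ] ℝ :=
  LinearMap.toContinuousLinearMap
    { toFun := fun A => ∑ i, (A (e2 i)) i
      map_add' := fun A B => by simp; ring
      map_smul' := fun c A => by simp; ring }

theorem trL_apply (A : E2 →L[ℝ] E2) : trL A = (A (e2 0)) 0 + (A (e2 1)) 1 := by
  simp [trL]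

end Gradients

section Piola

/-- `M ↦ tr M - M`. -/
def cofL : (E2 →L[ℝ] E2) →L[ℝ] (E2 →L[ℝ] E2) :=
  trL.smulRight (ContinuousLinearMap.id ℝ E2) - ContinuousLinearMap.id ℝ _

theorem cofL_apply (M : E2 →L[ℝ] E2) (v : E2) : cofL M v = trL M • v - M v := by
  simp [cofL]

/-- The Piola transform of a field `φ` by the perturbation `x + t N(x)` of the identity. -/
def piola (N : E2 → E2) (t : ℝ) (φ : E2 → E2) (x : E2) : E2 :=
  φ (x + t • N x) + t • cofL (fderiv ℝ N x) (φ (x + t • N x))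

/-- The differential of the Piola transform. -/
def piolaDeriv (N : E2 → E2) (t : ℝ) (φ : E2 → E2) (x : E2) : E2 →L[ℝ] E2 :=
  (ContinuousLinearMap.id ℝ E2 + t • cofL (fderiv ℝ N x)) ∘L
      ((fderiv ℝ φ (x + t • N x)) ∘L (ContinuousLinearMap.id ℝ E2 + t • fderiv ℝ N x)) +
    t • ((cofL ∘L fderiv ℝ (fderiv ℝ N) x).flip (φ (x + t • N x)))

variable {N : E2 → E2}

theorem hasFDerivAt_perturbation (hN : ContDiff ℝ 1 N) (t : ℝ) (x : E2) :
    HasFDerivAt (fun x => x + t • N x) (ContinuousLinearMap.id ℝ E2 + t • fderiv ℝ N x) x :=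
  (hasFDerivAt_id x).add ((hN.differentiable (by norm_num) x).hasFDerivAt.const_smul t)

theorem hasFDerivAt_piola (hN : ContDiff ℝ 2 N) (t : ℝ) {φ : E2 → E2} (hφ : ContDiff ℝ 1 φ)
    (x : E2) : HasFDerivAt (piola N t φ) (piolaDeriv N t φ x) x := by
  have h1 : HasFDerivAt (fun x => φ (x + t • N x)) _ x :=
    (hφ.differentiable (by norm_num) _).hasFDerivAt.comp x
      (hasFDerivAt_perturbation (hN.of_le (by norm_num)) t x)
  have h2 : HasFDerivAt (fderiv ℝ N) (fderiv ℝ (fderiv ℝ N) x) x :=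
    ((hN.fderiv_right (m := 1) (by norm_num)).differentiable (by norm_num) x).hasFDerivAt
  have h3 := (cofL.hasFDerivAt (x := fderiv ℝ N x)).comp x h2
  have h4 := h1.add ((h3.clm_apply h1).const_smul t)
  refine (h4.congr_fderiv ?_)
  ext v : 1
  simp [piolaDeriv, smul_add]
  abel

theorem contDiff_piola {n : ℕ∞} (hN : ContDiff ℝ (⊤ : ℕ∞) N) (t : ℝ) {φ : E2 → E2}
    (hφ : ContDiff ℝ n φ) : ContDiff ℝ n (piola N t φ) := by
  have hNn : ContDiff ℝ n N := hN.of_le (by exact_mod_cast le_top)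
  have h1 : ContDiff ℝ n (fun x => φ (x + t • N x)) :=
    hφ.comp (contDiff_id.add (hNn.const_smul t))
  have h2 : ContDiff ℝ n (fderiv ℝ N) := hN.fderiv_right (by exact_mod_cast le_top)
  exact h1.add (((cofL.contDiff.comp h2).clm_apply h1).const_smul t)

/-- The Piola transform preserves solenoidal fields. -/
theorem trL_piolaDeriv (hN : ContDiff ℝ 2 N) (t : ℝ) {φ : E2 → E2}
    (x : E2) (h : trL (fderiv ℝ φ (x + t • N x)) = 0) : trL (piolaDeriv N t φ x) = 0 := by
  have hsym : ∀ v w, fderiv ℝ (fderiv ℝ N) x v w = fderiv ℝ (fderiv ℝ N) x w v := fun v w =>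
    (hN.contDiffAt.isSymmSndFDerivAt (by simp)) v w
  set w := φ (x + t • N x)
  set T := fderiv ℝ (fderiv ℝ N) x
  set B := fderiv ℝ φ (x + t • N x)
  set M := fderiv ℝ N x
  have h01 := hsym (e2 0) (e2 1)
  simp only [trL_apply] at h
  simp only [piolaDeriv, trL_apply, _root_.add_apply, ContinuousLinearMap.comp_apply,
    _root_.smul_apply, ContinuousLinearMap.flip_apply, cofL_apply, ContinuousLinearMap.id_apply,
    PiLp.add_apply, PiLp.smul_apply, PiLp.sub_apply, smul_eq_mul]
  rw [map_eq_sum_e2 (T (e2 0)) w, map_eq_sum_e2 (T (e2 1)) w, h01]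
  simp only [map_add, map_smul]
  rw [map_eq_sum_e2 B (M (e2 0)), map_eq_sum_e2 B (M (e2 1))]
  simp only [map_add, map_smul]
  rw [map_eq_sum_e2 M (B (e2 0)), map_eq_sum_e2 M (B (e2 1))]
  simp only [PiLp.add_apply, PiLp.smul_apply, smul_eq_mul]
  have hb : (B (e2 1)) 1 = - (B (e2 0)) 0 := by linarith
  rw [hb]
  ring

theorem exists_bound_of_hasCompactSupport {F : Type*} [NormedAddCommGroup F] {f : E2 → F}
    (hf : Continuous f) (hc : HasCompactSupport f) : ∃ C : ℝ≥0, ∀ x, ‖f x‖₊ ≤ C := by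
  obtain ⟨C, hC⟩ := hf.bounded_above_of_compact_support hc
  exact ⟨C.toNNReal, fun x => by
    rw [← NNReal.coe_le_coe]; exact (hC x).trans (Real.le_coe_toNNReal C)⟩

/-- The Piola transform is bounded in `W^{1,2}`, uniformly for small perturbations. -/
theorem exists_eLpNorm_piola_le (hN : ContDiff ℝ 2 N) (hc : HasCompactSupport N) :
    ∃ C : ℝ≥0, ∃ t₁ > (0 : ℝ), ∀ t, 0 < t → t < t₁ → ∀ φ : E2 → E2, ContDiff ℝ 1 φ →
      eLpNorm (piola N t φ) 2 volume + eLpNorm (piolaDeriv N t φ) 2 volume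
        ≤ C * (eLpNorm φ 2 volume + eLpNorm (fderiv ℝ φ) 2 volume) := by
  have hN1 : ContDiff ℝ 1 N := hN.of_le (by norm_num)
  have hdN : ContDiff ℝ 1 (fderiv ℝ N) := hN.fderiv_right (by norm_num)
  have hcd : HasCompactSupport (fderiv ℝ N) := hc.fderiv (𝕜 := ℝ)
  obtain ⟨C1, hC1⟩ := exists_bound_of_hasCompactSupport hdN.continuous hcd
  obtain ⟨C2, hC2⟩ := exists_bound_of_hasCompactSupport (cofL.continuous.comp hdN.continuous)
    (hcd.comp_left (map_zero cofL))
  have hcdd : HasCompactSupport (fderiv ℝ (fderiv ℝ N)) := hcd.fderiv (𝕜 := ℝ)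
  obtain ⟨C3, hC3⟩ := exists_bound_of_hasCompactSupport
    (hdN.continuous_fderiv (by norm_num)) hcdd
  obtain ⟨t₁, ht₁, hcomp⟩ := exists_eLpNorm_comp_perturbation_le hN1 hc
  refine ⟨(1 + C2 + ‖cofL‖₊ * C3) * 2 + (1 + C2) * (1 + C1) * 2, min t₁ 1, by positivity,
    fun t ht htt φ hφ => ?_⟩
  have ht1 : t < t₁ := htt.trans_le (min_le_left _ _)
  have ht2 : t ≤ 1 := (htt.trans_le (min_le_right _ _)).le
  have htn : ‖t‖₊ ≤ 1 := by
    rw [← NNReal.coe_le_coe, coe_nnnorm, norm_of_nonneg ht.le]; simpa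
  have hA : ∀ x, ‖ContinuousLinearMap.id ℝ E2 + t • cofL (fderiv ℝ N x)‖₊ ≤ 1 + C2 := fun x => by
    refine (nnnorm_add_le _ _).trans (add_le_add ?_ ?_)
    · exact ContinuousLinearMap.norm_id_le
    · rw [nnnorm_smul]; exact (mul_le_of_le_one_left zero_le htn).trans (hC2 x)
  have hP : ∀ x, ‖ContinuousLinearMap.id ℝ E2 + t • fderiv ℝ N x‖₊ ≤ 1 + C1 := fun x => by
    refine (nnnorm_add_le _ _).trans (add_le_add ?_ ?_)
    · exact ContinuousLinearMap.norm_id_le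
    · rw [nnnorm_smul]; exact (mul_le_of_le_one_left zero_le htn).trans (hC1 x)
  have e1 : eLpNorm (fun x => φ (x + t • N x)) 2 volume ≤ 2 * eLpNorm φ 2 volume :=
    hcomp t ht ht1 φ
  have e2 : eLpNorm (fun x => fderiv ℝ φ (x + t • N x)) 2 volume
      ≤ 2 * eLpNorm (fderiv ℝ φ) 2 volume := hcomp t ht ht1 (fderiv ℝ φ)
  have b1 : eLpNorm (piola N t φ) 2 volume ≤ ((1 + C2 : ℝ≥0) : ℝ≥0∞) *
      eLpNorm (fun x => φ (x + t • N x)) 2 volume := by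
    refine eLpNorm_le_nnreal_smul_eLpNorm_of_ae_le_mul (ae_of_all _ fun x => ?_) 2
    have : piola N t φ x = (ContinuousLinearMap.id ℝ E2 + t • cofL (fderiv ℝ N x))
        (φ (x + t • N x)) := by simp [piola]
    rw [this]
    exact (ContinuousLinearMap.le_opNNNorm _ _).trans (mul_le_mul_left (hA x) _)
  have hcont : Continuous (fun x => φ (x + t • N x)) :=
    hφ.continuous.comp (continuous_id.add (hN.continuous.const_smul t))
  have hcont2 : Continuous (fun x => fderiv ℝ φ (x + t • N x)) :=
    (hφ.continuous_fderiv (by norm_num)).comp (continuous_id.add (hN.continuous.const_smul t))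
  have b2 : eLpNorm (piolaDeriv N t φ) 2 volume
      ≤ (((1 + C2) * (1 + C1) : ℝ≥0) : ℝ≥0∞) * eLpNorm (fun x => fderiv ℝ φ (x + t • N x)) 2 volume
        + ((‖cofL‖₊ * C3 : ℝ≥0) : ℝ≥0∞) * eLpNorm (fun x => φ (x + t • N x)) 2 volume := by
    have hc1 : Continuous fun x =>
      (ContinuousLinearMap.id ℝ E2 + t • cofL (fderiv ℝ N x)) ∘L
      ((fderiv ℝ φ (x + t • N x)) ∘L (ContinuousLinearMap.id ℝ E2 + t • fderiv ℝ N x)) := by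
      have := hdN.continuous
      refine Continuous.clm_comp ?_ (hcont2.clm_comp ?_)
      · exact continuous_const.add ((cofL.continuous.comp this).const_smul t)
      · exact continuous_const.add (this.const_smul t)
    have hc2 : Continuous fun x =>
        t • ((cofL ∘L fderiv ℝ (fderiv ℝ N) x).flip (φ (x + t • N x))) := by
      have h0 : Continuous fun x => fderiv ℝ (fderiv ℝ N) x := hdN.continuous_fderiv (by norm_num)
      have h1 : Continuous fun x => (cofL ∘L fderiv ℝ (fderiv ℝ N) x).flip :=
        (ContinuousLinearMap.flipₗᵢ ℝ E2 E2 E2).continuous.comp (continuous_const.clm_comp h0)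
      exact (h1.clm_apply hcont).const_smul t
    refine (eLpNorm_add_le hc1.aestronglyMeasurable hc2.aestronglyMeasurable (by norm_num)).trans
      (add_le_add ?_ ?_)
    · refine eLpNorm_le_nnreal_smul_eLpNorm_of_ae_le_mul (ae_of_all _ fun x => ?_) 2
      refine (ContinuousLinearMap.opNNNorm_comp_le _ _).trans ?_
      refine (mul_le_mul' (hA x) (ContinuousLinearMap.opNNNorm_comp_le _ _)).trans ?_
      rw [mul_assoc, mul_comm (1 + C1)]
      gcongr
      exact hP x
    · refine eLpNorm_le_nnreal_smul_eLpNorm_of_ae_le_mul (ae_of_all _ fun x => ?_) 2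
      rw [nnnorm_smul]
      refine (mul_le_of_le_one_left zero_le htn).trans ?_
      refine (ContinuousLinearMap.le_opNNNorm _ _).trans (mul_le_mul_left ?_ _)
      have : ‖(cofL ∘L fderiv ℝ (fderiv ℝ N) x).flip‖₊ = ‖cofL ∘L fderiv ℝ (fderiv ℝ N) x‖₊ := by
        ext; exact ContinuousLinearMap.opNorm_flip _
      rw [this]
      exact (ContinuousLinearMap.opNNNorm_comp_le _ _).trans (mul_le_mul_right (hC3 x) _)
  calc _ ≤ ((1 + C2 : ℝ≥0) : ℝ≥0∞) * (2 * eLpNorm φ 2 volume) +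
      ((((1 + C2) * (1 + C1) : ℝ≥0) : ℝ≥0∞) * (2 * eLpNorm (fderiv ℝ φ) 2 volume)
        + ((‖cofL‖₊ * C3 : ℝ≥0) : ℝ≥0∞) * (2 * eLpNorm φ 2 volume)) := by
        refine add_le_add (b1.trans (by gcongr)) (b2.trans (by gcongr))
    _ = (((1 + C2 + ‖cofL‖₊ * C3) * 2 : ℝ≥0) : ℝ≥0∞) * eLpNorm φ 2 volume +
        (((1 + C2) * (1 + C1) * 2 : ℝ≥0) : ℝ≥0∞) * eLpNorm (fderiv ℝ φ) 2 volume := by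
        push_cast; ring
    _ ≤ _ := by
        rw [mul_add (_ : ℝ≥0∞)]
        exact add_le_add (mul_le_mul_left (ENNReal.coe_le_coe.2 le_self_add) _)
          (mul_le_mul_left (ENNReal.coe_le_coe.2 le_add_self) _)

/-- A continuous family vanishing off a compact set and at parameter zero is small in `L²`. -/
theorem tendsto_eLpNorm_of_continuous_family {F : Type*} [NormedAddCommGroup F]
    {H : ℝ → E2 → F} (hH : Continuous (Function.uncurry H)) {K : Set E2} (hK : IsCompact K)
    (h0 : ∀ x, H 0 x = 0) (hs : ∀ t, ∀ x ∉ K, H t x = 0) :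
    Tendsto (fun t => eLpNorm (H t) 2 volume) (𝓝 0) (𝓝 0) := by
  have hfin : volume K ^ (1 / (2 : ℝ)) ≠ ∞ :=
    ENNReal.rpow_ne_top_of_nonneg (by norm_num) hK.measure_lt_top.ne
  have key : ∀ ε : ℝ, 0 < ε → ∀ᶠ t in 𝓝 (0 : ℝ),
      eLpNorm (H t) 2 volume ≤ volume K ^ (1 / (2 : ℝ)) * ofReal ε := by
    intro ε hε
    have := hK.eventually_forall_of_forall_eventually (x₀ := (0 : ℝ))
      (P := fun t x => ‖H t x‖ < ε) (fun x _ => by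
        have hc : ContinuousAt (fun z : ℝ × E2 => ‖H z.1 z.2‖) (0, x) := hH.norm.continuousAt
        exact hc.eventually_lt_const (by simpa [h0] using hε))
    filter_upwards [this] with t ht
    rw [← eLpNorm_restrict_eq_of_support_subset (s := K)
      (fun x hx => by by_contra h; exact hx (hs t x h))]
    refine (eLpNorm_le_of_ae_bound (C := ε) ?_).trans (le_of_eq ?_)
    · exact (ae_restrict_iff' hK.measurableSet).2 (ae_of_all _ fun x hx => (ht x hx).le)
    · simp
  rw [ENNReal.tendsto_nhds_zero]
  intro ε hε
  by_cases hz : volume K ^ (1 / (2 : ℝ)) = 0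
  · filter_upwards [key 1 one_pos] with t ht
    rw [hz, zero_mul] at ht
    exact ht.trans bot_le
  by_cases hεt : ε = ∞
  · simp [hεt]
  have hq : ε / volume K ^ (1 / (2 : ℝ)) ≠ ∞ := ENNReal.div_ne_top hεt hz
  have hq0 : 0 < ε / volume K ^ (1 / (2 : ℝ)) := ENNReal.div_pos hε.ne' hfin
  filter_upwards [key _ (ENNReal.toReal_pos hq0.ne' hq)] with t ht
  rw [ENNReal.ofReal_toReal hq, ENNReal.mul_div_cancel hz hfin] at ht
  exact ht

theorem tendsto_eLpNorm_piola_sub (hN : ContDiff ℝ 2 N) (hc : HasCompactSupport N)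
    {φ : E2 → E2} (hφ : ContDiff ℝ 1 φ) :
    Tendsto (fun t => eLpNorm (fun x => piola N t φ x - φ x) 2 volume
      + eLpNorm (fun x => piolaDeriv N t φ x - fderiv ℝ φ x) 2 volume) (𝓝 0) (𝓝 0) := by
  have hdN : ContDiff ℝ 1 (fderiv ℝ N) := hN.fderiv_right (by norm_num)
  have hddN : Continuous (fderiv ℝ (fderiv ℝ N)) := hdN.continuous_fderiv (by norm_num)
  have hdφ : Continuous (fderiv ℝ φ) := hφ.continuous_fderiv (by norm_num)
  have hN0 : ∀ x ∉ tsupport N, N x = 0 := fun x hx => image_eq_zero_of_notMem_tsupport hx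
  have hN1 : ∀ x ∉ tsupport N, fderiv ℝ N x = 0 := fun x hx =>
    image_eq_zero_of_notMem_tsupport fun h => hx (tsupport_fderiv_subset ℝ h)
  have hN2 : ∀ x ∉ tsupport N, fderiv ℝ (fderiv ℝ N) x = 0 := fun x hx =>
    image_eq_zero_of_notMem_tsupport fun h => hx (tsupport_fderiv_subset ℝ
      (tsupport_fderiv_subset ℝ h))
  have hcN := hN.continuous
  have hcdN := hdN.continuous
  have hcφ := hφ.continuous
  have cq : Continuous fun z : ℝ × E2 => z.2 + z.1 • N z.2 := by fun_prop
  have c1 : Continuous fun z : ℝ × E2 => φ (z.2 + z.1 • N z.2) := hcφ.comp cq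
  have c2 : Continuous fun z : ℝ × E2 => cofL (fderiv ℝ N z.2) :=
    cofL.continuous.comp (hcdN.comp continuous_snd)
  rw [← add_zero (0 : ℝ≥0∞)]
  refine Tendsto.add ?_ ?_
  · refine tendsto_eLpNorm_of_continuous_family (K := tsupport N) ?_ hc (fun x => ?_)
      (fun t x hx => ?_)
    · exact (c1.add (continuous_fst.smul (c2.clm_apply c1))).sub (hcφ.comp continuous_snd)
    · simp [piola]
    · simp [piola, hN0 x hx, hN1 x hx]
  · refine tendsto_eLpNorm_of_continuous_family (K := tsupport N) ?_ hc (fun x => ?_)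
      (fun t x hx => ?_)
    · refine Continuous.sub (Continuous.add ?_ ?_) (hdφ.comp continuous_snd)
      · refine Continuous.clm_comp (continuous_const.add (continuous_fst.smul c2))
          (Continuous.clm_comp (hdφ.comp cq) ?_)
        exact continuous_const.add (continuous_fst.smul (hcdN.comp continuous_snd))
      · refine continuous_fst.smul (Continuous.clm_apply ?_ c1)
        exact (ContinuousLinearMap.flipₗᵢ ℝ E2 E2 E2).continuous.comp
          (continuous_const.clm_comp (hddN.comp continuous_snd))
    · ext v; simp [piolaDeriv]
    · ext v; simp [piolaDeriv, hN0 x hx, hN1 x hx, hN2 x hx]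

end Piola

open scoped Convolution

section ConvolutionLimits

variable {X F G H : Type*} [NormedAddCommGroup X] [NormedSpace ℝ X] [FiniteDimensional ℝ X]
  [MeasureSpace X] [BorelSpace X] [(volume : Measure X).IsAddHaarMeasure]
  [NormedAddCommGroup F] [NormedSpace ℝ F] [NormedAddCommGroup G] [NormedSpace ℝ G]
  [NormedAddCommGroup H] [NormedSpace ℝ H]

/-- Convolution with a fixed kernel turns `L²` convergence into pointwise convergence. -/
theorem tendsto_convolution_of_tendsto_eLpNorm (B : G →L[ℝ] F →L[ℝ] H) {k : X → G}
    (hk : Continuous k) (hc : HasCompactSupport k) {h : ℕ → X → F} {h' : X → F}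
    (hm : ∀ m, MemLp (h m) 2 volume) (hm' : MemLp h' 2 volume)
    (hlim : Tendsto (fun m => eLpNorm (fun x => h m x - h' x) 2 volume) atTop (𝓝 0)) (x : X) :
    Tendsto (fun m => (k ⋆[B, volume] h m) x) atTop (𝓝 ((k ⋆[B, volume] h') x)) := by
  have hk2 : MemLp k 2 volume := hk.memLp_of_hasCompactSupport hc
  have mp := Measure.measurePreserving_sub_left (volume : Measure X) x
  have hb : ∀ (v : X → F) (t : X), ‖B (k t) (v t)‖₊ ≤ ‖B‖₊ * ‖k t‖₊ * ‖v t‖₊ := fun v t =>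
    ((B (k t)).le_opNNNorm _).trans (mul_le_mul_left (B.le_opNNNorm _) _)
  have hmem : ∀ v : X → F, MemLp v 2 volume → Integrable (fun t => B (k t) (v (x - t))) volume := by
    intro v hv
    rw [← memLp_one_iff_integrable]
    exact MemLp.of_bilin (fun a b => B a b) ‖B‖₊ hk2 (hv.comp_measurePreserving mp)
      (B.aestronglyMeasurable_comp₂ hk2.1 (hv.comp_measurePreserving mp).1)
      (ae_of_all _ fun t => hb (fun t => v (x - t)) t)
  refine tendsto_integral_of_L1' _ (hmem h' hm').1 (Eventually.of_forall fun m => hmem _ (hm m)) ?_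
  have hlim2 : Tendsto (fun m => ‖B‖₊ * eLpNorm k 2 volume
      * eLpNorm (fun x => h m x - h' x) 2 volume) atTop (𝓝 0) := by
    have := ENNReal.Tendsto.const_mul (a := ‖B‖₊ * eLpNorm k 2 volume) hlim
      (Or.inr (ENNReal.mul_ne_top ENNReal.coe_ne_top hk2.2.ne))
    rwa [mul_zero] at this
  refine tendsto_of_tendsto_of_tendsto_of_le_of_le tendsto_const_nhds hlim2 (fun _ => bot_le)
    (fun m => ?_)
  have hs : MemLp (fun x => h m x - h' x) 2 volume := (hm m).sub hm'
  have e : ((fun t => B (k t) (h m (x - t))) - fun t => B (k t) (h' (x - t)))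
      = fun t => B (k t) ((fun y => h m y - h' y) (x - t)) := by
    ext t; simp
  have e2 : eLpNorm (fun x => h m x - h' x) 2 volume
      = eLpNorm (fun t => (fun y => h m y - h' y) (x - t)) 2 volume :=
    (eLpNorm_comp_measurePreserving hs.1 mp).symm
  rw [e, e2]
  exact eLpNorm_le_eLpNorm_mul_eLpNorm_of_nnnorm hk2.1 (hs.comp_measurePreserving mp).1
    (fun a b => B a b) ‖B‖₊ (ae_of_all _ fun t => hb (fun t => h m (x - t) - h' (x - t)) t)

variable [CompleteSpace F]

theorem eLpNorm_mollify_sub_le_add (ρ : ContDiffBump (0 : X)) {φ g : X → F} (hφ : Continuous φ)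
    (hg : ContDiff ℝ 1 g) :
    eLpNorm (fun x => mollify ρ φ x - g x) 2 volume ≤
      eLpNorm (fun x => φ x - g x) 2 volume
        + ofReal ρ.rOut * eLpNorm (fderiv ℝ g) 2 volume := by
  refine eLpNorm_mollify_sub_le ρ hφ hg.continuous fun y hy => ?_
  have hc := hg.continuous
  have e : (fun x => φ (x - y) - g x)
      = (fun x => (fun x => φ x - g x) (x - y)) + fun x => g (x - y) - g x := by
    ext x; simp
  rw [e]
  refine (eLpNorm_add_le (Continuous.aestronglyMeasurable (by fun_prop))
    (Continuous.aestronglyMeasurable (by fun_prop)) (by norm_num)).trans (add_le_add ?_ ?_)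
  · exact (eLpNorm_comp_measurePreserving (hφ.sub hg.continuous).aestronglyMeasurable
      (measurePreserving_sub_right volume y)).le
  · refine (eLpNorm_translate_sub_le hg y).trans ?_
    gcongr
    rw [← ofReal_norm]
    exact ofReal_le_ofReal hy.le

theorem contDiff_mollify (ρ : ContDiffBump (0 : X)) {f : X → F} (hf : LocallyIntegrable f volume)
    (n : ℕ∞) : ContDiff ℝ n (mollify ρ f) :=
  ρ.hasCompactSupport_normed.contDiff_convolution_left _ ρ.contDiff_normed hf

theorem hasFDerivAt_mollify (ρ : ContDiffBump (0 : X)) {f : X → F}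
    (hf : LocallyIntegrable f volume) (x : X) :
    HasFDerivAt (mollify ρ f) ((fderiv ℝ (ρ.normed volume)
      ⋆[(lsmul ℝ ℝ : ℝ →L[ℝ] F →L[ℝ] F).precompL X, volume] f) x) x :=
  ρ.hasCompactSupport_normed.hasFDerivAt_convolution_left _ ρ.contDiff_normed hf x

/-- Mollifications of a limit of smooth fields stay as close to a given smooth field as the
approximations, up to a term vanishing with the mollification. -/
theorem eLpNorm_mollify_limit_le (ρ : ContDiffBump (0 : X)) {φ : ℕ → X → F} {f : X → F}
    (hφ : ∀ m, ContDiff ℝ 1 (φ m)) (hφc : ∀ m, HasCompactSupport (φ m)) (hf : MemLp f 2 volume)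
    (hlim : Tendsto (fun m => eLpNorm (fun x => φ m x - f x) 2 volume) atTop (𝓝 0))
    {g : X → F} (hg : ContDiff ℝ 2 g) {d d' : ℝ≥0∞}
    (hd : ∀ᶠ m in atTop, eLpNorm (fun x => φ m x - g x) 2 volume ≤ d)
    (hd' : ∀ᶠ m in atTop, eLpNorm (fun x => fderiv ℝ (φ m) x - fderiv ℝ g x) 2 volume ≤ d') :
    eLpNorm (fun x => mollify ρ f x - g x) 2 volume
        ≤ d + ofReal ρ.rOut * eLpNorm (fderiv ℝ g) 2 volume ∧
      eLpNorm (fun x => fderiv ℝ (mollify ρ f) x - fderiv ℝ g x) 2 volume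
        ≤ d' + ofReal ρ.rOut * eLpNorm (fderiv ℝ (fderiv ℝ g)) 2 volume := by
  have hm : ∀ m, MemLp (φ m) 2 volume := fun m =>
    (hφ m).continuous.memLp_of_hasCompactSupport (hφc m)
  have hfl : LocallyIntegrable f volume := hf.locallyIntegrable (by norm_num)
  have hφl : ∀ m, LocallyIntegrable (φ m) volume := fun m => (hφ m).continuous.locallyIntegrable
  have hg1 : ContDiff ℝ 1 g := hg.of_le (by norm_num)
  have hdg : ContDiff ℝ 1 (fderiv ℝ g) := hg.fderiv_right (by norm_num)
  constructor
  · refine Lp.eLpNorm_le_of_ae_tendsto (u := atTop) (f := fun m x => mollify ρ (φ m) x - g x)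
      ?_ (fun m => ?_) (ae_of_all _ fun x => ?_)
    · filter_upwards [hd] with m hm
      exact (eLpNorm_mollify_sub_le_add ρ (hφ m).continuous hg1).trans (by gcongr)
    · exact ((contDiff_mollify ρ (hφl m) 0).continuous.sub hg.continuous).aestronglyMeasurable
    · exact (tendsto_convolution_of_tendsto_eLpNorm _ ρ.continuous_normed
        ρ.hasCompactSupport_normed hm hf hlim x).sub_const _
  · refine Lp.eLpNorm_le_of_ae_tendsto (u := atTop)
      (f := fun m x => fderiv ℝ (mollify ρ (φ m)) x - fderiv ℝ g x)
      ?_ (fun m => ?_) (ae_of_all _ fun x => ?_)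
    · filter_upwards [hd'] with m hm
      have e : ∀ x, fderiv ℝ (mollify ρ (φ m)) x = mollify ρ (fderiv ℝ (φ m)) x := fun x =>
        fderiv_normed_convolution ρ (hφ m) (hφc m) x
      simp_rw [e]
      exact (eLpNorm_mollify_sub_le_add ρ ((hφ m).continuous_fderiv (by norm_num)) hdg).trans
        (by gcongr)
    · exact (((contDiff_mollify ρ (hφl m) 1).continuous_fderiv (by norm_num)).sub
        hdg.continuous).aestronglyMeasurable
    · simp_rw [(hasFDerivAt_mollify ρ (hφl _) x).fderiv, (hasFDerivAt_mollify ρ hfl x).fderiv]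
      exact (tendsto_convolution_of_tendsto_eLpNorm _
        ((ρ.contDiff_normed (n := 1)).continuous_fderiv (by norm_num))
        (ρ.hasCompactSupport_normed.fderiv (𝕜 := ℝ)) hm hf hlim x).sub_const _

end ConvolutionLimits

section Trace

variable {Ωh : Opens E2}

/-- The pairing of a `2 × 2` matrix with the identity. -/
def identity22 : E22 := toLp 2 fun ij => if ij.1 = ij.2 then 1 else 0

theorem inner_identity22 (M : E22) : ⟪identity22, M⟫_ℝ = M (0, 0) + M (1, 1) := by
  rw [PiLp.inner_apply, Fintype.sum_prod_type]
  simp [identity22, Fin.sum_univ_two]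

theorem inner_identity22_gradVecL (A : E2 →L[ℝ] E2) : ⟪identity22, gradVecL A⟫_ℝ = trL A := by
  rw [inner_identity22, trL_apply]; rfl

theorem integral_fderiv_testFunction {η : E2 → ℝ} (hη : ContDiff ℝ 1 η)
    (hc : HasCompactSupport η) (φ : 𝓓(Ωh, E2)) :
    ∫ y in Ωh, fderiv ℝ η y (φ y) = - ∫ y in Ωh, η y * trL (fderiv ℝ φ y) := by
  have hφ : ContDiff ℝ 1 φ := φ.contDiff.of_le (by exact_mod_cast le_top)
  have h0 : ∀ y ∉ (Ωh : Set E2), φ y = 0 := fun y hy =>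
    image_eq_zero_of_notMem_tsupport fun h => hy (φ.tsupport_subset h)
  have h1 : ∀ y ∉ (Ωh : Set E2), fderiv ℝ φ y = 0 := fun y hy =>
    image_eq_zero_of_notMem_tsupport fun h => hy (φ.tsupport_subset (tsupport_fderiv_subset ℝ h))
  rw [setIntegral_eq_integral_of_forall_compl_eq_zero (fun y hy => by rw [h0 y hy, map_zero]),
    setIntegral_eq_integral_of_forall_compl_eq_zero (fun y hy => by rw [h1 y hy]; simp)]
  have hφi : ∀ i, ContDiff ℝ 1 fun y => φ y i := fun i =>
    (PiLp.proj (𝕜 := ℝ) 2 (fun _ : Fin 2 => ℝ) i).contDiff.comp hφ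
  have hφd : ∀ i y v, fderiv ℝ (fun y => φ y i) y v = (fderiv ℝ φ y v) i := fun i y v => by
    have := ((PiLp.proj (𝕜 := ℝ) 2 (fun _ : Fin 2 => ℝ) i).hasFDerivAt.comp y
      (hφ.differentiable (by norm_num) y).hasFDerivAt).fderiv
    have e : (fun y => φ y i) = (⇑(PiLp.proj (𝕜 := ℝ) 2 (fun _ : Fin 2 => ℝ) i) ∘ ⇑φ) :=
      rfl
    rw [e, this]; rfl
  have ibp := fun i => integral_mul_fderiv_of_hasCompactSupport (hφi i) hη hc (e2 i)
  have hcη : Continuous (fderiv ℝ η) := hη.continuous_fderiv (by norm_num)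
  have hcφ : Continuous (fderiv ℝ φ) := hφ.continuous_fderiv (by norm_num)
  have e1 : ∀ y, fderiv ℝ η y (φ y)
      = φ y 0 * fderiv ℝ η y (e2 0) + φ y 1 * fderiv ℝ η y (e2 1) := fun y => by
    rw [map_eq_sum_e2 (fderiv ℝ η y)]; simp
  have e2' : ∀ y, η y * trL (fderiv ℝ φ y)
      = fderiv ℝ (fun y => φ y 0) y (e2 0) * η y + fderiv ℝ (fun y => φ y 1) y (e2 1) * η y :=
    fun y => by rw [trL_apply, hφd, hφd]; ring
  simp_rw [e1, e2']
  have i1 : ∀ i, Integrable fun y => φ y i * fderiv ℝ η y (e2 i) := fun i =>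
    ((hφi i).continuous.mul (hcη.clm_apply continuous_const)).integrable_of_hasCompactSupport
      (((hc.fderiv (𝕜 := ℝ)).comp_left (g := fun A : E2 →L[ℝ] ℝ => A (e2 i)) rfl).mul_left)
  have i2 : ∀ i, Integrable fun y => fderiv ℝ (fun y => φ y i) y (e2 i) * η y := fun i =>
    ((((hφi i).continuous_fderiv (by norm_num)).clm_apply continuous_const).mul
      hη.continuous).integrable_of_hasCompactSupport hc.mul_left
  rw [integral_add (i1 0) (i1 1), integral_add (i2 0) (i2 1), ibp, ibp]
  ring

/-- Integration by parts for `W^{1,2}_0` fields against smooth functions. -/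
theorem integral_fderiv_of_mem_W0 {η : E2 → ℝ} (hη : ContDiff ℝ 1 η)
    (hc : HasCompactSupport η) {p : SobPair E2 E22 Ωh} (hp : p ∈ W0 Ωh gradVecL) :
    ∫ y in Ωh, fderiv ℝ η y (p.fst y) = - ∫ y in Ωh, η y * ⟪identity22, p.snd y⟫_ℝ := by
  have hcη : Continuous (fderiv ℝ η) := hη.continuous_fderiv (by norm_num)
  have hg : ∀ y v, fderiv ℝ η y v = ⟪(toDual ℝ E2).symm (fderiv ℝ η y), v⟫_ℝ :=
    fun y v => by simp
  have m1 : MemLp (fun y => (toDual ℝ E2).symm (fderiv ℝ η y)) 2 (volH Ωh) :=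
    (((toDual ℝ E2).symm.continuous.comp hcη).memLp_of_hasCompactSupport
      ((hc.fderiv (𝕜 := ℝ)).comp_left (map_zero _))).restrict _
  have m2 : MemLp (fun y => η y • identity22) 2 (volH Ωh) :=
    ((hη.continuous.smul continuous_const).memLp_of_hasCompactSupport hc.smul_right).restrict _
  have e1 : ∀ f : Lp E2 2 (volH Ωh), ∫ y in Ωh, fderiv ℝ η y (f y) = ⟪toL2 (volH Ωh)
      (fun y => (toDual ℝ E2).symm (fderiv ℝ η y)), f⟫_ℝ := by
    intro f
    rw [L2.inner_def]
    refine integral_congr_ae ?_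
    filter_upwards [coeFn_toL2 m1] with y hy
    rw [hy, hg]
  have e2 : ∀ f : Lp E22 2 (volH Ωh), ∫ y in Ωh, η y * ⟪identity22, f y⟫_ℝ = ⟪toL2 (volH Ωh)
      (fun y => η y • identity22), f⟫_ℝ := by
    intro f
    rw [L2.inner_def]
    refine integral_congr_ae ?_
    filter_upwards [coeFn_toL2 m2] with y hy
    rw [hy, real_inner_smul_left]
  refine W0_induction gradVecL (P := fun p => ∫ y in Ωh, fderiv ℝ η y (p.fst y)
    = - ∫ y in Ωh, η y * ⟪identity22, p.snd y⟫_ℝ) ?_ (fun φ => ?_) hp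
  · simp_rw [e1, e2]
    exact isClosed_eq (continuous_const.inner (WithLp.fstL 2 ℝ _ _).continuous)
      (continuous_const.inner (WithLp.sndL 2 ℝ _ _).continuous).neg
  · have h1 : ∫ y in Ωh, fderiv ℝ η y ((testPair gradVecL φ).fst y)
        = ∫ y in Ωh, fderiv ℝ η y (φ y) := by
      refine integral_congr_ae ?_
      filter_upwards [coeFn_toL2 (memLp_testFunction φ)] with y hy
      exact congrArg _ hy
    have h2 : ∫ y in Ωh, η y * ⟪identity22, (testPair gradVecL φ).snd y⟫_ℝ
        = ∫ y in Ωh, η y * trL (fderiv ℝ φ y) := by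
      refine integral_congr_ae ?_
      filter_upwards [coeFn_toL2 (memLp_grad_testFunction gradVecL φ)] with y hy
      rw [← inner_identity22_gradVecL]
      exact congrArg (fun M => η y * ⟪identity22, M⟫_ℝ) hy
    simp only [h1, h2]
    exact integral_fderiv_testFunction hη hc φ

theorem contDiff_testFunction {Ω : Opens E2} {F : Type*} [NormedAddCommGroup F] [NormedSpace ℝ F]
    (φ : 𝓓(Ω, F)) (n : ℕ∞) : ContDiff ℝ n φ := φ.contDiff.of_le (by exact_mod_cast le_top)

/-- A distributionally solenoidal `W^{1,2}_0` field is solenoidal in the whole plane. -/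
theorem integral_fderiv_eq_zero_of_mem_W0 {p : SobPair E2 E22 Ωh}
    (hp : p ∈ W0 Ωh gradVecL) (hdiv : ∀ ψ : 𝓓(Ωh, ℝ), ∫ y in Ωh, fderiv ℝ ψ y (p.fst y) = 0)
    {η : E2 → ℝ} (hη : ContDiff ℝ 1 η) (hc : HasCompactSupport η) :
    ∫ y in Ωh, fderiv ℝ η y (p.fst y) = 0 := by
  have htr : ∀ᵐ y, y ∈ (Ωh : Set E2) →
      (Ωh : Set E2).indicator (fun y => ⟪identity22, p.snd y⟫_ℝ) y = 0 := by
    have hm : MemLp (fun y => ⟪identity22, p.snd y⟫_ℝ) 2 (volH Ωh) :=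
      (Lp.memLp p.snd).const_inner identity22
    have hm' := (memLp_indicator_iff_restrict Ωh.isOpen.measurableSet).2 hm
    refine IsOpen.ae_eq_zero_of_integral_contDiff_smul_eq_zero Ωh.isOpen
      ((hm'.locallyIntegrable (by norm_num)).locallyIntegrableOn _) fun g hg hgc hgs => ?_
    have h1 := integral_fderiv_of_mem_W0 (hg.of_le (by exact_mod_cast le_top)) hgc hp
    have h2 := hdiv ⟨g, hg, hgc, hgs⟩
    have h3 : ∫ y in Ωh, fderiv ℝ g y (p.fst y) = 0 := h2
    rw [h3, zero_eq_neg, ← integral_indicator Ωh.isOpen.measurableSet] at h1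
    rw [← h1]
    congr 1
    ext y
    by_cases hy : y ∈ (Ωh : Set E2) <;> simp [hy]
  rw [integral_fderiv_of_mem_W0 hη hc hp, neg_eq_zero]
  refine (setIntegral_congr_ae (g := fun _ => (0 : ℝ)) Ωh.isOpen.measurableSet ?_).trans (by simp)
  filter_upwards [htr] with y hy hyΩ
  have := hy hyΩ
  rw [indicator_of_mem hyΩ] at this
  rw [this, mul_zero]

/-- Mollifications of such a field are solenoidal. -/
theorem trL_fderiv_mollify_eq_zero {p : SobPair E2 E22 Ωh}
    (hp : p ∈ W0 Ωh gradVecL) (hdiv : ∀ ψ : 𝓓(Ωh, ℝ), ∫ y in Ωh, fderiv ℝ ψ y (p.fst y) = 0)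
    (ρ : ContDiffBump (0 : E2)) (x : E2) :
    trL (fderiv ℝ (mollify ρ ((Ωh : Set E2).indicator p.fst)) x) = 0 := by
  set f := (Ωh : Set E2).indicator p.fst
  have hf : MemLp f 2 volume :=
    (memLp_indicator_iff_restrict Ωh.isOpen.measurableSet).2 (Lp.memLp p.fst)
  have hfl : LocallyIntegrable f volume := hf.locallyIntegrable (by norm_num)
  rw [(hasFDerivAt_mollify ρ hfl x).fderiv, convolution_def]
  have hρ1 : ContDiff ℝ 1 (ρ.normed volume) := ρ.contDiff_normed
  have hconv := ((ρ.hasCompactSupport_normed.fderiv (𝕜 := ℝ)).convolutionExists_left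
    ((lsmul ℝ ℝ : ℝ →L[ℝ] E2 →L[ℝ] E2).precompL E2)
    (hρ1.continuous_fderiv (by norm_num)) hfl) x
  rw [← trL.integral_comp_comm hconv]
  have e : ∀ y, trL (((lsmul ℝ ℝ : ℝ →L[ℝ] E2 →L[ℝ] E2).precompL E2)
      (fderiv ℝ (ρ.normed volume) y) (f (x - y))) = fderiv ℝ (ρ.normed volume) y (f (x - y)) := by
    intro y
    rw [trL_apply, map_eq_sum_e2 (fderiv ℝ (ρ.normed volume) y)]
    simp [ContinuousLinearMap.precompL_apply]
    ring
  simp_rw [e]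
  rw [← integral_sub_left_eq_self _ volume x]
  simp only [sub_sub_cancel]
  have hd : ∀ y, fderiv ℝ (fun y => ρ.normed volume (x - y)) y
      = - fderiv ℝ (ρ.normed volume) (x - y) := fun y => by
    have := (hρ1.differentiable (by norm_num) (x - y)).hasFDerivAt.comp y
      ((hasFDerivAt_id y).const_sub x)
    exact this.fderiv.trans (by ext; simp)
  have h1 : ContDiff ℝ 1 (fun y => ρ.normed volume (x - y)) :=
    hρ1.comp (contDiff_const.sub contDiff_id)
  have h2 : HasCompactSupport (fun y => ρ.normed volume (x - y)) :=
    ρ.hasCompactSupport_normed.comp_homeomorph (Homeomorph.subLeft x)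
  have h3 := integral_fderiv_eq_zero_of_mem_W0 hp hdiv h1 h2
  simp_rw [hd] at h3
  rw [← integral_indicator Ωh.isOpen.measurableSet] at h3
  rw [← neg_eq_zero, ← integral_neg, ← h3]
  congr 1
  ext y
  by_cases hy : y ∈ (Ωh : Set E2) <;> simp [f, hy]

end Trace

open scoped Convolution

section SolenoidalDensity

variable {Ωh : Opens E2}

variable (Ωh) in
/-- Solenoidal test fields. -/
def solTest : Submodule ℝ 𝓓(Ωh, E2) where
  carrier := {φ | ∀ y, trL (fderiv ℝ φ y) = 0}
  add_mem' {φ ψ} hφ hψ y := by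
    have : fderiv ℝ (φ + ψ : 𝓓(Ωh, E2)) y = fderiv ℝ φ y + fderiv ℝ ψ y :=
      fderiv_add (φ.contDiff.differentiable (by simp) y) (ψ.contDiff.differentiable (by simp) y)
    rw [this, map_add, hφ y, hψ y, add_zero]
  zero_mem' y := by
    have : fderiv ℝ (0 : 𝓓(Ωh, E2)) y = 0 := by
      rw [show ((0 : 𝓓(Ωh, E2)) : E2 → E2) = fun _ => 0 from rfl]
      simp
    rw [this, map_zero]
  smul_mem' c φ hφ y := by
    have : fderiv ℝ (c • φ : 𝓓(Ωh, E2)) y = c • fderiv ℝ φ y :=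
      fderiv_const_smul (φ.contDiff.differentiable (by simp) y) c
    rw [this, map_smul, hφ y, smul_zero]

variable (Ωh) in
/-- The `W^{1,2}` closure of solenoidal test fields. -/
def Vsol : Submodule ℝ (SobPair E2 E22 Ωh) :=
  ((solTest Ωh).map (testPair gradVecL)).topologicalClosure

theorem isClosed_Vsol : IsClosed (Vsol Ωh : Set (SobPair E2 E22 Ωh)) :=
  Submodule.isClosed_topologicalClosure _

theorem Vsol_le_W0 : Vsol Ωh ≤ W0 Ωh gradVecL := by
  refine Submodule.topologicalClosure_mono ?_
  rintro _ ⟨φ, -, rfl⟩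
  exact ⟨φ, rfl⟩

theorem Vsol_induction {P : SobPair E2 E22 Ωh → Prop} (hP : IsClosed {p | P p})
    (h : ∀ φ ∈ solTest Ωh, P (testPair gradVecL φ)) {p : SobPair E2 E22 Ωh}
    (hp : p ∈ Vsol Ωh) : P p := by
  have : closure ((solTest Ωh).map (testPair gradVecL) : Set (SobPair E2 E22 Ωh)) ⊆ {p | P p} :=
    closure_minimal (by rintro _ ⟨φ, hφ, rfl⟩; exact h φ hφ) hP
  refine this ?_
  rw [Vsol, ← SetLike.mem_coe, topologicalClosure_coe] at hp
  exact hp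

theorem exists_antilipschitz_gradVecL :
    ∃ c : ℝ≥0, ∀ A : E2 →L[ℝ] E2, ‖A‖₊ ≤ c * ‖gradVecL A‖₊ := by
  obtain ⟨c, -, hc⟩ := (gradVecL : (E2 →L[ℝ] E2) →ₗ[ℝ] E22).exists_antilipschitzWith
    (LinearMap.ker_eq_bot.2 gradVecL_injective)
  refine ⟨c, fun A => ?_⟩
  have := hc.le_mul_nndist A 0
  simpa using this

theorem eLpNorm_testFunction_eq {F G : Type*} [NormedAddCommGroup F] [InnerProductSpace ℝ F]
    [FiniteDimensional ℝ F] [NormedAddCommGroup G] [InnerProductSpace ℝ G] [FiniteDimensional ℝ G]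
    (L : (E2 →L[ℝ] F) →L[ℝ] G) (φ : 𝓓(Ωh, F)) :
    eLpNorm φ 2 volume = ‖(testPair L φ).fst‖ₑ ∧
      eLpNorm (fun x => L (fderiv ℝ φ x)) 2 volume = ‖(testPair L φ).snd‖ₑ := by
  constructor
  · rw [Lp.enorm_def, (norm_toL2_testFunction L φ).1,
      eLpNorm_congr_ae (coeFn_toL2 (memLp_testFunction φ)),
      eLpNorm_restrict_eq_of_support_subset]
    exact (subset_tsupport _).trans φ.tsupport_subset
  · rw [Lp.enorm_def, (norm_toL2_testFunction L φ).2,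
      eLpNorm_congr_ae (coeFn_toL2 (memLp_grad_testFunction L φ)),
      eLpNorm_restrict_eq_of_support_subset]
    intro x hx
    by_contra h
    refine hx ?_
    simp only
    rw [image_eq_zero_of_notMem_tsupport (f := fderiv ℝ φ)
      (fun h' => h (φ.tsupport_subset (tsupport_fderiv_subset ℝ h'))), map_zero]

theorem norm_toLp_le_add {A B : Type*} [NormedAddCommGroup A] [NormedAddCommGroup B]
    (x : WithLp 2 (A × B)) : ‖x‖ ≤ ‖x.fst‖ + ‖x.snd‖ := by
  rw [WithLp.prod_norm_eq_of_L2, Real.sqrt_le_left (by positivity)]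
  nlinarith [norm_nonneg x.fst, norm_nonneg x.snd]

theorem norm_fst_le' {A B : Type*} [NormedAddCommGroup A] [NormedAddCommGroup B]
    (x : WithLp 2 (A × B)) : ‖x.fst‖ ≤ ‖x‖ := by
  rw [WithLp.prod_norm_eq_of_L2]
  exact le_sqrt_of_sq_le (by nlinarith [norm_nonneg x.snd])

theorem norm_snd_le' {A B : Type*} [NormedAddCommGroup A] [NormedAddCommGroup B]
    (x : WithLp 2 (A × B)) : ‖x.snd‖ ≤ ‖x‖ := by
  rw [WithLp.prod_norm_eq_of_L2]
  exact le_sqrt_of_sq_le (by nlinarith [norm_nonneg x.fst])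

/-- The `W^{1,2}` size of a field on the whole plane. -/
def sobSize (φ : E2 → E2) (D : E2 → E2 →L[ℝ] E2) : ℝ≥0∞ :=
  eLpNorm φ 2 volume + eLpNorm D 2 volume

theorem exists_norm_testPair_le :
    ∃ c : ℝ≥0, ∀ φ : 𝓓(Ωh, E2), ‖testPair gradVecL φ‖ₑ ≤ c * sobSize φ (fderiv ℝ φ) ∧
      sobSize φ (fderiv ℝ φ) ≤ c * ‖testPair gradVecL φ‖ₑ := by
  obtain ⟨c, hc⟩ := exists_antilipschitz_gradVecL
  refine ⟨1 + c + ‖gradVecL‖₊, fun φ => ?_⟩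
  obtain ⟨h1, h2⟩ := eLpNorm_testFunction_eq gradVecL φ
  constructor
  · have h3 : ‖testPair gradVecL φ‖ₑ
        ≤ ‖(testPair gradVecL φ).fst‖ₑ + ‖(testPair gradVecL φ).snd‖ₑ := by
      rw [← ofReal_norm, ← ofReal_norm, ← ofReal_norm, ← ENNReal.ofReal_add (norm_nonneg _)
        (norm_nonneg _)]
      exact ofReal_le_ofReal (norm_toLp_le_add _)
    have h4 : eLpNorm (fun x => gradVecL (fderiv ℝ φ x)) 2 volume
        ≤ ‖gradVecL‖₊ * eLpNorm (fderiv ℝ φ) 2 volume :=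
      eLpNorm_le_nnreal_smul_eLpNorm_of_ae_le_mul
        (ae_of_all _ fun x => gradVecL.le_opNNNorm _) 2
    refine h3.trans ?_
    rw [← h1, ← h2, sobSize, mul_add]
    refine add_le_add ?_ (h4.trans ?_)
    · refine le_mul_of_one_le_left bot_le ?_
      push_cast
      rw [add_assoc]; exact le_self_add
    · refine mul_le_mul_left ?_ _
      push_cast; exact le_add_self
  · have h4 : eLpNorm (fderiv ℝ φ) 2 volume
        ≤ c * eLpNorm (fun x => gradVecL (fderiv ℝ φ x)) 2 volume :=
      eLpNorm_le_nnreal_smul_eLpNorm_of_ae_le_mul (ae_of_all _ fun x => hc _) 2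
    have h5 : ‖(testPair gradVecL φ).fst‖ₑ ≤ ‖testPair gradVecL φ‖ₑ := by
      rw [← ofReal_norm, ← ofReal_norm]; exact ofReal_le_ofReal (norm_fst_le' _)
    have h6 : ‖(testPair gradVecL φ).snd‖ₑ ≤ ‖testPair gradVecL φ‖ₑ := by
      rw [← ofReal_norm, ← ofReal_norm]; exact ofReal_le_ofReal (norm_snd_le' _)
    rw [sobSize, h1]
    calc _ ≤ ‖testPair gradVecL φ‖ₑ + c * ‖testPair gradVecL φ‖ₑ := by
          refine add_le_add h5 (h4.trans ?_)
          rw [h2]; gcongr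
      _ = ((1 + c : ℝ≥0) : ℝ≥0∞) * ‖testPair gradVecL φ‖ₑ := by push_cast; ring
      _ ≤ _ := mul_le_mul_left (ENNReal.coe_le_coe.2 le_self_add) _

/-- Small outward perturbations move mollified fields into the domain. -/
theorem exists_tsupport_piola_mollify_subset (hb : IsBounded (Ωh : Set E2))
    {N : E2 → E2} (hN : Continuous N) (hc : HasCompactSupport N) {t : ℝ} (ht0 : 0 ≤ t)
    (ht : ∀ x ∉ Ωh, x + t • N x ∉ closure (Ωh : Set E2)) :
    ∃ ε > (0 : ℝ), ∀ ρ : ContDiffBump (0 : E2), ρ.rOut ≤ ε → ∀ f : E2 → E2,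
      HasCompactSupport (piola N t (mollify ρ ((Ωh : Set E2).indicator f))) ∧
      tsupport (piola N t (mollify ρ ((Ωh : Set E2).indicator f))) ⊆ Ωh := by
  obtain ⟨M, hM⟩ := hN.bounded_above_of_compact_support hc
  let Φ : E2 → E2 := fun x => x + t • N x
  have hΦ : Continuous Φ := continuous_id.add (hN.const_smul t)
  have hKc : IsCompact (closure (Ωh : Set E2)) := hb.isCompact_closure
  have hcomp : ∀ r : ℝ, IsCompact (Φ ⁻¹' cthickening r (closure (Ωh : Set E2))) := by
    intro r
    refine Metric.isCompact_of_isClosed_isBounded (Metric.isClosed_cthickening.preimage hΦ) ?_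
    obtain ⟨R, hR⟩ := (hKc.cthickening (r := r)).isBounded.exists_norm_le
    refine isBounded_iff_forall_norm_le.2 ⟨R + t * M, fun x hx => ?_⟩
    have h1 : ‖Φ x‖ ≤ R := hR _ hx
    have h2 : x = Φ x - t • N x := by simp [Φ]
    rw [h2]
    refine (norm_sub_le _ _).trans (add_le_add h1 ?_)
    rw [norm_smul, norm_of_nonneg ht0]
    exact mul_le_mul_of_nonneg_left (hM x) ht0
  have hQ : IsCompact (Φ '' (Φ ⁻¹' cthickening 1 (closure (Ωh : Set E2)) ∩
      (Ωh : Set E2)ᶜ)) :=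
    ((hcomp 1).inter_right Ωh.isOpen.isClosed_compl).image hΦ
  have hdisj : Disjoint (closure (Ωh : Set E2))
      (Φ '' (Φ ⁻¹' cthickening 1 (closure (Ωh : Set E2)) ∩ (Ωh : Set E2)ᶜ)) := by
    rw [Set.disjoint_right]
    rintro _ ⟨x, ⟨-, hx⟩, rfl⟩
    exact ht x hx
  obtain ⟨δ, hδ, hdis⟩ := hdisj.exists_cthickenings hKc hQ.isClosed
  refine ⟨min δ 1, by positivity, fun ρ hρ f => ?_⟩
  have hsub : Φ ⁻¹' cthickening (min δ 1) (closure (Ωh : Set E2)) ⊆ Ωh := by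
    intro x hx
    by_contra hxΩ
    have hx' : Φ x ∈ cthickening (min δ 1) (closure (Ωh : Set E2)) := hx
    have h1 : Φ x ∈ cthickening δ (closure (Ωh : Set E2)) :=
      Metric.cthickening_mono (min_le_left δ 1) _ hx'
    have h2 : Φ x ∈ cthickening 1 (closure (Ωh : Set E2)) :=
      Metric.cthickening_mono (min_le_right δ 1) _ hx'
    have h3 : Φ x ∈ Φ '' (Φ ⁻¹' cthickening 1 (closure (Ωh : Set E2)) ∩
        (Ωh : Set E2)ᶜ) := Set.mem_image_of_mem Φ ⟨h2, hxΩ⟩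
    exact Set.disjoint_left.1 hdis h1 (Metric.self_subset_cthickening _ h3)
  have hsupp : Function.support (piola N t (mollify ρ ((Ωh : Set E2).indicator f)))
      ⊆ Φ ⁻¹' cthickening (min δ 1) (closure (Ωh : Set E2)) := by
    intro x hx
    have hne : mollify ρ ((Ωh : Set E2).indicator f) (Φ x) ≠ 0 := by
      intro h0
      refine hx ?_
      have : mollify ρ ((Ωh : Set E2).indicator f) (x + t • N x) = 0 := h0
      simp [piola, this]
    obtain ⟨y, hy, z, hz, hyz⟩ := support_convolution_subset _ hne
    rw [ρ.support_normed_eq, mem_ball_zero_iff] at hy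
    have hzΩ : z ∈ (Ωh : Set E2) := by
      by_contra h; exact hz (indicator_of_notMem h _)
    refine Metric.mem_cthickening_of_dist_le _ z _ _ (subset_closure hzΩ) ?_
    simp only at hyz
    rw [← hyz, dist_add_self_left]
    exact hy.le.trans hρ
  have hts := closure_minimal hsupp (Metric.isClosed_cthickening.preimage hΦ)
  exact ⟨HasCompactSupport.of_support_subset_isCompact (hcomp _) hsupp, hts.trans hsub⟩

set_option maxHeartbeats 1000000 in
/-- In a bounded `C²` domain, distributionally solenoidal `W^{1,2}_0` fields are limits
of solenoidal test fields. -/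
theorem mem_Vsol_of_div_eq_zero (hΩ : IsBoundedC2 Ωh) {p : SobPair E2 E22 Ωh}
    (hp : p ∈ W0 Ωh gradVecL)
    (hdiv : ∀ ψ : 𝓓(Ωh, ℝ), ∫ y in Ωh, fderiv ℝ ψ y (p.fst y) = 0) : p ∈ Vsol Ωh := by
  obtain ⟨N, hN, hNc, t₀, ht₀, hout⟩ := exists_outward_field hΩ
  have hN2 : ContDiff ℝ 2 N := (contDiff_infty.1 hN) 2
  obtain ⟨C, t₁, ht₁, hC⟩ := exists_eLpNorm_piola_le hN2 hNc
  obtain ⟨c, hc⟩ := exists_norm_testPair_le (Ωh := Ωh)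
  obtain ⟨φ, hφ⟩ := exists_seq_of_mem_W0 gradVecL hp
  set f := (Ωh : Set E2).indicator p.fst with hfdef
  have hf : MemLp f 2 volume :=
    (memLp_indicator_iff_restrict Ωh.isOpen.measurableSet).2 (Lp.memLp p.fst)
  have hfl : LocallyIntegrable f volume := hf.locallyIntegrable (by norm_num)
  have hlim : Tendsto (fun m => eLpNorm (fun x => φ m x - f x) 2 volume) atTop (𝓝 0) := by
    have h1 := ((tendsto_toLp_iff.1 hφ).1)
    have h2 := (tendsto_eLpNorm_sub_iff p.fst fun k => memLp_testFunction (φ k)).2 h1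
    refine h2.congr fun k => ?_
    have h3 : eLpNorm (fun y => p.fst y - φ k y) 2 (volOn Ωh)
        = eLpNorm (fun y => φ k y - p.fst y) 2 (volOn Ωh) := eLpNorm_sub_comm _ _ _ _
    rw [h3, ← eLpNorm_indicator_eq_eLpNorm_restrict Ωh.isOpen.measurableSet]
    congr 1
    ext1 x
    by_cases hx : x ∈ (Ωh : Set E2)
    · simp [hfdef, hx]
    · have : φ k x = 0 := image_eq_zero_of_notMem_tsupport fun h => hx ((φ k).tsupport_subset h)
      simp [hfdef, hx, this]
  have key : ∀ δ : ℝ≥0, 0 < δ → ∃ χ ∈ solTest Ωh,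
      ‖testPair gradVecL χ - p‖ₑ ≤ (c * (C * (4 * (c + 1)) + 1) + 1) * δ := by
    intro δ hδ
    have hδ' : (0 : ℝ≥0∞) < δ := by exact_mod_cast hδ
    -- a good test field
    obtain ⟨k, hk⟩ := Metric.cauchySeq_iff'.1 hφ.cauchySeq (δ / 2) (by positivity)
    have hkp : ‖testPair gradVecL (φ k) - p‖ ≤ δ := by
      have : Tendsto (fun n => dist (testPair gradVecL (φ n)) (testPair gradVecL (φ k))) atTop
          (𝓝 (dist p (testPair gradVecL (φ k)))) := hφ.dist tendsto_const_nhds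
      have h3 := le_of_tendsto this (eventually_atTop.2 ⟨k, fun n hn => (hk n hn).le⟩)
      rw [← dist_eq_norm, dist_comm]
      exact h3.trans (by linarith [δ.2, (NNReal.coe_pos.2 hδ)])
    have hS : ∀ m ≥ k, sobSize (fun x => φ m x - φ k x) (fun x => fderiv ℝ (φ m) x
        - fderiv ℝ (φ k) x) ≤ c * δ := by
      intro m hm
      have h1 := (hc (φ m - φ k)).2
      have h2 : fderiv ℝ (φ m - φ k : 𝓓(Ωh, E2)) = fun x => fderiv ℝ (φ m) x - fderiv ℝ (φ k) x := by
        ext1 x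
        exact fderiv_sub ((φ m).contDiff.differentiable (by simp) x)
          ((φ k).contDiff.differentiable (by simp) x)
      have h3 : ((φ m - φ k : 𝓓(Ωh, E2)) : E2 → E2) = fun x => φ m x - φ k x := rfl
      rw [h2, h3, map_sub] at h1
      refine h1.trans ?_
      gcongr
      rw [← ofReal_norm, ← ENNReal.ofReal_coe_nnreal]
      refine ofReal_le_ofReal ?_
      rw [← dist_eq_norm]
      exact (hk m hm).le.trans (by linarith [δ.2])
    have hk1 : ContDiff ℝ 1 (φ k) := contDiff_testFunction (φ k) 1
    have hk2 : ContDiff ℝ 2 (φ k) := contDiff_testFunction (φ k) 2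
    -- a good perturbation
    have htend := tendsto_eLpNorm_piola_sub hN2 hNc hk1
    have hev := (htend.eventually_le_const hδ')
    obtain ⟨t, ht, ht0, htt⟩ : ∃ t : ℝ, (eLpNorm (fun x => piola N t (φ k) x - φ k x) 2 volume
        + eLpNorm (fun x => piolaDeriv N t (φ k) x - fderiv ℝ (φ k) x) 2 volume ≤ δ) ∧ 0 < t ∧
        t < min t₀ t₁ := by
      have h1 : ∀ᶠ t in 𝓝[>] (0 : ℝ), t < min t₀ t₁ :=
        nhdsWithin_le_nhds (gt_mem_nhds (lt_min ht₀ ht₁))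
      exact ((hev.filter_mono nhdsWithin_le_nhds).and (eventually_mem_nhdsWithin.and h1)).exists
    -- a good mollification
    obtain ⟨ε, hε, hsupp⟩ := exists_tsupport_piola_mollify_subset hΩ.1 hN.continuous hNc ht0.le
      (hout t ht0 (htt.trans_le (min_le_left _ _)))
    have hfin1 : eLpNorm (fderiv ℝ (φ k)) 2 volume ≠ ∞ :=
      ((hk1.continuous_fderiv (by norm_num)).memLp_of_hasCompactSupport
        ((φ k).hasCompactSupport.fderiv (𝕜 := ℝ))).2.ne
    have hdk : ContDiff ℝ 1 (fderiv ℝ (φ k)) := hk2.fderiv_right (by norm_num)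
    have hfin2 : eLpNorm (fderiv ℝ (fderiv ℝ (φ k))) 2 volume ≠ ∞ :=
      ((hdk.continuous_fderiv (by norm_num)).memLp_of_hasCompactSupport
        (((φ k).hasCompactSupport.fderiv (𝕜 := ℝ)).fderiv (𝕜 := ℝ))).2.ne
    have hrt : ∀ B : ℝ≥0∞, B ≠ ∞ → ∀ᶠ r : ℝ in 𝓝[>] 0, ofReal r * B ≤ δ := by
      intro B hB
      have h1 : Tendsto (fun r : ℝ => ofReal r * B) (𝓝 0) (𝓝 (ofReal 0 * B)) :=
        ENNReal.Tendsto.mul_const (ENNReal.tendsto_ofReal tendsto_id) (Or.inr hB)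
      rw [ENNReal.ofReal_zero, zero_mul] at h1
      exact (h1.eventually_le_const hδ').filter_mono nhdsWithin_le_nhds
    obtain ⟨r, hr1, hr2, hr0, hrε⟩ := ((hrt _ hfin1).and ((hrt _ hfin2).and
      (eventually_mem_nhdsWithin.and
        ((gt_mem_nhds hε : ∀ᶠ r : ℝ in 𝓝 0, r < ε).filter_mono nhdsWithin_le_nhds)))).exists
    have hr0 : 0 < r := hr0
    let ρ : ContDiffBump (0 : E2) := ⟨r / 2, r, by positivity, by linarith⟩
    obtain ⟨hcs, hts⟩ := hsupp ρ hrε.le p.fst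
    have hmol : ContDiff ℝ 1 (mollify ρ f) := contDiff_mollify ρ hfl 1
    let χ : 𝓓(Ωh, E2) := ⟨piola N t (mollify ρ f),
      contDiff_piola (n := ⊤) hN t (contDiff_mollify ρ hfl ⊤), hcs, hts⟩
    have hχd : ∀ x, fderiv ℝ χ x = piolaDeriv N t (mollify ρ f) x := fun x =>
      (hasFDerivAt_piola hN2 t hmol x).fderiv
    have hχ : χ ∈ solTest Ωh := fun y => by
      rw [hχd]
      exact trL_piolaDeriv hN2 t y (trL_fderiv_mollify_eq_zero hp hdiv ρ _)
    refine ⟨χ, hχ, ?_⟩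
    -- the distance of the mollified field
    obtain ⟨b1, b2⟩ := eLpNorm_mollify_limit_le ρ (fun m => contDiff_testFunction (φ m) 1)
      (fun m => (φ m).hasCompactSupport) hf hlim hk2 (d := c * δ) (d' := c * δ)
      (eventually_atTop.2 ⟨k, fun m hm => le_self_add.trans (hS m hm)⟩)
      (eventually_atTop.2 ⟨k, fun m hm => le_add_self.trans (hS m hm)⟩)
    have hg : ContDiff ℝ 1 (fun x => mollify ρ f x - φ k x) := hmol.sub hk1
    have hgd : fderiv ℝ (fun x => mollify ρ f x - φ k x)
        = fun x => fderiv ℝ (mollify ρ f) x - fderiv ℝ (φ k) x := by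
      ext1 x
      exact fderiv_fun_sub (hmol.differentiable (by norm_num) x) (hk1.differentiable (by norm_num) x)
    have b3 := hC t ht0 (htt.trans_le (min_le_right _ _)) _ hg
    rw [hgd] at b3
    have b4 : eLpNorm (piola N t fun x => mollify ρ f x - φ k x) 2 volume
        + eLpNorm (piolaDeriv N t fun x => mollify ρ f x - φ k x) 2 volume
        ≤ C * (4 * (c + 1)) * δ := by
      refine b3.trans ?_
      rw [mul_assoc]
      refine mul_le_mul_right ?_ _
      calc _ ≤ ((c : ℝ≥0∞) * δ + δ) + (c * δ + δ) :=
            add_le_add (b1.trans (by gcongr)) (b2.trans (by gcongr))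
        _ = 2 * (c + 1) * δ := by ring
        _ ≤ 4 * (c + 1) * δ := by gcongr; norm_num
    have e1 : ((χ - φ k : 𝓓(Ωh, E2)) : E2 → E2) = (piola N t fun x => mollify ρ f x - φ k x)
        + fun x => piola N t (φ k) x - φ k x := by
      ext1 x
      change piola N t (mollify ρ f) x - φ k x = _
      simp only [piola, Pi.add_apply, map_sub, smul_sub]
      abel
    have e2 : fderiv ℝ (χ - φ k : 𝓓(Ωh, E2)) = (piolaDeriv N t fun x => mollify ρ f x - φ k x)
        + fun x => piolaDeriv N t (φ k) x - fderiv ℝ (φ k) x := by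
      ext1 x
      have : fderiv ℝ (χ - φ k : 𝓓(Ωh, E2)) x = fderiv ℝ χ x - fderiv ℝ (φ k) x :=
        fderiv_sub (χ.contDiff.differentiable (by simp) x)
          ((φ k).contDiff.differentiable (by simp) x)
      rw [this, hχd, Pi.add_apply]
      simp only [piolaDeriv, hgd]
      ext1 v
      simp [smul_sub]
      abel
    have hcp : Continuous (piola N t (φ k)) :=
      (contDiff_piola (n := 1) hN t hk1).continuous
    have hcd : ∀ g : E2 → E2, ContDiff ℝ 1 g → Continuous (piolaDeriv N t g) := fun g hg => by
      have : piolaDeriv N t g = fderiv ℝ (piola N t g) := by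
        ext1 x; exact (hasFDerivAt_piola hN2 t hg x).fderiv.symm
      rw [this]
      exact (contDiff_piola (n := 1) hN t hg).continuous_fderiv (by norm_num)
    have b5 : sobSize (χ - φ k : 𝓓(Ωh, E2)) (fderiv ℝ (χ - φ k : 𝓓(Ωh, E2)))
        ≤ (C * (4 * (c + 1)) + 1) * δ := by
      rw [sobSize, e2, e1]
      calc _ ≤ _ := add_le_add
            (eLpNorm_add_le (contDiff_piola (n := 1) hN t hg).continuous.aestronglyMeasurable
              (hcp.sub hk1.continuous).aestronglyMeasurable (by norm_num))
            (eLpNorm_add_le (hcd _ hg).aestronglyMeasurable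
              ((hcd _ hk1).sub (hk1.continuous_fderiv (by norm_num))).aestronglyMeasurable
              (by norm_num))
        _ ≤ C * (4 * (c + 1)) * δ + δ := by
            rw [add_add_add_comm]
            exact add_le_add b4 ht
        _ = _ := by ring
    have h6 : ‖testPair gradVecL χ - testPair gradVecL (φ k)‖ₑ
        ≤ c * ((C * (4 * (c + 1)) + 1) * δ) := by
      rw [← map_sub]
      exact (hc (χ - φ k)).1.trans (mul_le_mul_right b5 _)
    have h7 : ‖testPair gradVecL (φ k) - p‖ₑ ≤ δ := by
      rw [← ofReal_norm, ← ENNReal.ofReal_coe_nnreal]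
      exact ofReal_le_ofReal hkp
    calc ‖testPair gradVecL χ - p‖ₑ
        ≤ ‖testPair gradVecL χ - testPair gradVecL (φ k)‖ₑ + ‖testPair gradVecL (φ k) - p‖ₑ := by
          rw [← sub_add_sub_cancel]; exact enorm_add_le _ _
      _ ≤ c * ((C * (4 * (c + 1)) + 1) * δ) + δ := add_le_add h6 h7
      _ = _ := by ring
  rw [Vsol, ← SetLike.mem_coe, topologicalClosure_coe, Metric.mem_closure_iff]
  intro e he
  set K : ℝ≥0 := c * (C * (4 * (c + 1)) + 1) + 1 with hK
  obtain ⟨χ, hχ, hb⟩ := key (Real.toNNReal (e / (2 * K))) (by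
    rw [Real.toNNReal_pos]; positivity)
  refine ⟨testPair gradVecL χ, ⟨χ, hχ, rfl⟩, ?_⟩
  rw [dist_comm, dist_eq_norm]
  have hb' : ‖testPair gradVecL χ - p‖ₑ ≤ ofReal (K * (e / (2 * K))) := by
    rw [ENNReal.ofReal_mul (p := (K : ℝ)) K.2]
    refine hb.trans (le_of_eq ?_)
    rw [ENNReal.ofReal_coe_nnreal, hK]
    push_cast
    rfl
  rw [← ofReal_norm, ENNReal.ofReal_le_ofReal_iff (by positivity)] at hb'
  have hK0 : (0 : ℝ) < K := by positivity
  have : (K : ℝ) * (e / (2 * K)) = e / 2 := by field_simp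
  linarith

end SolenoidalDensity

open scoped Convolution

section Ehrling

variable {Ωh : Opens E2}

theorem isFiniteMeasure_volOn {X : Type*} [NormedAddCommGroup X] [NormedSpace ℝ X]
    [FiniteDimensional ℝ X] [MeasureSpace X] [BorelSpace X] [(volume : Measure X).IsAddHaarMeasure]
    {Ω : Opens X} (hΩ : IsBounded (Ω : Set X)) : IsFiniteMeasure (volOn Ω) :=
  ⟨by simpa using hΩ.measure_lt_top⟩

theorem norm_le_sum_abs (v : E2) : ‖v‖ ≤ ∑ i, |v i| := by
  conv_lhs => rw [eq_sum_e2 v]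
  rw [Fin.sum_univ_two]
  refine (norm_add_le _ _).trans (le_of_eq ?_)
  simp [norm_smul, e2]

/-- On `W^{1,2}_0`, the `L²` norm is controlled by a small multiple of the gradient
and finitely many averages. -/
theorem exists_ehrling (hb : IsBounded (Ωh : Set E2)) {ε : ℝ} (hε : 0 < ε) :
    ∃ (s : Finset (L2Vel Ωh)) (C : ℝ), 0 ≤ C ∧ ∀ p ∈ W0 Ωh gradVecL,
      ‖p.fst‖ ≤ ε * ‖p.snd‖ + C * ∑ w ∈ s, |⟪w, p.fst⟫_ℝ| := by
  classical
  have hfin : IsFiniteMeasure (volH Ωh) := isFiniteMeasure_volOn hb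
  obtain ⟨c, hc⟩ := exists_antilipschitz_gradVecL
  set V := √((volH Ωh).real Set.univ) with hV
  have hV0 : 0 ≤ V := Real.sqrt_nonneg _
  set r := ε / (2 * (c + 1)) with hr
  have hr0 : 0 < r := by positivity
  let ρ : ContDiffBump (0 : E2) := ⟨r / 2, r, by positivity, by linarith⟩
  set η := 1 / (4 * (V * V + 1)) with hη
  have hη0 : 0 < η := by positivity
  obtain ⟨δ, hδ, hρδ⟩ := Metric.uniformContinuous_iff.1
    (ρ.hasCompactSupport_normed.uniformContinuous_of_continuous
      (ρ.continuous_normed (μ := volume))) η hη0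
  obtain ⟨t, -, htf, hcov⟩ := (hb.isCompact_closure).finite_cover_balls hδ
  let W : E2 → Fin 2 → L2Vel Ωh := fun x i =>
    toL2 (volH Ωh) fun y => ρ.normed volume (x - y) • e2 i
  have hWm : ∀ x i, MemLp (fun y => ρ.normed volume (x - y) • e2 i) 2 (volH Ωh) := fun x i => by
    have h1 : HasCompactSupport fun y => ρ.normed volume (x - y) :=
      ρ.hasCompactSupport_normed.comp_homeomorph (Homeomorph.subLeft x)
    have h2 : Continuous fun y => ρ.normed volume (x - y) :=
      ρ.continuous_normed.comp (continuous_const.sub continuous_id)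
    exact ((h2.smul continuous_const).memLp_of_hasCompactSupport
      (h1.smul_right (f' := fun _ => e2 i))).restrict _
  have hWd : ∀ x x' i, dist x x' < δ → ‖W x i - W x' i‖ ≤ V * η := by
    intro x x' i hxx
    refine norm_toL2_sub_le_of_forall (hWm x i) (hWm x' i) hη0.le (ae_of_all _ fun y => ?_)
    rw [← sub_smul, norm_smul]
    have : ‖e2 i‖ = 1 := by simp [e2]
    rw [this, mul_one, ← dist_eq_norm]
    exact (hρδ (by simpa using hxx)).le
  let s : Finset (L2Vel Ωh) := (htf.toFinset ×ˢ Finset.univ).image fun z => W z.1 z.2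
  refine ⟨s, 2 * (V * 2), by positivity, fun p hp => ?_⟩
  refine W0_induction gradVecL (P := fun p => ‖p.fst‖ ≤ ε * ‖p.snd‖
    + 2 * (V * 2) * ∑ w ∈ s, |⟪w, p.fst⟫_ℝ|) ?_ (fun φ => ?_) hp
  · refine isClosed_le (WithLp.fstL 2 ℝ _ _).continuous.norm ?_
    refine (continuous_const.mul (WithLp.sndL 2 ℝ _ _).continuous.norm).add
      (continuous_const.mul (continuous_finsetSum _ fun w _ => ?_))
    exact (continuous_const.inner (WithLp.fstL 2 ℝ _ _).continuous).abs
  set v := (testPair gradVecL φ).fst with hv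
  have hφ1 : ContDiff ℝ 1 φ := contDiff_testFunction φ 1
  obtain ⟨n1, n2⟩ := eLpNorm_testFunction_eq gradVecL φ
  set S := ∑ w ∈ s, |⟪w, v⟫_ℝ| with hS
  have hmem : MemLp (mollify ρ φ) 2 (volH Ωh) :=
    ((contDiff_mollify ρ hφ1.continuous.locallyIntegrable 0).continuous.memLp_of_hasCompactSupport
      (ρ.hasCompactSupport_normed.convolution _ φ.hasCompactSupport)).restrict _
  -- the error of mollification
  have h1 : ‖toL2 (volH Ωh) (mollify ρ φ) - v‖ ≤ r * (c * ‖(testPair gradVecL φ).snd‖) := by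
    have h2 := eLpNorm_mollify_sub_self_le ρ hφ1
    have h4 : eLpNorm (fderiv ℝ φ) 2 volume
        ≤ c * eLpNorm (fun x => gradVecL (fderiv ℝ φ x)) 2 volume :=
      eLpNorm_le_nnreal_smul_eLpNorm_of_ae_le_mul (ae_of_all _ fun x => hc _) 2
    rw [n2] at h4
    have h5 : eLpNorm (⇑(toL2 (volH Ωh) (mollify ρ φ) - v)) 2 (volH Ωh)
        ≤ eLpNorm (fun x => mollify ρ φ x - φ x) 2 volume := by
      refine (eLpNorm_congr_ae ?_).le.trans (eLpNorm_restrict_le _ _ _ _)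
      filter_upwards [Lp.coeFn_sub (toL2 (volH Ωh) (mollify ρ φ)) v, coeFn_toL2 hmem,
        coeFn_toL2 (memLp_testFunction φ)] with x h6 h7 h8
      rw [h6, Pi.sub_apply, h7]
      exact congrArg _ h8
    have h9 : ‖toL2 (volH Ωh) (mollify ρ φ) - v‖ₑ
        ≤ ofReal (r * (c * ‖(testPair gradVecL φ).snd‖)) := by
      rw [Lp.enorm_def, ENNReal.ofReal_mul hr0.le, ENNReal.ofReal_mul (p := (c : ℝ)) c.2,
        ENNReal.ofReal_coe_nnreal, ofReal_norm]
      exact h5.trans (h2.trans (mul_le_mul_right h4 _))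
    rw [← ofReal_norm, ENNReal.ofReal_le_ofReal_iff (by positivity)] at h9
    exact h9
  -- the size of the mollified field
  have hval : ∀ x i, (mollify ρ φ x) i = ⟪W x i, v⟫_ℝ := by
    intro x i
    rw [hv, (norm_toL2_testFunction gradVecL φ).1, inner_toL2 (hWm x i) (memLp_testFunction φ),
      mollify, convolution_eq_swap]
    have hint : Integrable fun y => ρ.normed volume (x - y) • φ y :=
      ((ρ.continuous_normed.comp (continuous_const.sub continuous_id)).smul
        hφ1.continuous).integrable_of_hasCompactSupport φ.hasCompactSupport.smul_left
    have h10 := ((PiLp.proj (𝕜 := ℝ) 2 (fun _ : Fin 2 => ℝ) i)).integral_comp_comm hint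
    simp only [ContinuousLinearMap.lsmul_apply]
    have h11 : (∫ y, ρ.normed volume (x - y) • φ y) i
        = ∫ y, (ρ.normed volume (x - y) • φ y) i := h10.symm
    rw [h11, setIntegral_eq_integral_of_forall_compl_eq_zero]
    · congr 1; ext1 y
      simp [real_inner_smul_left, e2, EuclideanSpace.inner_single_left]
    · intro y hy
      have : φ y = 0 := image_eq_zero_of_notMem_tsupport fun h => hy (φ.tsupport_subset h)
      rw [this, inner_zero_right]
  have hpt : ∀ x ∈ (Ωh : Set E2), ‖mollify ρ φ x‖ ≤ 2 * (S + V * η * ‖v‖) := by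
    intro x hx
    obtain ⟨x', hx', hxx'⟩ := Set.mem_iUnion₂.1 (hcov (subset_closure hx))
    refine (norm_le_sum_abs _).trans ?_
    have : ∀ i, |(mollify ρ φ x) i| ≤ S + V * η * ‖v‖ := by
      intro i
      rw [hval]
      have e : ⟪W x i, v⟫_ℝ = ⟪W x' i, v⟫_ℝ + ⟪W x i - W x' i, v⟫_ℝ := by
        rw [← inner_add_left]; congr 1; abel
      rw [e]
      refine (abs_add_le _ _).trans (add_le_add ?_ ?_)
      · exact Finset.single_le_sum (f := fun w => |⟪w, v⟫_ℝ|) (fun _ _ => abs_nonneg _)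
          (Finset.mem_image.2 ⟨(x', i), by simpa using hx', rfl⟩)
      · exact (abs_real_inner_le_norm _ _).trans
          (mul_le_mul_of_nonneg_right (hWd x x' i hxx') (norm_nonneg _))
    rw [Fin.sum_univ_two]
    linarith [this 0, this 1]
  have hS0 : 0 ≤ S := Finset.sum_nonneg fun _ _ => abs_nonneg _
  have h12 : ‖toL2 (volH Ωh) (mollify ρ φ)‖ ≤ V * (2 * (S + V * η * ‖v‖)) := by
    have := norm_toL2_sub_le_of_forall hmem (MemLp.zero (ε := E2) (μ := volH Ωh) (p := 2))
      (ε := 2 * (S + V * η * ‖v‖)) (by positivity)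
      (by
        filter_upwards [ae_restrict_mem Ωh.isOpen.measurableSet] with x hx
        simpa using hpt x hx)
    have hz : toL2 (volH Ωh) (0 : E2 → E2) = 0 := by
      refine Lp.ext ?_
      filter_upwards [coeFn_toL2 (MemLp.zero (ε := E2) (μ := volH Ωh) (p := 2)),
        Lp.coeFn_zero E2 2 (volH Ωh)] with x h1 h2
      rw [h1, h2]
    rwa [hz, sub_zero] at this
  have h13 : ‖v‖ ≤ ‖toL2 (volH Ωh) (mollify ρ φ)‖ + ‖toL2 (volH Ωh) (mollify ρ φ) - v‖ := by
    have : v = toL2 (volH Ωh) (mollify ρ φ) - (toL2 (volH Ωh) (mollify ρ φ) - v) := by abel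
    conv_lhs => rw [this]
    exact norm_sub_le _ _
  have h14 : V * V * η ≤ 1 / 4 := by
    rw [hη]; rw [mul_one_div, div_le_div_iff₀ (by positivity) (by norm_num)]; linarith
  have h15 : r * c ≤ ε / 2 := by
    rw [hr, div_mul_eq_mul_div, div_le_div_iff₀ (by positivity) (by norm_num)]
    nlinarith [c.2]
  have h16 : V * V * η * ‖v‖ ≤ 1 / 4 * ‖v‖ := mul_le_mul_of_nonneg_right h14 (norm_nonneg _)
  have h17 : r * c * ‖(testPair gradVecL φ).snd‖ ≤ ε / 2 * ‖(testPair gradVecL φ).snd‖ :=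
    mul_le_mul_of_nonneg_right h15 (norm_nonneg _)
  change ‖v‖ ≤ ε * ‖(testPair gradVecL φ).snd‖ + 2 * (V * 2) * S
  nlinarith

end Ehrling

section Lift

variable {Ωh : Opens E2}

theorem vol3_eq_prod : vol3 Ωh = (volH Ωh).prod (volume.restrict (Ioo (0 : ℝ) 1)) := by
  rw [Measure.prod_restrict]; rfl

instance isAddHaarMeasure_volume_X3 : (volume : Measure X3).IsAddHaarMeasure :=
  inferInstanceAs ((volume : Measure E2).prod (volume : Measure ℝ)).IsAddHaarMeasure

theorem integrable_cyl_iff {f : X3 → ℝ} : Integrable f (vol3 Ωh) ↔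
    Integrable f ((volH Ωh).prod (volume.restrict (Ioo (0 : ℝ) 1))) := by rw [vol3_eq_prod]

theorem integral_cyl_eq (f : X3 → ℝ) : ∫ x in cyl Ωh, f x =
    ∫ x, f x ∂((volH Ωh).prod (volume.restrict (Ioo (0 : ℝ) 1))) := by rw [← vol3_eq_prod]

instance isProbabilityMeasure_volume_Ioo : IsProbabilityMeasure (volume.restrict (Ioo (0 : ℝ) 1)) := ⟨by simp⟩

theorem measurePreserving_horizontal : MeasurePreserving Prod.fst (vol3 Ωh) (volH Ωh) := by
  rw [vol3_eq_prod]; exact measurePreserving_fst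

/-- A horizontal field as a field on the cylinder. -/
def liftH (Ωh : Opens E2) : L2Vel Ωh →L[ℝ] Lp E2 2 (vol3 Ωh) :=
  (Lp.compMeasurePreservingₗᵢ ℝ Prod.fst measurePreserving_horizontal).toContinuousLinearMap

theorem coeFn_liftH (u : L2Vel Ωh) : liftH Ωh u =ᵐ[vol3 Ωh] fun x => u x.1 :=
  Lp.coeFn_compMeasurePreserving u measurePreserving_horizontal

theorem norm_liftH (u : L2Vel Ωh) : ‖liftH Ωh u‖ = ‖u‖ :=
  (Lp.compMeasurePreservingₗᵢ ℝ Prod.fst measurePreserving_horizontal).norm_map u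

/-- The embedding of horizontal vectors in physical vectors. -/
def embH : E2 →L[ℝ] E3 :=
  LinearMap.toContinuousLinearMap
    { toFun := fun v => toLp 2 ![v 0, v 1, 0]
      map_add' := fun v w => by ext i; fin_cases i <;> simp
      map_smul' := fun c v => by ext i; fin_cases i <;> simp }

theorem norm_embH (v : E2) : ‖embH v‖ = ‖v‖ := by
  rw [EuclideanSpace.norm_eq, EuclideanSpace.norm_eq, Fin.sum_univ_three, Fin.sum_univ_two]
  simp [embH]

theorem inner_embH_gradScalL (v : E2) (A : X3 →L[ℝ] ℝ) : ⟪embH v, gradScalL A⟫_ℝ = A (v, 0) := by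
  have h : ((v, 0) : X3) = v 0 • ((e2 0, 0) : X3) + v 1 • ((e2 1, 0) : X3) := by
    refine Prod.ext ?_ ?_
    · simpa using eq_sum_e2 v
    · simp
  rw [h, map_add, map_smul, map_smul, PiLp.inner_apply, Fin.sum_univ_three]
  simp [embH, gradScalL_apply, e3]
  ring

/-- The transport velocity `(u, 0)` on the cylinder. -/
def lift (Ωh : Opens E2) : L2Vel Ωh →L[ℝ] L2GradTemp Ωh :=
  (embH.compLpL 2 (vol3 Ωh)).comp (liftH Ωh)

theorem coeFn_lift (u : L2Vel Ωh) : lift Ωh u =ᵐ[vol3 Ωh] fun x => embH (u x.1) := by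
  filter_upwards [ContinuousLinearMap.coeFn_compLpL (p := 2) (μ := vol3 Ωh) embH (liftH Ωh u),
    coeFn_liftH u] with x h1 h2
  rw [← h2]; exact h1

theorem norm_lift_le (u : L2Vel Ωh) : ‖lift Ωh u‖ ≤ ‖u‖ := by
  rw [← norm_liftH u]
  refine Lp.norm_le_norm_of_ae_le ?_
  filter_upwards [coeFn_lift u, coeFn_liftH u] with x h1 h2
  rw [h1, h2, norm_embH]

/-- A solenoidal horizontal field is orthogonal to gradients of `W^{1,2}_0` functions. -/
theorem inner_lift_snd_eq_zero {u : L2Vel Ωh}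
    (hu : ∀ ψ : 𝓓(Ωh, ℝ), ∫ y in Ωh, fderiv ℝ ψ y (u y) = 0) {q : SobPair ℝ E3 (cyl Ωh)}
    (hq : q ∈ W0 (cyl Ωh) gradScalL) : ⟪lift Ωh u, q.snd⟫_ℝ = 0 := by
  refine W0_induction gradScalL (P := fun q => ⟪lift Ωh u, q.snd⟫_ℝ = 0) ?_ (fun ψ => ?_) hq
  · exact isClosed_eq (continuous_const.inner (WithLp.sndL 2 ℝ _ _).continuous) continuous_const
  have hint := L2.integrable_inner (𝕜 := ℝ) (lift Ωh u) (testPair gradScalL ψ).snd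
  have hae : (fun x => ⟪lift Ωh u x, (testPair gradScalL ψ).snd x⟫_ℝ) =ᵐ[vol3 Ωh]
      fun x => fderiv ℝ ψ x (u x.1, 0) := by
    filter_upwards [coeFn_lift u, coeFn_toL2 (memLp_grad_testFunction gradScalL ψ)] with x h1 h2
    rw [h1, ← inner_embH_gradScalL]
    exact congrArg _ h2
  rw [L2.inner_def, integral_congr_ae hae]
  have hint' := hint.congr hae
  rw [integrable_cyl_iff] at hint'
  rw [integral_cyl_eq, integral_prod_symm _ hint']
  refine integral_eq_zero_of_ae (ae_of_all _ fun z => ?_)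
  have hsub : tsupport (fun y => ψ (y, z)) ⊆ Prod.fst '' tsupport ψ := by
    refine closure_minimal (fun y hy => ⟨(y, z), subset_tsupport _ hy, rfl⟩) ?_
    exact (ψ.hasCompactSupport.isCompact.image continuous_fst).isClosed
  have hsm : ContDiff ℝ (⊤ : ℕ∞) fun y : E2 => ψ (y, z) :=
    (ψ.contDiff).comp (contDiff_id.prodMk contDiff_const)
  let ψz : 𝓓(Ωh, ℝ) := ⟨fun y => ψ (y, z), hsm,
    (ψ.hasCompactSupport.isCompact.image continuous_fst).of_isClosed_subset
      (isClosed_tsupport _) hsub,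
    hsub.trans (by
      rintro _ ⟨x, hx, rfl⟩
      exact (ψ.tsupport_subset hx).1)⟩
  have := hu ψz
  rw [Pi.zero_apply]
  refine Eq.trans (integral_congr_ae (ae_of_all _ fun y => ?_)) this
  have hd : fderiv ℝ ψz y = (fderiv ℝ ψ (y, z)).comp (ContinuousLinearMap.inl ℝ E2 ℝ) := by
    have h1 : HasFDerivAt (fun y : E2 => (y, z)) (ContinuousLinearMap.inl ℝ E2 ℝ) y :=
      hasFDerivAt_prodMk_left y z
    exact ((ψ.contDiff.differentiable (by simp) (y, z)).hasFDerivAt.comp y h1).fderiv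
  simp [hd]

end Lift

section Forcing

variable {Ωh : Opens E2}

theorem continuous_gradF (g : X3) : Continuous (gradF g) := by
  unfold gradF; fun_prop

/-- Multiplication of a horizontal field with `∇_h F`. -/
def buoyancy (g : X3) {M : ℝ} (hM : ∀ y ∈ Ωh, ‖gradF g y‖ ≤ M) : L2Vel Ωh →L[ℝ] L2Temp Ωh :=
  (mulOp (μ := vol3 Ωh) (fun x => innerSL ℝ (gradF g x.1)) M
    (((innerSL ℝ).continuous.comp ((continuous_gradF g).comp continuous_fst)).aestronglyMeasurable)
    (by
      filter_upwards [ae_restrict_mem (cyl Ωh).isOpen.measurableSet] with x hx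
      rw [innerSL_apply_norm]
      exact hM _ hx.1)).comp (liftH Ωh)

variable (g : X3) {M : ℝ} (hM : ∀ y ∈ Ωh, ‖gradF g y‖ ≤ M)

theorem coeFn_buoyancy (v : L2Vel Ωh) :
    buoyancy g hM v =ᵐ[vol3 Ωh] fun x => ⟪gradF g x.1, v x.1⟫_ℝ := by
  have h1 := coeFn_mulOp (μ := vol3 Ωh) (A := fun x => innerSL ℝ (gradF g x.1)) (M := M)
    (((innerSL ℝ).continuous.comp ((continuous_gradF g).comp continuous_fst)).aestronglyMeasurable)
    (by
      filter_upwards [ae_restrict_mem (cyl Ωh).isOpen.measurableSet] with x hx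
      rw [innerSL_apply_norm]
      exact hM _ hx.1) (liftH Ωh v)
  filter_upwards [h1, coeFn_liftH v] with x h2 h3
  rw [← h3]
  exact h2

theorem norm_buoyancy_le (v : L2Vel Ωh) : ‖buoyancy g hM v‖ ≤ M * ‖v‖ := by
  rw [← norm_liftH v]
  refine Lp.norm_le_mul_norm_of_ae_le_mul ?_
  filter_upwards [coeFn_buoyancy g hM v, coeFn_liftH v,
    ae_restrict_mem (cyl Ωh).isOpen.measurableSet] with x h1 h2 h3
  rw [h1, h2]
  exact (norm_inner_le_norm _ _).trans (mul_le_mul_of_nonneg_right (hM _ h3.1) (norm_nonneg _))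

/-- The buoyancy force in terms of the vertical mean of the temperature. -/
theorem inner_buoyancy (Θ : L2Temp Ωh) (v : L2Vel Ωh) :
    Integrable (fun y => vmean Θ y * ⟪gradF g y, v y⟫_ℝ) (volH Ωh) ∧
    ⟪Θ, buoyancy g hM v⟫_ℝ = ∫ y in Ωh, vmean Θ y * ⟪gradF g y, v y⟫_ℝ := by
  have hint := L2.integrable_inner (𝕜 := ℝ) Θ (buoyancy g hM v)
  have hae : (fun x => ⟪Θ x, buoyancy g hM v x⟫_ℝ) =ᵐ[vol3 Ωh]
      fun x => Θ x * ⟪gradF g x.1, v x.1⟫_ℝ := by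
    filter_upwards [coeFn_buoyancy g hM v] with x h1
    rw [h1]; simp [mul_comm]
  have hint' := hint.congr hae
  rw [integrable_cyl_iff] at hint'
  have e : ∀ y, ∫ z in Ioo (0 : ℝ) 1, Θ (y, z) * ⟪gradF g y, v y⟫_ℝ
      = vmean Θ y * ⟪gradF g y, v y⟫_ℝ := fun y => by
    rw [integral_mul_const]; rfl
  constructor
  · have := hint'.integral_prod_left
    simpa only [e] using this
  · rw [L2.inner_def, integral_congr_ae hae]
    rw [integral_cyl_eq, integral_prod _ hint']
    simp only [e]

end Forcing

section Convection

variable {Ωh : Opens E2}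

/-- The symmetrized tensor product. -/
def symTens (a b : E2) : E22 :=
  toLp 2 fun ij => (a ij.1 * b ij.2 + b ij.1 * a ij.2) / 2

theorem norm_symTens_le (a b : E2) : ‖symTens a b‖ ≤ ‖a‖ * ‖b‖ := by
  refine abs_le_of_sq_le_sq' ?_ (by positivity) |>.2
  rw [mul_pow, EuclideanSpace.norm_sq_eq, EuclideanSpace.norm_sq_eq, EuclideanSpace.norm_sq_eq,
    Fintype.sum_prod_type]
  simp only [Fin.sum_univ_two, symTens, norm_eq_abs, sq_abs]
  nlinarith [sq_nonneg (a 0 * b 1 - a 1 * b 0)]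

theorem symTens_sub (v w : E2) : symTens v v - symTens w w = symTens (v - w) (v + w) := by
  ext ij
  simp [symTens]
  ring

theorem inner_symTens_gradVecL (v : E2) (A : E2 →L[ℝ] E2) :
    ⟪symTens v v, gradVecL A⟫_ℝ = ⟪v, A v⟫_ℝ := by
  rw [map_eq_sum_e2 A v, PiLp.inner_apply, PiLp.inner_apply, Fintype.sum_prod_type]
  simp [symTens, gradVecL_apply]
  ring

theorem continuous_symTens : Continuous fun z : E2 × E2 => symTens z.1 z.2 := by
  unfold symTens
  refine (PiLp.continuous_toLp 2 _).comp ?_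
  fun_prop

instance holderTriple_four : ENNReal.HolderTriple 4 4 2 := ⟨by
  rw [← two_mul, show (4 : ℝ≥0∞) = 2 * 2 by norm_num,
    ENNReal.mul_inv (by norm_num) (by norm_num), ← mul_assoc,
    ENNReal.mul_inv_cancel (by norm_num) (by norm_num), one_mul]⟩

theorem aestronglyMeasurable_symTens {Y : Type*} [MeasurableSpace Y] {m : Measure Y}
    {v w : Y → E2} (hv : AEStronglyMeasurable v m) (hw : AEStronglyMeasurable w m) :
    AEStronglyMeasurable (fun y => symTens (v y) (w y)) m :=
  continuous_symTens.comp_aestronglyMeasurable (hv.prodMk hw)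

theorem eLpNorm_symTens_le {Y : Type*} [MeasurableSpace Y] {m : Measure Y}
    {v w : Y → E2} (hv : AEStronglyMeasurable v m) (hw : AEStronglyMeasurable w m) :
    eLpNorm (fun y => symTens (v y) (w y)) 2 m ≤ eLpNorm v 4 m * eLpNorm w 4 m := by
  have := eLpNorm_le_eLpNorm_mul_eLpNorm'_of_norm (p := 4) (q := 4) (r := 2) hv hw symTens 1
    (ae_of_all _ fun x => by simpa using norm_symTens_le (v x) (w x))
  simpa using this

/-- Ladyzhenskaya's inequality in `W^{1,2}_0`. -/
theorem exists_ladyzhenskaya_W0 : ∃ C : ℝ≥0, ∀ p ∈ W0 Ωh gradVecL,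
    eLpNorm p.fst 4 (volH Ωh) ^ 2 ≤ ofReal (C * (‖p.fst‖ * ‖p.snd‖)) := by
  obtain ⟨C, hC⟩ := exists_ladyzhenskaya_const
  obtain ⟨c, hc⟩ := exists_antilipschitz_gradVecL
  have key : ∀ φ : 𝓓(Ωh, E2), eLpNorm (testPair gradVecL φ).fst 4 (volH Ωh) ^ 2
      ≤ ofReal ((C * c : ℝ≥0) *
        (‖(testPair gradVecL φ).fst‖ * ‖(testPair gradVecL φ).snd‖)) := by
    intro φ
    have h1 := hC φ (contDiff_testFunction φ 1) φ.hasCompactSupport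
    obtain ⟨n1, n2⟩ := eLpNorm_testFunction_eq gradVecL φ
    have h4 : eLpNorm (fderiv ℝ φ) 2 volume
        ≤ c * eLpNorm (fun x => gradVecL (fderiv ℝ φ x)) 2 volume :=
      eLpNorm_le_nnreal_smul_eLpNorm_of_ae_le_mul (ae_of_all _ fun x => hc _) 2
    have h5 : eLpNorm (testPair gradVecL φ).fst 4 (volH Ωh) ≤ eLpNorm φ 4 volume := by
      rw [(norm_toL2_testFunction gradVecL φ).1,
        eLpNorm_congr_ae (coeFn_toL2 (memLp_testFunction φ))]
      exact eLpNorm_restrict_le _ _ _ _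
    rw [ENNReal.ofReal_mul (p := ((C * c : ℝ≥0) : ℝ)) (C * c).2, ENNReal.ofReal_mul (norm_nonneg _),
      ENNReal.ofReal_coe_nnreal, ofReal_norm, ofReal_norm, ← n1, ← n2]
    calc _ ≤ eLpNorm φ 4 volume ^ 2 := by gcongr
      _ ≤ C * (eLpNorm φ 2 volume * (c * eLpNorm (fun x => gradVecL (fderiv ℝ φ x)) 2 volume)) := by
          refine h1.trans (by gcongr)
      _ = _ := by push_cast; ring
  refine ⟨C * c, fun p hp => ?_⟩
  obtain ⟨φ, hφ⟩ := exists_seq_of_mem_W0 gradVecL hp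
  obtain ⟨h1, h2⟩ := tendsto_toLp_iff.1 hφ
  obtain ⟨k, hk, hae⟩ := exists_subseq_tendsto_ae h1
  refine le_of_forall_gt fun B hB => ?_
  have hlim : Tendsto (fun n => ofReal ((C * c : ℝ≥0) *
        (‖(testPair gradVecL (φ (k n))).fst‖ * ‖(testPair gradVecL (φ (k n))).snd‖))) atTop
      (𝓝 (ofReal ((C * c : ℝ≥0) * (‖p.fst‖ * ‖p.snd‖)))) := by
    refine ENNReal.tendsto_ofReal (Tendsto.const_mul _ ?_)
    exact (h1.comp hk.tendsto_atTop).norm.mul (h2.comp hk.tendsto_atTop).norm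
  obtain ⟨B', hB1, hB2⟩ := exists_between hB
  refine lt_of_le_of_lt ?_ hB2
  have hsq : B' = (B' ^ (1 / 2 : ℝ)) ^ 2 := by
    rw [← ENNReal.rpow_natCast, ← ENNReal.rpow_mul]; norm_num
  rw [hsq]
  gcongr
  refine Lp.eLpNorm_le_of_ae_tendsto (u := atTop)
    (f := fun n => ((testPair gradVecL (φ (k n))).fst : E2 → E2)) ?_
    (fun n => Lp.aestronglyMeasurable _) hae
  filter_upwards [hlim.eventually_lt_const hB1] with n hn
  refine (ENNReal.pow_le_pow_left_iff two_ne_zero).1 ?_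
  rw [← hsq]
  exact (key _).trans hn.le

/-- The tensor product `u ⊗ u` of a velocity field. -/
def tens (p : SobPair E2 E22 Ωh) : L2GradVel Ωh :=
  toL2 (volH Ωh) fun y => symTens (p.fst y) (p.fst y)

theorem memLp_four_of_mem_W0 {p : SobPair E2 E22 Ωh} (hp : p ∈ W0 Ωh gradVecL) :
    MemLp p.fst 4 (volH Ωh) := by
  obtain ⟨C, hC⟩ := exists_ladyzhenskaya_W0 (Ωh := Ωh)
  refine ⟨Lp.aestronglyMeasurable _, ?_⟩
  have := (hC p hp).trans_lt ENNReal.ofReal_lt_top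
  by_contra h
  rw [not_lt, top_le_iff] at h
  simp [h] at this

theorem memLp_tens {p : SobPair E2 E22 Ωh} (hp : p ∈ W0 Ωh gradVecL) :
    MemLp (fun y => symTens (p.fst y) (p.fst y)) 2 (volH Ωh) := by
  have h4 := memLp_four_of_mem_W0 hp
  exact ⟨aestronglyMeasurable_symTens h4.1 h4.1,
    (eLpNorm_symTens_le h4.1 h4.1).trans_lt (ENNReal.mul_lt_top h4.2 h4.2)⟩

theorem exists_norm_tens_le : ∃ C : ℝ, 0 ≤ C ∧
    (∀ p ∈ W0 Ωh gradVecL, ‖tens p‖ ≤ C * (‖p.fst‖ * ‖p.snd‖)) ∧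
    ∀ p ∈ W0 Ωh gradVecL, ∀ q ∈ W0 Ωh gradVecL, ‖tens p - tens q‖ ≤ C * (‖p - q‖ * ‖p + q‖) := by
  obtain ⟨C, hC0, hC⟩ : ∃ C : ℝ, 0 ≤ C ∧ ∀ p ∈ W0 Ωh gradVecL,
      eLpNorm p.fst 4 (volH Ωh) ^ 2 ≤ ofReal (C * (‖p.fst‖ * ‖p.snd‖)) := by
    obtain ⟨C, hC⟩ := exists_ladyzhenskaya_W0 (Ωh := Ωh)
    exact ⟨C, C.coe_nonneg, hC⟩
  refine ⟨C, hC0, fun p hp => ?_, fun p hp q hq => ?_⟩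
  · have h4 := memLp_four_of_mem_W0 hp
    have h1 : ‖tens p‖ₑ ≤ ofReal (C * (‖p.fst‖ * ‖p.snd‖)) := by
      rw [Lp.enorm_def, tens, eLpNorm_congr_ae (coeFn_toL2 (memLp_tens hp))]
      exact (eLpNorm_symTens_le h4.1 h4.1).trans ((sq _).symm.le.trans (hC p hp))
    rw [← ofReal_norm, ENNReal.ofReal_le_ofReal_iff
      (mul_nonneg hC0 (by positivity))] at h1
    exact h1
  · have hs := (W0 Ωh gradVecL).sub_mem hp hq
    have ha := (W0 Ωh gradVecL).add_mem hp hq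
    have hb : ∀ r ∈ W0 Ωh gradVecL,
        eLpNorm r.fst 4 (volH Ωh) ^ 2 ≤ ofReal (C * (‖r‖ * ‖r‖)) := fun r hr =>
      (hC r hr).trans (ofReal_le_ofReal (mul_le_mul_of_nonneg_left
        (mul_le_mul (norm_fst_le' r) (norm_snd_le' r) (norm_nonneg _) (norm_nonneg _)) hC0))
    have h1 : ‖tens p - tens q‖ₑ
        ≤ eLpNorm (p - q).fst 4 (volH Ωh) * eLpNorm (p + q).fst 4 (volH Ωh) := by
      rw [Lp.enorm_def]
      refine (eLpNorm_congr_ae ?_).le.trans (eLpNorm_symTens_le (memLp_four_of_mem_W0 hs).1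
        (memLp_four_of_mem_W0 ha).1)
      filter_upwards [coeFn_toL2 (memLp_tens hp), coeFn_toL2 (memLp_tens hq),
        Lp.coeFn_sub (tens p) (tens q), Lp.coeFn_sub p.fst q.fst, Lp.coeFn_add p.fst q.fst]
        with y h1 h2 h3 h4 h5
      have h4' : (p - q).fst y = p.fst y - q.fst y := h4
      have h5' : (p + q).fst y = p.fst y + q.fst y := h5
      rw [h3, Pi.sub_apply, h4', h5', ← symTens_sub, ← h1, ← h2]
      rfl
    have h2 : ‖tens p - tens q‖ₑ ^ 2 ≤ ofReal (C * (‖p - q‖ * ‖p + q‖)) ^ 2 := by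
      calc _ ≤ (eLpNorm (p - q).fst 4 (volH Ωh) * eLpNorm (p + q).fst 4 (volH Ωh)) ^ 2 := by
            gcongr
        _ ≤ ofReal (C * (‖p - q‖ * ‖p - q‖)) * ofReal (C * (‖p + q‖ * ‖p + q‖)) := by
            rw [mul_pow]; exact mul_le_mul' (hb _ hs) (hb _ ha)
        _ = _ := by
            rw [← ENNReal.ofReal_mul (mul_nonneg hC0 (by positivity)), ← ENNReal.ofReal_pow
              (mul_nonneg hC0 (by positivity))]
            congr 1; ring
    have h3 := (ENNReal.pow_le_pow_left_iff two_ne_zero).1 h2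
    rw [← ofReal_norm, ENNReal.ofReal_le_ofReal_iff (mul_nonneg hC0 (by positivity))] at h3
    exact h3

theorem tendsto_tens {p : ℕ → SobPair E2 E22 Ωh} {q : SobPair E2 E22 Ωh}
    (hp : ∀ n, p n ∈ W0 Ωh gradVecL) (hq : q ∈ W0 Ωh gradVecL) (h : Tendsto p atTop (𝓝 q)) :
    Tendsto (fun n => tens (p n)) atTop (𝓝 (tens q)) := by
  obtain ⟨C, -, -, hC⟩ := exists_norm_tens_le (Ωh := Ωh)
  rw [tendsto_iff_norm_sub_tendsto_zero]
  refine squeeze_zero (fun _ => norm_nonneg _) (fun n => hC _ (hp n) _ hq) ?_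
  have h1 := (h.sub_const q).norm.mul (h.add_const q).norm
  have h2 := h1.const_mul C
  simpa using h2

/-- `p ↦ u ⊗ u`, extended to all pairs through the projection on `W^{1,2}_0`. -/
def tensProj (p : SobPair E2 E22 Ωh) : L2GradVel Ωh :=
  haveI : CompleteSpace (W0 Ωh gradVecL) := (isClosed_W0 gradVecL).completeSpace_coe
  tens ((W0 Ωh gradVecL).starProjection p)

theorem tensProj_of_mem {p : SobPair E2 E22 Ωh} (hp : p ∈ W0 Ωh gradVecL) :
    tensProj p = tens p := by
  have : CompleteSpace (W0 Ωh gradVecL) := (isClosed_W0 gradVecL).completeSpace_coe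
  rw [tensProj, Submodule.starProjection_eq_self_iff.2 hp]

theorem continuous_tensProj : Continuous (tensProj (Ωh := Ωh)) := by
  have : CompleteSpace (W0 Ωh gradVecL) := (isClosed_W0 gradVecL).completeSpace_coe
  rw [continuous_iff_seqContinuous]
  intro p q hpq
  exact tendsto_tens (fun n => Submodule.starProjection_apply_mem _ _)
    (Submodule.starProjection_apply_mem _ _)
    (((W0 Ωh gradVecL).starProjection.continuous.tendsto q).comp hpq)

/-- The convective term against a test field. -/
theorem inner_tens_testPair {p : SobPair E2 E22 Ωh} (hp : p ∈ W0 Ωh gradVecL) (φ : 𝓓(Ωh, E2)) :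
    ⟪tens p, (testPair gradVecL φ).snd⟫_ℝ
      = ∫ y in Ωh, ⟪p.fst y, fderiv ℝ φ y (p.fst y)⟫_ℝ := by
  rw [L2.inner_def]
  refine integral_congr_ae ?_
  filter_upwards [coeFn_toL2 (memLp_tens hp), coeFn_toL2 (memLp_grad_testFunction gradVecL φ)]
    with y h1 h2
  rw [← inner_symTens_gradVecL]
  exact congrArg₂ _ h1 h2

/-- The convective term does no work on solenoidal fields. -/
theorem inner_tens_snd_eq_zero {p : SobPair E2 E22 Ωh} (hp : p ∈ Vsol Ωh) :
    ⟪tens p, p.snd⟫_ℝ = 0 := by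
  have htest : ∀ φ ∈ solTest Ωh,
      ⟪tens (testPair gradVecL φ), (testPair gradVecL φ).snd⟫_ℝ = 0 := by
    intro φ hφ
    rw [inner_tens_testPair (testPair_mem_W0 gradVecL φ)]
    have hφ1 := contDiff_testFunction φ 1
    have hη : ContDiff ℝ 1 fun y => ‖φ y‖ ^ 2 := hφ1.norm_sq ℝ
    have hηc : HasCompactSupport fun y => ‖φ y‖ ^ 2 :=
      φ.hasCompactSupport.norm.comp_left (g := fun r : ℝ => r ^ 2) (by norm_num)
    have h1 := integral_fderiv_testFunction hη hηc φ
    have h2 : ∫ y in Ωh, ‖φ y‖ ^ 2 * trL (fderiv ℝ φ y) = 0 := by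
      simp_rw [hφ _]; simp
    rw [h2, neg_zero] at h1
    have h3 : ∀ y, fderiv ℝ (fun y => ‖φ y‖ ^ 2) y (φ y) = 2 * ⟪φ y, fderiv ℝ φ y (φ y)⟫_ℝ := by
      intro y
      rw [((hφ1.differentiable (by norm_num) y).hasFDerivAt.norm_sq).fderiv]
      simp
    simp_rw [h3] at h1
    rw [integral_const_mul] at h1
    have h4 : ∫ y in Ωh, ⟪φ y, fderiv ℝ φ y (φ y)⟫_ℝ = 0 := by linarith
    rw [← h4]
    refine integral_congr_ae ?_
    filter_upwards [coeFn_toL2 (memLp_testFunction φ)] with y hy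
    have hy' : (testPair gradVecL φ).fst y = φ y := hy
    rw [hy']
  obtain ⟨φ, hφ, hlim⟩ : ∃ φ : ℕ → 𝓓(Ωh, E2), (∀ n, φ n ∈ solTest Ωh) ∧
      Tendsto (fun n => testPair gradVecL (φ n)) atTop (𝓝 p) := by
    rw [Vsol, ← SetLike.mem_coe, topologicalClosure_coe] at hp
    obtain ⟨x, hx, hlim⟩ := mem_closure_iff_seq_limit.1 hp
    choose φ h1 h2 using hx
    exact ⟨φ, h1, by simpa [h2] using hlim⟩
  have h1 := tendsto_tens (fun n => testPair_mem_W0 gradVecL (φ n)) (Vsol_le_W0 hp) hlim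
  have h2 := h1.inner (𝕜 := ℝ) (tendsto_toLp_iff.1 hlim).2
  have h3 : Tendsto (fun n => ⟪tens (testPair gradVecL (φ n)), (testPair gradVecL (φ n)).snd⟫_ℝ)
      atTop (𝓝 0) := by
    simp_rw [htest _ (hφ _)]; exact tendsto_const_nhds
  exact tendsto_nhds_unique h2 h3

end Convection

section Pairs

variable {A B : Type*} [NormedAddCommGroup A] [InnerProductSpace ℝ A] [NormedAddCommGroup B]
  [InnerProductSpace ℝ B] {Y : Type*} [MeasurableSpace Y] {m : Measure Y}

theorem memLp_toLp {f : Y → A} {g : Y → B} (hf : MemLp f 2 m) (hg : MemLp g 2 m) :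
    MemLp (fun t => toLp 2 (f t, g t)) 2 m := by
  let e := (WithLp.prodContinuousLinearEquiv 2 ℝ A B).symm.toContinuousLinearMap
  have h := ((e.comp (ContinuousLinearMap.inl ℝ A B)).comp_memLp' hf).add
    ((e.comp (ContinuousLinearMap.inr ℝ A B)).comp_memLp' hg)
  refine h.congr_norm ?_ (ae_of_all _ fun t => ?_)
  · have : (fun t => toLp 2 (f t, g t)) = (fun t => (e.comp (ContinuousLinearMap.inl ℝ A B)) (f t))
      + fun t => (e.comp (ContinuousLinearMap.inr ℝ A B)) (g t) := by
      ext1 t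
      simp only [Pi.add_apply, ContinuousLinearMap.comp_apply, ← map_add]
      simp [e]
    rw [this]
    exact h.1
  · congr 1
    simp only [Pi.add_apply, Function.comp_apply, ContinuousLinearMap.comp_apply, ← map_add]
    simp [e]

theorem inner_toLp_eq (a : A) (b : B) (p : WithLp 2 (A × B)) :
    ⟪toLp 2 (a, b), p⟫_ℝ = ⟪a, p.fst⟫_ℝ + ⟪b, p.snd⟫_ℝ := by
  rw [WithLp.prod_inner_apply]
  rfl

end Pairs

section SolutionBasics

variable {Ωh : Opens E2} {μ κ α : ℝ} {g : X3} {ϑB : X3 → ℝ} {I : Set ℝ}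
  {u : ℝ → L2Vel Ωh} {Du : ℝ → L2GradVel Ωh} {Θ : ℝ → L2Temp Ωh} {DΘ : ℝ → L2GradTemp Ωh}

theorem IsWeakSolution.mono {J : Set ℝ} (h : IsWeakSolution Ωh μ κ α g ϑB I u Du Θ DΘ)
    (hJ : J ⊆ I) : IsWeakSolution Ωh μ κ α g ϑB J u Du Θ DΘ where
  u_weakCont w := (h.u_weakCont w).mono hJ
  Du_memLp a ha b hb := h.Du_memLp a (hJ ha) b (hJ hb)
  u_mem := ae_restrict_of_ae_restrict_of_subset hJ h.u_mem
  u_div t ht := h.u_div t (hJ ht)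
  Θ_cont := h.Θ_cont.mono hJ
  Θ_bdd a ha b hb := h.Θ_bdd a (hJ ha) b (hJ hb)
  DΘ_memLp a ha b hb := h.DΘ_memLp a (hJ ha) b (hJ hb)
  Θ_grad := ae_restrict_of_ae_restrict_of_subset hJ h.Θ_grad
  Θ_bdry := ae_restrict_of_ae_restrict_of_subset hJ h.Θ_bdry
  momentum φ hφ a ha b hb := h.momentum φ hφ a (hJ ha) b (hJ hb)
  heat ψ a ha b hb := h.heat ψ a (hJ ha) b (hJ hb)

variable {T S : ℝ}

local notation "WeakSol" =>
  IsWeakSolution Ωh μ κ α g ϑB (Ici T) u Du Θ DΘ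

theorem IsWeakSolution.ae_mem_Vsol (hΩ : IsBoundedC2 Ωh)
    (h : WeakSol) :
    ∀ᵐ t ∂volume.restrict (Ici T), toLp 2 (u t, Du t) ∈ Vsol Ωh := by
  filter_upwards [h.u_mem, ae_restrict_mem measurableSet_Ici] with t h1 h2
  refine mem_Vsol_of_div_eq_zero hΩ ?_ (fun ψ => h.u_div t h2 ψ)
  exact (mem_W0_iff gradVecL (u t) (Du t)).2 h1

theorem ae_Icc_of_ae_Ici {P : ℝ → Prop} {a b : ℝ} (ha : T ≤ a)
    (h : ∀ᵐ t ∂volume.restrict (Ici T), P t) : ∀ᵐ t ∂volume.restrict (Icc a b), P t :=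
  ae_restrict_of_ae_restrict_of_subset (fun _ ht => mem_Ici.2 (ha.trans ht.1)) h

theorem ae_uIoc_of_ae_Ici {P : ℝ → Prop} {a b : ℝ} (ha : T ≤ a) (hab : a ≤ b)
    (h : ∀ᵐ t ∂volume.restrict (Ici T), P t) : ∀ᵐ t, t ∈ Set.uIoc a b → P t := by
  rw [← ae_restrict_iff' measurableSet_uIoc]
  refine ae_restrict_of_ae_restrict_of_subset (fun t ht => ?_) h
  rw [Set.uIoc_of_le hab] at ht
  exact ha.trans ht.1.le

theorem IsWeakSolution.exists_norm_u_le (h : WeakSol)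
    {a : ℝ} (ha : T ≤ a) (b : ℝ) : ∃ R, 0 ≤ R ∧ ∀ t ∈ Icc a b, ‖u t‖ ≤ R :=
  exists_bound_of_continuousOn_inner isCompact_Icc fun w =>
    (h.u_weakCont w).mono fun _ ht => mem_Ici.2 (ha.trans ht.1)

theorem IsWeakSolution.memLp_u (h : WeakSol)
    {a : ℝ} (ha : T ≤ a) (b : ℝ) (p : ℝ≥0∞) : MemLp u p (volume.restrict (Icc a b)) := by
  obtain ⟨R, -, hR⟩ := h.exists_norm_u_le ha b
  refine MemLp.of_bound (aestronglyMeasurable_of_continuousOn_inner measurableSet_Icc fun w =>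
    (h.u_weakCont w).mono fun _ ht => mem_Ici.2 (ha.trans ht.1)) R ?_
  filter_upwards [ae_restrict_mem measurableSet_Icc] with t ht using hR t ht

theorem IsWeakSolution.memLp_Du (h : WeakSol)
    {a : ℝ} (ha : T ≤ a) (b : ℝ) : MemLp Du 2 (volume.restrict (Icc a b)) := by
  rcases le_or_gt a b with hab | hab
  · exact h.Du_memLp a ha b (ha.trans hab)
  · rw [Set.Icc_eq_empty_of_lt hab]; simp

theorem IsWeakSolution.memLp_DΘ (h : WeakSol)
    {a : ℝ} (ha : T ≤ a) (b : ℝ) : MemLp DΘ 2 (volume.restrict (Icc a b)) := by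
  rcases le_or_gt a b with hab | hab
  · exact h.DΘ_memLp a ha b (ha.trans hab)
  · rw [Set.Icc_eq_empty_of_lt hab]; simp

theorem IsWeakSolution.memLp_Θ (h : WeakSol)
    {a : ℝ} (ha : T ≤ a) (b : ℝ) (p : ℝ≥0∞) : MemLp Θ p (volume.restrict (Icc a b)) := by
  have hc : ContinuousOn Θ (Icc a b) := h.Θ_cont.mono fun _ ht => mem_Ici.2 (ha.trans ht.1)
  obtain ⟨R, hR⟩ := isCompact_Icc.exists_bound_of_continuousOn hc
  refine MemLp.of_bound (hc.aestronglyMeasurable measurableSet_Icc) R ?_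
  filter_upwards [ae_restrict_mem measurableSet_Icc] with t ht using hR t ht

theorem inner_testPair_fst_vel {Ωh : Opens E2} (v : L2Vel Ωh) (φ : 𝓓(Ωh, E2)) :
    ∫ y in Ωh, ⟪v y, φ y⟫_ℝ = ⟪v, (testPair gradVecL φ).fst⟫_ℝ :=
  (inner_toL2_right v (memLp_testFunction φ)).symm

section Momentum

/-- The forces in the momentum equation: body force and stress. -/
def momForce (μ : ℝ) (A : L2Vel Ωh →L[ℝ] L2Temp Ωh) (v : L2Vel Ωh) (D : L2GradVel Ωh)
    (θ : L2Temp Ωh) : SobPair E2 E22 Ωh :=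
  toLp 2 (-(ContinuousLinearMap.adjoint A θ), tensProj (toLp 2 (v, D)) - μ • D)

theorem inner_momForce (μ : ℝ) (A : L2Vel Ωh →L[ℝ] L2Temp Ωh) (v : L2Vel Ωh) (D : L2GradVel Ωh)
    (θ : L2Temp Ωh) (p : SobPair E2 E22 Ωh) : ⟪momForce μ A v D θ, p⟫_ℝ =
      ⟪tensProj (toLp 2 (v, D)), p.snd⟫_ℝ - μ * ⟪D, p.snd⟫_ℝ - ⟪θ, A p.fst⟫_ℝ := by
  rw [momForce, inner_toLp_eq, inner_neg_left, ContinuousLinearMap.adjoint_inner_left,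
    inner_sub_left, real_inner_smul_left]
  ring

/-- The raw momentum form of the weak formulation in operator notation. -/
theorem momentum_form_eq {M : ℝ} (hM : ∀ y ∈ Ωh, ‖gradF g y‖ ≤ M) {v : L2Vel Ωh}
    {D : L2GradVel Ωh} (θ : L2Temp Ωh) (hp : toLp 2 (v, D) ∈ W0 Ωh gradVecL)
    (φ : 𝓓(Ωh, E2)) :
    ∫ y in Ωh, (⟪v y, fderiv ℝ φ y (v y)⟫_ℝ - μ * ⟪D y, gradVec φ y⟫_ℝ
          - vmean θ y * ⟪gradF g y, φ y⟫_ℝ) =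
      ⟪momForce μ (buoyancy g hM) v D θ, testPair gradVecL φ⟫_ℝ := by
  rw [inner_momForce, tensProj_of_mem hp]
  set p : SobPair E2 E22 Ωh := toLp 2 (v, D) with hpdef
  have a1 := coeFn_toL2 (memLp_testFunction (Ω := Ωh) φ)
  have a2 := coeFn_toL2 (memLp_grad_testFunction (Ω := Ωh) gradVecL φ)
  have i1 : Integrable (fun y => ⟪v y, fderiv ℝ φ y (v y)⟫_ℝ) (volH Ωh) := by
    refine (L2.integrable_inner (𝕜 := ℝ) (tens p) (testPair gradVecL φ).snd).congr ?_
    filter_upwards [coeFn_toL2 (memLp_tens hp), a2] with y h1 h2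
    rw [← inner_symTens_gradVecL]
    exact congrArg₂ _ h1 h2
  have e2 : (fun y => ⟪D y, (testPair gradVecL φ).snd y⟫_ℝ) =ᵐ[volH Ωh]
      fun y => ⟪D y, gradVec φ y⟫_ℝ := by
    filter_upwards [a2] with y h2
    exact congrArg _ h2
  have i2 := (L2.integrable_inner (𝕜 := ℝ) D (testPair gradVecL φ).snd).congr e2
  obtain ⟨i3, h3⟩ := inner_buoyancy g hM θ (testPair gradVecL φ).fst
  have e3 : (fun y => vmean θ y * ⟪gradF g y, (testPair gradVecL φ).fst y⟫_ℝ) =ᵐ[volH Ωh]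
      fun y => vmean θ y * ⟪gradF g y, φ y⟫_ℝ := by
    filter_upwards [a1] with y h1
    exact congrArg (fun w => vmean θ y * ⟪gradF g y, w⟫_ℝ) h1
  have i3' := i3.congr e3
  have i12 : Integrable (fun y => ⟪v y, fderiv ℝ φ y (v y)⟫_ℝ - μ * ⟪D y, gradVec φ y⟫_ℝ)
      (volH Ωh) := i1.sub (i2.const_mul μ)
  rw [h3, inner_tens_testPair hp, integral_sub i12 i3',
    integral_sub i1 (i2.const_mul μ), integral_const_mul, integral_congr_ae e3,
    L2.inner_def D, integral_congr_ae e2]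
  rfl

variable (hΩ : IsBoundedC2 Ωh) {M : ℝ} (hM0 : 0 ≤ M) (hM : ∀ y ∈ Ωh, ‖gradF g y‖ ≤ M)
  (h : IsWeakSolution Ωh μ κ α g ϑB (Ici T) u Du Θ DΘ)

include hΩ h in
theorem IsWeakSolution.memLp_momForce (A : L2Vel Ωh →L[ℝ] L2Temp Ωh) {a : ℝ} (ha : T ≤ a) (b : ℝ) :
    MemLp (fun t => momForce μ A (u t) (Du t) (Θ t)) 2 (volume.restrict (Icc a b)) := by
  refine memLp_toLp ?_ ?_
  · exact ((ContinuousLinearMap.adjoint A).comp_memLp' (h.memLp_Θ ha b 2)).neg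
  · refine MemLp.sub ?_ ((h.memLp_Du ha b).const_smul μ)
    obtain ⟨C, hC0, hC, -⟩ := exists_norm_tens_le (Ωh := Ωh)
    obtain ⟨R, hR0, hR⟩ := h.exists_norm_u_le ha b
    have hp := memLp_toLp (h.memLp_u ha b 2) (h.memLp_Du ha b)
    refine (h.memLp_Du ha b).of_le_mul (c := C * R)
      (continuous_tensProj.comp_aestronglyMeasurable hp.1) ?_
    filter_upwards [ae_Icc_of_ae_Ici ha (h.ae_mem_Vsol hΩ), ae_restrict_mem measurableSet_Icc]
      with t ht htI
    rw [tensProj_of_mem (Vsol_le_W0 ht), mul_assoc]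
    refine (hC _ (Vsol_le_W0 ht)).trans (mul_le_mul_of_nonneg_left ?_ hC0)
    exact mul_le_mul_of_nonneg_right (hR t htI) (norm_nonneg _)

theorem intervalIntegrable_of_memLp_Icc {H : Type*} [NormedAddCommGroup H] {f : ℝ → H} {a b : ℝ}
    (hab : a ≤ b) (hf : MemLp f 2 (volume.restrict (Icc a b))) :
    IntervalIntegrable f volume a b :=
  intervalIntegrable_of_Icc hab <| hf.integrable (by norm_num)

include hΩ h in
/-- The momentum equation tested with solenoidal `W^{1,2}_0` fields. -/
theorem IsWeakSolution.vel_increment {p : SobPair E2 E22 Ωh} (hp : p ∈ Vsol Ωh) {a b : ℝ}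
    (ha : T ≤ a) (hab : a ≤ b) :
    ⟪u b - u a, p.fst⟫_ℝ
      = ∫ t in a..b, ⟪momForce μ (buoyancy g hM) (u t) (Du t) (Θ t), p⟫_ℝ := by
  have hint := intervalIntegrable_of_memLp_Icc hab (h.memLp_momForce hΩ (buoyancy g hM) ha b)
  have e : ∀ p : SobPair E2 E22 Ωh,
      ∫ t in a..b, ⟪momForce μ (buoyancy g hM) (u t) (Du t) (Θ t), p⟫_ℝ
        = ⟪∫ t in a..b, momForce μ (buoyancy g hM) (u t) (Du t) (Θ t), p⟫_ℝ := by
    intro p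
    have := (innerSL ℝ p).intervalIntegral_comp_comm hint
    simp only [innerSL_apply_apply] at this
    rw [real_inner_comm, ← this]
    simp_rw [real_inner_comm p]
  refine Vsol_induction (P := fun p => ⟪u b - u a, p.fst⟫_ℝ
      = ∫ t in a..b, ⟪momForce μ (buoyancy g hM) (u t) (Du t) (Θ t), p⟫_ℝ) ?_
    (fun φ hφ => ?_) hp
  · simp_rw [e]
    exact isClosed_eq (continuous_const.inner (WithLp.fstL 2 ℝ _ _).continuous)
      (continuous_const.inner continuous_id)
  have h1 := h.momentum φ hφ a ha b (ha.trans hab) hab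
  rw [inner_testPair_fst_vel, inner_testPair_fst_vel, ← inner_sub_left] at h1
  rw [h1]
  refine intervalIntegral.integral_congr_ae ?_
  filter_upwards [ae_uIoc_of_ae_Ici ha hab (h.ae_mem_Vsol hΩ)] with t ht hti
  exact momentum_form_eq hM (Θ t) (Vsol_le_W0 (ht hti)) φ

theorem half_sq_sub_le {H : Type*} [NormedAddCommGroup H] [InnerProductSpace ℝ H] (x y : H) :
    1 / 2 * ‖x‖ ^ 2 - 1 / 2 * ‖y‖ ^ 2 ≤ ⟪x - y, x⟫_ℝ := by
  have h1 : ‖x - y‖ ^ 2 = ‖x‖ ^ 2 - 2 * ⟪x, y⟫_ℝ + ‖y‖ ^ 2 := norm_sub_sq_real x y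
  have h2 : ⟪x - y, x⟫_ℝ = ‖x‖ ^ 2 - ⟪x, y⟫_ℝ := by
    rw [inner_sub_left, real_inner_self_eq_norm_sq, real_inner_comm y x]
  nlinarith [sq_nonneg ‖x - y‖]

include hΩ h in
/-- The energy inequality for the velocity. -/
theorem IsWeakSolution.vel_energy {s t : ℝ} (hs : T ≤ s) (hst : s ≤ t) :
    1 / 2 * ‖u t‖ ^ 2 - 1 / 2 * ‖u s‖ ^ 2
      ≤ ∫ τ in s..t, (- (μ * ‖Du τ‖ ^ 2) - ⟪Θ τ, buoyancy g hM (u τ)⟫_ℝ) := by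
  have hc : t < t + 1 := by linarith
  have hB := h.memLp_momForce hΩ (buoyancy g hM) hs (t + 1)
  have hW := memLp_toLp (h.memLp_u hs (t + 1) 2) (h.memLp_Du hs (t + 1))
  have hJ : IntegrableOn (fun t => 1 / 2 * ‖u t‖ ^ 2) (Icc s (t + 1)) :=
    ((h.memLp_u hs (t + 1) 2).integrable_norm_pow (by norm_num)).const_mul _
  have key := increment_le_integral (J := fun t => 1 / 2 * ‖u t‖ ^ 2) hB hW hJ ?_ ?_ le_rfl hst hc
  · refine key.trans_eq (intervalIntegral.integral_congr_ae ?_)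
    filter_upwards [ae_uIoc_of_ae_Ici hs hst (h.ae_mem_Vsol hΩ)] with τ hτ hτi
    rw [inner_momForce, tensProj_of_mem (Vsol_le_W0 (hτ hτi))]
    have h0 := inner_tens_snd_eq_zero (hτ hτi)
    have e1 : (toLp 2 (u τ, Du τ) : SobPair E2 E22 Ωh).snd = Du τ := rfl
    have e2 : (toLp 2 (u τ, Du τ) : SobPair E2 E22 Ωh).fst = u τ := rfl
    rw [h0, e1, e2, real_inner_self_eq_norm_sq]
    ring
  · filter_upwards [ae_Icc_of_ae_Ici hs (h.ae_mem_Vsol hΩ)] with r hr q hq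
    rw [← h.vel_increment hΩ hM hr (hs.trans hq.1) hq.2]
    exact half_sq_sub_le _ _
  · intro r hr ε hε
    have hcr : Tendsto (fun q => ⟪u q, u r⟫_ℝ) (𝓝[>] r) (𝓝 ⟪u r, u r⟫_ℝ) :=
      ((h.u_weakCont (u r)) r (hs.trans hr.1)).mono_left
        (nhdsWithin_mono r fun q hq => mem_Ici.2 ((hs.trans hr.1).trans (le_of_lt hq)))
    have hev := hcr.eventually (lt_mem_nhds (show ⟪u r, u r⟫_ℝ - ε < ⟪u r, u r⟫_ℝ by linarith))
    filter_upwards [hev] with q hq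
    have h2 : ‖u q - u r‖ ^ 2 = ‖u q‖ ^ 2 - 2 * ⟪u q, u r⟫_ℝ + ‖u r‖ ^ 2 := norm_sub_sq_real _ _
    rw [real_inner_self_eq_norm_sq] at hq
    nlinarith [sq_nonneg ‖u q - u r‖]

end Momentum

section Subgradient

variable {H K : Type*} [NormedAddCommGroup H] [InnerProductSpace ℝ H]
  [NormedAddCommGroup K] [InnerProductSpace ℝ K] [CompleteSpace K]

/-- Functions with a subgradient of linear growth are continuous. -/
theorem continuous_of_subgradient {J : H → ℝ} {G : H → H} {L : ℝ}
    (hJ : ∀ x y, J x - J y ≤ ⟪x - y, G x⟫_ℝ) (hG : ∀ x, ‖G x‖ ≤ L * (1 + ‖x‖)) :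
    Continuous J := by
  rw [continuous_iff_continuousAt]
  intro x
  have h1 : Tendsto (fun y => ‖x - y‖ * ‖G x‖) (𝓝 x) (𝓝 0) := by
    have : Continuous fun y => ‖x - y‖ * ‖G x‖ := by fun_prop
    simpa using this.tendsto x
  have h2 : Tendsto (fun y => ‖y - x‖ * (L * (1 + ‖y‖))) (𝓝 x) (𝓝 0) := by
    have : Continuous fun y => ‖y - x‖ * (L * (1 + ‖y‖)) := by fun_prop
    simpa using this.tendsto x
  refine tendsto_of_tendsto_of_tendsto_of_le_of_le (g := fun y => J x - ‖x - y‖ * ‖G x‖)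
    (h := fun y => J x + ‖y - x‖ * (L * (1 + ‖y‖)))
    (by simpa using h1.const_sub (J x)) (by simpa using h2.const_add (J x)) (fun y => ?_)
    fun y => ?_
  · have := (hJ x y).trans (real_inner_le_norm _ _)
    simp only; linarith
  · have := ((hJ y x).trans (real_inner_le_norm _ _)).trans
      (mul_le_mul_of_nonneg_left (hG y) (norm_nonneg _))
    simp only; linarith

/-- Energy inequality for a functional with subgradient along a curve with given increments. -/
theorem energy_of_subgradient {J : H → ℝ} {G : H → H} {L : ℝ}
    (hJ : ∀ x y, J x - J y ≤ ⟪x - y, G x⟫_ℝ) (hG : ∀ x, ‖G x‖ ≤ L * (1 + ‖x‖))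
    {v : ℝ → H} {F W : ℝ → K} {a c : ℝ} (hv : ContinuousOn v (Icc a c))
    (hF : MemLp F 2 (volume.restrict (Icc a c)))
    (hW : MemLp W 2 (volume.restrict (Icc a c)))
    (hinc : ∀ᵐ t ∂volume.restrict (Icc a c), ∀ s ∈ Icc a t,
      ⟪v t - v s, G (v t)⟫_ℝ = ∫ τ in s..t, ⟪F τ, W t⟫_ℝ)
    {s t : ℝ} (has : a ≤ s) (hst : s ≤ t) (htc : t < c) :
    J (v t) - J (v s) ≤ ∫ τ in s..t, ⟪F τ, W τ⟫_ℝ := by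
  have hJc := continuous_of_subgradient hJ hG
  refine increment_le_integral (J := fun t => J (v t)) hF hW
    ((hJc.comp_continuousOn hv).integrableOn_compact isCompact_Icc) ?_ ?_ has hst htc
  · filter_upwards [hinc] with t ht s hs
    rw [← ht s hs]
    exact hJ _ _
  · intro r hr ε hε
    have h1 : Tendsto (fun q => J (v q)) (𝓝[>] r) (𝓝 (J (v r))) := by
      have h2 := (hJc.comp_continuousOn hv) r ⟨hr.1, hr.2.le⟩
      refine h2.mono_left ?_
      rw [← nhdsWithin_Ioc_eq_nhdsGT hr.2]
      exact nhdsWithin_mono r fun q hq => ⟨hr.1.trans hq.1.le, hq.2⟩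
    filter_upwards [h1.eventually (lt_mem_nhds (show J (v r) - ε < J (v r) by linarith))] with q hq
    exact hq.le

end Subgradient

section Truncations

/-- Truncation of a number to the interval `[-S, S]`. -/
def clampR (S s : ℝ) : ℝ := max (-S) (min S s)

theorem continuous_clampR (S : ℝ) : Continuous (clampR S) := by unfold clampR; fun_prop

theorem abs_clampR_le {S : ℝ} (hS : 0 ≤ S) (s : ℝ) : |clampR S s| ≤ S := by
  rw [abs_le]
  exact ⟨le_max_left _ _, max_le (by linarith) (min_le_left _ _)⟩

theorem clampR_of_abs_le {S s : ℝ} (h : |s| ≤ S) : clampR S s = s := by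
  rw [abs_le] at h
  rw [clampR, min_eq_right h.2, max_eq_right h.1]

theorem hasDerivAt_primitive {γ : ℝ → ℝ} (hγ : Continuous γ) (s : ℝ) :
    HasDerivAt (fun s => ∫ r in (0 : ℝ)..s, γ r) (γ s) s :=
  intervalIntegral.integral_hasDerivAt_right (hγ.intervalIntegrable _ _)
    (hγ.stronglyMeasurableAtFilter _ _) hγ.continuousAt

theorem primitive_eq_zero {γ : ℝ → ℝ} {K s : ℝ} (h : ∀ r, |r| ≤ K → γ r = 0)
    (hs : |s| ≤ K) : ∫ r in (0 : ℝ)..s, γ r = 0 := by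
  refine (intervalIntegral.integral_congr (g := fun _ => (0 : ℝ)) fun r hr => ?_).trans (by simp)
  refine h r ?_
  rw [Set.mem_uIcc] at hr
  rw [abs_le] at hs ⊢
  rcases hr with hr | hr <;> constructor <;> linarith [hs.1, hs.2]

/-- A convex truncation of the square: `j'' = γ` with `γ` vanishing exactly on `[-K, K]`. -/
structure IsTruncation (K : ℝ) (γ β j : ℝ → ℝ) : Prop where
  cont : Continuous γ
  nonneg : ∀ s, 0 ≤ γ s
  le_one : ∀ s, γ s ≤ 1
  pos : ∀ s, K < |s| → 0 < γ s
  zero : ∀ s, |s| ≤ K → γ s = 0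
  beta : ∀ s, HasDerivAt β (γ s) s
  beta_zero : ∀ s, |s| ≤ K → β s = 0
  deriv : ∀ s, HasDerivAt j (β s) s
  j_zero : ∀ s, |s| ≤ K → j s = 0

theorem exists_isTruncation (K : ℝ) : ∃ γ β j, IsTruncation K γ β j := by
  let γ : ℝ → ℝ := fun s => min 1 (max 0 (|s| - K))
  have hc : Continuous γ := by fun_prop
  have hz : ∀ s, |s| ≤ K → γ s = 0 := fun s hs => by
    simp only [γ]
    rw [max_eq_left (by linarith), min_eq_right zero_le_one]
  let β : ℝ → ℝ := fun s => ∫ r in (0 : ℝ)..s, γ r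
  have hβ : ∀ s, HasDerivAt β (γ s) s := hasDerivAt_primitive hc
  have hβc : Continuous β := continuous_iff_continuousAt.2 fun s => (hβ s).continuousAt
  have hβz : ∀ s, |s| ≤ K → β s = 0 := fun s hs => primitive_eq_zero hz hs
  refine ⟨γ, β, fun s => ∫ r in (0 : ℝ)..s, β r, hc, fun s => ?_, fun s => min_le_left _ _,
    fun s hs => ?_, hz, hβ, hβz, hasDerivAt_primitive hβc, fun s hs => primitive_eq_zero hβz hs⟩
  · exact le_min zero_le_one (le_max_left _ _)
  · exact lt_min one_pos (lt_max_of_lt_right (by linarith))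

namespace IsTruncation

variable {K : ℝ} {γ β j : ℝ → ℝ}

theorem monotone_beta (h : IsTruncation K γ β j) : Monotone β :=
  monotone_of_deriv_nonneg (fun s => (h.beta s).differentiableAt) fun s => by
    rw [(h.beta s).deriv]; exact h.nonneg s

theorem abs_le_one (h : IsTruncation K γ β j) (s : ℝ) : |γ s| ≤ 1 := by
  rw [abs_of_nonneg (h.nonneg s)]; exact h.le_one s

theorem lipschitz_beta (h : IsTruncation K γ β j) : LipschitzWith 1 β :=
  lipschitzWith_of_hasDerivAt h.beta fun s => by simpa using h.abs_le_one s

theorem sub_le (h : IsTruncation K γ β j) (b a : ℝ) : j b - j a ≤ (b - a) * β b := by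
  have hc : Continuous j := continuous_iff_continuousAt.2 fun s => (h.deriv s).continuousAt
  rcases lt_trichotomy a b with hab | hab | hab
  · obtain ⟨c, hc1, hc2⟩ := exists_hasDerivAt_eq_slope j β hab hc.continuousOn
      fun x _ => h.deriv x
    rw [eq_div_iff (by linarith)] at hc2
    have := h.monotone_beta hc1.2.le
    nlinarith
  · simp [hab]
  · obtain ⟨c, hc1, hc2⟩ := exists_hasDerivAt_eq_slope j β hab hc.continuousOn
      fun x _ => h.deriv x
    rw [eq_div_iff (by linarith)] at hc2
    have := h.monotone_beta hc1.1.le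
    nlinarith

theorem j_nonneg (hK : 0 ≤ K) (h : IsTruncation K γ β j) (s : ℝ) : 0 ≤ j s := by
  have := h.sub_le 0 s
  rw [h.beta_zero 0 (by simpa), h.j_zero 0 (by simpa)] at this
  linarith

theorem j_le (hK : 0 ≤ K) (h : IsTruncation K γ β j) (s : ℝ) : j s ≤ s * β s := by
  have := h.sub_le s 0
  rw [h.j_zero 0 (by simpa)] at this
  linarith

theorem abs_beta_le (hK : 0 ≤ K) (h : IsTruncation K γ β j) (s : ℝ) : |β s| ≤ |s| := by
  have := h.lipschitz_beta.dist_le_mul s 0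
  rw [h.beta_zero 0 (by simpa)] at this
  simpa using this

theorem beta_pos (h : IsTruncation K γ β j) (hK : 0 ≤ K) {s : ℝ} (hs : K < s) : 0 < β s := by
  have hc : Continuous β := continuous_iff_continuousAt.2 fun s => (h.beta s).continuousAt
  obtain ⟨c, hc1, hc2⟩ := exists_hasDerivAt_eq_slope β γ hs hc.continuousOn fun x _ => h.beta x
  rw [eq_div_iff (by linarith), h.beta_zero K (by rw [abs_of_nonneg hK])] at hc2
  have h1 : 0 < γ c := h.pos c (by rw [abs_of_nonneg (hK.trans hc1.1.le)]; exact hc1.1)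
  nlinarith

theorem beta_neg (h : IsTruncation K γ β j) (hK : 0 ≤ K) {s : ℝ} (hs : s < -K) : β s < 0 := by
  have hc : Continuous β := continuous_iff_continuousAt.2 fun s => (h.beta s).continuousAt
  obtain ⟨c, hc1, hc2⟩ := exists_hasDerivAt_eq_slope β γ hs hc.continuousOn fun x _ => h.beta x
  rw [eq_div_iff (by linarith), h.beta_zero (-K) (by rw [abs_neg, abs_of_nonneg hK])] at hc2
  have h1 : 0 < γ c := h.pos c (by rw [abs_of_nonpos (by linarith [hc1.2])]; linarith [hc1.2])
  nlinarith

/-- The excess over the truncation level is controlled by the truncation. -/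
theorem exists_excess_le (h : IsTruncation K γ β j) (hK : 0 ≤ K) {ρ : ℝ} (hρ : 0 < ρ) :
    ∃ C, 0 ≤ C ∧ ∀ s, |s| - K - ρ ≤ C * j s := by
  have h1 := h.beta_pos hK (s := K + ρ) (by linarith)
  have h2 := h.beta_neg hK (s := -(K + ρ)) (by linarith)
  refine ⟨(β (K + ρ))⁻¹ + (-β (-(K + ρ)))⁻¹, by
    have := inv_pos.2 h1; have := inv_pos.2 (neg_pos.2 h2); linarith, fun s => ?_⟩
  have hj := h.j_nonneg hK
  have b1 : s - K - ρ ≤ (β (K + ρ))⁻¹ * j s := by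
    rw [inv_mul_eq_div, le_div_iff₀ h1]
    have := h.sub_le (K + ρ) s
    nlinarith [hj (K + ρ)]
  have b2 : -s - K - ρ ≤ (-β (-(K + ρ)))⁻¹ * j s := by
    rw [inv_mul_eq_div, le_div_iff₀ (neg_pos.2 h2)]
    have := h.sub_le (-(K + ρ)) s
    nlinarith [hj (-(K + ρ))]
  have c1 : 0 ≤ (β (K + ρ))⁻¹ * j s := mul_nonneg (inv_pos.2 h1).le (hj s)
  have c2 : 0 ≤ (-β (-(K + ρ)))⁻¹ * j s := mul_nonneg (inv_pos.2 (neg_pos.2 h2)).le (hj s)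
  rw [add_mul]
  rcases abs_cases s with ⟨hs, -⟩ | ⟨hs, -⟩ <;> rw [hs] <;> linarith

theorem abs_le_of_j_eq_zero (h : IsTruncation K γ β j) (hK : 0 ≤ K) {s : ℝ} (hs : j s ≤ 0) :
    |s| ≤ K := by
  by_contra! hlt
  obtain ⟨C, hC, hb⟩ := h.exists_excess_le hK (ρ := (|s| - K) / 2) (by linarith)
  have := hb s
  nlinarith

end IsTruncation

end Truncations

section TruncatedEnergy

variable {Y : Type*} [MeasurableSpace Y] {m : Measure Y} [IsFiniteMeasure m]
  {K : ℝ} {γ β j : ℝ → ℝ}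

/-- The functional `∫ j(θ)`. -/
def truncInt (m : Measure Y) (j : ℝ → ℝ) (θ : Lp ℝ 2 m) : ℝ := ∫ x, j (θ x) ∂m

theorem integrable_trunc (h : IsTruncation K γ β j) (hK : 0 ≤ K) (θ : Lp ℝ 2 m) :
    Integrable (fun x => j (θ x)) m := by
  have hc : Continuous j := continuous_iff_continuousAt.2 fun s => (h.deriv s).continuousAt
  refine (integrable_norm_sq θ).mono' (hc.comp_aestronglyMeasurable (Lp.aestronglyMeasurable θ))
    (ae_of_all _ fun x => ?_)
  rw [norm_of_nonneg (h.j_nonneg hK _), norm_eq_abs]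
  refine (h.j_le hK _).trans ((le_abs_self _).trans ?_)
  rw [abs_mul, sq]
  exact mul_le_mul_of_nonneg_left (h.abs_beta_le hK _) (abs_nonneg _)

theorem memLp_beta (h : IsTruncation K γ β j) (θ : Lp ℝ 2 m) :
    MemLp (fun x => β (θ x)) 2 m := memLp_comp_lipschitz h.lipschitz_beta θ

theorem truncInt_sub_le (h : IsTruncation K γ β j) (hK : 0 ≤ K) (θ θ' : Lp ℝ 2 m) :
    truncInt m j θ - truncInt m j θ' ≤ ⟪θ - θ', toL2 m fun x => β (θ x)⟫_ℝ := by
  rw [truncInt, truncInt, ← integral_sub (integrable_trunc h hK θ) (integrable_trunc h hK θ'),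
    L2.inner_def]
  refine integral_mono_ae ((integrable_trunc h hK θ).sub (integrable_trunc h hK θ'))
    (L2.integrable_inner (𝕜 := ℝ) _ _) ?_
  filter_upwards [Lp.coeFn_sub θ θ', coeFn_toL2 (memLp_beta h θ)] with x h1 h2
  rw [h1, h2]
  simpa [mul_comm] using h.sub_le (θ x) (θ' x)

theorem norm_toL2_beta_le (h : IsTruncation K γ β j) (hK : 0 ≤ K) (θ : Lp ℝ 2 m) :
    ‖toL2 m fun x => β (θ x)‖ ≤ 1 * (1 + ‖θ‖) := by
  refine (Lp.norm_le_norm_of_ae_le (g := θ) ?_).trans (by linarith)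
  filter_upwards [coeFn_toL2 (memLp_beta h θ)] with x hx
  rw [hx]
  exact h.abs_beta_le hK _

theorem truncInt_nonneg (h : IsTruncation K γ β j) (hK : 0 ≤ K) (θ : Lp ℝ 2 m) :
    0 ≤ truncInt m j θ := integral_nonneg fun _ => h.j_nonneg hK _

end TruncatedEnergy

theorem aestronglyMeasurable_comp₂ {A B C Y : Type*} [TopologicalSpace A] [TopologicalSpace B] [TopologicalSpace C]
    [MeasurableSpace Y] {ν : Measure Y} {F : A → B → C} (hF : Continuous fun q : A × B => F q.1 q.2)
    {f : Y → A} {D : Y → B} (hf : AEStronglyMeasurable f ν) (hD : AEStronglyMeasurable D ν) :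
    AEStronglyMeasurable (fun t => F (f t) (D t)) ν := hF.comp_aestronglyMeasurable (hf.prodMk hD)

theorem aestronglyMeasurable_nem {X E Y : Type*} [MeasurableSpace X] {m : Measure X}
    [NormedAddCommGroup E] [InnerProductSpace ℝ E] [MeasurableSpace Y] {ν : Measure Y} {γ : ℝ → ℝ}
    {M : ℝ} (hγ : Continuous γ) (hM : ∀ s, |γ s| ≤ M) {f : Y → Lp ℝ 2 m} {D : Y → Lp E 2 m}
    (hf : AEStronglyMeasurable f ν) (hD : AEStronglyMeasurable D ν) :
    AEStronglyMeasurable (fun t => nem γ (f t) (D t)) ν := by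
  have h1 := continuous_nem (μ := m) (E := E) hγ hM
  exact aestronglyMeasurable_comp₂ (F := fun (q : Lp ℝ 2 m) (q' : Lp E 2 m) => nem γ q q') h1 hf hD

/-- The constant function `1` on the cylinder. -/
def oneT (Ωh : Opens E2) : L2Temp Ωh := toL2 (vol3 Ωh) fun _ => (1 : ℝ)

/-- The mean value over the cylinder. -/
def meanT (θ : L2Temp Ωh) : ℝ := ⨍ z in (cyl Ωh : Set X3), θ z

theorem isBounded_cyl (hb : IsBounded (Ωh : Set E2)) :
    IsBounded (cyl Ωh : Set X3) := hb.prod (Metric.isBounded_Ioo 0 1)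

theorem isFiniteMeasure_vol3 (hb : IsBounded (Ωh : Set E2)) :
    IsFiniteMeasure (vol3 Ωh) := isFiniteMeasure_volOn (isBounded_cyl hb)

/-- The volume of the cylinder. -/
abbrev volC (Ωh : Opens E2) : ℝ := (vol3 Ωh).real Set.univ

theorem inner_oneT [IsFiniteMeasure (vol3 Ωh)] (θ : L2Temp Ωh) :
    ⟪oneT Ωh, θ⟫_ℝ = ∫ x in cyl Ωh, θ x := by
  rw [L2.inner_def]
  refine integral_congr_ae ?_
  filter_upwards [coeFn_toL2 (memLp_const (μ := vol3 Ωh) (p := 2) (1 : ℝ))] with x hx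
  rw [oneT, hx]; simp

theorem meanT_eq [IsFiniteMeasure (vol3 Ωh)] (θ : L2Temp Ωh) :
    meanT θ = (volC Ωh)⁻¹ * ⟪oneT Ωh, θ⟫_ℝ := by
  rw [inner_oneT, meanT, average_eq]; rfl

theorem abs_meanT_le_of_integral [IsFiniteMeasure (vol3 Ωh)] {θ : L2Temp Ωh} {K e : ℝ}
    (hK : 0 ≤ K)
    (h : ∫ x in cyl Ωh, |θ x| ≤ K * volC Ωh + e) : |meanT θ| ≤ K + (volC Ωh)⁻¹ * e := by
  have h1 : |∫ x in cyl Ωh, θ x| ≤ ∫ x in cyl Ωh, |θ x| := abs_integral_le_integral_abs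
  rw [meanT_eq, inner_oneT, abs_mul, abs_of_nonneg (by positivity)]
  have hV : 0 ≤ volC Ωh := measureReal_nonneg
  rcases hV.eq_or_lt with h0 | h0
  · rw [← h0]; simpa using hK
  · calc (volC Ωh)⁻¹ * |∫ x in cyl Ωh, θ x| ≤ (volC Ωh)⁻¹ * (K * volC Ωh + e) :=
          mul_le_mul_of_nonneg_left (h1.trans h) (by positivity)
      _ = K + (volC Ωh)⁻¹ * e := by field_simp

theorem integrable_temp [IsFiniteMeasure (vol3 Ωh)] (θ : L2Temp Ωh) :
    Integrable θ (vol3 Ωh) := (Lp.memLp θ).integrable (by norm_num)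

theorem abs_meanT_le [IsFiniteMeasure (vol3 Ωh)] {θ : L2Temp Ωh} {S : ℝ} (hS : 0 ≤ S)
    (h : ∀ᵐ x ∂vol3 Ωh, |θ x| ≤ S) : |meanT θ| ≤ S := by
  have h1 : ∫ x in cyl Ωh, |θ x| ≤ S * volC Ωh + 0 := by
    calc ∫ x in cyl Ωh, |θ x| ≤ ∫ _, S ∂vol3 Ωh :=
          integral_mono_ae (integrable_temp θ).abs (integrable_const _) h
      _ = S * volC Ωh + 0 := by simp [volC, mul_comm]
  simpa using abs_meanT_le_of_integral hS h1

theorem norm_sq_le_of_bdd [IsFiniteMeasure (vol3 Ωh)] {θ : L2Temp Ωh} {S : ℝ}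
    (h : ∀ᵐ x ∂vol3 Ωh, |θ x| ≤ S) : ‖θ‖ ^ 2 ≤ S ^ 2 * volC Ωh := by
  rw [norm_sq_eq_integral]
  calc ∫ x in cyl Ωh, ‖θ x‖ ^ 2 ≤ ∫ _, S ^ 2 ∂vol3 Ωh := by
        refine integral_mono_ae (integrable_norm_sq _) (integrable_const _) ?_
        filter_upwards [h] with x hx
        exact pow_le_pow_left₀ (norm_nonneg _) hx 2
    _ = S ^ 2 * volC Ωh := by simp [volC, mul_comm]

theorem ae_abs_le_of_eLpNorm_le {θ : L2Temp Ωh} {C : ℝ}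
    (h : eLpNorm θ ∞ (vol3 Ωh) ≤ ofReal C) : ∀ᵐ x ∂vol3 Ωh, |θ x| ≤ max C 0 := by
  rw [eLpNorm_exponent_top] at h
  filter_upwards [ae_le_eLpNormEssSup (f := θ) (μ := vol3 Ωh)] with x hx
  have h1 := hx.trans h
  rw [← ofReal_norm, norm_eq_abs] at h1
  exact (ENNReal.ofReal_le_ofReal_iff (le_max_right _ _)).1
    (h1.trans (ofReal_le_ofReal (le_max_left _ _)))

theorem eLpNorm_le_of_ae_abs_le {θ : L2Temp Ωh} {C : ℝ}
    (h : ∀ᵐ x ∂vol3 Ωh, |θ x| ≤ C) : eLpNorm θ ∞ (vol3 Ωh) ≤ ofReal C := by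
  rw [eLpNorm_exponent_top]
  exact eLpNormEssSup_le_of_ae_bound h

theorem isClosed_bdd (S : ℝ) : IsClosed {θ : L2Temp Ωh | ∀ᵐ x ∂vol3 Ωh, |θ x| ≤ S} := by
  refine isClosed_of_closure_subset fun θ hθ => ?_
  obtain ⟨f, hf, hlim⟩ := mem_closure_iff_seq_limit.1 hθ
  obtain ⟨k, -, hk⟩ := exists_subseq_tendsto_ae hlim
  have h1 : ∀ᵐ x ∂vol3 Ωh, ∀ n, |f n x| ≤ S := ae_all_iff.2 hf
  show ∀ᵐ x ∂vol3 Ωh, |θ x| ≤ S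
  filter_upwards [hk, h1] with x hx h2
  exact le_of_tendsto' hx.abs fun n => h2 _

/-- The flux in the heat equation, with truncated transported temperature. -/
def tempForce (S κ : ℝ) (v : L2Vel Ωh) (θ : L2Temp Ωh) (D : L2GradTemp Ωh) : L2GradTemp Ωh :=
  nem (clampR S) θ (lift Ωh v) - κ • D

theorem heat_form_eq {S κ : ℝ} (hS : 0 ≤ S) (v : L2Vel Ωh) {θ : L2Temp Ωh}
    (hθ : ∀ᵐ x ∂vol3 Ωh, |θ x| ≤ S) (D : L2GradTemp Ωh) (ψ : 𝓓(cyl Ωh, ℝ)) :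
    ∫ x in cyl Ωh, (θ x * fderiv ℝ ψ x (v x.1, 0) - κ * ⟪D x, gradScal ψ x⟫_ℝ)
      = ⟪tempForce S κ v θ D, (testPair gradScalL ψ).snd⟫_ℝ := by
  rw [tempForce, inner_sub_left, real_inner_smul_left, L2.inner_def, L2.inner_def,
    ← integral_const_mul, ← integral_sub (L2.integrable_inner (𝕜 := ℝ) _ _)
      ((L2.integrable_inner (𝕜 := ℝ) _ _).const_mul κ)]
  refine integral_congr_ae ?_
  filter_upwards [hθ, coeFn_toL2 (memLp_grad_testFunction (Ω := cyl Ωh) gradScalL ψ), coeFn_lift v,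
    coeFn_nem (continuous_clampR S) (abs_clampR_le hS) θ (lift Ωh v)] with x h1 h2 h3 h4
  have h2' : (testPair gradScalL ψ).snd x = gradScalL (fderiv ℝ ψ x) := h2
  rw [h4, h3, h2', clampR_of_abs_le h1, real_inner_smul_left, inner_embH_gradScalL]
  rfl

/-- The quadratic functional adapted to the nonlocal boundary condition. -/
def quadJ (α : ℝ) (b θ : L2Temp Ωh) : ℝ :=
  1 / 2 * ‖θ‖ ^ 2 + 1 / 2 * (α * (volC Ωh)⁻¹) * ⟪oneT Ωh, θ⟫_ℝ ^ 2 - ⟪b, θ⟫_ℝ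

/-- The gradient of `quadJ`. -/
def quadG (α : ℝ) (b θ : L2Temp Ωh) : L2Temp Ωh :=
  θ + (α * (volC Ωh)⁻¹ * ⟪oneT Ωh, θ⟫_ℝ) • oneT Ωh - b

theorem quadJ_sub_le {α : ℝ} (hα : 0 ≤ α) (b x y : L2Temp Ωh) :
    quadJ α b x - quadJ α b y ≤ ⟪x - y, quadG α b x⟫_ℝ := by
  have h1 := half_sq_sub_le x y
  have hk : 0 ≤ α * (volC Ωh)⁻¹ := mul_nonneg hα (inv_nonneg.2 measureReal_nonneg)
  set k := α * (volC Ωh)⁻¹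
  rw [quadG, inner_sub_right, inner_add_right, real_inner_smul_right, inner_sub_left x y (oneT Ωh),
    inner_sub_left x y b, real_inner_comm (oneT Ωh) x, real_inner_comm (oneT Ωh) y,
    real_inner_comm b x, real_inner_comm b y, quadJ, quadJ]
  nlinarith [mul_nonneg hk (sq_nonneg (⟪oneT Ωh, x⟫_ℝ - ⟪oneT Ωh, y⟫_ℝ))]

theorem exists_norm_quadG_le (α : ℝ) (b : L2Temp Ωh) :
    ∃ L, ∀ x, ‖quadG α b x‖ ≤ L * (1 + ‖x‖) := by
  generalize hk : α * (volC Ωh)⁻¹ = k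
  refine ⟨1 + |k| * ‖oneT Ωh‖ ^ 2 + ‖b‖, fun x => ?_⟩
  have h0 : ‖(k * ⟪oneT Ωh, x⟫_ℝ) • oneT Ωh‖ ≤ |k| * (‖oneT Ωh‖ * ‖x‖) * ‖oneT Ωh‖ := by
    rw [norm_smul, norm_eq_abs, abs_mul]
    gcongr
    exact abs_real_inner_le_norm _ _
  have h1 : ‖quadG α b x‖ ≤ ‖x‖ + ‖(k * ⟪oneT Ωh, x⟫_ℝ) • oneT Ωh‖ + ‖b‖ := by
    rw [quadG, hk]
    refine (norm_sub_le (x + (k * ⟪oneT Ωh, x⟫_ℝ) • oneT Ωh) b).trans ?_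
    gcongr
    exact norm_add_le x _
  have h2 : 0 ≤ |k| * ‖oneT Ωh‖ ^ 2 := by positivity
  generalize |k| = k' at *
  generalize ‖oneT Ωh‖ = o at *
  have := norm_nonneg x
  have := norm_nonneg b
  generalize ‖x‖ = y at *
  generalize ‖b‖ = z at *
  nlinarith

theorem inner_testPair_fst_temp {Ωh : Opens E2} (θ : L2Temp Ωh) (ψ : 𝓓(cyl Ωh, ℝ)) :
    ∫ x in cyl Ωh, θ x * ψ x = ⟪θ, (testPair gradScalL ψ).fst⟫_ℝ := by
  refine Eq.trans ?_ (inner_toL2_right θ (memLp_testFunction ψ)).symm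
  simp [mul_comm]

theorem IsWeakSolution.memLp_tempForce (h : WeakSol)
    (hS : 0 ≤ S) {a : ℝ} (ha : T ≤ a) (b : ℝ) :
    MemLp (fun t => tempForce S κ (u t) (Θ t) (DΘ t)) 2 (volume.restrict (Icc a b)) := by
  have hm : AEStronglyMeasurable (fun t => nem (clampR S) (Θ t) (lift Ωh (u t)))
      (volume.restrict (Icc a b)) := by
    have h1 : AEStronglyMeasurable (fun t => lift Ωh (u t)) (volume.restrict (Icc a b)) :=
      (lift Ωh).continuous.comp_aestronglyMeasurable (h.memLp_u ha b 2).1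
    exact aestronglyMeasurable_nem (continuous_clampR S) (abs_clampR_le hS)
      (h.memLp_Θ ha b 2).1 h1
  have hn : MemLp (fun t => nem (clampR S) (Θ t) (lift Ωh (u t))) 2
      (volume.restrict (Icc a b)) := by
    refine (h.memLp_u ha b 2).of_le_mul (c := S) hm (ae_of_all _ fun t => ?_)
    exact (norm_nem_le (continuous_clampR S) (abs_clampR_le hS) _ _).trans
      (mul_le_mul_of_nonneg_left (norm_lift_le _) hS)
  exact hn.sub ((h.memLp_DΘ ha b).const_smul κ)

/-- The heat equation tested with `W^{1,2}_0` functions. -/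
theorem IsWeakSolution.temp_increment (h : WeakSol)
    (hS : 0 ≤ S) {q : SobPair ℝ E3 (cyl Ωh)} (hq : q ∈ W0 (cyl Ωh) gradScalL) {a b : ℝ}
    (ha : T ≤ a) (hab : a ≤ b) (hbd : ∀ t ∈ Icc a b, ∀ᵐ x ∂vol3 Ωh, |Θ t x| ≤ S) :
    ⟪Θ b - Θ a, q.fst⟫_ℝ = ∫ t in a..b, ⟪tempForce S κ (u t) (Θ t) (DΘ t), q.snd⟫_ℝ := by
  have hint := intervalIntegrable_of_memLp_Icc hab (h.memLp_tempForce hS ha b)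
  have e : ∀ q : SobPair ℝ E3 (cyl Ωh),
      ∫ t in a..b, ⟪tempForce S κ (u t) (Θ t) (DΘ t), q.snd⟫_ℝ
        = ⟪∫ t in a..b, tempForce S κ (u t) (Θ t) (DΘ t), q.snd⟫_ℝ := by
    intro q
    have := (innerSL ℝ q.snd).intervalIntegral_comp_comm hint
    simp only [innerSL_apply_apply] at this
    rw [real_inner_comm, ← this]
    simp_rw [real_inner_comm q.snd]
  refine W0_induction gradScalL (P := fun q => ⟪Θ b - Θ a, q.fst⟫_ℝ
      = ∫ t in a..b, ⟪tempForce S κ (u t) (Θ t) (DΘ t), q.snd⟫_ℝ) ?_ (fun ψ => ?_) hq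
  · simp_rw [e]
    exact isClosed_eq (continuous_const.inner (WithLp.fstL 2 ℝ _ _).continuous)
      (continuous_const.inner (WithLp.sndL 2 ℝ _ _).continuous)
  have h1 := h.heat ψ a ha b (ha.trans hab) hab
  rw [inner_testPair_fst_temp, inner_testPair_fst_temp, ← inner_sub_left] at h1
  rw [h1]
  refine intervalIntegral.integral_congr fun t ht => ?_
  rw [Set.uIcc_of_le hab] at ht
  exact heat_form_eq hS (u t) (hbd t ht) (DΘ t) ψ

/-- The boundary condition for the temperature as membership in `W^{1,2}_0`. -/
theorem IsWeakSolution.ae_mem_W0 [IsFiniteMeasure (vol3 Ωh)]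
    (hb : IsBounded (Ωh : Set E2)) (hϑ : ContDiff ℝ 2 ϑB) {I : Set ℝ}
    (h : IsWeakSolution Ωh μ κ α g ϑB I u Du Θ DΘ) :
    ∀ᵐ t ∂volume.restrict I,
      toLp 2 (Θ t - toL2 (vol3 Ωh) (fun x => ϑB x - α * meanT (Θ t)),
        DΘ t - toL2 (vol3 Ωh) fun x =>
          gradScalL (fderiv ℝ (fun x => ϑB x - α * meanT (Θ t)) x)) ∈ W0 (cyl Ωh) gradScalL := by
  filter_upwards [h.Θ_bdry] with t ht
  obtain ⟨φ, h1, h2⟩ := ht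
  have hc : Continuous fun x => ϑB x - α * meanT (Θ t) := hϑ.continuous.sub continuous_const
  have hg : Continuous fun x => gradScalL (fderiv ℝ (fun x => ϑB x - α * meanT (Θ t)) x) := by
    simp only [fderiv_sub_const]
    exact gradScalL.continuous.comp (hϑ.continuous_fderiv (by norm_num))
  have m1 := coeFn_toL2 (continuous_memLp_volOn (isBounded_cyl hb) hc 2)
  have m2 := coeFn_toL2 (continuous_memLp_volOn (isBounded_cyl hb) hg 2)
  refine (mem_W0_iff gradScalL _ _).2 ⟨φ, ?_, ?_⟩
  · refine h1.congr fun k => eLpNorm_congr_ae ?_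
    filter_upwards [Lp.coeFn_sub (Θ t) (toL2 (vol3 Ωh) (fun x => ϑB x - α * meanT (Θ t))), m1]
      with x e1 e2
    rw [e1, Pi.sub_apply, e2]
    rfl
  · refine h2.congr fun k => eLpNorm_congr_ae ?_
    filter_upwards [Lp.coeFn_sub (DΘ t) (toL2 (vol3 Ωh) fun x =>
          gradScalL (fderiv ℝ (fun x => ϑB x - α * meanT (Θ t)) x)), m2] with x e1 e2
    rw [e1, Pi.sub_apply, e2, fderiv_sub_const]
    rfl

/-- Energy inequality for convex functionals of the temperature. -/
theorem IsWeakSolution.temp_energy (h : WeakSol)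
    (hS : 0 ≤ S) {J : L2Temp Ωh → ℝ} {G : L2Temp Ωh → L2Temp Ωh} {L : ℝ}
    (hJ : ∀ x y, J x - J y ≤ ⟪x - y, G x⟫_ℝ) (hG : ∀ x, ‖G x‖ ≤ L * (1 + ‖x‖))
    {W : ℝ → L2GradTemp Ωh} {a c : ℝ} (ha : T ≤ a)
    (hbd : ∀ t ∈ Icc a c, ∀ᵐ x ∂vol3 Ωh, |Θ t x| ≤ S)
    (hW : MemLp W 2 (volume.restrict (Icc a c)))
    (hGW : ∀ᵐ t ∂volume.restrict (Icc a c), toLp 2 (G (Θ t), W t) ∈ W0 (cyl Ωh) gradScalL)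
    {s t : ℝ} (has : a ≤ s) (hst : s ≤ t) (htc : t < c) :
    J (Θ t) - J (Θ s) ≤ ∫ τ in s..t, ⟪tempForce S κ (u τ) (Θ τ) (DΘ τ), W τ⟫_ℝ := by
  refine energy_of_subgradient hJ hG (h.Θ_cont.mono fun _ ht => mem_Ici.2 (ha.trans ht.1))
    (h.memLp_tempForce hS ha c) hW ?_ has hst htc
  filter_upwards [hGW, ae_restrict_mem measurableSet_Icc] with r hr hrc q hq
  exact h.temp_increment hS hr (ha.trans hq.1) hq.2 fun τ hτ =>
    hbd τ ⟨hq.1.trans hτ.1, hτ.2.trans hrc.2⟩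

section TruncatedDecay

variable {K MB m0 : ℝ} {γ β j : ℝ → ℝ}

/-- Functions of the temperature that vanish on its boundary values. -/
theorem IsWeakSolution.ae_chain_mem_W0 [IsFiniteMeasure (vol3 Ωh)]
    (hb : IsBounded (Ωh : Set E2)) (hϑ : ContDiff ℝ 2 ϑB)
    (hMB : ∀ x ∈ frontier (cyl Ωh : Set X3), |ϑB x| ≤ MB) (hα : 0 ≤ α) (hK : MB + α * m0 < K)
    {I : Set ℝ} (h : IsWeakSolution Ωh μ κ α g ϑB I u Du Θ DΘ) :
    ∀ᵐ t ∂volume.restrict I, |meanT (Θ t)| ≤ m0 → ∀ {Γ γ : ℝ → ℝ} {M : ℝ≥0},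
      (∀ s, HasDerivAt Γ (γ s) s) → Continuous γ → (∀ s, |γ s| ≤ M) →
      (∀ s, |s| ≤ K → Γ s = 0) →
      toLp 2 (toL2 (vol3 Ωh) fun x => Γ (Θ t x), nem γ (Θ t) (DΘ t))
        ∈ W0 (cyl Ωh) gradScalL := by
  filter_upwards [h.ae_mem_W0 hb hϑ] with t ht hm Γ γ M hΓ hγ hM hz
  have hc : Continuous fun x => ϑB x - α * meanT (Θ t) := hϑ.continuous.sub continuous_const
  refine chain_rule_mem_W0 gradScalL (isBounded_cyl hb)
    (b := fun x => ϑB x - α * meanT (Θ t)) ((hϑ.of_le (by norm_num)).sub contDiff_const) hΓ hγ hM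
    (C := closure (cyl Ωh : Set X3) ∩ {x | K ≤ |ϑB x - α * meanT (Θ t)|})
    ((isBounded_cyl hb).isCompact_closure.inter_right (isClosed_le continuous_const hc.abs)) ?_ ?_ ht
  · rintro x ⟨hx1, hx2⟩
    by_contra hx
    have hfr : x ∈ frontier (cyl Ωh : Set X3) := by
      rw [frontier, (cyl Ωh).isOpen.interior_eq]
      exact ⟨hx1, hx⟩
    have h1 : |ϑB x - α * meanT (Θ t)| ≤ MB + α * m0 := by
      refine (abs_sub _ _).trans (add_le_add (hMB x hfr) ?_)
      rw [abs_mul, abs_of_nonneg hα]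
      exact mul_le_mul_of_nonneg_left hm hα
    have h2 : K ≤ |ϑB x - α * meanT (Θ t)| := hx2
    linarith
  · intro x hx hxC
    refine hz _ ?_
    by_contra hlt
    exact hxC ⟨subset_closure hx, (not_le.1 hlt).le⟩

/-- Exchange of a bounded factor in an inner product. -/
theorem inner_nem_nem {Y E : Type*} [MeasurableSpace Y] {m : Measure Y} [NormedAddCommGroup E]
    [InnerProductSpace ℝ E] {γ₁ γ₂ : ℝ → ℝ} {M₁ M₂ : ℝ} (h1 : Continuous γ₁)
    (hM1 : ∀ s, |γ₁ s| ≤ M₁) (h2 : Continuous γ₂) (hM2 : ∀ s, |γ₂ s| ≤ M₂) (f : Lp ℝ 2 m)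
    (A B : Lp E 2 m) :
    ⟪nem γ₁ f A, nem γ₂ f B⟫_ℝ = ⟪A, nem (fun s => γ₁ s * γ₂ s) f B⟫_ℝ := by
  rw [L2.inner_def, L2.inner_def]
  refine integral_congr_ae ?_
  have hM : ∀ s, |γ₁ s * γ₂ s| ≤ M₁ * M₂ := fun s => by
    rw [abs_mul]
    exact mul_le_mul (hM1 s) (hM2 s) (abs_nonneg _) ((abs_nonneg _).trans (hM1 s))
  filter_upwards [coeFn_nem h1 hM1 f A, coeFn_nem h2 hM2 f B, coeFn_nem (γ := fun s => γ₁ s * γ₂ s) (h1.mul h2) hM f B]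
    with x e1 e2 e3
  rw [e1, e2, e3, real_inner_smul_left, real_inner_smul_right, real_inner_smul_right, mul_assoc]

theorem norm_nem_sq_le_inner {Y E : Type*} [MeasurableSpace Y] {m : Measure Y}
    [NormedAddCommGroup E] [InnerProductSpace ℝ E] (h : IsTruncation K γ β j) (f : Lp ℝ 2 m)
    (A : Lp E 2 m) : ‖nem γ f A‖ ^ 2 ≤ ⟪A, nem γ f A⟫_ℝ := by
  rw [← real_inner_self_eq_norm_sq, L2.inner_def, L2.inner_def]
  refine integral_mono_ae (L2.integrable_inner (𝕜 := ℝ) _ _) (L2.integrable_inner (𝕜 := ℝ) _ _) ?_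
  filter_upwards [coeFn_nem h.cont h.abs_le_one f A] with x hx
  simp only [hx]
  rw [real_inner_smul_left, real_inner_smul_right, real_inner_self_eq_norm_sq]
  have := h.nonneg (f x)
  exact mul_le_of_le_one_left (by positivity) (h.le_one _)

theorem memLp_toL2_comp_curve {X Y : Type*} [MeasurableSpace X] {m : Measure X}
    [IsFiniteMeasure m] [MeasurableSpace Y] {ν : Measure Y} [IsFiniteMeasure ν] {Γ : ℝ → ℝ}
    {M : ℝ≥0} (hΓ : LipschitzWith M Γ) {f : Y → Lp ℝ 2 m} (hf : MemLp f 2 ν) :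
    MemLp (fun t => toL2 m fun x => Γ (f t x)) 2 ν := by
  have h1 : AEStronglyMeasurable (fun t => toL2 m fun x => Γ (f t x)) ν :=
    (continuous_toL2_comp hΓ).comp_aestronglyMeasurable hf.1
  have h2 : MemLp (fun t => (M : ℝ) * ‖f t‖ + ‖toL2 m fun x => Γ ((0 : Lp ℝ 2 m) x)‖) 2 ν :=
    (hf.norm.const_mul (M : ℝ)).add (memLp_const _)
  refine h2.of_le h1 (ae_of_all _ fun t => ?_)
  have h3 := norm_toL2_comp_sub_le hΓ (f t) 0
  rw [sub_zero] at h3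
  refine le_trans ?_ (Real.le_norm_self _)
  refine (norm_le_norm_sub_add _ (toL2 m fun x => Γ ((0 : Lp ℝ 2 m) x))).trans ?_
  gcongr

theorem memLp_nem_curve {X E Y : Type*} [MeasurableSpace X] {m : Measure X}
    [NormedAddCommGroup E] [InnerProductSpace ℝ E] [MeasurableSpace Y] {ν : Measure Y} {γ : ℝ → ℝ}
    {M : ℝ} (hγ : Continuous γ) (hM : ∀ s, |γ s| ≤ M) {f : Y → Lp ℝ 2 m} {D : Y → Lp E 2 m}
    (hf : AEStronglyMeasurable f ν) (hD : MemLp D 2 ν) :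
    MemLp (fun t => nem γ (f t) (D t)) 2 ν :=
  hD.of_le_mul (c := M) (aestronglyMeasurable_nem hγ hM hf hD.1)
    (ae_of_all _ fun _ => norm_nem_le hγ hM _ _)

theorem norm_le_of_mem {A B : Type*} [NormedAddCommGroup A] [NormedAddCommGroup B]
    [NormedSpace ℝ A] [NormedSpace ℝ B] {W : Submodule ℝ (WithLp 2 (A × B))} {P : ℝ}
    (hP : ∀ q ∈ W, ‖q.fst‖ ≤ P * ‖q.snd‖) {a : A} {b : B} (h : toLp 2 (a, b) ∈ W) :
    ‖a‖ ≤ P * ‖b‖ := hP _ h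

/-- The dissipation of the part of the temperature above a level. -/
theorem inner_tempForce_trunc_le (hκ : 0 < κ) (hS : 0 ≤ S)
    (tr : IsTruncation K γ β j) {P : ℝ} (hP : 0 < P)
    (hPo : ∀ q ∈ W0 (cyl Ωh) gradScalL, ‖q.fst‖ ≤ P * ‖q.snd‖)
    {v : L2Vel Ωh} (hv : ∀ ψ : 𝓓(Ωh, ℝ), ∫ y in Ωh, fderiv ℝ ψ y (v y) = 0)
    {θ : L2Temp Ωh} {D : L2GradTemp Ωh}
    (hch : ∀ {Γ γ : ℝ → ℝ} {M : ℝ≥0},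
      (∀ s, HasDerivAt Γ (γ s) s) → Continuous γ → (∀ s, |γ s| ≤ M) →
      (∀ s, |s| ≤ K → Γ s = 0) →
      toLp 2 (toL2 (vol3 Ωh) fun x => Γ (θ x), nem γ θ D) ∈ W0 (cyl Ωh) gradScalL) :
    ⟪tempForce S κ v θ D, nem γ θ D⟫_ℝ
      ≤ -(κ / P ^ 2) * ‖toL2 (vol3 Ωh) fun x => β (θ x)‖ ^ 2 := by
  have hγ1 : ∀ s, |γ s| ≤ (1 : ℝ≥0) := by simpa using tr.abs_le_one
  have h1 : ⟪nem (clampR S) θ (lift Ωh v), nem γ θ D⟫_ℝ = 0 := by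
    rw [inner_nem_nem (continuous_clampR S) (abs_clampR_le hS) tr.cont tr.abs_le_one]
    have hc : Continuous fun s => clampR S s * γ s := (continuous_clampR S).mul tr.cont
    have hM : ∀ s, |clampR S s * γ s| ≤ (⟨S, hS⟩ : ℝ≥0) := fun s => by
      rw [abs_mul]
      exact (mul_le_mul (abs_clampR_le hS s) (tr.abs_le_one s) (abs_nonneg _) hS).trans_eq
        (mul_one S)
    exact inner_lift_snd_eq_zero hv (hch (hasDerivAt_primitive hc) hc hM
      fun s hs => primitive_eq_zero (fun r hr => by rw [tr.zero r hr, mul_zero]) hs)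
  have hw := hch tr.beta tr.cont hγ1 tr.beta_zero
  have h2 : ‖toL2 (vol3 Ωh) fun x => β (θ x)‖ ≤ P * ‖nem γ θ D‖ := norm_le_of_mem hPo hw
  have h3 := norm_nem_sq_le_inner tr θ D
  rw [tempForce, inner_sub_left, h1, real_inner_smul_left]
  have h4 : ‖toL2 (vol3 Ωh) fun x => β (θ x)‖ ^ 2 ≤ P ^ 2 * ⟪D, nem γ θ D⟫_ℝ := by
    calc _ ≤ (P * ‖nem γ θ D‖) ^ 2 := pow_le_pow_left₀ (norm_nonneg _) h2 2
      _ = P ^ 2 * ‖nem γ θ D‖ ^ 2 := mul_pow _ _ _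
      _ ≤ _ := by gcongr
  have h5 : κ / P ^ 2 * ‖toL2 (vol3 Ωh) fun x => β (θ x)‖ ^ 2 ≤ κ * ⟪D, nem γ θ D⟫_ℝ := by
    calc _ ≤ κ / P ^ 2 * (P ^ 2 * ⟪D, nem γ θ D⟫_ℝ) := by gcongr
      _ = _ := by field_simp
  linarith

/-- Decay of the part of the temperature above a level dominating its boundary values. -/
theorem IsWeakSolution.trunc_energy [IsFiniteMeasure (vol3 Ωh)]
    (hb : IsBounded (Ωh : Set E2)) (hϑ : ContDiff ℝ 2 ϑB) (hκ : 0 < κ)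
    (hMB : ∀ x ∈ frontier (cyl Ωh : Set X3), |ϑB x| ≤ MB) (hα : 0 ≤ α) (hK0 : 0 ≤ K)
    (hK : MB + α * m0 < K) (hS : 0 ≤ S) (tr : IsTruncation K γ β j) {P : ℝ} (hP : 0 < P)
    (hPo : ∀ q ∈ W0 (cyl Ωh) gradScalL, ‖q.fst‖ ≤ P * ‖q.snd‖)
    (h : WeakSol) {a c : ℝ} (ha : T ≤ a)
    (hbd : ∀ t ∈ Icc a c, ∀ᵐ x ∂vol3 Ωh, |Θ t x| ≤ S)
    (hm : ∀ t ∈ Icc a c, |meanT (Θ t)| ≤ m0) {s t : ℝ} (has : a ≤ s) (hst : s ≤ t)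
    (htc : t < c) :
    truncInt (vol3 Ωh) j (Θ t) - truncInt (vol3 Ωh) j (Θ s)
      ≤ ∫ τ in s..t, -(κ / P ^ 2) * ‖toL2 (vol3 Ωh) fun x => β (Θ τ x)‖ ^ 2 := by
  have hch := ae_Icc_of_ae_Ici (b := c) ha (h.ae_chain_mem_W0 hb hϑ hMB hα hK)
  have hWm : MemLp (fun t => nem γ (Θ t) (DΘ t)) 2 (volume.restrict (Icc a c)) :=
    memLp_nem_curve tr.cont tr.abs_le_one (h.memLp_Θ ha c 2).1 (h.memLp_DΘ ha c)
  have hγ1 : ∀ s, |γ s| ≤ (1 : ℝ≥0) := by simpa using tr.abs_le_one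
  have key := h.temp_energy hS (truncInt_sub_le tr hK0) (norm_toL2_beta_le tr hK0) ha hbd hWm
    (by
      filter_upwards [hch, ae_restrict_mem measurableSet_Icc] with r hr hrc
      exact hr (hm r hrc) tr.beta tr.cont hγ1 tr.beta_zero) has hst htc
  refine key.trans ?_
  have hβm := memLp_toL2_comp_curve tr.lipschitz_beta (h.memLp_Θ (ha.trans has) t 2)
  have i1 : IntervalIntegrable (fun τ => ⟪tempForce S κ (u τ) (Θ τ) (DΘ τ),
      nem γ (Θ τ) (DΘ τ)⟫_ℝ) volume s t :=
    intervalIntegrable_of_Icc hst <| MemLp.integrable_real_inner (h.memLp_tempForce hS (ha.trans has) t)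
      (memLp_nem_curve tr.cont tr.abs_le_one (h.memLp_Θ (ha.trans has) t 2).1
        (h.memLp_DΘ (ha.trans has) t))
  have i2 : IntervalIntegrable (fun τ => -(κ / P ^ 2) *
      ‖toL2 (vol3 Ωh) fun x => β (Θ τ x)‖ ^ 2) volume s t :=
    intervalIntegrable_of_Icc hst <| (hβm.integrable_norm_pow (by norm_num)).const_mul _
  refine integral_mono_ae_restrict hst i1 i2 ?_
  filter_upwards [ae_restrict_of_ae_restrict_of_subset (Set.Icc_subset_Icc has htc.le) hch,
    ae_restrict_mem measurableSet_Icc] with τ hτ hτm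
  exact inner_tempForce_trunc_le hκ hS tr hP hPo
    (h.u_div τ (mem_Ici.2 (ha.trans (has.trans hτm.1))))
    (hτ (hm τ ⟨has.trans hτm.1, hτm.2.trans htc.le⟩))

theorem truncInt_le [IsFiniteMeasure (vol3 Ωh)] (tr : IsTruncation K γ β j) (hK0 : 0 ≤ K)
    (θ : L2Temp Ωh) : truncInt (vol3 Ωh) j θ ≤ ‖θ‖ * ‖toL2 (vol3 Ωh) fun x => β (θ x)‖ := by
  refine le_trans ?_ (real_inner_le_norm _ _)
  rw [truncInt, L2.inner_def]
  refine integral_mono_ae (integrable_trunc tr hK0 θ) (L2.integrable_inner (𝕜 := ℝ) _ _) ?_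
  filter_upwards [coeFn_toL2 (memLp_beta tr θ)] with x h2
  simp only [h2]
  simpa [mul_comm] using tr.j_le hK0 (θ x)

/-- A quantitative form of the decay of the temperature above a level. -/
theorem IsWeakSolution.trunc_decay [IsFiniteMeasure (vol3 Ωh)]
    (hb : IsBounded (Ωh : Set E2)) (hϑ : ContDiff ℝ 2 ϑB) (hκ : 0 < κ)
    (hMB : ∀ x ∈ frontier (cyl Ωh : Set X3), |ϑB x| ≤ MB) (hα : 0 ≤ α) (hK0 : 0 ≤ K)
    (hK : MB + α * m0 < K) (hS : 0 ≤ S) (tr : IsTruncation K γ β j) {P : ℝ} (hP : 0 < P)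
    (hPo : ∀ q ∈ W0 (cyl Ωh) gradScalL, ‖q.fst‖ ≤ P * ‖q.snd‖)
    (h : WeakSol) {a c : ℝ} (ha : T ≤ a)
    (hbd : ∀ t ∈ Icc a c, ∀ᵐ x ∂vol3 Ωh, |Θ t x| ≤ S)
    (hm : ∀ t ∈ Icc a c, |meanT (Θ t)| ≤ m0) {s t : ℝ} (has : a ≤ s) (hst : s ≤ t)
    (htc : t < c) :
    truncInt (vol3 Ωh) j (Θ t) + κ / P ^ 2 / (S ^ 2 * volC Ωh + 1) * (t - s)
      * truncInt (vol3 Ωh) j (Θ t) ^ 2 ≤ truncInt (vol3 Ωh) j (Θ s) := by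
  have hen : ∀ {s t : ℝ}, a ≤ s → s ≤ t → t < c → _ := fun has hst htc =>
    h.trunc_energy hb hϑ hκ hMB hα hK0 hK hS tr hP hPo ha hbd hm has hst htc
  have hmono : ∀ {s t : ℝ}, a ≤ s → s ≤ t → t < c →
      truncInt (vol3 Ωh) j (Θ t) ≤ truncInt (vol3 Ωh) j (Θ s) := by
    intro s t has hst htc
    have h1 := hen has hst htc
    have h2 : ∫ τ in s..t, -(κ / P ^ 2) * ‖toL2 (vol3 Ωh) fun x => β (Θ τ x)‖ ^ 2 ≤ 0 := by
      rw [intervalIntegral.integral_const_mul, neg_mul, neg_nonpos]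
      have : 0 ≤ ∫ τ in s..t, ‖toL2 (vol3 Ωh) fun x => β (Θ τ x)‖ ^ 2 :=
        intervalIntegral.integral_nonneg hst fun τ _ => by positivity
      positivity
    linarith
  have hV : 0 ≤ volC Ωh := measureReal_nonneg
  set y := truncInt (vol3 Ωh) j (Θ t) with hy
  have hy0 : 0 ≤ y := truncInt_nonneg tr hK0 _
  have h3 : ∀ τ ∈ Icc s t, -(κ / P ^ 2) * ‖toL2 (vol3 Ωh) fun x => β (Θ τ x)‖ ^ 2
      ≤ -(κ / P ^ 2 / (S ^ 2 * volC Ωh + 1) * y ^ 2) := by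
    intro τ hτ
    have h4 : y ≤ ‖Θ τ‖ * ‖toL2 (vol3 Ωh) fun x => β (Θ τ x)‖ :=
      (hmono (has.trans hτ.1) hτ.2 htc).trans (truncInt_le tr hK0 _)
    have h5 : y ^ 2 ≤ (S ^ 2 * volC Ωh + 1) * ‖toL2 (vol3 Ωh) fun x => β (Θ τ x)‖ ^ 2 := by
      refine (pow_le_pow_left₀ hy0 h4 2).trans ?_
      rw [mul_pow]
      have := norm_sq_le_of_bdd (hbd τ ⟨has.trans hτ.1, hτ.2.trans htc.le⟩)
      gcongr
      linarith
    have h6 : κ / P ^ 2 / (S ^ 2 * volC Ωh + 1) * y ^ 2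
        ≤ κ / P ^ 2 * ‖toL2 (vol3 Ωh) fun x => β (Θ τ x)‖ ^ 2 := by
      calc _ ≤ κ / P ^ 2 / (S ^ 2 * volC Ωh + 1) *
            ((S ^ 2 * volC Ωh + 1) * ‖toL2 (vol3 Ωh) fun x => β (Θ τ x)‖ ^ 2) := by gcongr
        _ = _ := by field_simp
    linarith
  have hβm := memLp_toL2_comp_curve tr.lipschitz_beta (h.memLp_Θ (ha.trans has) t 2)
  have i2 : IntervalIntegrable (fun τ => -(κ / P ^ 2) *
      ‖toL2 (vol3 Ωh) fun x => β (Θ τ x)‖ ^ 2) volume s t :=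
    intervalIntegrable_of_Icc hst <| (hβm.integrable_norm_pow (by norm_num)).const_mul _
  have h7 := integral_mono_on hst i2 intervalIntegrable_const h3
  rw [intervalIntegral.integral_const, smul_eq_mul] at h7
  have h8 := hen has hst htc
  linarith

end TruncatedDecay

section TemperatureBounds

theorem forall_pos_of_contraction {α : ℝ} (hα0 : 0 ≤ α) (hα1 : α < 1) {P : ℝ → Prop}
    (hmono : ∀ D D', D ≤ D' → P D → P D') {D₀ : ℝ} (hD₀ : 0 ≤ D₀) (h0 : P D₀)
    (hstep : ∀ D ε, 0 ≤ D → 0 < ε → P D → P (α * D + ε)) {η : ℝ} (hη : 0 < η) : P η := by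
  have h1 : ∀ n : ℕ, P (α ^ n * D₀ + η / 2) := by
    intro n
    induction n with
    | zero => exact hmono _ _ (by simp; positivity) h0
    | succ n ih =>
      have := hstep _ ((1 - α) * (η / 2)) (by positivity)
        (mul_pos (by linarith) (by positivity)) ih
      refine hmono _ _ (le_of_eq ?_) this
      rw [pow_succ]; ring
  have h2 : Tendsto (fun n : ℕ => α ^ n * D₀) atTop (𝓝 0) := by
    simpa using (tendsto_pow_atTop_nhds_zero_of_lt_one hα0 hα1).mul_const D₀
  obtain ⟨n, hn⟩ := (h2.eventually (gt_mem_nhds (show (0 : ℝ) < η / 2 by positivity))).exists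
  exact hmono _ _ (by linarith) (h1 n)

theorem ae_abs_le_of_forall_pos {Y : Type*} [MeasurableSpace Y] {m : Measure Y} {f : Y → ℝ} {S : ℝ}
    (h : ∀ η, 0 < η → ∀ᵐ x ∂m, |f x| ≤ S + η) : ∀ᵐ x ∂m, |f x| ≤ S := by
  have h1 : ∀ᵐ x ∂m, ∀ n : ℕ, |f x| ≤ S + 1 / ((n : ℝ) + 1) :=
    ae_all_iff.2 fun n => h _ (by positivity)
  filter_upwards [h1] with x hx
  refine ge_of_tendsto' (x := atTop) (f := fun n : ℕ => S + 1 / ((n : ℝ) + 1)) ?_ hx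
  simpa using tendsto_one_div_add_atTop_nhds_zero_nat.const_add S

section

variable {Y : Type*} [MeasurableSpace Y] {m : Measure Y} [IsFiniteMeasure m]
  {K : ℝ} {γ β j : ℝ → ℝ}

theorem truncInt_eq_zero (tr : IsTruncation K γ β j) {θ : Lp ℝ 2 m} (h : ∀ᵐ x ∂m, |θ x| ≤ K) :
    truncInt m j θ = 0 := by
  refine integral_eq_zero_of_ae ?_
  filter_upwards [h] with x hx using tr.j_zero _ hx

theorem ae_abs_le_of_truncInt (tr : IsTruncation K γ β j) (hK : 0 ≤ K) {θ : Lp ℝ 2 m}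
    (h : truncInt m j θ ≤ 0) : ∀ᵐ x ∂m, |θ x| ≤ K := by
  have h1 := (integral_eq_zero_iff_of_nonneg (fun x => tr.j_nonneg hK (θ x))
    (integrable_trunc tr hK θ)).1 (le_antisymm h (truncInt_nonneg tr hK θ))
  filter_upwards [h1] with x hx
  exact tr.abs_le_of_j_eq_zero hK hx.le

theorem exists_integral_abs_le (tr : IsTruncation K γ β j) (hK : 0 ≤ K) {ρ : ℝ} (hρ : 0 < ρ) :
    ∃ C, 0 ≤ C ∧ ∀ θ : Lp ℝ 2 m,
      ∫ x, |θ x| ∂m ≤ (K + ρ) * m.real Set.univ + C * truncInt m j θ := by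
  obtain ⟨C, hC0, hC⟩ := tr.exists_excess_le hK hρ
  refine ⟨C, hC0, fun θ => ?_⟩
  have hi := (integrable_trunc tr hK θ).const_mul C
  calc ∫ x, |θ x| ∂m ≤ ∫ x, ((K + ρ) + C * j (θ x)) ∂m := by
        refine integral_mono ((Lp.memLp θ).integrable (by norm_num)).abs
          ((integrable_const _).add hi) fun x => ?_
        have := hC (θ x)
        simp only
        linarith
    _ = (K + ρ) * m.real Set.univ + C * truncInt m j θ := by
        rw [integral_add (integrable_const _) hi, integral_const_mul]
        simp [truncInt, mul_comm]

theorem exists_norm_sq_le_trunc (tr : IsTruncation K γ β j) (hK : 0 ≤ K) {ρ : ℝ} (hρ : 0 < ρ)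
    {S : ℝ} (hS : 0 ≤ S) :
    ∃ C, 0 ≤ C ∧ ∀ θ : Lp ℝ 2 m, (∀ᵐ x ∂m, |θ x| ≤ S) →
      ‖θ‖ ^ 2 ≤ (K + ρ) ^ 2 * m.real Set.univ + C * truncInt m j θ := by
  obtain ⟨C, hC0, hC⟩ := tr.exists_excess_le hK hρ
  refine ⟨C * (2 * S), by positivity, fun θ hθ => ?_⟩
  have hi := (integrable_trunc tr hK θ).const_mul (C * (2 * S))
  rw [norm_sq_eq_integral]
  calc ∫ x, ‖θ x‖ ^ 2 ∂m ≤ ∫ x, ((K + ρ) ^ 2 + C * (2 * S) * j (θ x)) ∂m := by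
        refine integral_mono_ae (integrable_norm_sq θ) ((integrable_const _).add hi) ?_
        filter_upwards [hθ] with x hx
        have h1 := hC (θ x)
        have h2 : 0 ≤ C * j (θ x) := mul_nonneg hC0 (tr.j_nonneg hK _)
        simp only [norm_eq_abs]
        rcases le_or_gt |θ x| (K + ρ) with h3 | h3
        · have := pow_le_pow_left₀ (abs_nonneg _) h3 2
          nlinarith [mul_nonneg h2 hS]
        · nlinarith [mul_le_mul h1 (show |θ x| + (K + ρ) ≤ 2 * S by linarith)
            (by positivity) h2]
    _ = _ := by
        rw [integral_add (integrable_const _) hi, integral_const_mul]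
        simp [truncInt, mul_comm]

end

variable {MB : ℝ}

theorem finrank_X3 : Module.finrank ℝ X3 = 3 := by simp [X3, E2]

theorem exists_poincare_temp (hb : IsBounded (Ωh : Set E2)) :
    ∃ P : ℝ, 0 < P ∧ ∀ q ∈ W0 (cyl Ωh) gradScalL, ‖q.fst‖ ≤ P * ‖q.snd‖ :=
  exists_poincare_W0 gradScalL (isBounded_cyl hb) (by rw [finrank_X3]; norm_num)
    (by rw [finrank_X3]) gradScalL_injective

theorem IsWeakSolution.exists_bdd (h : WeakSol) (c : ℝ) :
    ∃ C, 0 ≤ C ∧ ∀ t ∈ Icc T c, ∀ᵐ x ∂vol3 Ωh, |Θ t x| ≤ C := by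
  rcases le_or_gt T c with hc | hc
  · obtain ⟨C, hC⟩ := h.Θ_bdd T Set.self_mem_Ici c hc
    exact ⟨max C 0, le_max_right _ _, fun t ht => ae_abs_le_of_eLpNorm_le (hC t ht)⟩
  · exact ⟨0, le_rfl, fun t ht => absurd (ht.1.trans ht.2) (not_le.2 hc)⟩

/-- The maximum principle. -/
theorem IsWeakSolution.max_principle (hb : IsBounded (Ωh : Set E2))
    (hϑ : ContDiff ℝ 2 ϑB) (hκ : 0 < κ) (hMB0 : 0 ≤ MB)
    (hMB : ∀ x ∈ frontier (cyl Ωh : Set X3), |ϑB x| ≤ MB) (hα : 0 ≤ α) (hα1 : α < 1)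
    (hS : MB ≤ (1 - α) * S)
    (h : WeakSol)
    (hT : ∀ᵐ x ∂vol3 Ωh, |Θ T x| ≤ S) {t : ℝ} (ht : T ≤ t) : ∀ᵐ x ∂vol3 Ωh, |Θ t x| ≤ S := by
  have := isFiniteMeasure_vol3 hb
  obtain ⟨P, hP, hPo⟩ := exists_poincare_temp hb
  have hS0 : 0 ≤ S := by
    have : 0 ≤ (1 - α) * S := hMB0.trans hS
    exact nonneg_of_mul_nonneg_right this (by linarith)
  obtain ⟨C, hC0, hC⟩ := h.exists_bdd (t + 1)
  refine ae_abs_le_of_forall_pos fun η hη => ?_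
  refine forall_pos_of_contraction hα hα1
    (P := fun D => ∀ t' ∈ Set.Ico T (t + 1), ∀ᵐ x ∂vol3 Ωh, |Θ t' x| ≤ S + D) ?_ hC0 ?_ ?_ hη
    t ⟨ht, by linarith⟩
  · intro D D' hDD hD t' ht'
    filter_upwards [hD t' ht'] with x hx using by linarith
  · intro t' ht'
    filter_upwards [hC t' ⟨ht'.1, ht'.2.le⟩] with x hx using by linarith
  · intro D ε hD hε hPD t' ht'
    obtain ⟨γ, β, j, tr⟩ := exists_isTruncation (S + (α * D + ε))
    have hαD : 0 ≤ α * D := mul_nonneg hα hD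
    have hK0 : 0 ≤ S + (α * D + ε) := by linarith
    have hbd : ∀ r ∈ Icc T ((t' + (t + 1)) / 2), ∀ᵐ x ∂vol3 Ωh, |Θ r x| ≤ S + D :=
      fun r hr => hPD r ⟨hr.1, by linarith [hr.2, ht'.2]⟩
    have key := h.trunc_decay hb hϑ hκ hMB hα hK0 (m0 := S + D) (by nlinarith)
      (add_nonneg hS0 hD) tr hP hPo le_rfl hbd
      (fun r hr => abs_meanT_le (add_nonneg hS0 hD) (hbd r hr)) le_rfl ht'.1
      (show t' < (t' + (t + 1)) / 2 by linarith [ht'.2])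
    rw [truncInt_eq_zero tr (θ := Θ T)
      (by filter_upwards [hT] with x hx using by linarith)] at key
    have hV : 0 ≤ volC Ωh := measureReal_nonneg
    refine ae_abs_le_of_truncInt tr hK0 (le_trans ?_ key)
    have h0 : 0 ≤ t' - T := sub_nonneg.2 ht'.1
    exact le_add_of_nonneg_right (by positivity)

/-- The temperature of bounded entire solutions is bounded in terms of the boundary data. -/
theorem IsWeakSolution.entire_bound (hb : IsBounded (Ωh : Set E2))
    (hϑ : ContDiff ℝ 2 ϑB) (hκ : 0 < κ) (hMB0 : 0 ≤ MB)
    (hMB : ∀ x ∈ frontier (cyl Ωh : Set X3), |ϑB x| ≤ MB) (hα : 0 ≤ α) (hα1 : α < 1)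
    (h : IsWeakSolution Ωh μ κ α g ϑB Set.univ u Du Θ DΘ) {C : ℝ} (hC0 : 0 ≤ C)
    (hC : ∀ t, ∀ᵐ x ∂vol3 Ωh, |Θ t x| ≤ C) (t : ℝ) :
    ∀ᵐ x ∂vol3 Ωh, |Θ t x| ≤ MB / (1 - α) := by
  have := isFiniteMeasure_vol3 hb
  obtain ⟨P, hP, hPo⟩ := exists_poincare_temp hb
  have h1α : 0 < 1 - α := by linarith
  set S := MB / (1 - α) with hSdef
  have hS0 : 0 ≤ S := by positivity
  have hSeq : MB = (1 - α) * S := by rw [hSdef]; field_simp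
  refine ae_abs_le_of_forall_pos fun η hη => ?_
  refine forall_pos_of_contraction hα hα1
    (P := fun D => ∀ t, ∀ᵐ x ∂vol3 Ωh, |Θ t x| ≤ S + D) ?_ hC0 ?_ ?_ hη t
  · intro D D' hDD hD t'
    filter_upwards [hD t'] with x hx using by linarith
  · intro t'
    filter_upwards [hC t'] with x hx using by linarith
  · intro D ε hD hε hPD t'
    obtain ⟨γ, β, j, tr⟩ := exists_isTruncation (S + (α * D + ε))
    have hαD : 0 ≤ α * D := mul_nonneg hα hD
    have hK0 : 0 ≤ S + (α * D + ε) := by linarith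
    refine ae_abs_le_of_truncInt tr hK0 ?_
    by_contra hlt
    rw [not_le] at hlt
    set y := truncInt (vol3 Ωh) j (Θ t') with hy
    have hSD : 0 ≤ S + D := add_nonneg hS0 hD
    have hV : 0 ≤ volC Ωh := measureReal_nonneg
    set k := κ / P ^ 2 / ((S + D) ^ 2 * volC Ωh + 1) with hk
    have hk0 : 0 < k := by positivity
    have hB : ∀ s, truncInt (vol3 Ωh) j (Θ s) ≤
        √((S + D) ^ 2 * volC Ωh) * (1 * (1 + √((S + D) ^ 2 * volC Ωh))) := by
      intro s
      have hn : ‖Θ s‖ ≤ √((S + D) ^ 2 * volC Ωh) := le_sqrt_of_sq_le (norm_sq_le_of_bdd (hPD s))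
      refine (truncInt_le tr hK0 _).trans (mul_le_mul hn
        ((norm_toL2_beta_le tr hK0 _).trans (by linarith)) (norm_nonneg _) (Real.sqrt_nonneg _))
    set B := √((S + D) ^ 2 * volC Ωh) * (1 * (1 + √((S + D) ^ 2 * volC Ωh)))
    have hB0 : 0 ≤ B := by positivity
    have key : ∀ L : ℝ, 0 ≤ L → y + k * L * y ^ 2 ≤ B := by
      intro L hL
      have := (h.mono (Set.subset_univ (Ici (t' - L)))).trunc_decay hb hϑ hκ hMB hα hK0
        (m0 := S + D) (by nlinarith) hSD tr hP hPo le_rfl (c := t' + 1) (fun r _ => hPD r)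
        (fun r _ => abs_meanT_le hSD (hPD r)) le_rfl (show t' - L ≤ t' by linarith)
        (show t' < t' + 1 by linarith)
      have e : t' - (t' - L) = L := by ring
      rw [e] at this
      exact this.trans (hB _)
    have := key (B / (k * y ^ 2)) (by positivity)
    have e : k * (B / (k * y ^ 2)) * y ^ 2 = B := by field_simp
    rw [e] at this
    linarith

/-- Solutions enter a ball in `L²` depending only on the boundary data. -/
theorem IsWeakSolution.eventually_norm_temp_le (hb : IsBounded (Ωh : Set E2))
    (hϑ : ContDiff ℝ 2 ϑB) (hκ : 0 < κ) (hMB0 : 0 ≤ MB)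
    (hMB : ∀ x ∈ frontier (cyl Ωh : Set X3), |ϑB x| ≤ MB) (hα : 0 ≤ α) (hα1 : α < 1)
    (h : WeakSol) :
    ∀ᶠ t in atTop, ‖Θ t‖ ^ 2 ≤ (MB / (1 - α) + 1) ^ 2 * volC Ωh + 1 := by
  have := isFiniteMeasure_vol3 hb
  obtain ⟨P, hP, hPo⟩ := exists_poincare_temp hb
  have h1α : 0 < 1 - α := by linarith
  set S := MB / (1 - α) with hSdef
  have hS0 : 0 ≤ S := by positivity
  have hSeq : MB = (1 - α) * S := by rw [hSdef]; field_simp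
  have hV : 0 ≤ volC Ωh := measureReal_nonneg
  obtain ⟨C, hC0, hC⟩ : ∃ C, 0 ≤ C ∧ ∀ t, T ≤ t → ∀ᵐ x ∂vol3 Ωh, |Θ t x| ≤ C := by
    obtain ⟨C, hC0, hC⟩ := h.exists_bdd T
    refine ⟨max C S, le_max_of_le_left hC0, fun t ht => ?_⟩
    refine h.max_principle hb hϑ hκ hMB0 hMB hα hα1 (S := max C S) ?_ ?_ ht
    · rw [hSeq]
      exact mul_le_mul_of_nonneg_left (le_max_right _ _) h1α.le
    · filter_upwards [hC T ⟨le_rfl, le_rfl⟩] with x hx using hx.trans (le_max_left _ _)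
  have hdec : ∀ {K m0 : ℝ} {γ β j : ℝ → ℝ}, IsTruncation K γ β j → 0 ≤ K → MB + α * m0 < K →
      (∀ᶠ t in atTop, |meanT (Θ t)| ≤ m0) → ∀ η : ℝ, 0 < η →
      ∀ᶠ t in atTop, truncInt (vol3 Ωh) j (Θ t) ≤ η := by
    intro K m0 γ β j tr hK0 hK hm η hη
    obtain ⟨a, ha⟩ := eventually_atTop.1 hm
    set a' := max a T
    set k := κ / P ^ 2 / (C ^ 2 * volC Ωh + 1) with hk
    have hk0 : 0 < k := by positivity
    set y := truncInt (vol3 Ωh) j (Θ a')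
    have hy0 : 0 ≤ y := truncInt_nonneg tr hK0 _
    filter_upwards [eventually_gt_atTop (a' + y / (k * η ^ 2))] with t ht
    by_contra hlt
    rw [not_le] at hlt
    have hat : a' ≤ t := le_trans (le_add_of_nonneg_right (by positivity)) ht.le
    have key := h.trunc_decay hb hϑ hκ hMB hα hK0 hK hC0 tr hP hPo (le_max_right a T)
      (c := t + 1) (fun r hr => hC r ((le_max_right a T).trans hr.1))
      (fun r hr => ha r ((le_max_left a T).trans hr.1)) le_rfl hat (by linarith)
    have h1 : y < (t - a') * (k * η ^ 2) := by
      rw [← div_lt_iff₀ (by positivity)]; linarith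
    have h2 : (t - a') * (k * η ^ 2) ≤ k * (t - a') * truncInt (vol3 Ωh) j (Θ t) ^ 2 := by
      have : η ^ 2 ≤ truncInt (vol3 Ωh) j (Θ t) ^ 2 := pow_le_pow_left₀ hη.le hlt.le 2
      have h3 : 0 ≤ k * (t - a') := mul_nonneg hk0.le (sub_nonneg.2 hat)
      nlinarith [mul_le_mul_of_nonneg_left this h3]
    linarith
  have hmean : ∀ᶠ t in atTop, |meanT (Θ t)| ≤ S + 1 / 4 := by
    refine forall_pos_of_contraction hα hα1
      (P := fun D => ∀ᶠ t in atTop, |meanT (Θ t)| ≤ S + D) ?_ hC0 ?_ ?_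
      (show (0 : ℝ) < 1 / 4 by norm_num)
    · intro D D' hDD hD
      filter_upwards [hD] with x hx using by linarith
    · filter_upwards [eventually_ge_atTop T] with t ht
      linarith [abs_meanT_le hC0 (hC t ht)]
    · intro D ε hD hε hPD
      have hαD : 0 ≤ α * D := mul_nonneg hα hD
      have hK0 : 0 ≤ S + (α * D + ε / 3) := by linarith
      obtain ⟨γ, β, j, tr⟩ := exists_isTruncation (S + (α * D + ε / 3))
      obtain ⟨c, hc0, hc⟩ := exists_integral_abs_le (m := vol3 Ωh) tr hK0
        (ρ := ε / 3) (by positivity)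
      have := hdec tr hK0 (by nlinarith) hPD (ε / 3 / ((volC Ωh)⁻¹ * c + 1)) (by positivity)
      filter_upwards [this] with t ht
      have hy0 := truncInt_nonneg tr hK0 (Θ t)
      have h1 := abs_meanT_le_of_integral (θ := Θ t) (by linarith) (hc (Θ t))
      have h2 : (volC Ωh)⁻¹ * (c * truncInt (vol3 Ωh) j (Θ t)) ≤ ε / 3 := by
        rw [le_div_iff₀ (by positivity)] at ht
        nlinarith
      linarith
  have hK0 : 0 ≤ S + 1 / 2 := by linarith
  obtain ⟨γ, β, j, tr⟩ := exists_isTruncation (S + 1 / 2)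
  obtain ⟨c, hc0, hc⟩ := exists_norm_sq_le_trunc (m := vol3 Ωh) tr hK0
    (ρ := 1 / 2) (by positivity) hC0
  have := hdec tr hK0 (by nlinarith) hmean (1 / (c + 1)) (by positivity)
  filter_upwards [this, eventually_ge_atTop T] with t ht htT
  have h1 := hc (Θ t) (hC t htT)
  have hy0 := truncInt_nonneg tr hK0 (Θ t)
  have h2 : c * truncInt (vol3 Ωh) j (Θ t) ≤ 1 := by
    rw [le_div_iff₀ (by positivity)] at ht
    nlinarith
  have e : S + 1 / 2 + 1 / 2 = S + 1 := by ring
  rw [e] at h1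
  linarith

end TemperatureBounds

theorem toL2_sub_const [IsFiniteMeasure (vol3 Ωh)] {b : X3 → ℝ} (hb : MemLp b 2 (vol3 Ωh)) (k : ℝ) :
    toL2 (vol3 Ωh) (fun x => b x - k) = toL2 (vol3 Ωh) b - k • oneT Ωh := by
  have h1 : MemLp (fun x => b x - k) 2 (vol3 Ωh) := hb.sub (memLp_const k)
  refine Lp.ext ?_
  filter_upwards [coeFn_toL2 h1, coeFn_toL2 hb,
    coeFn_toL2 (memLp_const (μ := vol3 Ωh) (p := 2) (1 : ℝ)),
    Lp.coeFn_sub (toL2 (vol3 Ωh) b) (k • oneT Ωh), Lp.coeFn_smul k (oneT Ωh)] with x e1 e2 e3 e4 e5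
  have e3' : oneT Ωh x = 1 := e3
  rw [e1, e4, Pi.sub_apply, e2, e5, Pi.smul_apply, e3']
  simp

/-- The boundary condition in terms of the gradient of the quadratic functional. -/
theorem IsWeakSolution.ae_quadG_mem_W0 [IsFiniteMeasure (vol3 Ωh)]
    (hb : IsBounded (Ωh : Set E2)) (hϑ : ContDiff ℝ 2 ϑB) {I : Set ℝ}
    (h : IsWeakSolution Ωh μ κ α g ϑB I u Du Θ DΘ) :
    ∀ᵐ t ∂volume.restrict I,
      toLp 2 (quadG α (toL2 (vol3 Ωh) ϑB) (Θ t),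
        DΘ t - toL2 (vol3 Ωh) fun x => gradScalL (fderiv ℝ ϑB x)) ∈ W0 (cyl Ωh) gradScalL := by
  filter_upwards [h.ae_mem_W0 hb hϑ] with t ht
  have e : quadG α (toL2 (vol3 Ωh) ϑB) (Θ t) =
      Θ t - toL2 (vol3 Ωh) (fun x => ϑB x - α * meanT (Θ t)) := by
    rw [toL2_sub_const (continuous_memLp_volOn (isBounded_cyl hb) hϑ.continuous 2), quadG,
      meanT_eq, mul_assoc]
    abel
  rw [e]
  simpa only [fderiv_sub_const] using ht

theorem memLp_gradient_data (hb : IsBounded (Ωh : Set E2)) (hϑ : ContDiff ℝ 2 ϑB) :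
    MemLp (fun x => gradScalL (fderiv ℝ ϑB x)) 2 (vol3 Ωh) :=
  continuous_memLp_volOn (isBounded_cyl hb)
    (gradScalL.continuous.comp (hϑ.continuous_fderiv (by norm_num))) 2

theorem abs_quadJ_le {α : ℝ} (hα : 0 ≤ α) (b θ : L2Temp Ωh) {B : ℝ} (hB : ‖θ‖ ≤ B) :
    |quadJ α b θ| ≤ 1 / 2 * B ^ 2 + 1 / 2 * (α * (volC Ωh)⁻¹) * (‖oneT Ωh‖ * B) ^ 2 + ‖b‖ * B := by
  have hk : 0 ≤ α * (volC Ωh)⁻¹ := mul_nonneg hα (inv_nonneg.2 measureReal_nonneg)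
  have h1 : ‖θ‖ ^ 2 ≤ B ^ 2 := pow_le_pow_left₀ (norm_nonneg _) hB 2
  have h2 : |⟪oneT Ωh, θ⟫_ℝ| ≤ ‖oneT Ωh‖ * B :=
    (abs_real_inner_le_norm _ _).trans (mul_le_mul_of_nonneg_left hB (norm_nonneg _))
  have h3 : ⟪oneT Ωh, θ⟫_ℝ ^ 2 ≤ (‖oneT Ωh‖ * B) ^ 2 := by
    rw [← sq_abs]; exact pow_le_pow_left₀ (abs_nonneg _) h2 2
  have h4 : |⟪b, θ⟫_ℝ| ≤ ‖b‖ * B :=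
    (abs_real_inner_le_norm _ _).trans (mul_le_mul_of_nonneg_left hB (norm_nonneg _))
  rw [quadJ]
  generalize α * (volC Ωh)⁻¹ = k at *
  have h5 := mul_le_mul_of_nonneg_left h3 hk
  have h6 := mul_nonneg hk (sq_nonneg ⟪oneT Ωh, θ⟫_ℝ)
  have h7 := sq_nonneg ‖θ‖
  have h8 := abs_le.1 h4
  rw [abs_le]
  constructor <;> nlinarith

theorem inner_sub_dissipation {H : Type*} [NormedAddCommGroup H] [InnerProductSpace ℝ H] {κ r : ℝ}
    (hκ : 0 < κ) {n D N : H} (hn : ‖n‖ ≤ r) :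
    ⟪n - κ • D, D - N⟫_ℝ ≤ -(κ / 2) * ‖D‖ ^ 2 + (r ^ 2 / κ + κ * ‖N‖ ^ 2 + r * ‖N‖) := by
  have h1 : ⟪n, D⟫_ℝ ≤ r * ‖D‖ := (real_inner_le_norm _ _).trans
    (mul_le_mul_of_nonneg_right hn (norm_nonneg _))
  have h2 : -⟪n, N⟫_ℝ ≤ r * ‖N‖ := (neg_le_abs _).trans ((abs_real_inner_le_norm _ _).trans
    (mul_le_mul_of_nonneg_right hn (norm_nonneg _)))
  have h3 : ⟪D, N⟫_ℝ ≤ ‖D‖ * ‖N‖ := real_inner_le_norm _ _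
  have h4 : r * ‖D‖ ≤ κ / 4 * ‖D‖ ^ 2 + r ^ 2 / κ := by
    rw [← sub_nonneg]
    have : κ / 4 * ‖D‖ ^ 2 + r ^ 2 / κ - r * ‖D‖ = (κ * ‖D‖ / 2 - r) ^ 2 / κ := by
      field_simp; ring
    rw [this]; positivity
  have h5 : κ * (‖D‖ * ‖N‖) ≤ κ / 4 * ‖D‖ ^ 2 + κ * ‖N‖ ^ 2 := by
    nlinarith [mul_nonneg hκ.le (sq_nonneg (‖D‖ / 2 - ‖N‖))]
  rw [inner_sub_left, inner_sub_right, inner_sub_right, real_inner_smul_left,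
    real_inner_smul_left, real_inner_self_eq_norm_sq]
  have h6 := mul_le_mul_of_nonneg_left h3 hκ.le
  linarith

/-- Uniform bound of the dissipation of the temperature. -/
theorem exists_dissipation_bound (hb : IsBounded (Ωh : Set E2)) (hϑ : ContDiff ℝ 2 ϑB)
    (μ : ℝ) (g : X3) (hκ : 0 < κ) (hα : 0 ≤ α) (hS : 0 ≤ S) {R : ℝ} (hR : 0 ≤ R) :
    ∃ C, 0 ≤ C ∧ ∀ {u : ℝ → L2Vel Ωh} {Du : ℝ → L2GradVel Ωh} {Θ : ℝ → L2Temp Ωh}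
      {DΘ : ℝ → L2GradTemp Ωh} {T : ℝ}, IsWeakSolution Ωh μ κ α g ϑB (Ici T) u Du Θ DΘ →
      (∀ t, T ≤ t → ∀ᵐ x ∂vol3 Ωh, |Θ t x| ≤ S) → (∀ t, T ≤ t → ‖u t‖ ≤ R) →
      ∀ {s t : ℝ}, T ≤ s → s ≤ t → ∫ τ in s..t, ‖DΘ τ‖ ^ 2 ≤ C * (1 + (t - s)) := by
  have := isFiniteMeasure_vol3 hb
  set N := toL2 (vol3 Ωh) fun x => gradScalL (fderiv ℝ ϑB x) with hN
  set b := toL2 (vol3 Ωh) ϑB with hbdef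
  set B := √(S ^ 2 * volC Ωh) with hB
  obtain ⟨L, hL⟩ := exists_norm_quadG_le α b
  set C1 := (S * R) ^ 2 / κ + κ * ‖N‖ ^ 2 + S * R * ‖N‖ with hC1
  have hC10 : 0 ≤ C1 := by positivity
  set C2 := 1 / 2 * B ^ 2 + 1 / 2 * (α * (volC Ωh)⁻¹) * (‖oneT Ωh‖ * B) ^ 2 + ‖b‖ * B with hC2
  have hV : 0 ≤ volC Ωh := measureReal_nonneg
  have hC20 : 0 ≤ C2 := by positivity
  refine ⟨2 / κ * (2 * C2 + C1), by positivity, ?_⟩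
  intro u Du Θ DΘ T h hbd hu s t hs hst
  have hW : MemLp (fun t => DΘ t - N) 2 (volume.restrict (Icc s (t + 1))) :=
    (h.memLp_DΘ hs (t + 1)).sub (memLp_const N)
  have key := h.temp_energy hS (quadJ_sub_le hα b) hL hs
    (fun r hr => hbd r (hs.trans hr.1)) hW
    (ae_Icc_of_ae_Ici hs (h.ae_quadG_mem_W0 hb hϑ)) le_rfl hst (show t < t + 1 by linarith)
  have hDi : IntervalIntegrable (fun τ => ‖DΘ τ‖ ^ 2) volume s t :=
    intervalIntegrable_of_Icc hst <| (h.memLp_DΘ hs t).integrable_norm_pow (by norm_num)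
  have i1 : IntervalIntegrable (fun τ => ⟪tempForce S κ (u τ) (Θ τ) (DΘ τ), DΘ τ - N⟫_ℝ)
      volume s t :=
    intervalIntegrable_of_Icc hst <| MemLp.integrable_real_inner (h.memLp_tempForce hS hs t)
      ((h.memLp_DΘ hs t).sub (memLp_const N))
  have h1 := integral_mono_on hst i1
    ((hDi.const_mul (-(κ / 2))).add intervalIntegrable_const) (g := fun τ =>
      -(κ / 2) * ‖DΘ τ‖ ^ 2 + C1) fun τ hτ => by
    refine inner_sub_dissipation hκ ?_
    exact (norm_nem_le (continuous_clampR S) (abs_clampR_le hS) _ _).trans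
      (mul_le_mul_of_nonneg_left ((norm_lift_le _).trans (hu τ (hs.trans hτ.1))) hS)
  rw [intervalIntegral.integral_add (hDi.const_mul _) intervalIntegrable_const,
    intervalIntegral.integral_const_mul, intervalIntegral.integral_const, smul_eq_mul] at h1
  have hΘB : ∀ r, T ≤ r → ‖Θ r‖ ≤ B := fun r hr =>
    le_sqrt_of_sq_le (norm_sq_le_of_bdd (hbd r hr))
  have h2 := (abs_le.1 (abs_quadJ_le hα b (Θ t) (hΘB t (hs.trans hst)))).1
  have h3 := (abs_le.1 (abs_quadJ_le hα b (Θ s) (hΘB s hs))).2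
  have h4 : κ / 2 * ∫ τ in s..t, ‖DΘ τ‖ ^ 2 ≤ 2 * C2 + C1 * (t - s) := by linarith
  have h5 : 2 * C2 + C1 * (t - s) ≤ (2 * C2 + C1) * (1 + (t - s)) := by
    have : 0 ≤ t - s := sub_nonneg.2 hst
    nlinarith
  calc ∫ τ in s..t, ‖DΘ τ‖ ^ 2 = 2 / κ * (κ / 2 * ∫ τ in s..t, ‖DΘ τ‖ ^ 2) := by field_simp
    _ ≤ 2 / κ * ((2 * C2 + C1) * (1 + (t - s))) :=
        mul_le_mul_of_nonneg_left (h4.trans h5) (by positivity)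
    _ = _ := by ring

theorem nem_clampR_eq {Y E : Type*} [MeasurableSpace Y] {m : Measure Y} [NormedAddCommGroup E]
    [InnerProductSpace ℝ E] (hS : 0 ≤ S) {f : Lp ℝ 2 m} (hf : ∀ᵐ x ∂m, |f x| ≤ S) (A : Lp E 2 m) :
    nem (clampR S) f A =ᵐ[m] fun x => f x • A x := by
  filter_upwards [hf, coeFn_nem (continuous_clampR S) (abs_clampR_le hS) f A] with x h1 h2
  rw [h2, clampR_of_abs_le h1]

theorem inner_lift_nem_eq_zero (hb : IsBounded (Ωh : Set E2)) {v : L2Vel Ωh}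
    (hv : ∀ ψ : 𝓓(Ωh, ℝ), ∫ y in Ωh, fderiv ℝ ψ y (v y) = 0) {w : L2Temp Ωh} {D : L2GradTemp Ωh}
    (hw : toLp 2 (w, D) ∈ W0 (cyl Ωh) gradScalL) (hS : 0 ≤ S) :
    ⟪lift Ωh v, nem (clampR S) w D⟫_ℝ = 0 := by
  have hc := continuous_clampR S
  have e : ∀ (E : Type) [NormedAddCommGroup E] [InnerProductSpace ℝ E],
      toL2 (vol3 Ωh) (fun _ => (0 : E)) = 0 := by
    intro E _ _
    refine Lp.ext ?_
    filter_upwards [coeFn_toL2 (E := E) (f := fun _ : X3 => (0 : E)) (μ := vol3 Ωh) MemLp.zero,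
      Lp.coeFn_zero E 2 (vol3 Ωh)] with x h1 h2
    rw [h1, h2]; rfl
  have key := chain_rule_mem_W0 gradScalL (isBounded_cyl hb) (b := fun _ => (0 : ℝ))
    contDiff_const (hasDerivAt_primitive hc) hc (M := ⟨S, hS⟩) (abs_clampR_le hS) (C := ∅)
    isCompact_empty (Set.empty_subset _) (fun _ _ _ => by simp) (f := w) (D := D)
    (by simpa [e] using hw)
  exact inner_lift_snd_eq_zero hv key

/-- Dissipation of the difference of two temperatures. -/
theorem inner_tempForce_sub_le [IsFiniteMeasure (vol3 Ωh)] (hb : IsBounded (Ωh : Set E2))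
    (hκ : 0 < κ) (hS : 0 ≤ S) {v₁ v₂ : L2Vel Ωh}
    (hv : ∀ ψ : 𝓓(Ωh, ℝ), ∫ y in Ωh, fderiv ℝ ψ y (v₁ y) = 0)
    {θ₁ θ₂ : L2Temp Ωh} (h1 : ∀ᵐ x ∂vol3 Ωh, |θ₁ x| ≤ S) (h2 : ∀ᵐ x ∂vol3 Ωh, |θ₂ x| ≤ S)
    {D₁ D₂ : L2GradTemp Ωh}
    (hw : toLp 2 (quadG α 0 (θ₁ - θ₂), D₁ - D₂) ∈ W0 (cyl Ωh) gradScalL) :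
    ⟪tempForce S κ v₁ θ₁ D₁ - tempForce S κ v₂ θ₂ D₂, D₁ - D₂⟫_ℝ
      ≤ -(κ / 2) * ‖D₁ - D₂‖ ^ 2 + S ^ 2 / (2 * κ) * ‖v₁ - v₂‖ ^ 2 := by
  set k := α * (volC Ωh)⁻¹ * ⟪oneT Ωh, θ₁ - θ₂⟫_ℝ with hk
  set w := quadG α 0 (θ₁ - θ₂) with hwdef
  set S' := 2 * S + |k| with hS'
  have hS'0 : 0 ≤ S' := by positivity
  set W := D₁ - D₂ with hW
  have hwx : w =ᵐ[vol3 Ωh] fun x => θ₁ x - θ₂ x + k := by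
    have e0 : w = θ₁ - θ₂ + k • oneT Ωh := by rw [hwdef, quadG, sub_zero]
    rw [e0]
    filter_upwards [Lp.coeFn_add (θ₁ - θ₂) (k • oneT Ωh), Lp.coeFn_sub θ₁ θ₂,
      Lp.coeFn_smul k (oneT Ωh), coeFn_toL2 (memLp_const (μ := vol3 Ωh) (p := 2) (1 : ℝ))]
      with x e1 e2 e3 e4
    have e4' : oneT Ωh x = 1 := e4
    rw [e1, Pi.add_apply, e2, e3, Pi.smul_apply, e4', Pi.sub_apply]
    simp
  have hwb : ∀ᵐ x ∂vol3 Ωh, |w x| ≤ S' := by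
    filter_upwards [hwx, h1, h2] with x e1 e2 e3
    rw [e1]
    refine (abs_add_le _ _).trans (add_le_add ((abs_sub _ _).trans ?_) le_rfl)
    linarith
  have hdec : nem (clampR S) θ₁ (lift Ωh v₁) - nem (clampR S) θ₂ (lift Ωh v₂)
      = nem (clampR S) θ₂ (lift Ωh (v₁ - v₂)) +
        (nem (clampR S') w (lift Ωh v₁) - k • lift Ωh v₁) := by
    refine Lp.ext ?_
    have hsub : lift Ωh (v₁ - v₂) = lift Ωh v₁ - lift Ωh v₂ := map_sub _ _ _
    filter_upwards [nem_clampR_eq hS h1 (lift Ωh v₁), nem_clampR_eq hS h2 (lift Ωh v₂),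
      nem_clampR_eq hS h2 (lift Ωh (v₁ - v₂)), nem_clampR_eq hS'0 hwb (lift Ωh v₁), hwx,
      Lp.coeFn_sub (nem (clampR S) θ₁ (lift Ωh v₁)) (nem (clampR S) θ₂ (lift Ωh v₂)),
      Lp.coeFn_add (nem (clampR S) θ₂ (lift Ωh (v₁ - v₂)))
        (nem (clampR S') w (lift Ωh v₁) - k • lift Ωh v₁),
      Lp.coeFn_sub (nem (clampR S') w (lift Ωh v₁)) (k • lift Ωh v₁),
      Lp.coeFn_smul k (lift Ωh v₁), Lp.coeFn_sub (lift Ωh v₁) (lift Ωh v₂)]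
      with x a1 a2 a3 a4 a5 a6 a7 a8 a9 a10
    rw [a6, a7, Pi.sub_apply, Pi.add_apply, a1, a2, a3, a8, Pi.sub_apply, a4, a9, Pi.smul_apply,
      hsub, a10, a5, Pi.sub_apply]
    module
  have hz1 : ⟪nem (clampR S') w (lift Ωh v₁), W⟫_ℝ = 0 := by
    rw [← inner_lift_nem_eq_zero hb hv hw hS'0, L2.inner_def, L2.inner_def]
    refine integral_congr_ae ?_
    filter_upwards [nem_clampR_eq hS'0 hwb (lift Ωh v₁), nem_clampR_eq hS'0 hwb W] with x a1 a2
    rw [a1, a2, real_inner_smul_left, real_inner_smul_right]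
  have hz2 : ⟪lift Ωh v₁, W⟫_ℝ = 0 := inner_lift_snd_eq_zero hv hw
  have e : tempForce S κ v₁ θ₁ D₁ - tempForce S κ v₂ θ₂ D₂
      = nem (clampR S) θ₂ (lift Ωh (v₁ - v₂)) +
        (nem (clampR S') w (lift Ωh v₁) - k • lift Ωh v₁) - κ • W := by
    rw [← hdec, hW, smul_sub, tempForce, tempForce]; abel
  rw [e, inner_sub_left, inner_add_left, inner_sub_left, real_inner_smul_left,
    real_inner_smul_left, hz1, hz2, real_inner_self_eq_norm_sq]
  have h3 : ‖nem (clampR S) θ₂ (lift Ωh (v₁ - v₂))‖ ≤ S * ‖v₁ - v₂‖ :=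
    (norm_nem_le (continuous_clampR S) (abs_clampR_le hS) _ _).trans
      (mul_le_mul_of_nonneg_left (norm_lift_le _) hS)
  have h4 := (real_inner_le_norm (nem (clampR S) θ₂ (lift Ωh (v₁ - v₂))) W).trans
    (mul_le_mul_of_nonneg_right h3 (norm_nonneg _))
  have h5 : S * ‖v₁ - v₂‖ * ‖W‖ ≤ κ / 2 * ‖W‖ ^ 2 + S ^ 2 / (2 * κ) * ‖v₁ - v₂‖ ^ 2 := by
    rw [← sub_nonneg]
    have : κ / 2 * ‖W‖ ^ 2 + S ^ 2 / (2 * κ) * ‖v₁ - v₂‖ ^ 2 - S * ‖v₁ - v₂‖ * ‖W‖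
        = (κ * ‖W‖ - S * ‖v₁ - v₂‖) ^ 2 / (2 * κ) := by field_simp; ring
    rw [this]; positivity
  linarith

theorem two_quadJ_le [IsFiniteMeasure (vol3 Ωh)] (hα : 0 ≤ α) (δ : L2Temp Ωh) :
    ‖δ‖ ^ 2 ≤ 2 * quadJ α 0 δ ∧ 2 * quadJ α 0 δ ≤ ‖quadG α 0 δ‖ ^ 2 := by
  have hk : 0 ≤ α * (volC Ωh)⁻¹ := mul_nonneg hα (inv_nonneg.2 measureReal_nonneg)
  rw [quadG, sub_zero, norm_add_sq_real, real_inner_smul_right, real_inner_comm (oneT Ωh) δ, quadJ,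
    inner_zero_left]
  have h1 := sq_nonneg ‖(α * (volC Ωh)⁻¹ * ⟪oneT Ωh, δ⟫_ℝ) • oneT Ωh‖
  have h2 := mul_nonneg hk (sq_nonneg ⟪oneT Ωh, δ⟫_ℝ)
  constructor <;> nlinarith

variable {u₁ u₂ : ℝ → L2Vel Ωh} {Du₁ Du₂ : ℝ → L2GradVel Ωh} {Θ₁ Θ₂ : ℝ → L2Temp Ωh}
  {DΘ₁ DΘ₂ : ℝ → L2GradTemp Ωh}

/-- Stability of the temperature with respect to the velocity. -/
theorem temp_diff_energy (hb : IsBounded (Ωh : Set E2)) (hϑ : ContDiff ℝ 2 ϑB)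
    (hκ : 0 < κ) (hα : 0 ≤ α) (hS : 0 ≤ S) {P : ℝ} (hP : 0 < P)
    (hPo : ∀ q ∈ W0 (cyl Ωh) gradScalL, ‖q.fst‖ ≤ P * ‖q.snd‖)
    (h₁ : IsWeakSolution Ωh μ κ α g ϑB (Ici T) u₁ Du₁ Θ₁ DΘ₁)
    (h₂ : IsWeakSolution Ωh μ κ α g ϑB (Ici T) u₂ Du₂ Θ₂ DΘ₂)
    (hb₁ : ∀ t, T ≤ t → ∀ᵐ x ∂vol3 Ωh, |Θ₁ t x| ≤ S)
    (hb₂ : ∀ t, T ≤ t → ∀ᵐ x ∂vol3 Ωh, |Θ₂ t x| ≤ S) {s t : ℝ} (hs : T ≤ s) (hst : s ≤ t) :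
    quadJ α 0 (Θ₁ t - Θ₂ t) + κ / P ^ 2 * ∫ τ in s..t, quadJ α 0 (Θ₁ τ - Θ₂ τ)
      ≤ quadJ α 0 (Θ₁ s - Θ₂ s) + ∫ τ in s..t, S ^ 2 / (2 * κ) * ‖u₁ τ - u₂ τ‖ ^ 2 := by
  have := isFiniteMeasure_vol3 hb
  obtain ⟨L, hL⟩ := exists_norm_quadG_le α (0 : L2Temp Ωh)
  have hJc : Continuous (quadJ α (0 : L2Temp Ωh)) :=
    continuous_of_subgradient (quadJ_sub_le hα 0) hL
  have hδc : ContinuousOn (fun t => Θ₁ t - Θ₂ t) (Ici T) := h₁.Θ_cont.sub h₂.Θ_cont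
  have hmem : ∀ᵐ t ∂volume.restrict (Ici T),
      toLp 2 (quadG α 0 (Θ₁ t - Θ₂ t), DΘ₁ t - DΘ₂ t) ∈ W0 (cyl Ωh) gradScalL := by
    filter_upwards [h₁.ae_quadG_mem_W0 hb hϑ, h₂.ae_quadG_mem_W0 hb hϑ] with t a1 a2
    have := (W0 (cyl Ωh) gradScalL).sub_mem a1 a2
    rw [← WithLp.toLp_sub, Prod.mk_sub_mk] at this
    have e1 : quadG α (toL2 (vol3 Ωh) ϑB) (Θ₁ t) - quadG α (toL2 (vol3 Ωh) ϑB) (Θ₂ t)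
        = quadG α 0 (Θ₁ t - Θ₂ t) := by
      rw [quadG, quadG, quadG, inner_sub_right]; module
    rwa [e1, sub_sub_sub_cancel_right] at this
  have hF : ∀ b, MemLp (fun t => tempForce S κ (u₁ t) (Θ₁ t) (DΘ₁ t)
      - tempForce S κ (u₂ t) (Θ₂ t) (DΘ₂ t)) 2 (volume.restrict (Icc s b)) := fun b =>
    (h₁.memLp_tempForce hS hs b).sub (h₂.memLp_tempForce hS hs b)
  have hW : ∀ b, MemLp (fun t => DΘ₁ t - DΘ₂ t) 2 (volume.restrict (Icc s b)) := fun b =>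
    (h₁.memLp_DΘ hs b).sub (h₂.memLp_DΘ hs b)
  have key := energy_of_subgradient (quadJ_sub_le hα (0 : L2Temp Ωh)) hL
    (hδc.mono fun _ ht => mem_Ici.2 (hs.trans ht.1)) (hF (t + 1)) (hW (t + 1)) (by
      filter_upwards [ae_Icc_of_ae_Ici hs hmem] with r hr q hq
      have b1 := h₁.temp_increment hS hr (hs.trans hq.1) hq.2
        fun τ hτ => hb₁ τ (hs.trans (hq.1.trans hτ.1))
      have b2 := h₂.temp_increment hS hr (hs.trans hq.1) hq.2
        fun τ hτ => hb₂ τ (hs.trans (hq.1.trans hτ.1))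
      have i1 : ∀ {F : ℝ → L2GradTemp Ωh}, MemLp F 2 (volume.restrict (Icc q r)) →
          IntervalIntegrable (fun τ => ⟪F τ, DΘ₁ r - DΘ₂ r⟫_ℝ) volume q r := by
        intro F hF
        exact intervalIntegrable_of_Icc hq.2 <| MemLp.integrable_real_inner hF (memLp_const _)
      have e1 : (toLp 2 (quadG α 0 (Θ₁ r - Θ₂ r), DΘ₁ r - DΘ₂ r) :
        SobPair ℝ E3 (cyl Ωh)).fst = quadG α 0 (Θ₁ r - Θ₂ r) := rfl
      have e2 : (toLp 2 (quadG α 0 (Θ₁ r - Θ₂ r), DΘ₁ r - DΘ₂ r) :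
        SobPair ℝ E3 (cyl Ωh)).snd = DΘ₁ r - DΘ₂ r := rfl
      rw [e1, e2] at b1 b2
      simp_rw [inner_sub_left (tempForce S κ _ _ _)]
      rw [intervalIntegral.integral_sub (i1 (h₁.memLp_tempForce hS (hs.trans hq.1) r))
        (i1 (h₂.memLp_tempForce hS (hs.trans hq.1) r)), ← b1, ← b2, ← inner_sub_left]
      congr 1
      abel) le_rfl hst (show t < t + 1 by linarith)
  have hJi : IntervalIntegrable (fun τ => quadJ α 0 (Θ₁ τ - Θ₂ τ)) volume s t :=
    intervalIntegrable_of_Icc hst <| (hJc.comp_continuousOn (hδc.mono fun _ ht =>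
      mem_Ici.2 (hs.trans ht.1))).integrableOn_compact isCompact_Icc
  have hui : IntervalIntegrable (fun τ => S ^ 2 / (2 * κ) * ‖u₁ τ - u₂ τ‖ ^ 2) volume s t :=
    intervalIntegrable_of_Icc hst <| (((h₁.memLp_u hs t 2).sub (h₂.memLp_u hs t 2)).integrable_norm_pow
      (by norm_num)).const_mul _
  have i1 : IntervalIntegrable (fun t => ⟪tempForce S κ (u₁ t) (Θ₁ t) (DΘ₁ t)
      - tempForce S κ (u₂ t) (Θ₂ t) (DΘ₂ t), DΘ₁ t - DΘ₂ t⟫_ℝ) volume s t :=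
    intervalIntegrable_of_Icc hst <| MemLp.integrable_real_inner (hF t) (hW t)
  have hmono := integral_mono_ae_restrict hst i1
    ((hJi.const_mul (-(κ / P ^ 2))).add hui) (by
      filter_upwards [ae_Icc_of_ae_Ici hs hmem, ae_restrict_mem measurableSet_Icc] with τ hτ hτm
      refine (inner_tempForce_sub_le hb hκ hS (h₁.u_div τ (hs.trans hτm.1))
        (hb₁ τ (hs.trans hτm.1)) (hb₂ τ (hs.trans hτm.1)) hτ).trans
        (add_le_add ?_ le_rfl)
      have c1 := norm_le_of_mem hPo hτ
      have c2 := (two_quadJ_le hα (Θ₁ τ - Θ₂ τ)).2.trans (pow_le_pow_left₀ (norm_nonneg _) c1 2)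
      rw [mul_pow] at c2
      have c3 : κ / P ^ 2 * quadJ α 0 (Θ₁ τ - Θ₂ τ) ≤ κ / 2 * ‖DΘ₁ τ - DΘ₂ τ‖ ^ 2 := by
        calc _ ≤ κ / P ^ 2 * (P ^ 2 * ‖DΘ₁ τ - DΘ₂ τ‖ ^ 2 / 2) := by gcongr; linarith
          _ = _ := by field_simp
      linarith)
  rw [intervalIntegral.integral_add (hJi.const_mul _) hui,
    intervalIntegral.integral_const_mul] at hmono
  linarith

theorem exists_poincare_vel (hb : IsBounded (Ωh : Set E2)) :
    ∃ P : ℝ, 0 < P ∧ ∀ p ∈ W0 Ωh gradVecL, ‖p.fst‖ ≤ P * ‖p.snd‖ :=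
  exists_poincare_W0 gradVecL hb (by simp) (by simp) gradVecL_injective

theorem IsWeakSolution.vel_dissipation {M B P : ℝ}
    (hΩ : IsBoundedC2 Ωh) (hμ : 0 < μ) (hM0 : 0 ≤ M) (hB : 0 ≤ B) (hP : 0 < P)
    (hPo : ∀ p ∈ W0 Ωh gradVecL, ‖p.fst‖ ≤ P * ‖p.snd‖)
    (hM : ∀ y ∈ Ωh, ‖gradF g y‖ ≤ M) (h : WeakSol)
    (hΘ : ∀ t, T ≤ t → ‖Θ t‖ ≤ B) {s t : ℝ} (hs : T ≤ s) (hst : s ≤ t) :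
    ‖u t‖ ^ 2 + μ / 2 * (∫ τ in s..t, ‖Du τ‖ ^ 2) + μ / P ^ 2 * (∫ τ in s..t, ‖u τ‖ ^ 2)
      ≤ ‖u s‖ ^ 2 + 2 * ((B * M * P) ^ 2 / μ) * (t - s) := by
  have key := h.vel_energy hΩ hM hs hst
  have hD : IntervalIntegrable (fun τ => ‖Du τ‖ ^ 2) volume s t :=
    intervalIntegrable_of_Icc hst <| (h.memLp_Du hs t).integrable_norm_pow (by norm_num)
  have hu : IntervalIntegrable (fun τ => ‖u τ‖ ^ 2) volume s t :=
    intervalIntegrable_of_Icc hst <| (h.memLp_u hs t 2).integrable_norm_pow (by norm_num)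
  have i1 : IntervalIntegrable (fun τ => - (μ * ‖Du τ‖ ^ 2) - ⟪Θ τ, buoyancy g hM (u τ)⟫_ℝ)
      volume s t := by
    refine ((hD.const_mul μ).neg).sub ?_
    exact intervalIntegrable_of_Icc hst <| MemLp.integrable_real_inner (h.memLp_Θ hs t 2)
      ((buoyancy g hM).comp_memLp' (h.memLp_u hs t 2))
  have hmono := integral_mono_ae_restrict hst i1
    (((hD.const_mul (-(μ / 4))).add (hu.const_mul (-(μ / P ^ 2 / 2)))).add
      (intervalIntegrable_const (c := (B * M * P) ^ 2 / μ))) (by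
      filter_upwards [ae_Icc_of_ae_Ici hs (h.ae_mem_Vsol hΩ), ae_restrict_mem measurableSet_Icc]
        with τ hτ hτm
      have c1 := norm_le_of_mem hPo (Vsol_le_W0 hτ)
      have c2 : -⟪Θ τ, buoyancy g hM (u τ)⟫_ℝ ≤ B * M * P * ‖Du τ‖ := by
        refine (neg_le_abs _).trans ((abs_real_inner_le_norm _ _).trans ?_)
        have c3 : ‖buoyancy g hM (u τ)‖ ≤ M * (P * ‖Du τ‖) :=
          (norm_buoyancy_le g hM (u τ)).trans (mul_le_mul_of_nonneg_left c1 hM0)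
        calc ‖Θ τ‖ * ‖buoyancy g hM (u τ)‖ ≤ B * (M * (P * ‖Du τ‖)) :=
              mul_le_mul (hΘ τ (hs.trans hτm.1)) c3 (norm_nonneg _) hB
          _ = _ := by ring
      have c4 : B * M * P * ‖Du τ‖ ≤ μ / 4 * ‖Du τ‖ ^ 2 + (B * M * P) ^ 2 / μ := by
        rw [← sub_nonneg]
        have : μ / 4 * ‖Du τ‖ ^ 2 + (B * M * P) ^ 2 / μ - B * M * P * ‖Du τ‖
            = (μ * ‖Du τ‖ / 2 - B * M * P) ^ 2 / μ := by field_simp; ring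
        rw [this]; positivity
      have c5 : μ / P ^ 2 / 2 * ‖u τ‖ ^ 2 ≤ μ / 2 * ‖Du τ‖ ^ 2 := by
        calc _ ≤ μ / P ^ 2 / 2 * (P * ‖Du τ‖) ^ 2 := by gcongr
          _ = _ := by field_simp
      linarith)
  have hDu := (hD.const_mul (-(μ / 4))).add (hu.const_mul (-(μ / P ^ 2 / 2)))
  rw [intervalIntegral.integral_add hDu intervalIntegrable_const,
    intervalIntegral.integral_add (hD.const_mul _) (hu.const_mul _),
    intervalIntegral.integral_const_mul, intervalIntegral.integral_const_mul,
    intervalIntegral.integral_const, smul_eq_mul] at hmono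
  have e : μ / P ^ 2 / 2 = 1 / 2 * (μ / P ^ 2) := by ring
  rw [e] at hmono
  linarith

/-- Dissipative bounds of the velocity. -/
theorem exists_velocity_constants (hΩ : IsBoundedC2 Ωh) (hμ : 0 < μ) {M B : ℝ} (hM0 : 0 ≤ M)
    (hB : 0 ≤ B) : ∃ q E : ℝ, 0 ≤ q ∧ q < 1 ∧ 0 ≤ E ∧ ∀ {κ α : ℝ} {g : X3} {ϑB : X3 → ℝ}
      {u : ℝ → L2Vel Ωh} {Du : ℝ → L2GradVel Ωh} {Θ : ℝ → L2Temp Ωh} {DΘ : ℝ → L2GradTemp Ωh}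
      {T : ℝ}, (∀ y ∈ Ωh, ‖gradF g y‖ ≤ M) →
      IsWeakSolution Ωh μ κ α g ϑB (Ici T) u Du Θ DΘ → (∀ t, T ≤ t → ‖Θ t‖ ≤ B) →
      ∀ {s t : ℝ}, T ≤ s → s ≤ t → ‖u t‖ ^ 2 ≤ q ^ ⌊t - s⌋₊ * ‖u s‖ ^ 2 + E ∧
        ∫ τ in s..t, ‖Du τ‖ ^ 2 ≤ 2 / μ * ‖u s‖ ^ 2 + E * (t - s) := by
  obtain ⟨P, hP, hPo⟩ := exists_poincare_vel hΩ.1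
  set C := 2 * ((B * M * P) ^ 2 / μ) with hC
  set c := μ / P ^ 2 with hc
  have hC0 : 0 ≤ C := by positivity
  have hc0 : 0 < c := by positivity
  have hE1 : 0 ≤ C * ((1 + c) / c + 1) := by positivity
  have hE2 : 0 ≤ 2 / μ * C := by positivity
  refine ⟨(1 + c)⁻¹, C * ((1 + c) / c + 1) + 2 / μ * C, by positivity,
    inv_lt_one_of_one_lt₀ (by linarith), by positivity, ?_⟩
  intro κ α g ϑB u Du Θ DΘ T hM h hΘ s t hs hst
  have key : ∀ p q, T ≤ p → p ≤ q → _ := fun p q hp hpq =>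
    h.vel_dissipation hΩ hμ hM0 hB hP hPo hM hΘ hp hpq
  have hn1 : ∀ p q : ℝ, p ≤ q → 0 ≤ ∫ τ in p..q, ‖Du τ‖ ^ 2 := fun p q hpq =>
    intervalIntegral.integral_nonneg hpq fun _ _ => by positivity
  have hn2 : ∀ p q : ℝ, p ≤ q → 0 ≤ ∫ τ in p..q, ‖u τ‖ ^ 2 := fun p q hpq =>
    intervalIntegral.integral_nonneg hpq fun _ _ => by positivity
  constructor
  · have hfi : ∀ b, IntegrableOn (fun t => ‖u t‖ ^ 2) (Icc T b) := fun b =>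
      (h.memLp_u le_rfl b 2).integrable_norm_pow (by norm_num)
    have := decay_const (f := fun t => ‖u t‖ ^ 2) (T := T) hc0 hC0
      hfi (fun t => by positivity)
      (fun p q hp hpq => by
        have h1 := key p q hp hpq
        have h2 := mul_nonneg (show 0 ≤ μ / 2 by positivity) (hn1 p q hpq)
        linarith) hs hst
    linarith
  · have h1 := key s t hs hst
    have h2 := mul_nonneg hc0.le (hn2 s t hst)
    have h3 : μ / 2 * (∫ τ in s..t, ‖Du τ‖ ^ 2) ≤ ‖u s‖ ^ 2 + C * (t - s) := by
      have := sq_nonneg ‖u t‖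
      linarith
    have h4 : 0 ≤ t - s := sub_nonneg.2 hst
    calc ∫ τ in s..t, ‖Du τ‖ ^ 2 = 2 / μ * (μ / 2 * ∫ τ in s..t, ‖Du τ‖ ^ 2) := by field_simp
      _ ≤ 2 / μ * (‖u s‖ ^ 2 + C * (t - s)) := mul_le_mul_of_nonneg_left h3 (by positivity)
      _ = 2 / μ * ‖u s‖ ^ 2 + 2 / μ * C * (t - s) := by ring
      _ ≤ _ := by nlinarith [mul_nonneg hE1 h4]

/-- The absorbing ball in `L² × L²`. -/
theorem exists_absorbing_bound (hΩ : IsBoundedC2 Ωh) (hμ : 0 < μ) {κ α M MB : ℝ} (hκ : 0 < κ)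
    (hα : 0 ≤ α) (hα1 : α < 1) (hM0 : 0 ≤ M) (hMB0 : 0 ≤ MB) :
    ∃ E : ℝ, ∀ {g : X3} {ϑB : X3 → ℝ} {u : ℝ → L2Vel Ωh} {Du : ℝ → L2GradVel Ωh}
      {Θ : ℝ → L2Temp Ωh} {DΘ : ℝ → L2GradTemp Ωh} {T : ℝ}, ContDiff ℝ 2 ϑB →
      (∀ y ∈ Ωh, ‖gradF g y‖ ≤ M) → (∀ x ∈ frontier (cyl Ωh : Set X3), |ϑB x| ≤ MB) →
      IsWeakSolution Ωh μ κ α g ϑB (Ici T) u Du Θ DΘ →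
      limsup (fun t => ‖u t‖ₑ + ‖Θ t‖ₑ) atTop ≤ ofReal E := by
  set B := √((MB / (1 - α) + 1) ^ 2 * volC Ωh + 1) with hB
  obtain ⟨q, E, hq0, hq1, hE0, hE⟩ := exists_velocity_constants hΩ hμ hM0 (Real.sqrt_nonneg _ : 0 ≤ B)
  refine ⟨√(E + 1) + B, ?_⟩
  intro g ϑB u Du Θ DΘ T hϑ hM hMB h
  have h1 : ∀ᶠ t in atTop, ‖Θ t‖ ≤ B := by
    filter_upwards [h.eventually_norm_temp_le hΩ.1 hϑ hκ hMB0 hMB hα hα1] with t ht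
    exact le_sqrt_of_sq_le ht
  obtain ⟨a, ha⟩ := eventually_atTop.1 h1
  have h' := h.mono (Set.Ici_subset_Ici.2 (le_max_right a T))
  have hdec : ∀ t, max a T ≤ t → _ := fun t ht =>
    hE hM h' (fun t ht => ha t ((le_max_left a T).trans ht)) le_rfl ht
  have hlim : Tendsto (fun t : ℝ => q ^ ⌊t - max a T⌋₊ * ‖u (max a T)‖ ^ 2) atTop (𝓝 0) := by
    have h2 : Tendsto (fun t : ℝ => ⌊t - max a T⌋₊) atTop atTop :=
      tendsto_nat_floor_atTop.comp (tendsto_atTop_add_const_right _ _ tendsto_id)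
    simpa using ((tendsto_pow_atTop_nhds_zero_of_lt_one hq0 hq1).comp h2).mul_const
      (‖u (max a T)‖ ^ 2)
  refine limsup_le_of_le (h := ?_)
  filter_upwards [h1, hlim.eventually (gt_mem_nhds zero_lt_one), eventually_ge_atTop (max a T)]
    with t t1 t2 t3
  have t4 : ‖u t‖ ≤ √(E + 1) := le_sqrt_of_sq_le (by linarith [(hdec t t3).1])
  rw [← ofReal_norm, ← ofReal_norm, ← ENNReal.ofReal_add (norm_nonneg _) (norm_nonneg _)]
  exact ofReal_le_ofReal (add_le_add t4 t1)

end SolutionBasics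

section WeakCompactness

variable {H : Type*} [NormedAddCommGroup H] [InnerProductSpace ℝ H] [CompleteSpace H]
  [SeparableSpace H] {v : ℕ → ℝ → H} {v' : ℝ → H} {T : ℕ → ℝ} {R : ℝ}

/-- Weak equicontinuity of curves defined on half lines. -/
def WeaklyEquicont (v : ℕ → ℝ → H) (T : ℕ → ℝ) (w : H) : Prop :=
  ∀ ε : ℝ, 0 < ε → ∃ δ : ℝ, 0 < δ ∧ ∀ n s t, T n ≤ s → s ≤ t → t ≤ s + δ →
    |⟪v n t, w⟫_ℝ - ⟪v n s, w⟫_ℝ| ≤ ε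

theorem WeaklyEquicont.symm_bound {w : H} (h : WeaklyEquicont v T w) {ε : ℝ} (hε : 0 < ε) :
    ∃ δ : ℝ, 0 < δ ∧ ∀ n s t, T n ≤ s → T n ≤ t → |t - s| ≤ δ →
      |⟪v n t, w⟫_ℝ - ⟪v n s, w⟫_ℝ| ≤ ε := by
  obtain ⟨δ, hδ, h1⟩ := h ε hε
  refine ⟨δ, hδ, fun n s t hs ht hst => ?_⟩
  have h2 := abs_le.1 hst
  rcases le_total s t with h3 | h3
  · exact h1 n s t hs h3 (by linarith)
  · rw [abs_sub_comm]; exact h1 n t s ht h3 (by linarith)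

/-- Pointwise weak convergence of weakly equicontinuous curves is locally uniform. -/
theorem tendstoCWeakLoc_of_pointwise (hT : Tendsto T atTop atBot)
    (hequi : ∀ w, WeaklyEquicont v T w)
    (hpt : ∀ t w, Tendsto (fun n => ⟪v n t, w⟫_ℝ) atTop (𝓝 ⟪v' t, w⟫_ℝ)) :
    (∀ w, Continuous fun t => ⟪v' t, w⟫_ℝ) ∧ TendstoCWeakLoc v v' := by
  have hlim : ∀ w ε, 0 < ε → ∃ δ : ℝ, 0 < δ ∧
      (∀ n s t, T n ≤ s → T n ≤ t → |t - s| ≤ δ → |⟪v n t, w⟫_ℝ - ⟪v n s, w⟫_ℝ| ≤ ε) ∧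
      ∀ s t, |t - s| ≤ δ → |⟪v' t, w⟫_ℝ - ⟪v' s, w⟫_ℝ| ≤ ε := by
    intro w ε hε
    obtain ⟨δ, hδ, h1⟩ := (hequi w).symm_bound hε
    refine ⟨δ, hδ, h1, fun s t hst => ?_⟩
    refine le_of_tendsto ((hpt t w).sub (hpt s w)).abs ?_
    filter_upwards [hT.eventually (eventually_le_atBot s), hT.eventually (eventually_le_atBot t)]
      with n h2 h3 using h1 n s t h2 h3 hst
  refine ⟨fun w => Metric.continuous_iff.2 fun s ε hε => ?_, fun w K => ?_⟩
  · obtain ⟨δ, hδ, -, h1⟩ := hlim w (ε / 2) (by positivity)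
    refine ⟨δ, hδ, fun t ht => ?_⟩
    rw [Real.dist_eq] at ht ⊢
    exact (h1 s t ht.le).trans_lt (by linarith)
  · rw [Metric.tendstoUniformlyOn_iff]
    intro ε hε
    obtain ⟨δ, hδ, h1, h2⟩ := hlim w (ε / 4) (by positivity)
    obtain ⟨A, -, hAf, hA⟩ := (isCompact_Icc (a := -K) (b := K)).finite_cover_balls hδ
    have h3 : ∀ᶠ n in atTop, ∀ r ∈ A, T n ≤ r ∧ |⟪v n r, w⟫_ℝ - ⟪v' r, w⟫_ℝ| ≤ ε / 4 := by
      refine (hAf.eventually_all).2 fun r _ => ?_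
      refine (hT.eventually (eventually_le_atBot r)).and ?_
      have := Metric.tendsto_nhds.1 (hpt r w) (ε / 4) (by positivity)
      filter_upwards [this] with n hn
      rw [Real.dist_eq] at hn
      exact hn.le
    filter_upwards [h3, hT.eventually (eventually_le_atBot (-K))] with n hn hTn t ht
    obtain ⟨r, hr, htr⟩ := Set.mem_iUnion₂.1 (hA ht)
    have htr' : |t - r| ≤ δ := by rw [← Real.dist_eq]; exact (Metric.mem_ball.1 htr).le
    have a1 := abs_le.1 (h1 n r t (hn r hr).1 (hTn.trans ht.1) htr')
    have a2 := abs_le.1 (h2 r t htr')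
    have a3 := abs_le.1 (hn r hr).2
    rw [Real.dist_eq, abs_lt]
    constructor <;> linarith [a1.1, a1.2, a2.1, a2.2, a3.1, a3.2]

theorem cauchySeq_of_eventually_near {x : ℕ → ℝ}
    (h : ∀ ε : ℝ, 0 < ε → ∃ a, ∀ᶠ n in atTop, |x n - a| ≤ ε) : CauchySeq x := by
  rw [Metric.cauchySeq_iff']
  intro ε hε
  obtain ⟨a, ha⟩ := h (ε / 3) (by positivity)
  obtain ⟨N, hN⟩ := eventually_atTop.1 ha
  refine ⟨N, fun n hn => ?_⟩
  have h1 := abs_le.1 (hN n hn)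
  have h2 := abs_le.1 (hN N le_rfl)
  rw [Real.dist_eq, abs_lt]
  constructor <;> linarith [h1.1, h1.2, h2.1, h2.2]

/-- The Arzelà–Ascoli theorem for the weak topology. -/
theorem exists_subseq_tendstoCWeakLoc (hT : Tendsto T atTop atBot)
    (hR : ∀ n t, T n ≤ t → ‖v n t‖ ≤ R) (hequi : ∀ w, WeaklyEquicont v T w) :
    ∃ k : ℕ → ℕ, StrictMono k ∧ ∃ v' : ℝ → H, (∀ t, ‖v' t‖ ≤ R) ∧
      (∀ w, Continuous fun t => ⟪v' t, w⟫_ℝ) ∧ TendstoCWeakLoc (fun n => v (k n)) v' := by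
  classical
  have hR0 : 0 ≤ R := (norm_nonneg _).trans (hR 0 (T 0) le_rfl)
  let w : ℕ → H := denseSeq H
  let z : ℕ → ℚ × ℕ → ℝ := fun n p => if T n ≤ p.1 then ⟪v n p.1, w p.2⟫_ℝ else 0
  have hz : ∀ n, z n ∈ Set.univ.pi fun p : ℚ × ℕ => Icc (-(R * ‖w p.2‖)) (R * ‖w p.2‖) := by
    intro n p _
    refine Set.mem_Icc.2 (abs_le.1 ?_)
    simp only [z]
    split_ifs with h
    · exact (abs_real_inner_le_norm _ _).trans
        (mul_le_mul_of_nonneg_right (hR n _ h) (norm_nonneg _))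
    · rw [abs_zero]; positivity
  obtain ⟨a, -, k, hk, ha⟩ := (isCompact_univ_pi fun p : ℚ × ℕ =>
    isCompact_Icc (a := -(R * ‖w p.2‖)) (b := R * ‖w p.2‖)).tendsto_subseq hz
  rw [tendsto_pi_nhds] at ha
  have hTk : Tendsto (fun n => T (k n)) atTop atBot := hT.comp hk.tendsto_atTop
  have hcauchy : ∀ t x, CauchySeq fun n => ⟪v (k n) t, x⟫_ℝ := by
    intro t x
    refine cauchySeq_of_eventually_near fun ε hε => ?_
    obtain ⟨δ, hδ, h1⟩ := hequi x (ε / 3) (by positivity)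
    obtain ⟨q, hq1, hq2⟩ := exists_rat_btwn (show t < t + δ by linarith)
    obtain ⟨i, hi⟩ := Metric.denseRange_iff.1 (denseRange_denseSeq H) x (ε / (3 * (R + 1)))
      (by positivity)
    refine ⟨a (q, i), ?_⟩
    filter_upwards [Metric.tendsto_nhds.1 (ha (q, i)) (ε / 3) (by positivity),
      hTk.eventually (eventually_le_atBot t)] with n h2 h3
    have h4 : T (k n) ≤ q := h3.trans hq1.le
    have h2' : |⟪v (k n) q, w i⟫_ℝ - a (q, i)| < ε / 3 := by
      simpa [z, h4, Real.dist_eq] using h2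
    have h5 := abs_le.1 (h1 (k n) t q h3 hq1.le hq2.le)
    have h6 : |⟪v (k n) q, x - w i⟫_ℝ| ≤ ε / 3 := by
      refine (abs_real_inner_le_norm _ _).trans ?_
      rw [dist_eq_norm] at hi
      calc ‖v (k n) q‖ * ‖x - w i‖ ≤ (R + 1) * (ε / (3 * (R + 1))) :=
            mul_le_mul ((hR _ _ h4).trans (by linarith)) hi.le (norm_nonneg _) (by positivity)
        _ = ε / 3 := by field_simp
    rw [inner_sub_right] at h6
    have h7 := abs_le.1 h6
    have h8 := abs_lt.1 h2'
    rw [abs_le]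
    constructor <;> linarith [h5.1, h5.2, h7.1, h7.2, h8.1, h8.2]
  have hex : ∀ t, ∃ x : H, ∀ y, Tendsto (fun n => ⟪v (k n) t, y⟫_ℝ) atTop (𝓝 ⟪x, y⟫_ℝ) := by
    intro t
    obtain ⟨k', hk', x, hx⟩ := exists_subseq_tendsto_inner
      (v := fun n => if T (k n) ≤ t then v (k n) t else 0) (C := R) (fun n => by
        split_ifs with h
        · exact hR _ _ h
        · simpa using hR0)
    refine ⟨x, fun y => ?_⟩
    obtain ⟨l, hl⟩ := cauchySeq_tendsto_of_complete (hcauchy t y)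
    have h1 := hl.comp hk'.tendsto_atTop
    have h2 := (hx y).congr' (f₂ := fun n => ⟪v (k (k' n)) t, y⟫_ℝ) (by
      filter_upwards [(hTk.comp hk'.tendsto_atTop).eventually (eventually_le_atBot t)] with n hn
      have hn' : T (k (k' n)) ≤ t := hn
      simp only [if_pos hn'])
    rwa [← tendsto_nhds_unique h1 h2]
  choose v' hv' using hex
  have hequi' : ∀ x, WeaklyEquicont (fun n => v (k n)) (fun n => T (k n)) x := by
    intro x ε hε
    obtain ⟨δ, hδ, h1⟩ := hequi x ε hε
    exact ⟨δ, hδ, fun n => h1 (k n)⟩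
  obtain ⟨h1, h2⟩ := tendstoCWeakLoc_of_pointwise hTk hequi' hv'
  refine ⟨k, hk, v', fun t => ?_, h1, h2⟩
  have h3 : ⟪v' t, v' t⟫_ℝ ≤ R * ‖v' t‖ := by
    refine le_of_tendsto (hv' t (v' t)) ?_
    filter_upwards [hTk.eventually (eventually_le_atBot t)] with n hn
    exact (real_inner_le_norm _ _).trans (mul_le_mul_of_nonneg_right (hR _ _ hn) (norm_nonneg _))
  rw [real_inner_self_eq_norm_sq] at h3
  by_contra hlt
  rw [not_le] at hlt
  nlinarith [hR0]

theorem TendstoCWeakLoc.tendsto_inner {v : ℕ → ℝ → H} (h : TendstoCWeakLoc v v') (t : ℝ) (w : H) :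
    Tendsto (fun n => ⟪v n t, w⟫_ℝ) atTop (𝓝 ⟪v' t, w⟫_ℝ) :=
  (h w |t|).tendsto_at ⟨neg_abs_le t, le_abs_self t⟩

/-- Bounded curves converging in `C_weak` converge weakly in `L²`. -/
theorem TendstoCWeakLoc.tendstoWeakL2Loc (h : TendstoCWeakLoc v v') (hT : Tendsto T atTop atBot)
    (hR : ∀ n t, T n ≤ t → ‖v n t‖ ≤ R)
    (hc : ∀ n w, ContinuousOn (fun t => ⟪v n t, w⟫_ℝ) (Ici (T n))) : TendstoWeakL2Loc v v' := by
  intro K Φ hΦ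
  have h1 : ∀ᶠ n in atTop, AEStronglyMeasurable (fun t => ⟪v n t, Φ t⟫_ℝ)
      (volume.restrict (Icc (-K) K)) := by
    filter_upwards [hT.eventually (eventually_le_atBot (-K))] with n hn
    refine AEStronglyMeasurable.inner ?_ hΦ.1
    exact aestronglyMeasurable_of_continuousOn_inner measurableSet_Icc fun w =>
      (hc n w).mono fun t ht => mem_Ici.2 (hn.trans ht.1)
  refine tendsto_integral_filter_of_dominated_convergence (fun t => R * ‖Φ t‖) h1 ?_
    ((hΦ.norm.integrable (by norm_num)).const_mul R) (ae_of_all _ fun t => h.tendsto_inner t (Φ t))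
  filter_upwards [hT.eventually (eventually_le_atBot (-K))] with n hn
  filter_upwards [ae_restrict_mem measurableSet_Icc] with t ht
  exact (norm_inner_le_norm _ _).trans
    (mul_le_mul_of_nonneg_right (hR n t (hn.trans ht.1)) (norm_nonneg _))

theorem TendstoCLoc.tendstoCWeakLoc {v : ℕ → ℝ → H} (h : TendstoCLoc v v') :
    TendstoCWeakLoc v v' := by
  intro w K
  rw [Metric.tendstoUniformlyOn_iff]
  intro ε hε
  filter_upwards [Metric.tendstoUniformlyOn_iff.1 (h K) (ε / (‖w‖ + 1)) (by positivity)]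
    with n hn t ht
  have h1 := hn t ht
  rw [dist_eq_norm, lt_div_iff₀ (by positivity)] at h1
  rw [Real.dist_eq, ← inner_sub_left]
  refine (abs_real_inner_le_norm _ _).trans_lt ?_
  nlinarith [norm_nonneg (v' t - v n t)]

/-- Weak compactness in `L²_loc` for functions on half lines. -/
theorem exists_subseq_tendstoWeakL2Loc_of_halfLine {D : ℕ → ℝ → H} {C : ℝ} (hC : 0 ≤ C)
    (hT : Tendsto T atTop atBot)
    (hm : ∀ n b, MemLp (D n) 2 (volume.restrict (Icc (T n) b)))
    (hD : ∀ n s t, T n ≤ s → s ≤ t → ∫ τ in s..t, ‖D n τ‖ ^ 2 ≤ C * (1 + (t - s))) :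
    ∃ k : ℕ → ℕ, StrictMono k ∧ ∃ D' : ℝ → H,
      (∀ K : ℝ, MemLp D' 2 (volume.restrict (Icc (-K) K))) ∧
      TendstoWeakL2Loc (fun n => D (k n)) D' := by
  let v : ℕ → ℝ → H := fun n => (Ici (T n)).indicator (D n)
  have hm' : ∀ n, AEStronglyMeasurable (v n) volume := by
    intro n
    rw [aestronglyMeasurable_indicator_iff measurableSet_Ici]
    have e : Ici (T n) = ⋃ j : ℕ, Icc (T n) (T n + j) := by
      ext t
      simp only [mem_Ici, Set.mem_iUnion, Set.mem_Icc]
      refine ⟨fun h => ?_, fun ⟨j, h, _⟩ => h⟩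
      obtain ⟨j, hj⟩ := exists_nat_ge (t - T n)
      exact ⟨j, h, by linarith⟩
    rw [e, aestronglyMeasurable_iUnion_iff]
    exact fun j => (hm n _).1
  have hv : ∀ n (j : ℤ), ∫⁻ t in Set.Ico (j : ℝ) (j + 1), ‖v n t‖ₑ ^ 2
      ≤ ofReal (2 * C) := by
    intro n j
    set s := max (T n) j with hs
    rcases le_or_gt s (j + 1) with hsj | hsj
    · have h1 : ∫⁻ t in Set.Ico (j : ℝ) (j + 1), ‖v n t‖ₑ ^ 2
          ≤ ∫⁻ t in Icc s (j + 1), ‖D n t‖ₑ ^ 2 := by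
        rw [← lintegral_indicator measurableSet_Ico, ← lintegral_indicator measurableSet_Icc]
        refine lintegral_mono fun t => ?_
        by_cases ht : t ∈ Set.Ico (j : ℝ) (j + 1)
        · by_cases ht' : T n ≤ t
          · have h2 : t ∈ Icc s ((j : ℝ) + 1) := ⟨max_le ht' ht.1, ht.2.le⟩
            rw [indicator_of_mem ht, indicator_of_mem h2]
            simp only [v]
            rw [indicator_of_mem (mem_Ici.2 ht')]
          · rw [indicator_of_mem ht]
            simp only [v]
            rw [indicator_of_notMem (by simpa using ht')]
            simp
        · rw [indicator_of_notMem ht]; exact bot_le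
      refine h1.trans ?_
      have h3 : Integrable (fun t => ‖D n t‖ ^ 2) (volume.restrict (Icc s ((j : ℝ) + 1))) :=
        ((hm n _).integrable_norm_pow two_ne_zero).mono_measure
          (Measure.restrict_mono (Set.Icc_subset_Icc_left (le_max_left _ _)) le_rfl)
      have h4 : ∫⁻ t in Icc s ((j : ℝ) + 1), ‖D n t‖ₑ ^ 2
          = ofReal (∫ t in Icc s ((j : ℝ) + 1), ‖D n t‖ ^ 2) := by
        rw [ofReal_integral_eq_lintegral_ofReal h3 (ae_of_all _ fun _ => by positivity)]
        refine lintegral_congr fun t => ?_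
        rw [ENNReal.ofReal_pow (norm_nonneg _), ofReal_norm]
      rw [h4]
      refine ofReal_le_ofReal ?_
      rw [integral_Icc_eq_integral_Ioc, ← integral_of_le hsj]
      refine (hD n s _ (le_max_left _ _) hsj).trans ?_
      have : (j : ℝ) ≤ s := le_max_right _ _
      nlinarith
    · have h1 : ∫⁻ t in Set.Ico (j : ℝ) (j + 1), ‖v n t‖ₑ ^ 2 = 0 := by
        rw [setLIntegral_eq_zero_iff' measurableSet_Ico ((hm' n).restrict.enorm.pow_const 2)]
        refine ae_of_all _ fun t ht => ?_
        have h2 : (j : ℝ) + 1 < T n := by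
          rcases lt_max_iff.1 hsj with h | h
          · exact h
          · linarith
        simp only [v]
        rw [indicator_of_notMem (by simpa using ht.2.trans h2)]
        simp
      rw [h1]; exact bot_le
  obtain ⟨k, hk, D', h1, h2⟩ := exists_subseq_tendstoWeakL2Loc hm' hv
  refine ⟨k, hk, D', h1, fun K Φ hΦ => (h2 K Φ hΦ).congr' ?_⟩
  filter_upwards [(hT.comp hk.tendsto_atTop).eventually (eventually_le_atBot (-K))] with n hn
  refine setIntegral_congr_fun measurableSet_Icc fun t ht => ?_
  have : T (k n) ≤ t := le_trans hn ht.1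
  simp only [v]
  rw [indicator_of_mem (mem_Ici.2 this)]

theorem TendstoWeakL2Loc.comp_strictMono {v : ℕ → ℝ → H} (h : TendstoWeakL2Loc v v') {k : ℕ → ℕ}
    (hk : StrictMono k) : TendstoWeakL2Loc (fun n => v (k n)) v' := fun K Φ hΦ =>
  (h K Φ hΦ).comp hk.tendsto_atTop

theorem TendstoCWeakLoc.comp_strictMono {v : ℕ → ℝ → H} (h : TendstoCWeakLoc v v') {k : ℕ → ℕ}
    (hk : StrictMono k) : TendstoCWeakLoc (fun n => v (k n)) v' := fun w K s hs =>
  hk.tendsto_atTop.eventually (h w K s hs)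

/-- Weak convergence of pairs. -/
theorem tendstoWeakL2Loc_toLp {A B : Type*} [NormedAddCommGroup A] [InnerProductSpace ℝ A]
    [NormedAddCommGroup B] [InnerProductSpace ℝ B] {a : ℕ → ℝ → A} {a' : ℝ → A} {b : ℕ → ℝ → B}
    {b' : ℝ → B} (ha : TendstoWeakL2Loc a a') (hb : TendstoWeakL2Loc b b')
    (ham : ∀ K, ∀ᶠ n in atTop, MemLp (a n) 2 (volume.restrict (Icc (-K) K)))
    (hbm : ∀ K, ∀ᶠ n in atTop, MemLp (b n) 2 (volume.restrict (Icc (-K) K)))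
    (ham' : ∀ K, MemLp a' 2 (volume.restrict (Icc (-K) K)))
    (hbm' : ∀ K, MemLp b' 2 (volume.restrict (Icc (-K) K))) :
    TendstoWeakL2Loc (fun n t => toLp 2 (a n t, b n t))
      (fun t => toLp 2 (a' t, b' t)) := by
  intro K Φ hΦ
  have h1 : MemLp (fun t => (Φ t).fst) 2 (volume.restrict (Icc (-K) K)) :=
    (WithLp.fstL 2 ℝ A B).comp_memLp' hΦ
  have h2 : MemLp (fun t => (Φ t).snd) 2 (volume.restrict (Icc (-K) K)) :=
    (WithLp.sndL 2 ℝ A B).comp_memLp' hΦ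
  simp_rw [inner_toLp_eq]
  rw [integral_add ((ham' K).integrable_real_inner h1) ((hbm' K).integrable_real_inner h2)]
  refine ((ha K _ h1).add (hb K _ h2)).congr' ?_
  filter_upwards [ham K, hbm K] with n c1 c2
  rw [integral_add (c1.integrable_real_inner h1) (c2.integrable_real_inner h2)]

/-- Weak convergence tested with constants on intervals. -/
theorem TendstoWeakL2Loc.tendsto_intervalIntegral {v : ℕ → ℝ → H} (h : TendstoWeakL2Loc v v')
    {a b : ℝ} (hab : a ≤ b) (w : H) :
    Tendsto (fun n => ∫ t in a..b, ⟪v n t, w⟫_ℝ) atTop (𝓝 (∫ t in a..b, ⟪v' t, w⟫_ℝ)) := by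
  set K := max |a| |b|
  have hsub : Ioc a b ⊆ Icc (-K) K := fun t ht =>
    ⟨(neg_le_neg (le_max_left _ _)).trans ((neg_abs_le a).trans ht.1.le),
      ht.2.trans ((le_abs_self b).trans (le_max_right _ _))⟩
  have hm : MemLp ((Ioc a b).indicator fun _ => w) 2 (volume.restrict (Icc (-K) K)) :=
    (memLp_const w).indicator measurableSet_Ioc
  have e : ∀ f : ℝ → H, ∫ t in Icc (-K) K, ⟪f t, (Ioc a b).indicator (fun _ => w) t⟫_ℝ
      = ∫ t in a..b, ⟪f t, w⟫_ℝ := by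
    intro f
    have e1 : (fun t => ⟪f t, (Ioc a b).indicator (fun _ => w) t⟫_ℝ)
        = (Ioc a b).indicator fun t => ⟪f t, w⟫_ℝ := by
      ext t
      by_cases ht : t ∈ Ioc a b <;> simp [ht]
    rw [e1, setIntegral_indicator measurableSet_Ioc, Set.inter_eq_right.2 hsub,
      integral_of_le hab]
  have := h K _ hm
  simpa only [e] using this

end WeakCompactness

section Equicontinuity

variable {H : Type*} [NormedAddCommGroup H] [InnerProductSpace ℝ H] {v : ℕ → ℝ → H}
  {T : ℕ → ℝ} {R : ℝ}

theorem isClosed_weaklyEquicont (hR : ∀ n t, T n ≤ t → ‖v n t‖ ≤ R) :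
    IsClosed {w | WeaklyEquicont v T w} := by
  have hR0 : 0 ≤ R := (norm_nonneg _).trans (hR 0 (T 0) le_rfl)
  refine isClosed_of_closure_subset fun w hw ε hε => ?_
  obtain ⟨w', hw', hd⟩ := Metric.mem_closure_iff.1 hw (ε / (4 * (R + 1))) (by positivity)
  obtain ⟨δ, hδ, h1⟩ := hw' (ε / 2) (by positivity)
  refine ⟨δ, hδ, fun n s t hs hst htδ => ?_⟩
  have h2 : ∀ r, T n ≤ r → |⟪v n r, w - w'⟫_ℝ| ≤ ε / 4 := fun r hr => by
    refine (abs_real_inner_le_norm _ _).trans ?_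
    rw [dist_eq_norm] at hd
    calc ‖v n r‖ * ‖w - w'‖ ≤ (R + 1) * (ε / (4 * (R + 1))) :=
          mul_le_mul ((hR n r hr).trans (by linarith)) hd.le (norm_nonneg _) (by positivity)
      _ = ε / 4 := by field_simp
  have a1 := abs_le.1 (h1 n s t hs hst htδ)
  have a2 := h2 s hs
  have a3 := h2 t (hs.trans hst)
  rw [inner_sub_right] at a2 a3
  have a2' := abs_le.1 a2
  have a3' := abs_le.1 a3
  rw [abs_le]
  constructor <;> linarith [a1.1, a1.2, a2'.1, a2'.2, a3'.1, a3'.2]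

theorem WeaklyEquicont.add {w w' : H} (h : WeaklyEquicont v T w) (h' : WeaklyEquicont v T w') :
    WeaklyEquicont v T (w + w') := by
  intro ε hε
  obtain ⟨δ, hδ, h1⟩ := h (ε / 2) (by positivity)
  obtain ⟨δ', hδ', h1'⟩ := h' (ε / 2) (by positivity)
  refine ⟨min δ δ', lt_min hδ hδ', fun n s t hs hst ht => ?_⟩
  have a1 := abs_le.1 (h1 n s t hs hst (ht.trans (by gcongr; exact min_le_left _ _)))
  have a2 := abs_le.1 (h1' n s t hs hst (ht.trans (by gcongr; exact min_le_right _ _)))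
  rw [inner_add_right, inner_add_right, abs_le]
  constructor <;> linarith [a1.1, a1.2, a2.1, a2.2]

end Equicontinuity

section Sequences

variable {Ωh : Opens E2} {μ κ α : ℝ} {g : X3} {ϑB : X3 → ℝ}

/-- A sequence of weak solutions on half lines exhausting the real line, with uniform bounds. -/
structure BoundedSolutions (Ωh : Opens E2) (μ κ α : ℝ) (g : X3) (ϑB : X3 → ℝ) (T : ℕ → ℝ)
    (u : ℕ → ℝ → L2Vel Ωh) (Du : ℕ → ℝ → L2GradVel Ωh)
    (Θ : ℕ → ℝ → L2Temp Ωh) (DΘ : ℕ → ℝ → L2GradTemp Ωh) (S R C : ℝ) : Prop where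
  T_lim : Tendsto T atTop atBot
  sol : ∀ n, IsWeakSolution Ωh μ κ α g ϑB (Ici (T n)) (u n) (Du n) (Θ n) (DΘ n)
  S_nonneg : 0 ≤ S
  C_nonneg : 0 ≤ C
  Θ_le : ∀ n t, T n ≤ t → ∀ᵐ x ∂vol3 Ωh, |Θ n t x| ≤ S
  u_le : ∀ n t, T n ≤ t → ‖u n t‖ ≤ R
  Du_le : ∀ n s t, T n ≤ s → s ≤ t → ∫ τ in s..t, ‖Du n τ‖ ^ 2 ≤ C * (1 + (t - s))
  DΘ_le : ∀ n s t, T n ≤ s → s ≤ t → ∫ τ in s..t, ‖DΘ n τ‖ ^ 2 ≤ C * (1 + (t - s))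

variable {T : ℕ → ℝ} {u : ℕ → ℝ → L2Vel Ωh} {Du : ℕ → ℝ → L2GradVel Ωh}
    {Θ : ℕ → ℝ → L2Temp Ωh} {DΘ : ℕ → ℝ → L2GradTemp Ωh} {S R C : ℝ}

theorem BoundedSolutions.comp (h : BoundedSolutions Ωh μ κ α g ϑB T u Du Θ DΘ S R C) {k : ℕ → ℕ}
    (hk : StrictMono k) :
    BoundedSolutions Ωh μ κ α g ϑB (fun n => T (k n)) (fun n => u (k n)) (fun n => Du (k n))
      (fun n => Θ (k n)) (fun n => DΘ (k n)) S R C :=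
  ⟨h.T_lim.comp hk.tendsto_atTop, fun _ => h.sol _, h.S_nonneg, h.C_nonneg, fun _ => h.Θ_le _,
    fun _ => h.u_le _, fun _ => h.Du_le _, fun _ => h.DΘ_le _⟩

/-- Solutions with bounded initial data satisfy uniform bounds. -/
theorem exists_boundedSolutions (hΩ : IsBoundedC2 Ωh) (hμ : 0 < μ) (hκ : 0 < κ) (hα : 0 ≤ α)
    (hα1 : α < 1) {M MB : ℝ} (hM0 : 0 ≤ M) (hMB0 : 0 ≤ MB) (hϑ : ContDiff ℝ 2 ϑB)
    (hM : ∀ y ∈ Ωh, ‖gradF g y‖ ≤ M) (hMB : ∀ x ∈ frontier (cyl Ωh : Set X3), |ϑB x| ≤ MB)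
    {F₀ : ℝ} (hT : Tendsto T atTop atBot)
    (h : ∀ n, IsWeakSolution Ωh μ κ α g ϑB (Ici (T n)) (u n) (Du n) (Θ n) (DΘ n))
    (h0 : ∀ n, ‖u n (T n)‖ₑ + eLpNorm (Θ n (T n)) ∞ (vol3 Ωh) ≤ ofReal F₀) :
    ∃ S R C, BoundedSolutions Ωh μ κ α g ϑB T u Du Θ DΘ S R C := by
  have hfin := isFiniteMeasure_vol3 hΩ.1
  have h1α : 0 < 1 - α := by linarith
  set F := max F₀ 0
  have hF0 : 0 ≤ F := le_max_right _ _
  set S := max F (MB / (1 - α)) with hS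
  have hS0 : 0 ≤ S := le_max_of_le_left hF0
  have hΘ : ∀ n t, T n ≤ t → ∀ᵐ x ∂vol3 Ωh, |Θ n t x| ≤ S := by
    intro n t ht
    refine (h n).max_principle hΩ.1 hϑ hκ hMB0 hMB hα hα1 ?_ ?_ ht
    · calc MB = (1 - α) * (MB / (1 - α)) := by field_simp
        _ ≤ (1 - α) * S := mul_le_mul_of_nonneg_left (le_max_right _ _) h1α.le
    · filter_upwards [ae_abs_le_of_eLpNorm_le (le_trans le_add_self (h0 n))] with x hx
      exact hx.trans (le_max_left _ _)
  set B := √(S ^ 2 * volC Ωh)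
  have hΘB : ∀ n t, T n ≤ t → ‖Θ n t‖ ≤ B := fun n t ht =>
    le_sqrt_of_sq_le (norm_sq_le_of_bdd (hΘ n t ht))
  obtain ⟨q, E, hq0, hq1, hE0, hE⟩ := exists_velocity_constants hΩ hμ hM0
    (Real.sqrt_nonneg _ : 0 ≤ B)
  have hu0 : ∀ n, ‖u n (T n)‖ ≤ F := fun n => by
    have h2 : ‖u n (T n)‖ₑ ≤ ofReal F := (le_trans le_self_add (h0 n)).trans
      (ofReal_le_ofReal (le_max_left _ _))
    rw [← ofReal_norm] at h2
    exact (ENNReal.ofReal_le_ofReal_iff hF0).1 h2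
  set R := √(F ^ 2 + E) with hR
  have hR2 : R ^ 2 = F ^ 2 + E := Real.sq_sqrt (by positivity)
  have hu : ∀ n t, T n ≤ t → ‖u n t‖ ≤ R := fun n t ht => by
    refine le_sqrt_of_sq_le ((hE hM (h n) (hΘB n) le_rfl ht).1.trans ?_)
    have h2 : q ^ ⌊t - T n⌋₊ ≤ 1 := pow_le_one₀ hq0 hq1.le
    have h3 : ‖u n (T n)‖ ^ 2 ≤ F ^ 2 := pow_le_pow_left₀ (norm_nonneg _) (hu0 n) 2
    nlinarith [sq_nonneg ‖u n (T n)‖]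
  obtain ⟨C, hC0, hC⟩ := exists_dissipation_bound hΩ.1 hϑ μ g hκ hα hS0 (Real.sqrt_nonneg _ : 0 ≤ R)
  have hc1 : 0 ≤ 2 / μ * R ^ 2 + E := by positivity
  refine ⟨S, R, C + (2 / μ * R ^ 2 + E), hT, h, hS0, by positivity, hΘ, hu, ?_, ?_⟩
  · intro n s t hs hst
    refine (hE hM (h n) (hΘB n) hs hst).2.trans ?_
    have h4 : ‖u n s‖ ^ 2 ≤ R ^ 2 := pow_le_pow_left₀ (norm_nonneg _) (hu n s hs) 2
    have h5 : 0 ≤ t - s := sub_nonneg.2 hst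
    have h6 : 2 / μ * ‖u n s‖ ^ 2 ≤ 2 / μ * R ^ 2 := by gcongr
    have h7 : 0 ≤ 2 / μ * R ^ 2 := by positivity
    nlinarith [mul_nonneg hC0 h5, mul_nonneg h7 h5]
  · intro n s t hs hst
    refine (hC (h n) (hΘ n) (hu n) hs hst).trans ?_
    have h5 : 0 ≤ t - s := sub_nonneg.2 hst
    exact mul_le_mul_of_nonneg_right (by linarith) (by positivity)

theorem BoundedSolutions.norm_Θ_le [IsFiniteMeasure (vol3 Ωh)]
    (h : BoundedSolutions Ωh μ κ α g ϑB T u Du Θ DΘ S R C) (n : ℕ) {t : ℝ} (ht : T n ≤ t) :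
    ‖Θ n t‖ ≤ √(S ^ 2 * volC Ωh) :=
  le_sqrt_of_sq_le (norm_sq_le_of_bdd (h.Θ_le n t ht))

/-- The velocities are perpendicular to the complement of the solenoidal fields. -/
theorem IsWeakSolution.inner_u_eq_zero (hΩ : IsBoundedC2 Ωh) {T : ℝ} {u : ℝ → L2Vel Ωh}
    {Du : ℝ → L2GradVel Ωh} {Θ : ℝ → L2Temp Ωh} {DΘ : ℝ → L2GradTemp Ωh}
    (h : IsWeakSolution Ωh μ κ α g ϑB (Ici T) u Du Θ DΘ) {w : L2Vel Ωh}
    (hw : ∀ p ∈ Vsol Ωh, ⟪p.fst, w⟫_ℝ = 0) {t : ℝ} (ht : T ≤ t) : ⟪u t, w⟫_ℝ = 0 := by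
  have h1 : (fun t => ⟪u t, w⟫_ℝ) =ᵐ[volume.restrict (Ici T)] fun _ => (0 : ℝ) := by
    filter_upwards [h.ae_mem_Vsol hΩ] with t ht
    exact hw _ ht
  exact Measure.eqOn_of_ae_eq h1 (h.u_weakCont w) continuousOn_const
    (by rw [interior_Ici, closure_Ioi]) (mem_Ici.2 ht)

theorem abs_inner_momForce_le {M : ℝ} (hM : ∀ y ∈ Ωh, ‖gradF g y‖ ≤ M) (hμ : 0 < μ) :
    ∃ c, 0 ≤ c ∧ ∀ {v : L2Vel Ωh} {D : L2GradVel Ωh} {θ : L2Temp Ωh} {R B : ℝ},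
      toLp 2 (v, D) ∈ W0 Ωh gradVecL → ‖v‖ ≤ R → ‖θ‖ ≤ B → ∀ p : SobPair E2 E22 Ωh,
      |⟪momForce μ (buoyancy g hM) v D θ, p⟫_ℝ|
        ≤ B * ‖buoyancy g hM p.fst‖ + (c * R + μ) * ‖p.snd‖ * ‖D‖ := by
  obtain ⟨c, hc0, hc, -⟩ := exists_norm_tens_le (Ωh := Ωh)
  refine ⟨c, hc0, fun {v D θ R B} hv hR hB p => ?_⟩
  rw [inner_momForce, tensProj_of_mem hv]
  have h1 : |⟪tens (toLp 2 (v, D)), p.snd⟫_ℝ| ≤ c * R * ‖D‖ * ‖p.snd‖ := by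
    refine (abs_real_inner_le_norm _ _).trans (mul_le_mul_of_nonneg_right ?_ (norm_nonneg _))
    refine (hc _ hv).trans ?_
    rw [mul_assoc]
    exact mul_le_mul_of_nonneg_left (mul_le_mul_of_nonneg_right hR (norm_nonneg _)) hc0
  have h2 : |μ * ⟪D, p.snd⟫_ℝ| ≤ μ * (‖D‖ * ‖p.snd‖) := by
    rw [abs_mul, abs_of_pos hμ]
    exact mul_le_mul_of_nonneg_left (abs_real_inner_le_norm _ _) hμ.le
  have h3 : |⟪θ, buoyancy g hM p.fst⟫_ℝ| ≤ B * ‖buoyancy g hM p.fst‖ :=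
    (abs_real_inner_le_norm _ _).trans (mul_le_mul_of_nonneg_right hB (norm_nonneg _))
  have a1 := abs_le.1 h1
  have a2 := abs_le.1 h2
  have a3 := abs_le.1 h3
  rw [abs_le]
  constructor <;> nlinarith [a1.1, a1.2, a2.1, a2.2, a3.1, a3.2]

theorem BoundedSolutions.weaklyEquicont_fst (hΩ : IsBoundedC2 Ωh) (hμ : 0 < μ) {M : ℝ}
    (hM : ∀ y ∈ Ωh, ‖gradF g y‖ ≤ M) (h : BoundedSolutions Ωh μ κ α g ϑB T u Du Θ DΘ S R C)
    {p : SobPair E2 E22 Ωh} (hp : p ∈ Vsol Ωh) : WeaklyEquicont u T p.fst := by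
  have hfin := isFiniteMeasure_vol3 hΩ.1
  intro ε hε
  obtain ⟨c, hc0, hc⟩ := abs_inner_momForce_le (g := g) hM hμ
  have hR0 : 0 ≤ R := (norm_nonneg _).trans (h.u_le 0 (T 0) le_rfl)
  have hC0 := h.C_nonneg
  set a := √(S ^ 2 * volC Ωh) * ‖buoyancy g hM p.fst‖
  set b := (c * R + μ) * ‖p.snd‖
  have ha0 : 0 ≤ a := by positivity
  have hb0 : 0 ≤ b := by positivity
  set ρ := ε / (4 * (b * C + 1)) with hρ
  have hρ0 : 0 < ρ := by positivity
  set δ := min 1 (ε / (2 * (a + b / (4 * ρ) + 1))) with hδ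
  have hδ0 : 0 < δ := lt_min one_pos (by positivity)
  refine ⟨δ, hδ0, fun n s t hs hst htδ => ?_⟩
  rw [← inner_sub_left, (h.sol n).vel_increment hΩ hM hp hs hst]
  have hDi : IntervalIntegrable (fun τ => ‖Du n τ‖ ^ 2) volume s t :=
    intervalIntegrable_of_Icc hst <| ((h.sol n).memLp_Du hs t).integrable_norm_pow (by norm_num)
  have hi2 : IntervalIntegrable (fun τ => (a + b / (4 * ρ)) + b * ρ * ‖Du n τ‖ ^ 2) volume s t :=
    intervalIntegrable_const.add (hDi.const_mul _)
  have h1 : ∀ᵐ τ ∂volume.restrict (Ioc s t),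
      ‖⟪momForce μ (buoyancy g hM) (u n τ) (Du n τ) (Θ n τ), p⟫_ℝ‖
        ≤ (a + b / (4 * ρ)) + b * ρ * ‖Du n τ‖ ^ 2 := by
    have h2 := ae_Icc_of_ae_Ici (b := t) hs ((h.sol n).ae_mem_Vsol hΩ)
    filter_upwards [ae_restrict_of_ae_restrict_of_subset Set.Ioc_subset_Icc_self h2,
      ae_restrict_mem measurableSet_Ioc] with τ hτ hτm
    have h3 := hc (Vsol_le_W0 hτ) (h.u_le n τ (hs.trans hτm.1.le))
      (h.norm_Θ_le n (hs.trans hτm.1.le)) p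
    rw [norm_eq_abs]
    have h4 : ‖Du n τ‖ ≤ 1 / (4 * ρ) + ρ * ‖Du n τ‖ ^ 2 := by
      rw [← sub_nonneg]
      have : 1 / (4 * ρ) + ρ * ‖Du n τ‖ ^ 2 - ‖Du n τ‖ = (2 * ρ * ‖Du n τ‖ - 1) ^ 2 / (4 * ρ) := by
        field_simp; ring
      rw [this]; positivity
    calc _ ≤ a + b * ‖Du n τ‖ := h3
      _ ≤ a + b * (1 / (4 * ρ) + ρ * ‖Du n τ‖ ^ 2) := by gcongr
      _ = _ := by ring
  have h5 := intervalIntegral.norm_integral_le_of_norm_le hst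
    ((ae_restrict_iff' measurableSet_Ioc).1 h1) hi2
  rw [intervalIntegral.integral_add intervalIntegrable_const (hDi.const_mul _),
    intervalIntegral.integral_const_mul, intervalIntegral.integral_const, smul_eq_mul] at h5
  rw [← norm_eq_abs]
  refine h5.trans ?_
  have h6 : t - s ≤ δ := by linarith
  have h7 : ∫ τ in s..t, ‖Du n τ‖ ^ 2 ≤ C * 2 :=
    (h.Du_le n s t hs hst).trans (mul_le_mul_of_nonneg_left
      (by linarith [min_le_left 1 (ε / (2 * (a + b / (4 * ρ) + 1)))]) hC0)
  have h8 : (t - s) * (a + b / (4 * ρ)) ≤ ε / 2 := by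
    calc (t - s) * (a + b / (4 * ρ)) ≤ (ε / (2 * (a + b / (4 * ρ) + 1))) * (a + b / (4 * ρ) + 1) :=
          mul_le_mul (h6.trans (min_le_right _ _)) (by linarith) (by positivity) (by positivity)
      _ = ε / 2 := by field_simp
  have h9 : b * ρ * ∫ τ in s..t, ‖Du n τ‖ ^ 2 ≤ ε / 2 := by
    calc _ ≤ b * ρ * (C * 2) := mul_le_mul_of_nonneg_left h7 (by positivity)
      _ = (b * C) * (ε / (2 * (b * C + 1))) := by rw [hρ]; field_simp; ring
      _ ≤ (b * C + 1) * (ε / (2 * (b * C + 1))) :=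
          mul_le_mul_of_nonneg_right (by linarith) (by positivity)
      _ = ε / 2 := by field_simp
  linarith

theorem BoundedSolutions.weaklyEquicont (hΩ : IsBoundedC2 Ωh) (hμ : 0 < μ) {M : ℝ}
    (hM : ∀ y ∈ Ωh, ‖gradF g y‖ ≤ M) (h : BoundedSolutions Ωh μ κ α g ϑB T u Du Θ DΘ S R C)
    (w : L2Vel Ωh) : WeaklyEquicont u T w := by
  let U : Submodule ℝ (L2Vel Ωh) :=
    ((Vsol Ωh).map (WithLp.fstL 2 ℝ (L2Vel Ωh) (L2GradVel Ωh)).toLinearMap).topologicalClosure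
  have hUc : IsClosed (U : Set (L2Vel Ωh)) := Submodule.isClosed_topologicalClosure _
  have : CompleteSpace U := hUc.completeSpace_coe
  obtain ⟨y, hy, z, hz, rfl⟩ := U.exists_add_mem_mem_orthogonal w
  refine WeaklyEquicont.add ?_ ?_
  · have hsub : (U : Set (L2Vel Ωh)) ⊆ {w | WeaklyEquicont u T w} := by
      rw [topologicalClosure_coe]
      refine closure_minimal ?_ (isClosed_weaklyEquicont h.u_le)
      rintro _ ⟨p, hp, rfl⟩
      exact h.weaklyEquicont_fst hΩ hμ hM hp
    exact hsub hy
  · intro ε hε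
    refine ⟨1, one_pos, fun n s t hs hst _ => ?_⟩
    have h0 : ∀ p ∈ Vsol Ωh, ⟪p.fst, z⟫_ℝ = 0 := fun p hp =>
      (Submodule.mem_orthogonal _ _).1 hz _
        (Submodule.le_topologicalClosure _ (Submodule.mem_map_of_mem hp))
    rw [(h.sol n).inner_u_eq_zero hΩ h0 (hs.trans hst), (h.sol n).inner_u_eq_zero hΩ h0 hs]
    simpa using hε.le

theorem forall_mem_toLp {A B : Type*} [NormedAddCommGroup A] [NormedAddCommGroup B]
    [NormedSpace ℝ A] [NormedSpace ℝ B] {W : Submodule ℝ (WithLp 2 (A × B))} {Q : A → B → Prop}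
    (hQ : ∀ q ∈ W, Q q.fst q.snd) {a : A} {b : B} (h : toLp 2 (a, b) ∈ W) : Q a b := hQ _ h

theorem toLp_sub_mem {A B : Type*} [NormedAddCommGroup A] [NormedAddCommGroup B]
    [NormedSpace ℝ A] [NormedSpace ℝ B] {W : Submodule ℝ (WithLp 2 (A × B))} {a a' : A} {b b' : B}
    (h : toLp 2 (a, b) ∈ W) (h' : toLp 2 (a', b') ∈ W) :
    toLp 2 (a - a', b - b') ∈ W := W.sub_mem h h'

/-- Bounded sequences of solutions that converge in the weak topologies. -/
structure ConvergentSolutions (Ωh : Opens E2) (μ κ α : ℝ) (g : X3) (ϑB : X3 → ℝ) (T : ℕ → ℝ)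
    (u : ℕ → ℝ → L2Vel Ωh) (Du : ℕ → ℝ → L2GradVel Ωh)
    (Θ : ℕ → ℝ → L2Temp Ωh) (DΘ : ℕ → ℝ → L2GradTemp Ωh) (S R C : ℝ)
    (u' : ℝ → L2Vel Ωh) (Du' : ℝ → L2GradVel Ωh) (DΘ' : ℝ → L2GradTemp Ωh) : Prop extends
    BoundedSolutions Ωh μ κ α g ϑB T u Du Θ DΘ S R C where
  u_conv : TendstoCWeakLoc u u'
  u_cont : ∀ w, Continuous fun t => ⟪u' t, w⟫_ℝ
  u'_le : ∀ t, ‖u' t‖ ≤ R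
  Du_conv : TendstoWeakL2Loc Du Du'
  Du'_memLp : ∀ K : ℝ, MemLp Du' 2 (volume.restrict (Icc (-K) K))
  DΘ_conv : TendstoWeakL2Loc DΘ DΘ'
  DΘ'_memLp : ∀ K : ℝ, MemLp DΘ' 2 (volume.restrict (Icc (-K) K))

theorem BoundedSolutions.exists_convergent (hΩ : IsBoundedC2 Ωh) (hμ : 0 < μ) {M : ℝ}
    (hM : ∀ y ∈ Ωh, ‖gradF g y‖ ≤ M) (h : BoundedSolutions Ωh μ κ α g ϑB T u Du Θ DΘ S R C) :
    ∃ k : ℕ → ℕ, StrictMono k ∧ ∃ (u' : ℝ → L2Vel Ωh) (Du' : ℝ → L2GradVel Ωh)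
      (DΘ' : ℝ → L2GradTemp Ωh),
      ConvergentSolutions Ωh μ κ α g ϑB (fun n => T (k n)) (fun n => u (k n)) (fun n => Du (k n))
        (fun n => Θ (k n)) (fun n => DΘ (k n)) S R C u' Du' DΘ' := by
  obtain ⟨k1, hk1, u', hu'R, hu'c, hu'⟩ :=
    exists_subseq_tendstoCWeakLoc h.T_lim h.u_le (h.weaklyEquicont hΩ hμ hM)
  have h1 := h.comp hk1
  obtain ⟨k2, hk2, Du', hDm, hD⟩ := exists_subseq_tendstoWeakL2Loc_of_halfLine h1.C_nonneg h1.T_lim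
    (fun n b => (h1.sol n).memLp_Du le_rfl b) h1.Du_le
  have h2 := h1.comp hk2
  obtain ⟨k3, hk3, DΘ', hDΘm, hDΘ⟩ := exists_subseq_tendstoWeakL2Loc_of_halfLine h2.C_nonneg
    h2.T_lim (fun n b => (h2.sol n).memLp_DΘ le_rfl b) h2.DΘ_le
  exact ⟨fun n => k1 (k2 (k3 n)), hk1.comp (hk2.comp hk3), u', Du', DΘ',
    { toBoundedSolutions := h2.comp hk3
      u_conv := hu'.comp_strictMono (hk2.comp hk3)
      u_cont := hu'c
      u'_le := hu'R
      Du_conv := hD.comp_strictMono hk3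
      Du'_memLp := hDm
      DΘ_conv := hDΘ
      DΘ'_memLp := hDΘm }⟩

variable {u' : ℝ → L2Vel Ωh} {Du' : ℝ → L2GradVel Ωh} {DΘ' : ℝ → L2GradTemp Ωh}
  {Θ' : ℝ → L2Temp Ωh}

local notation "Convergent" =>
  ConvergentSolutions Ωh μ κ α g ϑB T u Du Θ DΘ S R C u' Du' DΘ'

namespace ConvergentSolutions

theorem memLp_u' (h : Convergent) (K : ℝ) :
    MemLp u' 2 (volume.restrict (Icc (-K) K)) :=
  MemLp.of_bound (aestronglyMeasurable_of_continuousOn_inner measurableSet_Icc fun w =>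
    (h.u_cont w).continuousOn) R (ae_of_all _ h.u'_le)

theorem eventually_memLp (h : Convergent)
    (K : ℝ) : ∀ᶠ n in atTop, MemLp (u n) 2 (volume.restrict (Icc (-K) K)) ∧
      MemLp (Du n) 2 (volume.restrict (Icc (-K) K)) ∧
      MemLp (Θ n) 2 (volume.restrict (Icc (-K) K)) ∧
      MemLp (DΘ n) 2 (volume.restrict (Icc (-K) K)) := by
  filter_upwards [h.T_lim.eventually (eventually_le_atBot (-K))] with n hn
  exact ⟨(h.sol n).memLp_u hn K 2, (h.sol n).memLp_Du hn K, (h.sol n).memLp_Θ hn K 2,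
    (h.sol n).memLp_DΘ hn K⟩

theorem u_weak (h : Convergent) :
    TendstoWeakL2Loc u u' :=
  h.u_conv.tendstoWeakL2Loc h.T_lim h.u_le fun n => (h.sol n).u_weakCont

theorem ae_mem_Vsol (hΩ : IsBoundedC2 Ωh)
    (h : Convergent) :
    ∀ᵐ t, toLp 2 (u' t, Du' t) ∈ Vsol Ωh := by
  refine ae_mem_of_tendstoWeakL2Loc (Vsol Ωh) isClosed_Vsol
    (tendstoWeakL2Loc_toLp h.u_weak h.Du_conv
      (fun K => (h.eventually_memLp K).mono fun n hn => hn.1)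
      (fun K => (h.eventually_memLp K).mono fun n hn => hn.2.1) h.memLp_u' h.Du'_memLp)
    (fun K => memLp_toLp (h.memLp_u' K) (h.Du'_memLp K)) fun K => ?_
  filter_upwards [h.T_lim.eventually (eventually_le_atBot (-K))] with n hn
  exact ae_Icc_of_ae_Ici hn ((h.sol n).ae_mem_Vsol hΩ)

/-- Strong convergence of the velocities. -/
theorem tendsto_integral_norm_sq (hΩ : IsBoundedC2 Ωh)
    (h : Convergent) (K : ℝ) :
    Tendsto (fun n => ∫ t in Icc (-K) K, ‖u n t - u' t‖ ^ 2) atTop (𝓝 0) := by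
  rcases lt_or_ge K 0 with hK | hK
  · have : Icc (-K) K = ∅ := Set.Icc_eq_empty (by linarith)
    simp [this]
  set Q := ∫ t in Icc (-K) K, ‖Du' t‖ ^ 2 with hQ
  have hQ0 : 0 ≤ Q := integral_nonneg fun _ => by positivity
  set A := C * (1 + 2 * K) + Q with hA
  have hA0 : 0 ≤ A := by have := h.C_nonneg; positivity
  rw [Metric.tendsto_nhds]
  intro e he
  set ε := √(e / (8 * (A + 1))) with hε
  have hε0 : 0 < ε := Real.sqrt_pos.2 (by positivity)
  have hε2 : ε ^ 2 = e / (8 * (A + 1)) := Real.sq_sqrt (by positivity)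
  set r := √(e / (16 * (K + 1))) with hr
  have hr0 : 0 < r := Real.sqrt_pos.2 (by positivity)
  have hr2 : r ^ 2 = e / (16 * (K + 1)) := Real.sq_sqrt (by positivity)
  obtain ⟨s, C1, hC1, hE⟩ := exists_ehrling hΩ.1 hε0
  have hsmall : ∀ᶠ n in atTop, ∀ w ∈ s, ∀ t ∈ Icc (-K) K,
      |⟪w, u n t - u' t⟫_ℝ| ≤ r / (C1 * s.card + 1) := by
    refine (Filter.eventually_all_finset s).2 fun w _ => ?_
    filter_upwards [Metric.tendstoUniformlyOn_iff.1 (h.u_conv w K) (r / (C1 * s.card + 1))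
      (by positivity)] with n hn t ht
    have := hn t ht
    rw [Real.dist_eq, abs_sub_comm, ← inner_sub_left, real_inner_comm] at this
    exact this.le
  filter_upwards [hsmall, h.T_lim.eventually (eventually_le_atBot (-K)), h.eventually_memLp K]
    with n hn hTn hm
  have hDn : ∫ t in Icc (-K) K, ‖Du n t‖ ^ 2 ≤ C * (1 + 2 * K) := by
    rw [integral_Icc_eq_integral_Ioc, ← integral_of_le (by linarith)]
    refine (h.Du_le n (-K) K hTn (by linarith)).trans_eq ?_
    ring
  have i0 : Integrable (fun t => ‖u n t - u' t‖ ^ 2) (volume.restrict (Icc (-K) K)) :=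
    (hm.1.sub (h.memLp_u' K)).integrable_norm_pow two_ne_zero
  have i1 : Integrable (fun t => ‖Du n t‖ ^ 2) (volume.restrict (Icc (-K) K)) :=
    hm.2.1.integrable_norm_pow two_ne_zero
  have i2 : Integrable (fun t => ‖Du' t‖ ^ 2) (volume.restrict (Icc (-K) K)) :=
    (h.Du'_memLp K).integrable_norm_pow two_ne_zero
  have hle : ∫ t in Icc (-K) K, ‖u n t - u' t‖ ^ 2 ≤
      ∫ t in Icc (-K) K, (4 * ε ^ 2 * (‖Du n t‖ ^ 2 + ‖Du' t‖ ^ 2) + 2 * r ^ 2) := by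
    refine integral_mono_ae i0 (((i1.add i2).const_mul _).add (integrable_const _)) ?_
    filter_upwards [ae_Icc_of_ae_Ici hTn ((h.sol n).ae_mem_Vsol hΩ),
      ae_restrict_of_ae (h.ae_mem_Vsol hΩ), ae_restrict_mem measurableSet_Icc] with t t1 t2 t3
    have key : ‖u n t - u' t‖ ≤ ε * ‖Du n t - Du' t‖ + C1 * ∑ w ∈ s, |⟪w, u n t - u' t⟫_ℝ| :=
      forall_mem_toLp (Q := fun a b => ‖a‖ ≤ ε * ‖b‖ + C1 * ∑ w ∈ s, |⟪w, a⟫_ℝ|) hE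
        (toLp_sub_mem (Vsol_le_W0 t1) (Vsol_le_W0 t2))
    have hsum : C1 * ∑ w ∈ s, |⟪w, u n t - u' t⟫_ℝ| ≤ r := by
      have c1 : ∑ w ∈ s, |⟪w, u n t - u' t⟫_ℝ| ≤ s.card * (r / (C1 * s.card + 1)) := by
        rw [← nsmul_eq_mul]
        exact Finset.sum_le_card_nsmul _ _ _ fun w hw => hn w hw t t3
      calc _ ≤ C1 * (s.card * (r / (C1 * s.card + 1))) := mul_le_mul_of_nonneg_left c1 hC1
        _ = (C1 * s.card) * (r / (C1 * s.card + 1)) := by ring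
        _ ≤ (C1 * s.card + 1) * (r / (C1 * s.card + 1)) :=
            mul_le_mul_of_nonneg_right (by linarith) (by positivity)
        _ = r := by field_simp
    have hsub := norm_sub_le (Du n t) (Du' t)
    have c2 : ‖u n t - u' t‖ ≤ ε * (‖Du n t‖ + ‖Du' t‖) + r :=
      key.trans (add_le_add (mul_le_mul_of_nonneg_left hsub hε0.le) hsum)
    have c3 := pow_le_pow_left₀ (norm_nonneg _) c2 2
    nlinarith [sq_nonneg (ε * (‖Du n t‖ + ‖Du' t‖) - r),
      mul_nonneg (sq_nonneg ε) (sq_nonneg (‖Du n t‖ - ‖Du' t‖))]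
  have i12 : Integrable (fun t => 4 * ε ^ 2 * (‖Du n t‖ ^ 2 + ‖Du' t‖ ^ 2))
      (volume.restrict (Icc (-K) K)) := (i1.add i2).const_mul _
  rw [integral_add i12 (integrable_const _), integral_const_mul, integral_add i1 i2] at hle
  have hvol : ∫ _ in Icc (-K) K, 2 * r ^ 2 = 2 * K * (2 * r ^ 2) := by
    rw [setIntegral_const, smul_eq_mul, measureReal_def, Real.volume_Icc,
      ENNReal.toReal_ofReal (by linarith)]
    ring
  rw [hvol] at hle
  have hnn : 0 ≤ ∫ t in Icc (-K) K, ‖u n t - u' t‖ ^ 2 :=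
    integral_nonneg fun _ => by positivity
  rw [Real.dist_eq, sub_zero, abs_of_nonneg hnn]
  have f1 : 4 * ε ^ 2 * ((∫ t in Icc (-K) K, ‖Du n t‖ ^ 2) + Q) ≤ 4 * ε ^ 2 * A :=
    mul_le_mul_of_nonneg_left (by linarith) (by positivity)
  have f2 : 4 * ε ^ 2 * A ≤ e / 2 := by
    rw [hε2]
    calc 4 * (e / (8 * (A + 1))) * A ≤ 4 * (e / (8 * (A + 1))) * (A + 1) :=
          mul_le_mul_of_nonneg_left (by linarith) (by positivity)
      _ = e / 2 := by field_simp; ring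
  have f3 : 2 * K * (2 * r ^ 2) ≤ e / 4 := by
    rw [hr2]
    calc 2 * K * (2 * (e / (16 * (K + 1)))) ≤ 2 * (K + 1) * (2 * (e / (16 * (K + 1)))) :=
          mul_le_mul_of_nonneg_right (by linarith) (by positivity)
      _ = e / 4 := by field_simp; ring
  linarith

theorem tendsto_integral_norm (hΩ : IsBoundedC2 Ωh)
    (h : Convergent) (K : ℝ) :
    Tendsto (fun n => ∫ t in Icc (-K) K, ‖u n t - u' t‖) atTop (𝓝 0) := by
  rw [Metric.tendsto_nhds]
  intro e he
  set V := volume.real (Icc (-K) K)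
  have hV : 0 ≤ V := measureReal_nonneg
  set δ := e / (2 * (V + 1)) with hδ
  have hδ0 : 0 < δ := by positivity
  filter_upwards [Metric.tendsto_nhds.1 (h.tendsto_integral_norm_sq hΩ K) (2 * δ * e)
    (by positivity), h.eventually_memLp K] with n hn hm
  have hnn : 0 ≤ ∫ t in Icc (-K) K, ‖u n t - u' t‖ := integral_nonneg fun _ => norm_nonneg _
  have hnn' : 0 ≤ ∫ t in Icc (-K) K, ‖u n t - u' t‖ ^ 2 :=
    integral_nonneg fun _ => by positivity
  rw [Real.dist_eq, sub_zero, abs_of_nonneg hnn'] at hn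
  rw [Real.dist_eq, sub_zero, abs_of_nonneg hnn]
  have i0 : Integrable (fun t => ‖u n t - u' t‖ ^ 2) (volume.restrict (Icc (-K) K)) :=
    (hm.1.sub (h.memLp_u' K)).integrable_norm_pow two_ne_zero
  have hle : ∫ t in Icc (-K) K, ‖u n t - u' t‖ ≤
      ∫ t in Icc (-K) K, (δ + (4 * δ)⁻¹ * ‖u n t - u' t‖ ^ 2) := by
    refine integral_mono ((hm.1.sub (h.memLp_u' K)).norm.integrable (by norm_num))
      ((integrable_const _).add (i0.const_mul _)) fun t => ?_
    rw [← sub_nonneg]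
    have : δ + (4 * δ)⁻¹ * ‖u n t - u' t‖ ^ 2 - ‖u n t - u' t‖
        = (2 * δ - ‖u n t - u' t‖) ^ 2 / (4 * δ) := by field_simp; ring
    rw [this]; positivity
  rw [integral_add (integrable_const _) (i0.const_mul _), integral_const_mul, setIntegral_const,
    smul_eq_mul] at hle
  have f1 : V * δ ≤ e / 2 := by
    calc V * δ ≤ (V + 1) * δ := by nlinarith
      _ = e / 2 := by rw [hδ]; field_simp
  have f2 : (4 * δ)⁻¹ * ∫ t in Icc (-K) K, ‖u n t - u' t‖ ^ 2 < e / 2 := by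
    calc _ < (4 * δ)⁻¹ * (2 * δ * e) := mul_lt_mul_of_pos_left hn (by positivity)
      _ = e / 2 := by field_simp; norm_num
  linarith

/-- The temperatures converge locally uniformly in time. -/
theorem exists_tendstoCLoc (hΩ : IsBoundedC2 Ωh) (hϑ : ContDiff ℝ 2 ϑB) (hκ : 0 < κ) (hα : 0 ≤ α)
    (h : Convergent) :
    ∃ Θ' : ℝ → L2Temp Ωh, TendstoCLoc Θ Θ' := by
  have hfin := isFiniteMeasure_vol3 hΩ.1
  obtain ⟨P, hP, hPo⟩ := exists_poincare_temp hΩ.1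
  have hcau : ∀ K, UniformCauchySeqOn Θ atTop (Icc (-K) K) := by
    intro K
    rcases lt_or_ge K 0 with hK | hK
    · have : Icc (-K) K = ∅ := Set.Icc_eq_empty (by linarith)
      rw [this]
      intro U _
      exact Eventually.of_forall fun m x hx => absurd hx (Set.notMem_empty x)
    rw [Metric.uniformCauchySeqOn_iff]
    intro ε hε
    set c := κ / P ^ 2 with hc
    have hc0 : 0 < c := by positivity
    set B := √(S ^ 2 * volC Ωh)
    set J0 := 1 / 2 * (2 * B) ^ 2 + 1 / 2 * (α * (volC Ωh)⁻¹) * (‖oneT Ωh‖ * (2 * B)) ^ 2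
      + ‖(0 : L2Temp Ωh)‖ * (2 * B) with hJ0
    have hlim : Tendsto (fun L : ℕ => (1 + c)⁻¹ ^ L * J0) atTop (𝓝 0) := by
      simpa using (tendsto_pow_atTop_nhds_zero_of_lt_one (by positivity : 0 ≤ (1 + c)⁻¹)
        (inv_lt_one_of_one_lt₀ (by linarith))).mul_const J0
    obtain ⟨L, hL⟩ := (hlim.eventually (gt_mem_nhds (show 0 < ε ^ 2 / 4 by positivity))).exists
    set a := -K - L with ha
    set b := K + L with hb
    have hbL : -b = a := by rw [ha, hb]; ring
    set k := S ^ 2 / (2 * κ) with hk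
    have hk0 : 0 ≤ k := by positivity
    have hul := h.tendsto_integral_norm_sq hΩ b
    have hev := (Metric.tendsto_nhds.1 hul (ε ^ 2 / (16 * (k + 1))) (by positivity)).and
      ((h.T_lim.eventually (eventually_le_atBot a)).and (h.eventually_memLp b))
    obtain ⟨N, hN⟩ := eventually_atTop.1 hev
    refine ⟨N, fun m hm n hn t ht => ?_⟩
    obtain ⟨m1, m2, m3⟩ := hN m hm
    obtain ⟨n1, n2, n3⟩ := hN n hn
    have hmn : ∀ n, 0 ≤ ∫ t in Icc (-b) b, ‖u n t - u' t‖ ^ 2 := fun n =>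
      integral_nonneg fun _ => by positivity
    rw [Real.dist_eq, sub_zero, abs_of_nonneg (hmn _)] at m1 n1
    have s1 := (h.sol m).mono (Set.Ici_subset_Ici.2 m2)
    have s2 := (h.sol n).mono (Set.Ici_subset_Ici.2 n2)
    have hdiff : ∀ p q, a ≤ p → p ≤ q → _ := fun p q hp hpq =>
      temp_diff_energy hΩ.1 hϑ hκ hα h.S_nonneg hP hPo s1 s2
        (fun r hr => h.Θ_le m r (m2.trans hr)) (fun r hr => h.Θ_le n r (n2.trans hr)) hp hpq
    have hJc : Continuous (quadJ α (0 : L2Temp Ωh)) := by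
      obtain ⟨L, hL⟩ := exists_norm_quadG_le α (0 : L2Temp Ωh)
      exact continuous_of_subgradient (quadJ_sub_le hα 0) hL
    have hJi : IntegrableOn (fun τ => quadJ α 0 (Θ m τ - Θ n τ)) (Icc a b) :=
      (hJc.comp_continuousOn ((s1.Θ_cont.sub s2.Θ_cont).mono fun _ ht =>
        mem_Ici.2 ht.1)).integrableOn_compact isCompact_Icc
    have hum : MemLp (fun t => u m t - u n t) 2 (volume.restrict (Icc a b)) :=
      (s1.memLp_u le_rfl b 2).sub (s2.memLp_u le_rfl b 2)
    have hFi : IntegrableOn (fun τ => k * ‖u m τ - u n τ‖ ^ 2) (Icc a b) :=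
      (hum.integrable_norm_pow two_ne_zero).const_mul k
    have hJnn : ∀ x : L2Temp Ωh, 0 ≤ quadJ α 0 x := fun x => by
      have := (two_quadJ_le hα x).1
      nlinarith [sq_nonneg ‖x‖]
    have hat : a ≤ t := by
      have : (0 : ℝ) ≤ L := Nat.cast_nonneg _
      linarith [ht.1]
    have htb : t ≤ b := by
      have : (0 : ℝ) ≤ L := Nat.cast_nonneg _
      linarith [ht.2]
    have key := decay_integrable (f := fun τ => quadJ α 0 (Θ m τ - Θ n τ))
      (F := fun τ => k * ‖u m τ - u n τ‖ ^ 2) hc0.le hJi hFi (fun _ => by positivity)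
      (fun _ => hJnn _) (fun p q hp hpq _ => hdiff p q hp hpq) hat htb
    have hJa : quadJ α 0 (Θ m a - Θ n a) ≤ J0 := by
      refine (le_abs_self _).trans (abs_quadJ_le hα 0 _ ((norm_sub_le _ _).trans ?_))
      have e1 := h.norm_Θ_le m m2
      have e2 := h.norm_Θ_le n n2
      linarith
    have hfl : L ≤ ⌊t - a⌋₊ := Nat.le_floor (by rw [ha]; linarith [ht.1])
    have h1 : (1 + c)⁻¹ ^ ⌊t - a⌋₊ * quadJ α 0 (Θ m a - Θ n a) ≤ (1 + c)⁻¹ ^ L * J0 := by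
      refine mul_le_mul ?_ hJa (hJnn _) (by positivity)
      exact pow_le_pow_of_le_one (by positivity) (inv_le_one_of_one_le₀ (by linarith)) hfl
    have h2 : ∫ τ in a..b, k * ‖u m τ - u n τ‖ ^ 2 ≤ ε ^ 2 / 4 := by
      rw [intervalIntegral.integral_const_mul, integral_of_le (hat.trans htb),
        ← integral_Icc_eq_integral_Ioc]
      rw [hbL] at m1 n1 m3 n3
      have hu'a := h.memLp_u' b
      rw [hbL] at hu'a
      have j1 : Integrable (fun t => ‖u m t - u' t‖ ^ 2) (volume.restrict (Icc a b)) :=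
        (m3.1.sub hu'a).integrable_norm_pow two_ne_zero
      have j2 : Integrable (fun t => ‖u n t - u' t‖ ^ 2) (volume.restrict (Icc a b)) :=
        (n3.1.sub hu'a).integrable_norm_pow two_ne_zero
      have h3 : ∫ t in Icc a b, ‖u m t - u n t‖ ^ 2 ≤
          ∫ t in Icc a b, (2 * ‖u m t - u' t‖ ^ 2 + 2 * ‖u n t - u' t‖ ^ 2) := by
        refine integral_mono (hum.integrable_norm_pow two_ne_zero)
          ((j1.const_mul 2).add (j2.const_mul 2)) fun t => ?_
        have e : u m t - u n t = (u m t - u' t) - (u n t - u' t) := by abel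
        have e1 := norm_sub_le (u m t - u' t) (u n t - u' t)
        rw [← e] at e1
        have e2 := pow_le_pow_left₀ (norm_nonneg _) e1 2
        simp only
        nlinarith [sq_nonneg (‖u m t - u' t‖ - ‖u n t - u' t‖)]
      rw [integral_add (j1.const_mul 2) (j2.const_mul 2), integral_const_mul,
        integral_const_mul] at h3
      have h4 : ∫ t in Icc a b, ‖u m t - u n t‖ ^ 2 ≤ ε ^ 2 / (4 * (k + 1)) := by
        have : ε ^ 2 / (4 * (k + 1)) = 2 * (ε ^ 2 / (16 * (k + 1)))
          + 2 * (ε ^ 2 / (16 * (k + 1))) := by field_simp; norm_num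
        linarith
      calc _ ≤ k * (ε ^ 2 / (4 * (k + 1))) := mul_le_mul_of_nonneg_left h4 hk0
        _ ≤ (k + 1) * (ε ^ 2 / (4 * (k + 1))) :=
            mul_le_mul_of_nonneg_right (by linarith) (by positivity)
        _ = ε ^ 2 / 4 := by field_simp
    have h5 := (two_quadJ_le hα (Θ m t - Θ n t)).1
    have h6 : ‖Θ m t - Θ n t‖ ^ 2 < ε ^ 2 := by
      linarith
    rw [dist_eq_norm]
    exact lt_of_pow_lt_pow_left₀ 2 hε.le h6
  have hex : ∀ t, ∃ θ, Tendsto (fun n => Θ n t) atTop (𝓝 θ) := fun t =>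
    cauchySeq_tendsto_of_complete ((hcau |t|).cauchySeq ⟨neg_abs_le t, le_abs_self t⟩)
  choose Θ' hΘ' using hex
  exact ⟨Θ', fun K => (hcau K).tendstoUniformlyOn_of_tendsto fun t _ => hΘ' t⟩

end ConvergentSolutions

/-- The vectors orthogonal to a set. -/
def annihilatorOf {H : Type*} [NormedAddCommGroup H] [InnerProductSpace ℝ H] (Z : Set H) :
    Submodule ℝ H where
  carrier := {q | ∀ z ∈ Z, ⟪q, z⟫_ℝ = 0}
  zero_mem' := fun z _ => inner_zero_left z
  add_mem' := fun {p q} hp hq z hz => by rw [inner_add_left, hp z hz, hq z hz, add_zero]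
  smul_mem' := fun c q hq z hz => by rw [real_inner_smul_left, hq z hz, mul_zero]

theorem isClosed_annihilatorOf {H : Type*} [NormedAddCommGroup H] [InnerProductSpace ℝ H]
    (Z : Set H) : IsClosed (annihilatorOf Z : Set H) := by
  have : (annihilatorOf Z : Set H) = ⋂ z ∈ Z, {q | ⟪q, z⟫_ℝ = 0} := by
    ext q; simp [annihilatorOf]
  rw [this]
  exact isClosed_biInter fun z _ =>
    isClosed_eq (continuous_id.inner continuous_const) continuous_const

theorem tendsto_intervalIntegral_of_abs_sub_le {f : ℕ → ℝ → ℝ} {f' : ℝ → ℝ} {d : ℕ → ℝ → ℝ}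
    {a b : ℝ} (hab : a ≤ b) (hd : Tendsto (fun n => ∫ t in a..b, d n t) atTop (𝓝 0))
    (hdi : ∀ᶠ n in atTop, IntervalIntegrable (d n) volume a b)
    (hf : ∀ᶠ n in atTop, IntervalIntegrable (f n) volume a b)
    (hf' : IntervalIntegrable f' volume a b)
    (hle : ∀ᶠ n in atTop, ∀ t ∈ Icc a b, |f n t - f' t| ≤ d n t) :
    Tendsto (fun n => ∫ t in a..b, f n t) atTop (𝓝 (∫ t in a..b, f' t)) := by
  rw [tendsto_iff_norm_sub_tendsto_zero]
  refine squeeze_zero' (Eventually.of_forall fun _ => norm_nonneg _) ?_ hd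
  filter_upwards [hdi, hf, hle] with n h1 h2 h3
  rw [← intervalIntegral.integral_sub h2 hf']
  refine (intervalIntegral.norm_integral_le_integral_norm hab).trans ?_
  exact integral_mono_on hab (h2.sub hf').norm h1 h3

theorem Icc_subset_Icc_max_abs (a b : ℝ) :
    Icc a b ⊆ Icc (-max |a| |b|) (max |a| |b|) := fun _ ht =>
  ⟨(neg_le_neg (le_max_left _ _)).trans ((neg_abs_le a).trans ht.1),
    ht.2.trans ((le_abs_self b).trans (le_max_right _ _))⟩

theorem exists_convection_operator (φ : 𝓓(Ωh, E2)) : ∃ A : L2Vel Ωh →L[ℝ] L2Vel Ωh,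
    ∀ v : L2Vel Ωh, ∫ y in Ωh, ⟪v y, fderiv ℝ φ y (v y)⟫_ℝ = ⟪v, A v⟫_ℝ := by
  have hc : Continuous (fderiv ℝ φ) := φ.contDiff.continuous_fderiv (by simp)
  obtain ⟨M, hM⟩ := hc.bounded_above_of_compact_support (φ.hasCompactSupport.fderiv (𝕜 := ℝ))
  refine ⟨mulOp (fderiv ℝ φ) M hc.aestronglyMeasurable (ae_of_all _ hM), fun v => ?_⟩
  rw [L2.inner_def]
  refine integral_congr_ae ?_
  filter_upwards [coeFn_mulOp (μ := volH Ωh) hc.aestronglyMeasurable (ae_of_all _ hM) v] with y hy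
  rw [hy]

theorem exists_divergence_functional (ψ : 𝓓(Ωh, ℝ)) : ∃ w : L2Vel Ωh,
    ∀ v : L2Vel Ωh, ∫ y in Ωh, fderiv ℝ ψ y (v y) = ⟪v, w⟫_ℝ := by
  let L : (E2 →L[ℝ] ℝ) →L[ℝ] E2 :=
    (toDual ℝ E2).symm.toContinuousLinearEquiv.toContinuousLinearMap
  have hm := memLp_grad_testFunction (Ω := Ωh) L ψ
  refine ⟨toL2 (volH Ωh) fun y => L (fderiv ℝ ψ y), fun v => ?_⟩
  rw [inner_toL2_right v hm]
  exact integral_congr_ae (ae_of_all _ fun y =>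
    ((real_inner_comm _ _).trans InnerProductSpace.toDual_symm_apply).symm)

/-- The test pairs in the definition of weak gradients. -/
def weakGradTest (z : 𝓓(cyl Ωh, ℝ) × Fin 3) : SobPair ℝ E3 (cyl Ωh) :=
  toLp 2 (toL2 (vol3 Ωh) fun x => gradScal z.1 x z.2,
    toL2 (vol3 Ωh) fun x => z.1 x • (EuclideanSpace.single z.2 (1 : ℝ) : E3))

theorem hasWeakGradTemp_iff (θ : L2Temp Ωh) (D : L2GradTemp Ωh) : HasWeakGradTemp Ωh θ D ↔
    toLp 2 (θ, D) ∈ annihilatorOf (Set.range (weakGradTest (Ωh := Ωh))) := by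
  have key : ∀ (φ : 𝓓(cyl Ωh, ℝ)) (i : Fin 3), ⟪toLp 2 (θ, D), weakGradTest (φ, i)⟫_ℝ =
      (∫ x in cyl Ωh, θ x * gradScal φ x i) + ∫ x in cyl Ωh, D x i * φ x := by
    intro φ i
    have m1 : MemLp (fun x => gradScal φ x i) 2 (vol3 Ωh) :=
      (EuclideanSpace.proj (𝕜 := ℝ) i).comp_memLp' (memLp_grad_testFunction gradScalL φ)
    have m2 : MemLp (fun x => φ x • (EuclideanSpace.single i (1 : ℝ) : E3)) 2 (vol3 Ωh) :=
      (ContinuousLinearMap.toSpanSingleton ℝ (EuclideanSpace.single i (1 : ℝ) : E3)).comp_memLp'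
        (memLp_testFunction φ)
    rw [inner_toLp_eq]
    congr 1
    · refine (inner_toL2_right θ m1).trans ?_
      simp [mul_comm]
    · refine (inner_toL2_right D m2).trans ?_
      simp [real_inner_smul_right, EuclideanSpace.inner_single_right, mul_comm]
  constructor
  · rintro h _ ⟨⟨φ, i⟩, rfl⟩
    rw [key, h φ i, neg_add_cancel]
  · intro h φ i
    have := h _ ⟨(φ, i), rfl⟩
    rw [key] at this
    linarith

/-- The boundary condition in terms of the gradient of the quadratic functional. -/
theorem memW120Temp_of_quadG [IsFiniteMeasure (vol3 Ωh)] {α : ℝ} {ϑB : X3 → ℝ}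
    (hb : IsBounded (Ωh : Set E2)) (hϑ : ContDiff ℝ 2 ϑB) {θ : L2Temp Ωh}
    {D : L2GradTemp Ωh}
    (h : toLp 2 (quadG α (toL2 (vol3 Ωh) ϑB) θ,
        D - toL2 (vol3 Ωh) fun x => gradScalL (fderiv ℝ ϑB x)) ∈ W0 (cyl Ωh) gradScalL) :
    MemW120Temp Ωh (fun x => θ x - (ϑB x - α * ⨍ z in (cyl Ωh : Set X3), θ z))
      (fun x => D x - gradScal ϑB x) := by
  obtain ⟨φ, h1, h2⟩ := (mem_W0_iff gradScalL _ _).1 h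
  have hbm : MemLp ϑB 2 (vol3 Ωh) := continuous_memLp_volOn (isBounded_cyl hb) hϑ.continuous 2
  have m1 := coeFn_toL2 (hbm.sub (memLp_const (α * meanT θ)))
  have m2 := coeFn_toL2 (memLp_gradient_data hb hϑ)
  have e : quadG α (toL2 (vol3 Ωh) ϑB) θ =
      θ - toL2 (vol3 Ωh) (fun x => ϑB x - α * meanT θ) := by
    rw [toL2_sub_const hbm, quadG, meanT_eq, mul_assoc]
    abel
  refine ⟨φ, h1.congr fun k => eLpNorm_congr_ae ?_, h2.congr fun k => eLpNorm_congr_ae ?_⟩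
  · filter_upwards [Lp.coeFn_sub θ (toL2 (vol3 Ωh) (fun x => ϑB x - α * meanT θ)), m1]
      with x e1 e2
    have e2' : toL2 (vol3 Ωh) (fun x => ϑB x - α * meanT θ) x = ϑB x - α * meanT θ := e2
    rw [e, e1, Pi.sub_apply, e2']
    rfl
  · filter_upwards [Lp.coeFn_sub D (toL2 (vol3 Ωh) fun x => gradScalL (fderiv ℝ ϑB x)), m2]
      with x e1 e2
    rw [e1, Pi.sub_apply, e2]
    rfl

namespace ConvergentSolutions

theorem continuous_Θ' (h : Convergent)
    (hΘ : TendstoCLoc Θ Θ') : Continuous Θ' := by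
  rw [continuous_iff_continuousAt]
  intro t
  have h1 : ContinuousOn Θ' (Icc (-(|t| + 1)) (|t| + 1)) := by
    refine (hΘ (|t| + 1)).continuousOn (Eventually.frequently ?_)
    filter_upwards [h.T_lim.eventually (eventually_le_atBot (-(|t| + 1)))] with n hn
    exact (h.sol n).Θ_cont.mono fun r hr => mem_Ici.2 (hn.trans hr.1)
  refine h1.continuousAt (Icc_mem_nhds ?_ ?_)
  · linarith [neg_abs_le t]
  · linarith [le_abs_self t]

theorem tendsto_Θ (hΘ : TendstoCLoc Θ Θ') (t : ℝ) : Tendsto (fun n => Θ n t) atTop (𝓝 (Θ' t)) :=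
  (hΘ |t|).tendsto_at ⟨neg_abs_le t, le_abs_self t⟩

theorem Θ'_le (h : Convergent)
    (hΘ : TendstoCLoc Θ Θ') (t : ℝ) : ∀ᵐ x ∂vol3 Ωh, |Θ' t x| ≤ S :=
  (isClosed_bdd S).mem_of_tendsto (tendsto_Θ hΘ t)
    ((h.T_lim.eventually (eventually_le_atBot t)).mono fun n hn => h.Θ_le n t hn)

theorem Θ_weak [IsFiniteMeasure (vol3 Ωh)]
    (h : Convergent)
    (hΘ : TendstoCLoc Θ Θ') : TendstoWeakL2Loc Θ Θ' :=
  hΘ.tendstoCWeakLoc.tendstoWeakL2Loc h.T_lim (fun n _ ht => h.norm_Θ_le n ht)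
    fun n _ => (h.sol n).Θ_cont.inner continuousOn_const

theorem memLp_Θ' (h : Convergent)
    (hΘ : TendstoCLoc Θ Θ') (a b : ℝ) : MemLp Θ' 2 (volume.restrict (Icc a b)) := by
  have hc := (h.continuous_Θ' hΘ).continuousOn (s := Icc a b)
  obtain ⟨B, hB⟩ := isCompact_Icc.exists_bound_of_continuousOn hc
  refine MemLp.of_bound (hc.aestronglyMeasurable measurableSet_Icc) B ?_
  filter_upwards [ae_restrict_mem measurableSet_Icc] with t ht using hB t ht

theorem ae_hasWeakGradTemp [IsFiniteMeasure (vol3 Ωh)]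
    (h : Convergent)
    (hΘ : TendstoCLoc Θ Θ') : ∀ᵐ t, HasWeakGradTemp Ωh (Θ' t) (DΘ' t) := by
  have := ae_mem_of_tendstoWeakL2Loc (annihilatorOf (Set.range (weakGradTest (Ωh := Ωh))))
    (isClosed_annihilatorOf _)
    (tendstoWeakL2Loc_toLp (h.Θ_weak hΘ) h.DΘ_conv
      (fun K => (h.eventually_memLp K).mono fun n hn => hn.2.2.1)
      (fun K => (h.eventually_memLp K).mono fun n hn => hn.2.2.2)
      (fun K => h.memLp_Θ' hΘ _ _) h.DΘ'_memLp)
    (fun K => memLp_toLp (h.memLp_Θ' hΘ _ _) (h.DΘ'_memLp K)) fun K => by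
      filter_upwards [h.T_lim.eventually (eventually_le_atBot (-K))] with n hn
      filter_upwards [ae_Icc_of_ae_Ici hn (h.sol n).Θ_grad] with t ht
      exact (hasWeakGradTemp_iff _ _).1 ht
  filter_upwards [this] with t ht
  exact (hasWeakGradTemp_iff _ _).2 ht

theorem quadG_sub (α : ℝ) (b x y : L2Temp Ωh) :
    quadG α b x - quadG α b y = quadG α 0 (x - y) := by
  rw [quadG, quadG, quadG, inner_sub_right, mul_sub, sub_smul]
  abel

theorem exists_norm_quadG_sub_le (α : ℝ) (b : L2Temp Ωh) :
    ∃ L, 0 ≤ L ∧ ∀ x y, ‖quadG α b x - quadG α b y‖ ≤ L * ‖x - y‖ := by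
  refine ⟨1 + |α * (volC Ωh)⁻¹| * ‖oneT Ωh‖ * ‖oneT Ωh‖, by positivity, fun x y => ?_⟩
  rw [quadG_sub, quadG, sub_zero]
  refine (norm_add_le _ _).trans ?_
  rw [norm_smul, norm_eq_abs, abs_mul, add_mul, one_mul]
  refine add_le_add le_rfl ?_
  have h1 := mul_le_mul_of_nonneg_left (mul_le_mul_of_nonneg_right
    (abs_real_inner_le_norm (oneT Ωh) (x - y)) (norm_nonneg (oneT Ωh)))
    (abs_nonneg (α * (volC Ωh)⁻¹))
  refine le_trans (le_of_eq (by ring)) (h1.trans (le_of_eq (by ring)))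

theorem continuous_quadG (α : ℝ) (b : L2Temp Ωh) : Continuous (quadG α b) := by
  unfold quadG
  fun_prop

theorem tendstoWeakL2Loc_quadG [IsFiniteMeasure (vol3 Ωh)]
    (h : Convergent)
    (hΘ : TendstoCLoc Θ Θ') (b : L2Temp Ωh) :
    TendstoWeakL2Loc (fun n t => quadG α b (Θ n t)) (fun t => quadG α b (Θ' t)) := by
  obtain ⟨L, hL0, hL⟩ := exists_norm_quadG_sub_le α b
  have h1 : TendstoCLoc (fun n t => quadG α b (Θ n t)) (fun t => quadG α b (Θ' t)) := by
    intro K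
    rw [Metric.tendstoUniformlyOn_iff]
    intro ε hε
    filter_upwards [Metric.tendstoUniformlyOn_iff.1 (hΘ K) (ε / (L + 1)) (by positivity)]
      with n hn t ht
    have h2 := hn t ht
    rw [dist_eq_norm, lt_div_iff₀ (by positivity)] at h2
    rw [dist_eq_norm]
    refine (hL _ _).trans_lt ?_
    nlinarith [norm_nonneg (Θ' t - Θ n t)]
  refine h1.tendstoCWeakLoc.tendstoWeakL2Loc h.T_lim
    (R := ‖quadG α b 0‖ + L * √(S ^ 2 * volC Ωh)) (fun n t ht => ?_) fun n _ =>
    ((continuous_quadG α b).comp_continuousOn (h.sol n).Θ_cont).inner continuousOn_const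
  have h2 := hL (Θ n t) 0
  rw [sub_zero] at h2
  have h3 := norm_le_norm_add_norm_sub' (quadG α b (Θ n t)) (quadG α b 0)
  have h4 := mul_le_mul_of_nonneg_left (h.norm_Θ_le n ht) hL0
  linarith

theorem TendstoWeakL2Loc_sub_const {H : Type*} [NormedAddCommGroup H] [InnerProductSpace ℝ H]
    {v : ℕ → ℝ → H} {v' : ℝ → H} (h : TendstoWeakL2Loc v v') (w : H)
    (hv : ∀ K, ∀ᶠ n in atTop, MemLp (v n) 2 (volume.restrict (Icc (-K) K)))
    (hv' : ∀ K, MemLp v' 2 (volume.restrict (Icc (-K) K))) :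
    TendstoWeakL2Loc (fun n t => v n t - w) (fun t => v' t - w) := by
  intro K Φ hΦ
  have hw : MemLp (fun _ : ℝ => w) 2 (volume.restrict (Icc (-K) K)) := memLp_const w
  simp_rw [inner_sub_left]
  rw [integral_sub ((hv' K).integrable_real_inner hΦ) (hw.integrable_real_inner hΦ)]
  refine ((h K Φ hΦ).sub_const _).congr' ?_
  filter_upwards [hv K] with n hn
  rw [integral_sub (hn.integrable_real_inner hΦ) (hw.integrable_real_inner hΦ)]

theorem ae_boundary (hΩ : IsBoundedC2 Ωh) (hϑ : ContDiff ℝ 2 ϑB)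
    (h : Convergent)
    (hΘ : TendstoCLoc Θ Θ') : ∀ᵐ t,
    MemW120Temp Ωh (fun x => Θ' t x - (ϑB x - α * ⨍ z in (cyl Ωh : Set X3), Θ' t z))
      (fun x => DΘ' t x - gradScal ϑB x) := by
  have hfin := isFiniteMeasure_vol3 hΩ.1
  set b := toL2 (vol3 Ωh) ϑB
  set N := toL2 (vol3 Ωh) fun x => gradScalL (fderiv ℝ ϑB x)
  have hq : ∀ {v : ℝ → L2Temp Ωh} {K : ℝ}, MemLp v 2 (volume.restrict (Icc (-K) K)) →
      MemLp (fun t => quadG α b (v t)) 2 (volume.restrict (Icc (-K) K)) := by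
    intro v K hv
    obtain ⟨L, hL⟩ := exists_norm_quadG_le α b
    have h1 : MemLp (fun t => L * (1 + ‖v t‖)) 2 (volume.restrict (Icc (-K) K)) :=
      ((memLp_const (1 : ℝ)).add hv.norm).const_mul L
    exact h1.mono' ((continuous_quadG α b).comp_aestronglyMeasurable hv.1)
      (ae_of_all _ fun t => hL _)
  have hN : ∀ {v : ℝ → L2GradTemp Ωh} {K : ℝ}, MemLp v 2 (volume.restrict (Icc (-K) K)) →
      MemLp (fun t => v t - N) 2 (volume.restrict (Icc (-K) K)) :=
    fun hv => hv.sub (memLp_const N)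
  have := ae_mem_of_tendstoWeakL2Loc (W0 (cyl Ωh) gradScalL) (isClosed_W0 gradScalL)
    (tendstoWeakL2Loc_toLp (h.tendstoWeakL2Loc_quadG hΘ b)
      (TendstoWeakL2Loc_sub_const h.DΘ_conv N
        (fun K => (h.eventually_memLp K).mono fun n hn => hn.2.2.2) h.DΘ'_memLp)
      (fun K => (h.eventually_memLp K).mono fun n hn => hq hn.2.2.1)
      (fun K => (h.eventually_memLp K).mono fun n hn => hN hn.2.2.2)
      (fun K => hq (h.memLp_Θ' hΘ _ _)) fun K => hN (h.DΘ'_memLp K))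
    (fun K => memLp_toLp (hq (h.memLp_Θ' hΘ _ _)) (hN (h.DΘ'_memLp K))) fun K => by
      filter_upwards [h.T_lim.eventually (eventually_le_atBot (-K))] with n hn
      exact ae_Icc_of_ae_Ici hn ((h.sol n).ae_quadG_mem_W0 hΩ.1 hϑ)
  filter_upwards [this] with t ht
  exact memW120Temp_of_quadG hΩ.1 hϑ ht

end ConvergentSolutions

/-- The raw momentum form as a quadratic form in the velocity plus linear terms. -/
theorem momentum_form_eq_of_convection {M : ℝ} (hM : ∀ y ∈ Ωh, ‖gradF g y‖ ≤ M) {φ : 𝓓(Ωh, E2)}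
    {A : L2Vel Ωh →L[ℝ] L2Vel Ωh}
    (hA : ∀ v : L2Vel Ωh, ∫ y in Ωh, ⟪v y, fderiv ℝ φ y (v y)⟫_ℝ = ⟪v, A v⟫_ℝ)
    {v : L2Vel Ωh} {D : L2GradVel Ωh} (θ : L2Temp Ωh)
    (hp : toLp 2 (v, D) ∈ W0 Ωh gradVecL) :
    ∫ y in Ωh, (⟪v y, fderiv ℝ φ y (v y)⟫_ℝ - μ * ⟪D y, gradVec φ y⟫_ℝ
          - vmean θ y * ⟪gradF g y, φ y⟫_ℝ) =
      ⟪v, A v⟫_ℝ - μ * ⟪D, (testPair gradVecL φ).snd⟫_ℝ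
        - ⟪θ, buoyancy g hM (testPair gradVecL φ).fst⟫_ℝ := by
  rw [momentum_form_eq hM θ hp φ, inner_momForce, tensProj_of_mem hp, inner_tens_testPair hp φ]
  congr 2
  exact hA v

theorem abs_quadratic_sub_le {H : Type*} [NormedAddCommGroup H] [InnerProductSpace ℝ H]
    (A : H →L[ℝ] H) {v w : H} {R : ℝ} (hv : ‖v‖ ≤ R) (hw : ‖w‖ ≤ R) :
    |⟪v, A v⟫_ℝ - ⟪w, A w⟫_ℝ| ≤ 2 * R * ‖A‖ * ‖v - w‖ := by
  have e : ⟪v, A v⟫_ℝ - ⟪w, A w⟫_ℝ = ⟪v - w, A v⟫_ℝ + ⟪w, A (v - w)⟫_ℝ := by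
    rw [map_sub, inner_sub_left, inner_sub_right]; ring
  have h1 : |⟪v - w, A v⟫_ℝ| ≤ ‖v - w‖ * (‖A‖ * R) :=
    (abs_real_inner_le_norm _ _).trans (mul_le_mul_of_nonneg_left
      ((A.le_opNorm v).trans (mul_le_mul_of_nonneg_left hv (norm_nonneg _))) (norm_nonneg _))
  have h2 : |⟪w, A (v - w)⟫_ℝ| ≤ R * (‖A‖ * ‖v - w‖) :=
    (abs_real_inner_le_norm _ _).trans
      (mul_le_mul hw (A.le_opNorm _) (norm_nonneg _) ((norm_nonneg _).trans hw))
  rw [e]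
  refine (abs_add_le _ _).trans ((add_le_add h1 h2).trans (le_of_eq (by ring)))

theorem memLp_two_mono_Icc {H : Type*} [NormedAddCommGroup H] {f : ℝ → H} {a b K : ℝ}
    (hs : Icc a b ⊆ Icc (-K) K) (hf : MemLp f 2 (volume.restrict (Icc (-K) K))) :
    MemLp f 2 (volume.restrict (Icc a b)) :=
  hf.mono_measure (Measure.restrict_mono hs le_rfl)

theorem intervalIntegrable_inner {H : Type*} [NormedAddCommGroup H] [InnerProductSpace ℝ H]
    {f : ℝ → H} {a b : ℝ} (hab : a ≤ b) (hf : MemLp f 2 (volume.restrict (Icc a b))) (w : H) :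
    IntervalIntegrable (fun t => ⟪f t, w⟫_ℝ) volume a b :=
  intervalIntegrable_of_memLp_Icc hab (hf.inner_const w)

theorem intervalIntegrable_inner_operator {H : Type*} [NormedAddCommGroup H]
    [InnerProductSpace ℝ H] {f : ℝ → H} {a b : ℝ} (hab : a ≤ b)
    (hf : MemLp f 2 (volume.restrict (Icc a b))) (A : H →L[ℝ] H) :
    IntervalIntegrable (fun t => ⟪f t, A (f t)⟫_ℝ) volume a b :=
  intervalIntegrable_of_Icc hab <| hf.integrable_real_inner (A.comp_memLp' hf)

namespace ConvergentSolutions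

theorem tendsto_intervalIntegral_norm (hΩ : IsBoundedC2 Ωh)
    (h : Convergent) {a b : ℝ} (hab : a ≤ b) :
    Tendsto (fun n => ∫ t in a..b, ‖u n t - u' t‖) atTop (𝓝 0) := by
  set K := max |a| |b|
  have hs := Icc_subset_Icc_max_abs a b
  refine squeeze_zero' (Eventually.of_forall fun n =>
    intervalIntegral.integral_nonneg hab fun _ _ => norm_nonneg _) ?_ (h.tendsto_integral_norm hΩ K)
  filter_upwards [h.eventually_memLp K] with n hn
  rw [integral_of_le hab, ← integral_Icc_eq_integral_Ioc]
  exact setIntegral_mono_set ((hn.1.sub (h.memLp_u' K)).norm.integrable (by norm_num))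
    (ae_of_all _ fun _ => norm_nonneg _) hs.eventuallyLE

theorem momentum_limit (hΩ : IsBoundedC2 Ωh) {M : ℝ} (hM : ∀ y ∈ Ωh, ‖gradF g y‖ ≤ M)
    (h : Convergent)
    (hΘ : TendstoCLoc Θ Θ') (φ : 𝓓(Ωh, E2)) (hφ : ∀ y, divVec φ y = 0) {a b : ℝ} (hab : a ≤ b) :
    (∫ y in Ωh, ⟪u' b y, φ y⟫_ℝ) - (∫ y in Ωh, ⟪u' a y, φ y⟫_ℝ) =
      ∫ t in a..b, ∫ y in Ωh,
        (⟪u' t y, fderiv ℝ φ y (u' t y)⟫_ℝ - μ * ⟪Du' t y, gradVec φ y⟫_ℝ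
          - vmean (Θ' t) y * ⟪gradF g y, φ y⟫_ℝ) := by
  have hfin := isFiniteMeasure_vol3 hΩ.1
  obtain ⟨A, hA⟩ := exists_convection_operator φ
  set G := (testPair gradVecL φ).snd
  set w := buoyancy g hM (testPair gradVecL φ).fst
  set K := max |a| |b|
  have hs := Icc_subset_Icc_max_abs a b
  have split : ∀ {v : ℝ → L2Vel Ωh} {D : ℝ → L2GradVel Ωh} {θ : ℝ → L2Temp Ωh},
      MemLp v 2 (volume.restrict (Icc a b)) → MemLp D 2 (volume.restrict (Icc a b)) →
      MemLp θ 2 (volume.restrict (Icc a b)) →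
      (∀ᵐ t, t ∈ Set.uIoc a b → toLp 2 (v t, D t) ∈ W0 Ωh gradVecL) →
      ∫ t in a..b, ∫ y in Ωh,
        (⟪v t y, fderiv ℝ φ y (v t y)⟫_ℝ - μ * ⟪D t y, gradVec φ y⟫_ℝ
          - vmean (θ t) y * ⟪gradF g y, φ y⟫_ℝ) =
      (∫ t in a..b, ⟪v t, A (v t)⟫_ℝ) - μ * (∫ t in a..b, ⟪D t, G⟫_ℝ)
        - ∫ t in a..b, ⟪θ t, w⟫_ℝ := by
    intro v D θ hv hD hθ hp
    have i1 := intervalIntegrable_inner_operator hab hv A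
    have i2 := (intervalIntegrable_inner hab hD G).const_mul μ
    have i3 := intervalIntegrable_inner hab hθ w
    rw [← intervalIntegral.integral_const_mul, ← intervalIntegral.integral_sub i1 i2,
      ← intervalIntegral.integral_sub (i1.sub i2) i3]
    refine intervalIntegral.integral_congr_ae ?_
    filter_upwards [hp] with t ht hti
    exact momentum_form_eq_of_convection hM hA (θ t) (ht hti)
  have hu'm := memLp_two_mono_Icc hs (h.memLp_u' K)
  rw [split hu'm (memLp_two_mono_Icc hs (h.Du'_memLp K)) (h.memLp_Θ' hΘ a b)
    ((h.ae_mem_Vsol hΩ).mono fun t ht _ => Vsol_le_W0 ht), inner_testPair_fst_vel,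
    inner_testPair_fst_vel]
  have hev : ∀ᶠ n in atTop, T n ≤ a := h.T_lim.eventually (eventually_le_atBot a)
  have l1 : Tendsto (fun n => ∫ t in a..b, ⟪u n t, A (u n t)⟫_ℝ) atTop
      (𝓝 (∫ t in a..b, ⟪u' t, A (u' t)⟫_ℝ)) := by
    refine tendsto_intervalIntegral_of_abs_sub_le
      (d := fun n t => 2 * R * ‖A‖ * ‖u n t - u' t‖) hab ?_ ?_ ?_ ?_ ?_
    · simp_rw [intervalIntegral.integral_const_mul]
      simpa using (h.tendsto_intervalIntegral_norm hΩ hab).const_mul (2 * R * ‖A‖)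
    · filter_upwards [hev] with n hn
      exact (intervalIntegrable_of_memLp_Icc hab
        (((h.sol n).memLp_u hn b 2).sub hu'm)).norm.const_mul _
    · filter_upwards [hev] with n hn
      exact intervalIntegrable_inner_operator hab ((h.sol n).memLp_u hn b 2) A
    · exact intervalIntegrable_inner_operator hab hu'm A
    · filter_upwards [hev] with n hn t ht
      exact abs_quadratic_sub_le A (h.u_le n t (hn.trans ht.1)) (h.u'_le t)
  have l2 := (h.Du_conv.tendsto_intervalIntegral hab G).const_mul μ
  have l3 := (h.Θ_weak hΘ).tendsto_intervalIntegral hab w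
  have l4 := (h.u_conv.tendsto_inner b (testPair gradVecL φ).fst).sub
    (h.u_conv.tendsto_inner a (testPair gradVecL φ).fst)
  refine tendsto_nhds_unique (l4.congr' ?_) ((l1.sub l2).sub l3)
  filter_upwards [hev] with n hn
  rw [← split ((h.sol n).memLp_u hn b 2) ((h.sol n).memLp_Du hn b) ((h.sol n).memLp_Θ hn b 2)
    ((ae_uIoc_of_ae_Ici hn hab ((h.sol n).ae_mem_Vsol hΩ)).mono fun t ht hti =>
      Vsol_le_W0 (ht hti)), ← (h.sol n).momentum φ hφ a hn b (hn.trans hab) hab,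
    inner_testPair_fst_vel, inner_testPair_fst_vel]

theorem heat_limit (hΩ : IsBoundedC2 Ωh)
    (h : Convergent)
    (hΘ : TendstoCLoc Θ Θ') (ψ : 𝓓(cyl Ωh, ℝ)) {a b : ℝ} (hab : a ≤ b) :
    (∫ x in cyl Ωh, Θ' b x * ψ x) - (∫ x in cyl Ωh, Θ' a x * ψ x) =
      ∫ t in a..b, ∫ x in cyl Ωh,
        (Θ' t x * fderiv ℝ ψ x (u' t x.1, 0) - κ * ⟪DΘ' t x, gradScal ψ x⟫_ℝ) := by
  have hfin := isFiniteMeasure_vol3 hΩ.1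
  have hS := h.S_nonneg
  set G := (testPair gradScalL ψ).snd with hG
  set K := max |a| |b|
  have hs := Icc_subset_Icc_max_abs a b
  have hnm : ∀ {v : ℝ → L2Vel Ωh} {θ : ℝ → L2Temp Ωh},
      MemLp v 2 (volume.restrict (Icc a b)) → MemLp θ 2 (volume.restrict (Icc a b)) →
      MemLp (fun t => nem (clampR S) (θ t) (lift Ωh (v t))) 2 (volume.restrict (Icc a b)) := by
    intro v θ hv hθ
    exact memLp_nem_curve (continuous_clampR S) (abs_clampR_le hS) hθ.1 ((lift Ωh).comp_memLp' hv)
  have split : ∀ {v : ℝ → L2Vel Ωh} {D : ℝ → L2GradTemp Ωh} {θ : ℝ → L2Temp Ωh},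
      MemLp v 2 (volume.restrict (Icc a b)) → MemLp D 2 (volume.restrict (Icc a b)) →
      MemLp θ 2 (volume.restrict (Icc a b)) →
      (∀ t ∈ Icc a b, ∀ᵐ x ∂vol3 Ωh, |θ t x| ≤ S) →
      ∫ t in a..b, ∫ x in cyl Ωh,
        (θ t x * fderiv ℝ ψ x (v t x.1, 0) - κ * ⟪D t x, gradScal ψ x⟫_ℝ) =
      (∫ t in a..b, ⟪nem (clampR S) (θ t) (lift Ωh (v t)), G⟫_ℝ)
        - κ * ∫ t in a..b, ⟪D t, G⟫_ℝ := by
    intro v D θ hv hD hθ hb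
    have i1 := intervalIntegrable_inner hab (hnm hv hθ) G
    have i2 := (intervalIntegrable_inner hab hD G).const_mul κ
    rw [← intervalIntegral.integral_const_mul, ← intervalIntegral.integral_sub i1 i2]
    refine intervalIntegral.integral_congr fun t ht => ?_
    rw [Set.uIcc_of_le hab] at ht
    refine (heat_form_eq hS (v t) (hb t ht) (D t) ψ).trans ?_
    rw [tempForce, inner_sub_left, real_inner_smul_left]
  have hu'm := memLp_two_mono_Icc hs (h.memLp_u' K)
  have hΘ'm := h.memLp_Θ' hΘ a b
  rw [split hu'm (memLp_two_mono_Icc hs (h.DΘ'_memLp K)) hΘ'm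
    (fun t _ => h.Θ'_le hΘ t), inner_testPair_fst_temp, inner_testPair_fst_temp]
  have hev : ∀ᶠ n in atTop, T n ≤ a := h.T_lim.eventually (eventually_le_atBot a)
  have l0 : Tendsto (fun n => ∫ t in a..b, ⟪nem (clampR S) (Θ n t) (lift Ωh (u' t)), G⟫_ℝ) atTop
      (𝓝 (∫ t in a..b, ⟪nem (clampR S) (Θ' t) (lift Ωh (u' t)), G⟫_ℝ)) := by
    refine intervalIntegral.tendsto_integral_filter_of_dominated_convergence
      (fun _ => S * R * ‖G‖) ?_ ?_ intervalIntegrable_const ?_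
    · filter_upwards [hev] with n hn
      have := intervalIntegrable_inner hab (hnm hu'm ((h.sol n).memLp_Θ hn b 2)) G
      rw [Set.uIoc_of_le hab]
      exact this.1.aestronglyMeasurable
    · refine Eventually.of_forall fun n => ae_of_all _ fun t _ => ?_
      refine (norm_inner_le_norm _ _).trans (mul_le_mul_of_nonneg_right ?_ (norm_nonneg _))
      exact (norm_nem_le (continuous_clampR S) (abs_clampR_le hS) _ _).trans
        (mul_le_mul_of_nonneg_left ((norm_lift_le _).trans (h.u'_le t)) hS)
    · refine ae_of_all _ fun t _ => ?_
      exact (tendsto_nem (continuous_clampR S) (abs_clampR_le hS) (tendsto_Θ hΘ t)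
        (tendsto_const_nhds (x := lift Ωh (u' t)))).inner tendsto_const_nhds
  have ldiff : Tendsto (fun n => ∫ t in a..b, (⟪nem (clampR S) (Θ n t) (lift Ωh (u n t)), G⟫_ℝ
      - ⟪nem (clampR S) (Θ n t) (lift Ωh (u' t)), G⟫_ℝ)) atTop (𝓝 (∫ t in a..b, (0 : ℝ))) := by
    refine tendsto_intervalIntegral_of_abs_sub_le
      (d := fun n t => S * ‖G‖ * ‖u n t - u' t‖) hab ?_ ?_ ?_ intervalIntegrable_const ?_
    · simp_rw [intervalIntegral.integral_const_mul]
      simpa using (h.tendsto_intervalIntegral_norm hΩ hab).const_mul (S * ‖G‖)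
    · filter_upwards [hev] with n hn
      exact (intervalIntegrable_of_memLp_Icc hab
        (((h.sol n).memLp_u hn b 2).sub hu'm)).norm.const_mul _
    · filter_upwards [hev] with n hn
      have hm := (h.sol n).memLp_Θ hn b 2
      exact (intervalIntegrable_inner hab (hnm ((h.sol n).memLp_u hn b 2) hm) G).sub
        (intervalIntegrable_inner hab (hnm hu'm hm) G)
    · filter_upwards [hev] with n hn t ht
      rw [sub_zero, ← inner_sub_left, ← nem_sub (continuous_clampR S) (abs_clampR_le hS),
        ← map_sub]
      refine (abs_real_inner_le_norm _ _).trans ?_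
      have h1 := (norm_nem_le (continuous_clampR S) (abs_clampR_le hS) (Θ n t)
        (lift Ωh (u n t - u' t))).trans (mul_le_mul_of_nonneg_left (norm_lift_le _) hS)
      exact (mul_le_mul_of_nonneg_right h1 (norm_nonneg G)).trans (le_of_eq (by ring))
  have l1 : Tendsto (fun n => ∫ t in a..b, ⟪nem (clampR S) (Θ n t) (lift Ωh (u n t)), G⟫_ℝ) atTop
      (𝓝 (∫ t in a..b, ⟪nem (clampR S) (Θ' t) (lift Ωh (u' t)), G⟫_ℝ)) := by
    have := ldiff.add l0
    rw [intervalIntegral.integral_zero, zero_add] at this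
    refine this.congr' ?_
    filter_upwards [hev] with n hn
    have hm := (h.sol n).memLp_Θ hn b 2
    rw [intervalIntegral.integral_sub
      (intervalIntegrable_inner hab (hnm ((h.sol n).memLp_u hn b 2) hm) G)
      (intervalIntegrable_inner hab (hnm hu'm hm) G)]
    ring
  have l2 := (h.DΘ_conv.tendsto_intervalIntegral hab G).const_mul κ
  have l4 := (hΘ.tendstoCWeakLoc.tendsto_inner b (testPair gradScalL ψ).fst).sub
    (hΘ.tendstoCWeakLoc.tendsto_inner a (testPair gradScalL ψ).fst)
  refine tendsto_nhds_unique (l4.congr' ?_) (l1.sub l2)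
  filter_upwards [hev] with n hn
  rw [← split ((h.sol n).memLp_u hn b 2) ((h.sol n).memLp_DΘ hn b) ((h.sol n).memLp_Θ hn b 2)
    (fun t ht => h.Θ_le n t (hn.trans ht.1)), ← (h.sol n).heat ψ a hn b (hn.trans hab) hab,
    inner_testPair_fst_temp, inner_testPair_fst_temp]

/-- The limit is an entire weak solution. -/
theorem isWeakSolution (hΩ : IsBoundedC2 Ωh) (hϑ : ContDiff ℝ 2 ϑB) {M : ℝ}
    (hM : ∀ y ∈ Ωh, ‖gradF g y‖ ≤ M)
    (h : Convergent)
    (hΘ : TendstoCLoc Θ Θ') : IsWeakSolution Ωh μ κ α g ϑB Set.univ u' Du' Θ' DΘ' := by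
  have hfin := isFiniteMeasure_vol3 hΩ.1
  refine
    { u_weakCont := fun w => (h.u_cont w).continuousOn
      Du_memLp := fun a _ b _ => memLp_two_mono_Icc (Icc_subset_Icc_max_abs a b) (h.Du'_memLp _)
      u_mem := ?_
      u_div := fun t _ ψ => ?_
      Θ_cont := (h.continuous_Θ' hΘ).continuousOn
      Θ_bdd := fun a _ b _ => ⟨S, fun t _ => eLpNorm_le_of_ae_abs_le (h.Θ'_le hΘ t)⟩
      DΘ_memLp := fun a _ b _ => memLp_two_mono_Icc (Icc_subset_Icc_max_abs a b) (h.DΘ'_memLp _)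
      Θ_grad := ?_
      Θ_bdry := ?_
      momentum := fun φ hφ a _ b _ hab => h.momentum_limit hΩ hM hΘ φ hφ hab
      heat := fun ψ a _ b _ hab => h.heat_limit hΩ hΘ ψ hab }
  · rw [Measure.restrict_univ]
    filter_upwards [h.ae_mem_Vsol hΩ] with t ht
    exact (mem_W0_iff gradVecL _ _).1 (Vsol_le_W0 ht)
  · obtain ⟨w, hw⟩ := exists_divergence_functional ψ
    rw [hw]
    refine tendsto_nhds_unique (h.u_conv.tendsto_inner t w) (tendsto_const_nhds.congr' ?_)
    filter_upwards [h.T_lim.eventually (eventually_le_atBot t)] with n hn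
    rw [← hw, (h.sol n).u_div t hn ψ]
  · rw [Measure.restrict_univ]
    exact h.ae_hasWeakGradTemp hΘ
  · rw [Measure.restrict_univ]
    exact h.ae_boundary hΩ hϑ hΘ

end ConvergentSolutions

theorem abs_clampR_le_abs {S : ℝ} (hS : 0 ≤ S) (s : ℝ) : |clampR S s| ≤ |s| := by
  rcases le_or_gt |s| S with h | h
  · rw [clampR_of_abs_le h]
  · exact (abs_clampR_le hS s).trans h.le

theorem tendsto_integral_mul_of_bdd {θ : ℕ → L2Temp Ωh} {θ' : L2Temp Ωh} {S : ℝ}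
    (hθ : Tendsto θ atTop (𝓝 θ')) (hb : ∀ᶠ n in atTop, ∀ᵐ x ∂vol3 Ωh, |θ n x| ≤ S)
    {f : X3 → ℝ} (hf : Integrable f (vol3 Ωh)) :
    Tendsto (fun n => ∫ x in cyl Ωh, θ n x * f x) atTop (𝓝 (∫ x in cyl Ωh, θ' x * f x)) := by
  refine tendsto_of_subseq_tendsto fun ns hns => ?_
  obtain ⟨k, hk, hae⟩ := exists_subseq_tendsto_ae (hθ.comp hns)
  refine ⟨k, tendsto_integral_filter_of_dominated_convergence (fun x => S * ‖f x‖)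
    (Eventually.of_forall fun n => (Lp.aestronglyMeasurable _).mul hf.1) ?_
    (hf.norm.const_mul S) ?_⟩
  · filter_upwards [(hns.comp hk.tendsto_atTop).eventually hb] with n hn
    filter_upwards [hn] with x hx
    rw [norm_mul]
    exact mul_le_mul_of_nonneg_right hx (norm_nonneg _)
  · filter_upwards [hae] with x hx
    exact hx.mul_const _

variable {ν : Measure ℝ} [SFinite ν]

/-- Measurability in time of pairings with an integrable function of time and space. -/
theorem aestronglyMeasurable_integral_mul [IsFiniteMeasure (vol3 Ωh)] {h : ℝ × X3 → ℝ}
    (hh : Integrable h (ν.prod (vol3 Ωh))) {θ : ℝ → L2Temp Ωh} (hθ : AEStronglyMeasurable θ ν)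
    {S : ℝ} (hb : ∀ᵐ t ∂ν, ∀ᵐ x ∂vol3 Ωh, |θ t x| ≤ S) :
    AEStronglyMeasurable (fun t => ∫ x in cyl Ωh, θ t x * h (t, x)) ν := by
  have hint : ∀ᵐ t ∂ν, Integrable (fun x => h (t, x)) (vol3 Ωh) := hh.prod_right_ae
  let H : ℕ → ℝ → L2Temp Ωh := fun N t => toL2 (vol3 Ωh) fun x => clampR N (h (t, x))
  have hm : ∀ (N : ℕ) t, Integrable (fun x => h (t, x)) (vol3 Ωh) →
      MemLp (fun x => clampR N (h (t, x))) 2 (vol3 Ωh) := fun N t ht =>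
    MemLp.of_bound ((continuous_clampR N).comp_aestronglyMeasurable ht.1) N
      (ae_of_all _ fun _ => abs_clampR_le (Nat.cast_nonneg N) _)
  have hinner : ∀ (N : ℕ) t (w : L2Temp Ωh), Integrable (fun x => h (t, x)) (vol3 Ωh) →
      ⟪w, H N t⟫_ℝ = ∫ x in cyl Ωh, w x * clampR N (h (t, x)) := by
    intro N t w ht
    refine (inner_toL2_right w (hm N t ht)).trans ?_
    simp [mul_comm]
  have hH : ∀ N, AEStronglyMeasurable (H N) ν := by
    intro N
    refine aestronglyMeasurable_of_inner fun w => ?_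
    have h1 : AEStronglyMeasurable (fun z : ℝ × X3 => w z.2 * clampR N (h z)) (ν.prod (vol3 Ωh)) :=
      (Lp.aestronglyMeasurable w).comp_snd.mul ((continuous_clampR N).comp_aestronglyMeasurable hh.1)
    refine h1.integral_prod_right'.congr ?_
    filter_upwards [hint] with t ht
    rw [real_inner_comm, hinner N t w ht]
  refine aestronglyMeasurable_of_tendsto_ae atTop (fun N => hθ.inner (𝕜 := ℝ) (hH N)) ?_
  filter_upwards [hint, hb] with t ht htb
  simp_rw [hinner _ t (θ t) ht]
  refine tendsto_integral_of_dominated_convergence (fun x => S * ‖h (t, x)‖)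
    (fun N => (Lp.aestronglyMeasurable _).mul ((continuous_clampR N).comp_aestronglyMeasurable ht.1))
    (ht.norm.const_mul S) (fun N => ?_) (ae_of_all _ fun x => ?_)
  · filter_upwards [htb] with x hx
    rw [norm_mul]
    exact mul_le_mul hx (abs_clampR_le_abs (Nat.cast_nonneg N) _) (norm_nonneg _)
      ((abs_nonneg _).trans hx)
  · obtain ⟨N, hN⟩ := exists_nat_ge |h (t, x)|
    refine tendsto_const_nhds.congr' ?_
    filter_upwards [eventually_ge_atTop N] with n hn
    rw [clampR_of_abs_le (hN.trans (Nat.cast_le.2 hn))]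

theorem ConvergentSolutions.tendstoWeakStar [IsFiniteMeasure (vol3 Ωh)]
    (h : Convergent)
    (hΘ : TendstoCLoc Θ Θ') : TendstoWeakStarLinftyLoc Ωh Θ Θ' := by
  intro K f hf
  have hint : ∀ᵐ t ∂volume.restrict (Icc (-K) K), Integrable (fun x => f (t, x)) (vol3 Ωh) :=
    hf.prod_right_ae
  have hev := h.T_lim.eventually (eventually_le_atBot (-K))
  refine tendsto_integral_filter_of_dominated_convergence
    (fun t => S * ∫ x in cyl Ωh, ‖f (t, x)‖) ?_ ?_ (hf.integral_norm_prod_left.const_mul S) ?_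
  · filter_upwards [hev, h.eventually_memLp K] with n hn hm
    refine aestronglyMeasurable_integral_mul hf hm.2.2.1.1 (S := S) ?_
    filter_upwards [ae_restrict_mem measurableSet_Icc] with t ht using h.Θ_le n t (hn.trans ht.1)
  · filter_upwards [hev] with n hn
    filter_upwards [hint, ae_restrict_mem measurableSet_Icc] with t ht htI
    rw [← integral_const_mul]
    refine norm_integral_le_of_norm_le (ht.norm.const_mul S) ?_
    filter_upwards [h.Θ_le n t (hn.trans htI.1)] with x hx
    rw [norm_mul]
    exact mul_le_mul_of_nonneg_right hx (norm_nonneg _)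
  · filter_upwards [hint] with t ht
    exact tendsto_integral_mul_of_bdd (ConvergentSolutions.tendsto_Θ hΘ t)
      ((h.T_lim.eventually (eventually_le_atBot t)).mono fun n hn => h.Θ_le n t hn) ht

/-- Bounds for entire bounded solutions that depend only on the data. -/
theorem exists_entire_bound (hΩ : IsBoundedC2 Ωh) (hμ : 0 < μ) (hκ : 0 < κ) (hα : 0 ≤ α)
    (hα1 : α < 1) {M MB : ℝ} (hM0 : 0 ≤ M) (hMB0 : 0 ≤ MB) :
    ∃ E : ℝ, ∀ {g : X3} {ϑB : X3 → ℝ} {u : ℝ → L2Vel Ωh} {Du : ℝ → L2GradVel Ωh}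
      {Θ : ℝ → L2Temp Ωh} {DΘ : ℝ → L2GradTemp Ωh} {R S : ℝ}, ContDiff ℝ 2 ϑB →
      (∀ y ∈ Ωh, ‖gradF g y‖ ≤ M) → (∀ x ∈ frontier (cyl Ωh : Set X3), |ϑB x| ≤ MB) →
      IsWeakSolution Ωh μ κ α g ϑB Set.univ u Du Θ DΘ → 0 ≤ S → (∀ t, ‖u t‖ ≤ R) →
      (∀ t, ∀ᵐ x ∂vol3 Ωh, |Θ t x| ≤ S) →
      ∀ t, ‖u t‖ₑ + eLpNorm (Θ t) ∞ (vol3 Ωh) ≤ ofReal E := by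
  have hfin := isFiniteMeasure_vol3 hΩ.1
  have h1α : 0 < 1 - α := by linarith
  set B := √((MB / (1 - α)) ^ 2 * volC Ωh)
  obtain ⟨q, E, hq0, hq1, hE0, hE⟩ := exists_velocity_constants hΩ hμ hM0 (Real.sqrt_nonneg _ : 0 ≤ B)
  refine ⟨√E + MB / (1 - α), ?_⟩
  intro g ϑB u Du Θ DΘ R S hϑ hM hMB h hS hu hΘ t
  have hb := fun t => h.entire_bound hΩ.1 hϑ hκ hMB0 hMB hα hα1 hS hΘ t
  have hB : ∀ t, ‖Θ t‖ ≤ B := fun t => le_sqrt_of_sq_le (norm_sq_le_of_bdd (hb t))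
  have h1 : ‖u t‖ ^ 2 ≤ E := by
    have hlim : Tendsto (fun n : ℕ => q ^ n * R ^ 2 + E) atTop (𝓝 E) := by
      simpa using ((tendsto_pow_atTop_nhds_zero_of_lt_one hq0 hq1).mul_const (R ^ 2)).add_const E
    refine ge_of_tendsto' hlim fun n => ?_
    have h2 := (hE hM (h.mono (Set.subset_univ (Ici (t - n)))) (fun t _ => hB t) le_rfl
      (show t - n ≤ t by linarith [(Nat.cast_nonneg n : (0 : ℝ) ≤ n)])).1
    rw [sub_sub_cancel, Nat.floor_natCast] at h2
    have h3 : ‖u (t - n)‖ ^ 2 ≤ R ^ 2 := pow_le_pow_left₀ (norm_nonneg _) (hu _) 2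
    have h4 := mul_le_mul_of_nonneg_left h3 (pow_nonneg hq0 n)
    linarith
  rw [ENNReal.ofReal_add (Real.sqrt_nonneg _) (by positivity), ← ofReal_norm]
  exact add_le_add (ofReal_le_ofReal (le_sqrt_of_sq_le h1))
    (eLpNorm_le_of_ae_abs_le (hb t))

end Sequences

end ROB

end

theorem proposition3p2
    (Ωh : TopologicalSpace.Opens ROB.E2) (hΩ : ROB.IsBoundedC2 Ωh)
    (μ κ α : ℝ) (hμ : 0 < μ) (hκ : 0 < κ) (hα0 : 0 < α) (hα1 : α < 1)
    (MF MB : ℝ) :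
    ∃ E E' : ℝ,
      ∀ (g : ROB.X3) (ϑB : ROB.X3 → ℝ), ContDiff ℝ 2 ϑB →
        (∀ y ∈ Ωh, ‖ROB.gradF g y‖ ≤ MF) →
        (∀ x ∈ frontier (ROB.cyl Ωh : Set ROB.X3), |ϑB x| ≤ MB) →
        -- compactness of sequences of solutions, and the bound for the limit
        (∀ (F₀ : ℝ) (T : ℕ → ℝ)
            (u : ℕ → ℝ → ROB.L2Vel Ωh) (Du : ℕ → ℝ → ROB.L2GradVel Ωh)
            (Θ : ℕ → ℝ → ROB.L2Temp Ωh) (DΘ : ℕ → ℝ → ROB.L2GradTemp Ωh),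
          Tendsto T atTop atBot →
          (∀ n, ROB.IsWeakSolution Ωh μ κ α g ϑB (Set.Ici (T n)) (u n) (Du n) (Θ n) (DΘ n)) →
          (∀ n, ‖u n (T n)‖ₑ + eLpNorm (Θ n (T n)) ∞ (ROB.vol3 Ωh) ≤ ENNReal.ofReal F₀) →
          ∃ k : ℕ → ℕ, StrictMono k ∧
            ∃ (u' : ℝ → ROB.L2Vel Ωh) (Du' : ℝ → ROB.L2GradVel Ωh)
              (Θ' : ℝ → ROB.L2Temp Ωh) (DΘ' : ℝ → ROB.L2GradTemp Ωh),
              ROB.IsWeakSolution Ωh μ κ α g ϑB Set.univ u' Du' Θ' DΘ' ∧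
              ROB.TendstoCWeakLoc (fun j => u (k j)) u' ∧
              ROB.TendstoWeakL2Loc (fun j => u (k j)) u' ∧
              ROB.TendstoWeakL2Loc (fun j => Du (k j)) Du' ∧
              ROB.TendstoCLoc (fun j => Θ (k j)) Θ' ∧
              ROB.TendstoWeakStarLinftyLoc Ωh (fun j => Θ (k j)) Θ' ∧
              ROB.TendstoWeakL2Loc (fun j => Θ (k j)) Θ' ∧
              ROB.TendstoWeakL2Loc (fun j => DΘ (k j)) DΘ' ∧
              ∀ t : ℝ, ‖u' t‖ₑ + eLpNorm (Θ' t) ∞ (ROB.vol3 Ωh) ≤ ENNReal.ofReal E) ∧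
        -- the absorbing set in L² × L²
        (∀ (T : ℝ)
            (u : ℝ → ROB.L2Vel Ωh) (Du : ℝ → ROB.L2GradVel Ωh)
            (Θ : ℝ → ROB.L2Temp Ωh) (DΘ : ℝ → ROB.L2GradTemp Ωh),
          ROB.IsWeakSolution Ωh μ κ α g ϑB (Set.Ici T) u Du Θ DΘ →
          limsup (fun t => ‖u t‖ₑ + ‖Θ t‖ₑ) atTop ≤ ENNReal.ofReal E') := by
  have hMF0 : (0 : ℝ) ≤ max MF 0 := le_max_right _ _
  have hMB0 : (0 : ℝ) ≤ max MB 0 := le_max_right _ _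
  obtain ⟨E, hE⟩ := ROB.exists_entire_bound hΩ hμ hκ hα0.le hα1 hMF0 hMB0
  obtain ⟨E', hE'⟩ := ROB.exists_absorbing_bound hΩ hμ hκ hα0.le hα1 hMF0 hMB0
  refine ⟨E, E', fun g ϑB hϑ hF hB => ?_⟩
  have hF' : ∀ y ∈ Ωh, ‖ROB.gradF g y‖ ≤ max MF 0 := fun y hy => (hF y hy).trans (le_max_left _ _)
  have hB' : ∀ x ∈ frontier (ROB.cyl Ωh : Set ROB.X3), |ϑB x| ≤ max MB 0 := fun x hx =>
    (hB x hx).trans (le_max_left _ _)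
  refine ⟨fun F₀ T u Du Θ DΘ hT h h0 => ?_, fun T u Du Θ DΘ h => hE' hϑ hF' hB' h⟩
  have hfin := ROB.isFiniteMeasure_vol3 hΩ.1
  obtain ⟨S, R, C, hbdd⟩ := ROB.exists_boundedSolutions hΩ hμ hκ hα0.le hα1 hMF0 hMB0 hϑ hF' hB'
    hT h h0
  obtain ⟨k, hk, u', Du', DΘ', hconv⟩ := hbdd.exists_convergent hΩ hμ hF'
  obtain ⟨Θ', hΘ'⟩ := hconv.exists_tendstoCLoc hΩ hϑ hκ hα0.le
  have hsol := hconv.isWeakSolution hΩ hϑ hF' hΘ'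
  exact ⟨k, hk, u', Du', Θ', DΘ', hsol, hconv.u_conv, hconv.u_weak, hconv.Du_conv, hΘ',
    hconv.tendstoWeakStar hΘ', hconv.Θ_weak hΘ', hconv.DΘ_conv,
    hE hϑ hF' hB' hsol hconv.S_nonneg hconv.u'_le (hconv.Θ'_le hΘ')⟩
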